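/- Conventions. Let $L\ge 1$ be an odd integer, $n\ge 0$ an integer, $\varepsilon_j=L^{-j}$, and let $L_{\rm tp},L_{\rm sp}$ be powers of $L$ with $L^{2(n+1)}\mid L_{\rm tp}$ and $L^{n+1}\mid L_{\rm sp}$. For integers $j\ge -1$, $s\ge 0$ put $$\mathcal X_j^{(s)}=\big(\varepsilon_j^2\mathbb Z/\varepsilon_{s+j}^2L_{\rm tp}\mathbb Z\big)\times\big(\varepsilon_j\mathbb Z^3/\varepsilon_{s+j}L_{\rm sp}\mathbb Z^3\big),$$ let $\mathcal H_j^{(s)}$ be the space of complex functions on $\mathcal X_j^{(s)}$ with integral $\int du=\varepsilon_j^5\sum_u$ and real inner product $\langle\alpha,\beta\rangle_j=\int\alpha\beta\,du$ (adjoints ${}^*$ are with respect to these bilinear forms), and let $\mathbb L_*:\mathcal H_j^{(s)}\to\mathcal H_{j-1}^{(s)}$ be $(\mathbb L_*\alpha)(L^2u_0,L\mathbf u)=\alpha(u_0,\mathbf u)$. For an operator $A$ on $\mathcal H_j^{(s)}$ with kernel $A(u,u')$ and $m\ge 0$, $$\|A\|_m=\max\Big\{\sup_u\int du'\,e^{m|u-u'|}|A(u,u')|,\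 \sup_{u'}\int du\,e^{m|u-u'|}|A(u,u')|\Big\},$$ where $|u-u'|$ is the Euclidean distance on the torus. Let $\mathfrak q\ge 4$ be an even integer and $q=L^{-5\mathfrak q}\,1_\square*\cdots*1_\square$ ($\mathfrak q$ factors), where $1_\square$ is the characteristic function of $\big[-\tfrac{L^2-1}2,\tfrac{L^2-1}2\big]\times\big[-\tfrac{L-1}2,\tfrac{L-1}2\big]^3$ on $\mathbb Z\times\mathbb Z^3$. Let $(Q\psi)(y)=\sum_{x\in\mathbb Z\times\mathbb Z^3}q(x)\psi(y+[x])$, $Q:\mathcal H_0^{(s)}\to\mathcal H_{-1}^{(s+1)}$, $Q^{(j)}=\mathbb L_*^{-j}Q\,\mathbb L_*^{j}$, $Q_j=Q^{(1)}\cdots Q^{(j)}:\mathcal H_j^{(n-j)}\to\mathcal H_0^{(n)}$, and, for $a>0$, $\mathfrak Q_n=a\big(1+\sum_{j=1}^{n-1}L^{-2j}Q_jQ_j^*\big)^{-1}$ (for $n\ge1$). Let $\mathbf h_0$ be a translation invariant operator on $L^2(\mathbb Z^3)$ whose Fourier transform $\hat{\mathbf h}_0(\mathbf p)$ is entire, invariant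 under $\mathbf p_\nu\to-\mathbf p_\nu$ for each $\nu$, nonnegative for real $\mathbf p$, strictly positive for $\mathbf p\in\mathbb R^3\setminus 2\pi\mathbb Z^3$, vanishes together with its gradient at $0$, and has positive definite Hessian at $0$. Let $h_0$ be its periodization to $\mathbb Z^3/L_{\rm sp}\mathbb Z^3$, let $(\partial_0\alpha)(u)=\alpha(u+e_0)-\alpha(u)$ be the forward time derivative on $\mathcal X_0^{(0)}$, and set $D_0=1-e^{-h_0}-e^{-h_0}\partial_0$ on $\mathcal H_0^{(0)}$, $D_n=L^{2n}\mathbb L_*^{-n}D_0\mathbb L_*^n$ on $\mathcal H_n^{(0)}$. Let $\Delta^{(0)}=D_0$ and, for $n\ge1$, $$\Delta^{(n)}=\lim_{t\downarrow0}\big(1+\mathfrak Q_nQ_n(D_n+t)^{-1}Q_n^*\big)^{-1}\mathfrak Q_n\quad\text{on }\mathcal H_0^{(n)},$$ which is the meaning of $\big(1+\mathfrak Q_nQ_nD_n^{-1}Q_n^*\big)^{-1}\mathfrak Q_n$ ($D_n$ annihilates the constants). The square root $\sqrt{A}$ of an operator is the principal one: the unique square root whose spectrum lies in $\{\mathrm{Re}\,z>0\}$.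 Statement. For every even $\mathfrak q\ge4$ there is a constant $\Gamma_2$, depending only on $\mathfrak q$, such that for all $a>0$ and all $\mathbf h_0$ as above there are constants $m_2>0$ and $\Gamma_{10}$, depending only on $\mathfrak q$, $a$ and $\mathbf h_0$ (hence independent of $L$, $n$, $L_{\rm tp}$, $L_{\rm sp}$), such that for all odd $L>\Gamma_2$, all $n\ge0$ and all $L_{\rm tp},L_{\rm sp}$ as above: the limit $\Delta^{(n)}$ exists (all inverses in its definition exist); the operator $\tfrac a{L^2}Q^*Q+\Delta^{(n)}$ on $\mathcal H_0^{(n)}$ is invertible, so that $$C^{(n)}=\Big(\frac a{L^2}Q^*Q+\Delta^{(n)}\Big)^{-1}$$ exists; $\sqrt{C^{(n)}}$ and $\big(\sqrt{C^{(n)}}\big)^{-1}$ exist; and $$\big\|\mathbb L_*^{-1}C^{(n)}\mathbb L_*\big\|_{m_2},\quad \Big\|\sqrt{\mathbb L_*^{-1}C^{(n)}\mathbb L_*}\Big\|_{m_2},\quad \Big\|\Big(\sqrt{\mathbb L_*^{-1}C^{(n)}\mathbb L_*}\Big)^{-1}\Big\|_{m_2}\ \le\ \Gamma_{10}L^9 .$$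 -/

import Mathlib

open Filter Topology

noncomputable section

namespace BlockSpin

/-! ### Lattices

A site of the discrete torus with lattice spacing `ε_j²` in the time direction and `ε_j` in the
three space directions, `ε_j = L^{-j}`, with `L^(2i+τ)` points in the time direction and `L^(i+σ)`
points in each space direction. A site is given by its integer coordinates, in units of the
lattice spacing; `j` only records the spacing. With `L_tp = L^(2(n+1)+τ)`,
`L_sp = L^(n+1+σ)`, the lattice
`𝓧_j^{(s)} = (ε_j² ℤ / ε_{s+j}² L_tp ℤ) × (ε_j ℤ³ / ε_{s+j} L_sp ℤ³)` is `Site L τ σ j (n+1-s)`.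
So, for fixed `n`, the lattice `𝓧_j^{(n-j)}` is `Site L τ σ j (j+1)`; in particular
`𝓧_{-1}^{(n+1)}` is `Site L τ σ (-1) 0`, `𝓧_0^{(n)}` is `Site L τ σ 0 1`,
`𝓧_n = 𝓧_n^{(0)}` is `Site L τ σ n (n+1)`, and `𝓧_1^{(n)}` is `Site L τ σ 1 1`. -/

/-- The sites of a lattice, in units of its spacing. -/
@[nolint unusedArguments]
def Site (L τ σ : ℕ) (_j : ℤ) (i : ℕ) : Type :=
  ZMod (L ^ (2 * i + τ)) × (Fin 3 → ZMod (L ^ (i + σ)))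

instance (L τ σ : ℕ) (j : ℤ) (i : ℕ) : AddCommGroup (Site L τ σ j i) :=
  inferInstanceAs (AddCommGroup (ZMod (L ^ (2 * i + τ)) × (Fin 3 → ZMod (L ^ (i + σ)))))

instance (L τ σ : ℕ) (j : ℤ) (i : ℕ) : DecidableEq (Site L τ σ j i) :=
  inferInstanceAs (DecidableEq (ZMod (L ^ (2 * i + τ)) × (Fin 3 → ZMod (L ^ (i + σ)))))

instance (L τ σ : ℕ) [NeZero L] (j : ℤ) (i : ℕ) : Fintype (Site L τ σ j i) :=
  inferInstanceAs (Fintype (ZMod (L ^ (2 * i + τ)) × (Fin 3 → ZMod (L ^ (i + σ)))))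

/-- The class `[x]` of an integer vector `x`. -/
def Site.ofInt {L τ σ : ℕ} {j : ℤ} {i : ℕ} (x : ℤ × (Fin 3 → ℤ)) : Site L τ σ j i :=
  ((x.1 : ZMod (L ^ (2 * i + τ))), fun ν => (x.2 ν : ZMod (L ^ (i + σ))))

/-- `ε_j = L^{-j}`. -/
def eps (L : ℕ) (j : ℤ) : ℝ := (L : ℝ) ^ (-j)

/-- The distance of a site from the origin of the torus: the Euclidean length of the shortest
representative in `ε_j² ℤ × ε_j ℤ³`. -/
def Site.abs {L τ σ : ℕ} {j : ℤ} {i : ℕ} (u : Site L τ σ j i) : ℝ :=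
  √((eps L j ^ 2 * (u.1.valMinAbs : ℝ)) ^ 2 + ∑ ν, (eps L j * ((u.2 ν).valMinAbs : ℝ)) ^ 2)

/-- The scaling bijection `𝕃^{j-k} : (u₀, 𝐮) ↦ (L^{2(j-k)} u₀, L^{j-k} 𝐮)` from the lattice of
spacing index `j` to the one of spacing index `k`. It fixes the coordinates in units of the
spacing. -/
def scaling {L τ σ : ℕ} (j k : ℤ) (i : ℕ) : Site L τ σ j i ≃ Site L τ σ k i := Equiv.refl _

/-! ### Operators

A linear operator from functions on one lattice to functions on another is given by its matrix,
`(A α)(u) = ∑ u', A u u' * α u'`. Its integral kernel with respect to `∫ du' = ε_j⁵ ∑_{u'}` is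
`A u u' / ε_j⁵`. -/

/-- The conjugated operator `𝕃_*^{-(j-k)} A 𝕃_*^{j-k}`, where `𝕃_*(α)(𝕃 u) = α(u)`. -/
def rescale {L τ σ : ℕ} {k k' : ℤ} {i i' : ℕ} (j j' : ℤ)
    (A : Matrix (Site L τ σ k' i') (Site L τ σ k i) ℂ) :
    Matrix (Site L τ σ j' i') (Site L τ σ j i) ℂ :=
  A.submatrix (scaling j' k' i') (scaling j k i)

/-- The adjoint with respect to the real inner products `⟨α, β⟩_j = ε_j⁵ ∑_u α(u) β(u)`. -/
def adj {L τ σ : ℕ} {j k : ℤ} {i i' : ℕ} (A : Matrix (Site L τ σ k i') (Site L τ σ j i) ℂ) :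
    Matrix (Site L τ σ j i) (Site L τ σ k i') ℂ :=
  (((eps L k ^ 5 / eps L j ^ 5 : ℝ)) : ℂ) • A.transpose

/-- The integral kernel `A(u, u')` of an operator. -/
def kernel {L τ σ : ℕ} {j k : ℤ} {i i' : ℕ} (A : Matrix (Site L τ σ k i') (Site L τ σ j i) ℂ)
    (u : Site L τ σ k i') (u' : Site L τ σ j i) : ℂ :=
  A u u' / ((eps L j ^ 5 : ℝ) : ℂ)

/-- The norm `‖A‖_m`: the larger of `sup_u ∫ du' e^{m|u-u'|} |A(u,u')|` and
`sup_{u'} ∫ du e^{m|u-u'|} |A(u,u')|`. -/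
def opNorm {L τ σ : ℕ} [NeZero L] {j : ℤ} {i : ℕ} (m : ℝ)
    (A : Matrix (Site L τ σ j i) (Site L τ σ j i) ℂ) : ℝ :=
  max (⨆ u, eps L j ^ 5 * ∑ u', Real.exp (m * (u - u').abs) * ‖kernel A u u'‖)
    (⨆ u', eps L j ^ 5 * ∑ u, Real.exp (m * (u - u').abs) * ‖kernel A u u'‖)

/-! ### Block spin averaging -/

/-- The integer points of `[-(L²-1)/2, (L²-1)/2] × [-(L-1)/2, (L-1)/2]³`. -/
def box (L : ℕ) : Finset (ℤ × (Fin 3 → ℤ)) :=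
  Finset.Icc (-(((L : ℤ) ^ 2 - 1) / 2)) (((L : ℤ) ^ 2 - 1) / 2) ×ˢ
    Fintype.piFinset fun _ => Finset.Icc (-(((L : ℤ) - 1) / 2)) (((L : ℤ) - 1) / 2)

/-- The `r`-fold convolution of the characteristic function of the box with itself. -/
def boxConv (L : ℕ) : ℕ → ℤ × (Fin 3 → ℤ) → ℝ
  | 0 => Pi.single 0 1
  | r + 1 => fun x => ∑ b ∈ box L, boxConv L r (x - b)

/-- The averaging profile `q = L^{-5𝔮} 1_□ * ⋯ * 1_□` (`𝔮` factors). -/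
def profile (L 𝔮 : ℕ) (x : ℤ × (Fin 3 → ℤ)) : ℝ :=
  ((L : ℝ) ^ (5 * 𝔮))⁻¹ * boxConv L 𝔮 x

/-- The inclusion of the lattice of spacing `(L², L, L, L)` into the lattice of spacing one. -/
def incl {L τ σ : ℕ} {i : ℕ} (y : Site L τ σ (-1) i) : Site L τ σ 0 (i + 1) :=
  Site.ofInt ((L : ℤ) ^ 2 * (y.1.val : ℤ), fun ν => (L : ℤ) * ((y.2 ν).val : ℤ))

/-- The averaging operator `(Q ψ)(y) = ∑_{x ∈ ℤ×ℤ³} q(x) ψ(y + [x])`. -/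
def Q (L τ σ 𝔮 i : ℕ) : Matrix (Site L τ σ (-1) i) (Site L τ σ 0 (i + 1)) ℂ :=
  fun y u => ∑' x : ℤ × (Fin 3 → ℤ), if incl y + Site.ofInt x = u then (profile L 𝔮 x : ℂ) else 0

/-- `Q_j = Q^{(1)} ⋯ Q^{(j)} : 𝓗_j^{(n-j)} → 𝓗_0^{(n)}`, where `Q^{(j)} = 𝕃_*^{-j} Q 𝕃_*^j`. -/
def Qit (L τ σ 𝔮 : ℕ) [NeZero L] : (j : ℕ) → Matrix (Site L τ σ 0 1) (Site L τ σ j (j + 1)) ℂ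
  | 0 => (1 : Matrix (Site L τ σ 0 1) (Site L τ σ 0 1) ℂ)
  | j + 1 => Qit L τ σ 𝔮 j * rescale ((j + 1 : ℕ) : ℤ) (j : ℤ) (Q L τ σ 𝔮 (j + 1))

/-- `𝔔_n = a (1 + ∑_{j=1}^{n-1} L^{-2j} Q_j Q_j^*)^{-1}`. -/
def frakQ (L τ σ 𝔮 : ℕ) [NeZero L] (a : ℝ) (n : ℕ) :
    Matrix (Site L τ σ 0 1) (Site L τ σ 0 1) ℂ :=
  (a : ℂ) • (1 + ∑ j ∈ Finset.Icc 1 (n - 1),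
    ((L : ℂ) ^ (2 * j))⁻¹ • (Qit L τ σ 𝔮 j * adj (Qit L τ σ 𝔮 j)))⁻¹

/-! ### Differential operators -/

/-- `h` is the kernel `𝐡₀(x, x') = h (x - x')` of a translation invariant operator on `L²(ℤ³)`
whose Fourier transform `hhat` satisfies the standing assumptions. -/
structure IsHamiltonian (h : (Fin 3 → ℤ) → ℂ) (hhat : (Fin 3 → ℂ) → ℂ) : Prop where
  hasSum : ∀ p : Fin 3 → ℝ,
    HasSum (fun x : Fin 3 → ℤ => h x * Complex.exp (-Complex.I * ∑ ν, (p ν : ℂ) * (x ν : ℂ)))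
      (hhat fun ν => (p ν : ℂ))
  entire : Differentiable ℂ hhat
  even : ∀ (p : Fin 3 → ℂ) (ν : Fin 3), hhat (Function.update p ν (-p ν)) = hhat p
  real : ∀ p : Fin 3 → ℝ, (hhat fun ν => (p ν : ℂ)).im = 0
  nonneg : ∀ p : Fin 3 → ℝ, 0 ≤ (hhat fun ν => (p ν : ℂ)).re
  pos : ∀ p : Fin 3 → ℝ, (¬ ∃ z : Fin 3 → ℤ, ∀ ν, p ν = 2 * Real.pi * (z ν : ℝ)) →
    0 < (hhat fun ν => (p ν : ℂ)).re
  zero : hhat 0 = 0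
  grad : fderiv ℂ hhat 0 = 0
  hess : (Matrix.of fun μ ν : Fin 3 =>
    (iteratedFDeriv ℂ 2 hhat 0 ![Pi.single μ 1, Pi.single ν 1]).re).PosDef

/-- The operator `h₀`: the periodization `∑_{z ∈ L_sp ℤ³} 𝐡₀(x, x' + z)`, acting on the space
variables only. -/
def ham (L τ σ : ℕ) (h : (Fin 3 → ℤ) → ℂ) (i : ℕ) :
    Matrix (Site L τ σ 0 i) (Site L τ σ 0 i) ℂ :=
  fun u u' => if u.1 = u'.1 then
    ∑' z : Fin 3 → ℤ, if (fun ν => ((z ν : ℤ) : ZMod (L ^ (i + σ)))) = u.2 - u'.2 then h z else 0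
  else 0

/-- The forward time derivative `(∂₀ α)(u) = α(u + e₀) - α(u)` on a lattice of spacing one. -/
def timeDeriv (L τ σ i : ℕ) : Matrix (Site L τ σ 0 i) (Site L τ σ 0 i) ℂ :=
  fun u u' => (if u' = u + Site.ofInt (1, 0) then 1 else 0) - (if u' = u then 1 else 0)

/-- `D_0 = 1 - e^{-h₀} - e^{-h₀} ∂₀`. -/
def D0 (L τ σ : ℕ) [NeZero L] (h : (Fin 3 → ℤ) → ℂ) (i : ℕ) :
    Matrix (Site L τ σ 0 i) (Site L τ σ 0 i) ℂ :=
  1 - NormedSpace.exp (-ham L τ σ h i) - NormedSpace.exp (-ham L τ σ h i) * timeDeriv L τ σ i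

/-- `D_n = L^{2n} 𝕃_*^{-n} D_0 𝕃_*^n`. -/
def D (L τ σ : ℕ) [NeZero L] (h : (Fin 3 → ℤ) → ℂ) (n : ℕ) :
    Matrix (Site L τ σ n (n + 1)) (Site L τ σ n (n + 1)) ℂ :=
  (L : ℂ) ^ (2 * n) • rescale (n : ℤ) (n : ℤ) (D0 L τ σ h (n + 1))

/-! ### The covariance -/

/-- `1 + 𝔔_n Q_n (D_n + t)^{-1} Q_n^*`. -/
def deltaDen (L τ σ 𝔮 : ℕ) [NeZero L] (a : ℝ) (h : (Fin 3 → ℤ) → ℂ) (n : ℕ) (t : ℝ) :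
    Matrix (Site L τ σ 0 1) (Site L τ σ 0 1) ℂ :=
  1 + frakQ L τ σ 𝔮 a n * Qit L τ σ 𝔮 n * (D L τ σ h n + (t : ℂ) • 1)⁻¹ * adj (Qit L τ σ 𝔮 n)

/-- `Δ` is the operator `Δ^{(n)}`, that is `D_0` for `n = 0` and
`(1 + 𝔔_n Q_n D_n^{-1} Q_n^*)^{-1} 𝔔_n` for `n ≥ 1`. Since `D_n` annihilates the constant
functions on the torus, the latter expression is understood as its limit when `D_n` is replaced by
`D_n + t`, `t ↓ 0`. In Fourier space this is the continuous extension to `k = 0` of the symbol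
`𝔔̂_n(k) (1 + 𝔔̂_n(k) ∑_ℓ u_n(k+ℓ)^{2𝔮} / D̂_n(k+ℓ))^{-1}`. -/
def IsDelta (L τ σ 𝔮 : ℕ) [NeZero L] (a : ℝ) (h : (Fin 3 → ℤ) → ℂ) (n : ℕ)
    (Δ : Matrix (Site L τ σ 0 1) (Site L τ σ 0 1) ℂ) : Prop :=
  (n = 0 → Δ = D0 L τ σ h 1) ∧
  (1 ≤ n →
    (∀ t : ℝ, 0 < t → IsUnit (D L τ σ h n + (t : ℂ) • 1) ∧ IsUnit (deltaDen L τ σ 𝔮 a h n t)) ∧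
    Tendsto (fun t : ℝ => (deltaDen L τ σ 𝔮 a h n t)⁻¹ * frakQ L τ σ 𝔮 a n) (𝓝[>] 0) (𝓝 Δ))

/-- `(a / L²) Q^* Q + Δ` on `𝓗_0^{(n)}`. -/
def covInv (L τ σ 𝔮 : ℕ) [NeZero L] (a : ℝ)
    (Δ : Matrix (Site L τ σ 0 1) (Site L τ σ 0 1) ℂ) :
    Matrix (Site L τ σ 0 1) (Site L τ σ 0 1) ℂ :=
  ((a / (L : ℝ) ^ 2 : ℝ) : ℂ) • (adj (Q L τ σ 𝔮 0) * Q L τ σ 𝔮 0) + Δ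

/-- `B` is the principal square root of `C`: the square root with spectrum in the open right half
plane, obtained from the principal value of `√z`. -/
def IsPrincipalSqrt {ι : Type*} [Fintype ι] [DecidableEq ι] (B C : Matrix ι ι ℂ) : Prop :=
  B * B = C ∧ ∀ z ∈ spectrum ℂ B, 0 < z.re

/-- A matrix has at most one principal square root. -/
theorem IsPrincipalSqrt.unique {ι : Type*} [Fintype ι] [DecidableEq ι] {B B' C : Matrix ι ι ℂ}
    (hB : IsPrincipalSqrt B C) (hB' : IsPrincipalSqrt B' C) : B = B' := by
  rcases isEmpty_or_nonempty ι with hι | hι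
  · exact Subsingleton.elim _ _
  have hX : B * (B - B') = (B - B') * (-B') := by
    have h1 := hB.1.trans hB'.1.symm
    have h2 : B * (B - B') - (B - B') * (-B') = B * B - B' * B' := by noncomm_ring
    rw [h1, sub_self] at h2
    exact sub_eq_zero.mp h2
  have hp : ∀ p : Polynomial ℂ,
      Polynomial.aeval B p * (B - B') = (B - B') * Polynomial.aeval (-B') p := by
    intro p
    induction p using Polynomial.induction_on' with
    | add p q hp hq => simp only [map_add, add_mul, mul_add, hp, hq]
    | monomial k c =>
      have hk : B ^ k * (B - B') = (B - B') * (-B') ^ k := by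
        induction k with
        | zero => simp
        | succ k ih => rw [pow_succ, mul_assoc, hX, ← mul_assoc, ih, mul_assoc, ← pow_succ]
      simp only [Polynomial.aeval_monomial, Algebra.algebraMap_eq_smul_one, smul_mul_assoc,
        one_mul, mul_smul_comm, hk]
  have hu : IsUnit (Polynomial.aeval (-B') B.charpoly) := by
    by_contra hn
    have h0 : (0 : ℂ) ∈ spectrum ℂ (Polynomial.aeval (-B') B.charpoly) :=
      spectrum.zero_mem ℂ hn
    rw [spectrum.map_polynomial_aeval_of_nonempty (-B') B.charpoly
      (spectrum.nonempty_of_isAlgClosed_of_finiteDimensional ℂ (-B'))] at h0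
    obtain ⟨z, hz, hz0⟩ := h0
    have hzB := hB.2 z (Matrix.mem_spectrum_iff_isRoot_charpoly.mpr hz0)
    rw [← spectrum.neg_eq] at hz
    have hzB' := hB'.2 (-z) hz
    simp only [Complex.neg_re] at hzB'
    linarith
  have h0 := hp B.charpoly
  rw [Matrix.aeval_self_charpoly, zero_mul] at h0
  exact sub_eq_zero.mp ((hu.mul_left_eq_zero).mp h0.symm)

end BlockSpin

end

/-! Fourier analysis on the tori turns the theorem into estimates on symbols, uniform in `L`, `n`
and the volume. At real momenta `D_0` has the symbol `heatSym`, namely 1 - exp(-ĥ) exp(iθ₀); it has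
nonnegative real part and the size |θ₀| + |θ|². `Q` multiplies a character by the real number
`blockSym` and identifies the characters in one fibre, that is, those whose momenta differ by a
reciprocal vector of the coarse lattice.

With v_l the block symbols and d_l the values of L^{2n} `heatSym` on the fibre over k, the symbol of
Δ^{(n)} is 1/(ρ + ∑ v_l²/d_l), where ρ is the symbol of 𝔔_n⁻¹. Only d_0 can be small, so this is
rewritten as d_0/Z with Z = v_0² + d_0 X and X = ρ + ∑_{l≠0} v_l²/d_l, which makes sense at d_0 = 0
and supplies the limit t ↓ 0. The v_l are real and the d_l have nonnegative real part, so Re X ≥ Re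
ρ; as v_0 is bounded below, |Z| is at least a constant times 1 + |d_0| (`FiberData.le_norm_Z`). This
persists under small imaginary shifts of one momentum component (`exists_fiber_bounds`), because
Parseval bounds v_l and its variation in ℓ² uniformly in the block size. Hence Δ^{(n)} again has a
symbol of parabolic type, with constants independent of `n` and `L`
(`exists_parabolicSymbol_deltaSym`).

On the fibre over a coarse momentum, L² times (a/L²) Q*Q + Δ + λ is a diagonal matrix plus a rank
one matrix, and the denominator Z of its explicit inverse has the same form with ρ = 1/a. So the
column sums of the inverse fibre matrices are O((L⁻² + λ)⁻¹), also for shifts of the coarse momentum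
by a fixed imaginary amount (`exists_fibMat_bounds`). An entry of the resolvent is an average of
fibre matrices over discrete momenta. By contour shift and aliasing it decays exponentially at a
fixed rate in each direction, measured in units of the coarse lattice (`exists_fibAvg_bounds`);
these units are the ones of the torus after conjugation by 𝕃_*.

With A the inverse covariance, √C = (2/π) ∫₀^∞ (A + s²)⁻¹ ds and its inverse is A√C. Integration of
the resolvent bounds gives the same decay with prefactor `L`, against L² for C itself
(`exists_isPrincipalSqrt_inv`). The quadratic form of A has nonnegative real part, which makes the
root principal. Summation over the torus costs L⁵, so the norms are O(L⁷), within the claimed L⁹. -/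

noncomputable section

namespace BlockSpin

/-! ### Exponential decay of discrete Fourier sums of analytic functions -/

/-- The Fourier coefficients of a periodic function that is analytic in a strip decay
exponentially. -/
theorem norm_integral_mul_exp_le {f : ℂ → ℂ} {b M : ℝ} (hb : 0 < b)
    (hd : ∀ z : ℂ, |z.im| ≤ b → DifferentiableAt ℂ f z)
    (hper : ∀ z, f (z + 2 * Real.pi) = f z)
    (hM : ∀ z : ℂ, |z.im| ≤ b → ‖f z‖ ≤ M) (n : ℤ) :
    ‖∫ x in (0 : ℝ)..2 * Real.pi, f x * Complex.exp (-(n * x * Complex.I))‖ ≤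
      M * Real.exp (-(b * |(n : ℝ)|)) * (2 * Real.pi) := by
  -- The height of the shifted contour: y = ∓b, with the sign for which |exp(-in(x+iy))| = exp(ny)
  -- is the decaying factor. The vertical sides of the rectangle cancel by periodicity.
  obtain ⟨y, hy, hny⟩ : ∃ y : ℝ, |y| ≤ b ∧ n * y = -(b * |(n : ℝ)|) := by
    rcases le_total 0 (n : ℝ) with h | h
    · exact ⟨-b, by rw [abs_neg, abs_of_pos hb], by rw [abs_of_nonneg h]; ring⟩
    · exact ⟨b, by rw [abs_of_pos hb], by rw [abs_of_nonpos h]; ring⟩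
  set F : ℂ → ℂ := fun z => f z * Complex.exp (-(n * z * Complex.I)) with hF
  have hFper : ∀ z, F (z + 2 * Real.pi) = F z := by
    intro z
    simp only [hF, hper]
    congr 1
    rw [Complex.exp_eq_exp_iff_exists_int]
    exact ⟨-n, by push_cast; ring⟩
  have key := Complex.integral_boundary_rect_eq_zero_of_differentiableOn F 0
    (2 * Real.pi + y * Complex.I) (by
      intro z hz
      have hz2 : z.im ∈ Set.uIcc (0 : ℝ) y := by
        have := hz.2
        simpa using this
      have hzb : |z.im| ≤ b := by
        refine le_trans ?_ hy
        have := Set.abs_sub_left_of_mem_uIcc hz2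
        simpa using this
      apply DifferentiableAt.differentiableWithinAt
      exact (hd z hzb).mul (by fun_prop))
  simp only [Complex.zero_re, Complex.zero_im, Complex.add_re, Complex.mul_re, Complex.re_ofNat,
    Complex.ofReal_re, Complex.im_ofNat, Complex.ofReal_im, mul_zero, sub_zero, Complex.I_re,
    Complex.I_im, mul_one, zero_mul, add_zero, Complex.add_im, Complex.mul_im, zero_add,
    Complex.ofReal_zero] at key
  have hside : ∀ t : ℝ, F (((2 * Real.pi : ℝ) : ℂ) + t * Complex.I) = F (t * Complex.I) := by
    intro t
    rw [← hFper (t * Complex.I)]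
    congr 1
    push_cast
    ring
  simp only [hside] at key
  rw [add_sub_cancel_right, sub_eq_zero] at key
  change ‖∫ x in (0 : ℝ)..2 * Real.pi, F x‖ ≤ _
  rw [key]
  refine (intervalIntegral.norm_integral_le_of_norm_le_const (C := M * Real.exp (-(b * |(n : ℝ)|)))
    ?_).trans ?_
  · intro x _
    simp only [hF]
    rw [norm_mul, Complex.norm_exp]
    have h1 : (-((n : ℂ) * (x + y * Complex.I) * Complex.I)).re = -(b * |(n : ℝ)|) := by
      rw [← hny]
      simp
    rw [h1]
    gcongr
    apply hM
    simpa using hy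
  · rw [sub_zero, abs_of_pos Real.two_pi_pos]

theorem sum_exp_two_pi_div {N : ℕ} (hN : N ≠ 0) (j : ℤ) :
    ∑ w ∈ Finset.range N, Complex.exp (2 * Real.pi * w / N * j * Complex.I) =
      if (N : ℤ) ∣ j then (N : ℂ) else 0 := by
  have hN' : (N : ℂ) ≠ 0 := by exact_mod_cast hN
  have h1 : ∀ w : ℕ, Complex.exp (2 * Real.pi * w / N * j * Complex.I) =
      Complex.exp (2 * Real.pi * j / N * Complex.I) ^ w := by
    intro w
    rw [← Complex.exp_nat_mul]
    congr 1
    ring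
  simp only [h1]
  have h2 : Complex.exp (2 * Real.pi * j / N * Complex.I) = 1 ↔ (N : ℤ) ∣ j := by
    rw [Complex.exp_eq_one_iff]
    constructor
    · rintro ⟨z, hz⟩
      refine ⟨z, ?_⟩
      have : (j : ℂ) = N * z := by
        have h3 : (2 * Real.pi * Complex.I : ℂ) ≠ 0 := Complex.two_pi_I_ne_zero
        field_simp at hz
        exact hz
      exact_mod_cast this
    · rintro ⟨z, rfl⟩
      refine ⟨z, ?_⟩
      push_cast
      field_simp
  split_ifs with h
  · simp [h2.2 h]
  · have h3 : Complex.exp (2 * Real.pi * j / N * Complex.I) ≠ 1 := fun h' => h (h2.1 h')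
    rw [geom_sum_eq h3, ← Complex.exp_nat_mul]
    have : Complex.exp (N * (2 * Real.pi * j / N * Complex.I)) = 1 := by
      rw [Complex.exp_eq_one_iff]
      exact ⟨j, by field_simp⟩
    rw [this]; simp

/-- A periodic function analytic in a strip is the sum of its Fourier series, whose coefficients
decay exponentially. -/
theorem exists_fourier_coeff {f : ℂ → ℂ} {b M : ℝ} (hb : 0 < b)
    (hd : ∀ z : ℂ, |z.im| ≤ b → DifferentiableAt ℂ f z)
    (hper : ∀ z, f (z + 2 * Real.pi) = f z)
    (hM : ∀ z : ℂ, |z.im| ≤ b → ‖f z‖ ≤ M) :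
    ∃ c : ℤ → ℂ, (∀ n, ‖c n‖ ≤ M * Real.exp (-(b * |(n : ℝ)|))) ∧
      ∀ x : ℝ, HasSum (fun n => c n * Complex.exp (n * x * Complex.I)) (f x) := by
  have : Fact (0 < 2 * Real.pi) := ⟨Real.two_pi_pos⟩
  have hcont : Continuous fun x : ℝ => f x := by
    rw [continuous_iff_continuousAt]
    intro x
    have h1 : ContinuousAt f (x : ℂ) := (hd x (by simpa using hb.le)).continuousAt
    exact h1.comp Complex.continuous_ofReal.continuousAt
  have hp : Function.Periodic (fun x : ℝ => f x) (2 * Real.pi) := by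
    intro x
    have := hper x
    push_cast
    exact this
  let g : C(AddCircle (2 * Real.pi), ℂ) :=
    ⟨hp.lift, continuous_coinduced_dom.mpr hcont⟩
  have hg : ∀ x : ℝ, g (x : AddCircle (2 * Real.pi)) = f x := fun x => hp.lift_coe x
  have hexp : ∀ (n : ℤ) (x : ℝ), (fourier n (x : AddCircle (2 * Real.pi)) : ℂ) =
      Complex.exp (n * x * Complex.I) := by
    intro n x
    rw [fourier_coe_apply]
    congr 1
    have := Real.pi_ne_zero
    push_cast
    field_simp
  have hcoef : ∀ n, ‖fourierCoeff g n‖ ≤ M * Real.exp (-(b * |(n : ℝ)|)) := by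
    intro n
    rw [fourierCoeff_eq_intervalIntegral g n 0, norm_smul, zero_add]
    have h1 : ∫ x in (0 : ℝ)..2 * Real.pi, fourier (-n) (x : AddCircle (2 * Real.pi)) •
        g (x : AddCircle (2 * Real.pi)) =
        ∫ x in (0 : ℝ)..2 * Real.pi, f x * Complex.exp (-(n * x * Complex.I)) := by
      congr 1
      ext x
      rw [hexp, hg, smul_eq_mul, mul_comm]
      congr 2
      push_cast
      ring
    rw [h1]
    have h2 := norm_integral_mul_exp_le hb hd hper hM n
    have h3 : ‖(1 / (2 * Real.pi) : ℝ)‖ = (2 * Real.pi)⁻¹ := by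
      rw [Real.norm_of_nonneg (by positivity)]; simp
    rw [h3, inv_mul_le_iff₀ Real.two_pi_pos]
    linarith
  have hsum : Summable fun n : ℤ => M * Real.exp (-(b * |(n : ℝ)|)) := by
    apply Summable.mul_left
    have h1 : Summable fun n : ℕ => Real.exp (-(b * (n : ℝ))) := by
      have := Real.summable_exp_nat_mul_iff.2 (neg_lt_zero.2 hb)
      refine this.congr fun n => ?_
      congr 1; ring
    refine Summable.of_nat_of_neg ?_ ?_ <;> simpa using h1
  have hs : Summable (fourierCoeff g) := Summable.of_norm_bounded hsum hcoef
  refine ⟨fourierCoeff g, hcoef, fun x => ?_⟩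
  have := has_pointwise_sum_fourier_series_of_summable hs (x : AddCircle (2 * Real.pi))
  rw [hg] at this
  simpa only [hexp, smul_eq_mul] using this

/-- Aliasing: in a sum over N equally spaced points only the Fourier coefficients with index Nz - x
survive. Since 2|x| ≤ N, |Nz - x| ≥ |x| + N(|z| - 1) for z ≠ 0, so all images together cost the
factor 1 + 2/(1 - exp(-bN)). The offset t contributes only phases. -/
theorem norm_sum_range_mul_exp_le {f : ℂ → ℂ} {b M : ℝ} (hb : 0 < b)
    (hd : ∀ z : ℂ, |z.im| ≤ b → DifferentiableAt ℂ f z)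
    (hper : ∀ z, f (z + 2 * Real.pi) = f z)
    (hM : ∀ z : ℂ, |z.im| ≤ b → ‖f z‖ ≤ M) {N : ℕ} (hN : N ≠ 0) (x : ℤ) (hx : 2 * |x| ≤ N)
    (t : ℝ) :
    ‖∑ w ∈ Finset.range N, f (t + 2 * Real.pi * w / N) *
        Complex.exp ((t + 2 * Real.pi * w / N) * x * Complex.I)‖ ≤
      N * (M * (1 + 2 / (1 - Real.exp (-(b * N)))) * Real.exp (-(b * |(x : ℝ)|))) := by
  obtain ⟨c, hc, hsum⟩ := exists_fourier_coeff hb hd hper hM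
  have hM0 : 0 ≤ M := (norm_nonneg _).trans (hM 0 (by simpa using hb.le))
  have hNpos : (0 : ℝ) < N := by positivity
  set T : ℤ → ℂ := fun n => c n * Complex.exp ((n + x) * t * Complex.I) *
    (if (N : ℤ) ∣ n + x then (N : ℂ) else 0) with hT
  have h1 : HasSum T (∑ w ∈ Finset.range N, f (t + 2 * Real.pi * w / N) *
      Complex.exp ((t + 2 * Real.pi * w / N) * x * Complex.I)) := by
    have h2 : ∀ w ∈ Finset.range N, HasSum (fun n : ℤ => c n * Complex.exp ((n + x) * t * Complex.I)
        * Complex.exp (2 * Real.pi * w / N * (n + x : ℤ) * Complex.I))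
        (f (t + 2 * Real.pi * w / N) *
          Complex.exp ((t + 2 * Real.pi * w / N) * x * Complex.I)) := by
      intro w _
      have h3 := (hsum (t + 2 * Real.pi * w / N)).mul_right
        (Complex.exp ((t + 2 * Real.pi * w / N) * x * Complex.I))
      push_cast at h3 ⊢
      refine h3.congr_fun fun n => ?_
      rw [mul_assoc, mul_assoc (c n), ← Complex.exp_add, ← Complex.exp_add]
      congr 2
      ring
    refine (hasSum_sum h2).congr_fun fun n => ?_
    rw [← Finset.mul_sum, sum_exp_two_pi_div hN]
  have hinj : Function.Injective fun z : ℤ => N * z - x := by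
    intro z z' h
    simpa [hN] using h
  have h4 := (hinj.hasSum_iff (f := T) (by
    intro n hn
    simp only [hT]
    rw [if_neg, mul_zero]
    rintro ⟨z, hz⟩
    exact hn ⟨z, by simp only; omega⟩)).2 h1
  set q := Real.exp (-(b * N)) with hq
  have hq1 : q < 1 := by rw [hq, Real.exp_lt_one_iff]; nlinarith
  -- Majorant of the z-th image relative to exp(-b|x|): 1 for z = 0, and a geometric series in |z| -
  -- 1 on either side.
  set g : ℤ → ℝ := fun z => if z = 0 then 1 else q ^ (z.natAbs - 1) with hg
  have hgs : HasSum g ((1 - q)⁻¹ + 1 + (1 - q)⁻¹) := by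
    have hgeo := hasSum_geometric_of_lt_one (Real.exp_pos _).le hq1
    have e0 : g 0 = 1 := by simp [hg]
    rw [← e0]
    refine HasSum.of_add_one_of_neg_add_one (f := g) ?_ ?_
    · refine hgeo.congr_fun fun n => ?_
      have h0 : ((n : ℤ) + 1) ≠ 0 := by omega
      have h' : ((n : ℤ) + 1).natAbs - 1 = n := by omega
      simp only [hg, if_neg h0, h', hq]
    · refine hgeo.congr_fun fun n => ?_
      have h0 : (-((n : ℤ) + 1)) ≠ 0 := by omega
      have h' : (-((n : ℤ) + 1)).natAbs - 1 = n := by omega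
      simp only [hg, if_neg h0, h', hq]
  have hbound := hgs.mul_left (N * M * Real.exp (-(b * |(x : ℝ)|)))
  rw [← h4.tsum_eq]
  refine (tsum_of_norm_bounded hbound fun z => ?_).trans (le_of_eq (by ring))
  simp only [Function.comp, hT]
  rw [norm_mul, norm_mul]
  have e1 : ‖Complex.exp (((N * z - x : ℤ) + x) * t * Complex.I)‖ = 1 := by
    have := Complex.norm_exp_ofReal_mul_I (((N * z - x : ℤ) + x) * t)
    push_cast at this ⊢
    exact this
  have e2 : ‖(if (N : ℤ) ∣ N * z - x + x then (N : ℂ) else 0)‖ = N := by simp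
  rw [e1, e2, mul_one]
  have e3 : Real.exp (-(b * |((N * z - x : ℤ) : ℝ)|)) ≤ Real.exp (-(b * |(x : ℝ)|)) * g z := by
    by_cases hz : z = 0
    · subst hz; simp [hg]
    · simp only [hg, if_neg hz]
      rw [hq, ← Real.exp_nat_mul, ← Real.exp_add]
      apply Real.exp_le_exp.2
      have h5 : ((z.natAbs - 1 : ℕ) : ℝ) = |(z : ℝ)| - 1 := by
        rw [Nat.cast_sub (by omega), Nat.cast_natAbs]
        push_cast; ring
      rw [h5]
      have h6 : N * |(z : ℝ)| ≤ |((N * z - x : ℤ) : ℝ)| + |(x : ℝ)| := by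
        have := abs_sub_abs_le_abs_sub ((N : ℝ) * z) x
        rw [abs_mul, abs_of_pos hNpos] at this
        push_cast
        linarith
      have h7 : 2 * |(x : ℝ)| ≤ N := by exact_mod_cast hx
      nlinarith
  calc _ ≤ (M * (Real.exp (-(b * |(x : ℝ)|)) * g z)) * N := by
        gcongr
        exact (hc _).trans (by gcongr)
    _ = _ := by ring

/-! ### The square root of an inverse as an integral over resolvents -/

theorem inv_add_sq_le {κ : ℝ} (hκ : 0 < κ) (s : ℝ) :
    (κ + s ^ 2)⁻¹ ≤ (1 + κ⁻¹) * (1 + s ^ 2)⁻¹ := by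
  have h1 : 0 < κ + s ^ 2 := by positivity
  have h2 : 0 < 1 + s ^ 2 := by positivity
  rw [← div_eq_mul_inv, le_div_iff₀ h2, inv_mul_le_iff₀ h1]
  have : κ * κ⁻¹ = 1 := mul_inv_cancel₀ hκ.ne'
  have h3 : 0 < κ⁻¹ := by positivity
  nlinarith [mul_nonneg h3.le (sq_nonneg s)]

theorem integrable_inv_add_sq {κ : ℝ} (hκ : 0 < κ) :
    MeasureTheory.Integrable fun s : ℝ => (κ + s ^ 2)⁻¹ := by
  refine (integrable_inv_one_add_sq.const_mul (1 + κ⁻¹)).mono' ?_ ?_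
  · apply Continuous.aestronglyMeasurable
    exact Continuous.inv₀ (by fun_prop) fun s => by positivity
  · refine Filter.Eventually.of_forall fun s => ?_
    rw [Real.norm_of_nonneg (by positivity)]
    exact inv_add_sq_le hκ s

theorem integral_Ioi_inv_sq_add_sq {l : ℝ} (hl : 0 < l) :
    ∫ s in Set.Ioi (0 : ℝ), (l ^ 2 + s ^ 2)⁻¹ = Real.pi / 2 * l⁻¹ := by
  have h := MeasureTheory.integral_comp_mul_left_Ioi (fun s : ℝ => (l ^ 2 + s ^ 2)⁻¹) 0 hl
  have h2 : ∀ x : ℝ, (l ^ 2 + (l * x) ^ 2)⁻¹ = (l ^ 2)⁻¹ * (1 + x ^ 2)⁻¹ := by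
    intro x
    rw [← mul_inv]
    congr 1; ring
  simp only [h2, mul_zero, smul_eq_mul] at h
  rw [MeasureTheory.integral_const_mul, integral_Ioi_inv_one_add_sq, Real.arctan_zero,
    sub_zero] at h
  field_simp at h ⊢
  linarith

variable {𝔸 : Type*} [NormedRing 𝔸] [NormedAlgebra ℂ 𝔸]

/-- `G` is the resolvent `l ↦ (a + l)⁻¹` on the half line `l ≥ 0`, extended by a constant to the
negative half line, and decays at infinity. -/
structure IsResolvent (a : 𝔸) (G : ℝ → 𝔸) (κ K : ℝ) : Prop where
  pos : 0 < κ
  left : ∀ l : ℝ, 0 ≤ l → (a + (l : ℂ) • (1 : 𝔸)) * G l = 1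
  right : ∀ l : ℝ, 0 ≤ l → G l * (a + (l : ℂ) • (1 : 𝔸)) = 1
  neg : ∀ l : ℝ, l ≤ 0 → G l = G 0
  bound : ∀ l : ℝ, 0 ≤ l → ‖G l‖ ≤ K * (κ + l)⁻¹

namespace IsResolvent

variable {a : 𝔸} {G : ℝ → 𝔸} {κ K : ℝ}

theorem K_nonneg (h : IsResolvent a G κ K) : 0 ≤ K := by
  have h1 := (norm_nonneg _).trans (h.bound 0 le_rfl)
  have h2 := h.pos
  rw [add_zero] at h1
  exact nonneg_of_mul_nonneg_left h1 (by positivity)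

theorem resolvent_sub (h : IsResolvent a G κ K) {l l' : ℝ} (hl : 0 ≤ l) (hl' : 0 ≤ l') :
    G l - G l' = ((l' - l : ℝ) : ℂ) • (G l * G l') := by
  have h1 : G l * ((a + (l' : ℂ) • (1 : 𝔸)) - (a + (l : ℂ) • (1 : 𝔸))) * G l' = G l - G l' := by
    rw [mul_sub, sub_mul, mul_assoc, h.left l' hl', h.right l hl, mul_one, one_mul]
  rw [← h1, add_sub_add_left_eq_sub, ← sub_smul]
  push_cast
  rw [mul_smul_comm, mul_one, smul_mul_assoc]

theorem comm (h : IsResolvent a G κ K) {l : ℝ} (hl : 0 ≤ l) : a * G l = G l * a := by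
  have h1 := h.left l hl
  have h2 := h.right l hl
  rw [add_mul, smul_mul_assoc, one_mul] at h1
  rw [mul_add, mul_smul_comm, mul_one] at h2
  exact add_right_cancel (h1.trans h2.symm)

theorem norm_le (h : IsResolvent a G κ K) {l : ℝ} (hl : 0 ≤ l) : ‖G l‖ ≤ K * κ⁻¹ := by
  refine (h.bound l hl).trans ?_
  have := h.pos
  have := h.K_nonneg
  gcongr
  linarith

theorem eq_max (h : IsResolvent a G κ K) (l : ℝ) : G l = G (max l 0) := by
  rcases le_total l 0 with hl | hl
  · rw [max_eq_right hl, h.neg l hl]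
  · rw [max_eq_left hl]

/-- By the resolvent identity `G` is Lipschitz on the half line; the constant extension to negative
arguments makes it continuous on all of ℝ. -/
theorem continuous (h : IsResolvent a G κ K) : Continuous G := by
  have hL : LipschitzWith (Real.toNNReal ((K * κ⁻¹) ^ 2)) G := by
    refine LipschitzWith.of_dist_le_mul fun l l' => ?_
    rw [h.eq_max l, h.eq_max l', dist_eq_norm, h.resolvent_sub (le_max_right _ _) (le_max_right _ _),
      norm_smul, Complex.norm_real, Real.coe_toNNReal _ (sq_nonneg _), mul_comm]
    refine mul_le_mul ?_ ?_ (norm_nonneg _) (sq_nonneg _)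
    · refine (norm_mul_le _ _).trans ?_
      rw [sq]
      have := h.norm_le (le_max_right l 0)
      have h2 := h.norm_le (le_max_right l' 0)
      gcongr
      exact (norm_nonneg _).trans this
    · rw [dist_comm, Real.dist_eq]
      exact abs_max_sub_max_le_abs _ _ _
  exact hL.continuous

theorem hasDerivAt (h : IsResolvent a G κ K) {l : ℝ} (hl : 0 < l) :
    HasDerivAt G (-(G l * G l)) l := by
  rw [hasDerivAt_iff_tendsto_slope]
  have h1 : Tendsto (fun l' => -(G l' * G l)) (𝓝[≠] l) (𝓝 (-(G l * G l))) := by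
    apply Tendsto.mono_left _ nhdsWithin_le_nhds
    exact (((h.continuous.mul continuous_const).neg).tendsto l)
  refine h1.congr' ?_
  have h2 : ∀ᶠ l' in 𝓝[≠] l, 0 < l' := nhdsWithin_le_nhds (lt_mem_nhds hl)
  filter_upwards [h2, self_mem_nhdsWithin] with l' hl' hne
  rw [slope_def_module, h.resolvent_sub hl'.le hl.le, Complex.coe_smul, smul_smul]
  have : l' - l ≠ 0 := sub_ne_zero.2 hne
  have h3 : (l' - l)⁻¹ * (l - l') = -1 := by field_simp; ring
  rw [h3, neg_one_smul]

/-- `∫₀^∞ (a + t + s²)⁻¹ ds`. -/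
def sqrtInt (G : ℝ → 𝔸) (t : ℝ) : 𝔸 := ∫ s in Set.Ioi (0 : ℝ), G (t + s ^ 2)

theorem bound_sq (h : IsResolvent a G κ K) {t : ℝ} (ht : 0 ≤ t) (s : ℝ) :
    ‖G (t + s ^ 2)‖ ≤ K * (κ + s ^ 2)⁻¹ := by
  refine (h.bound _ (by positivity)).trans ?_
  have := h.pos
  have := h.K_nonneg
  gcongr
  linarith

theorem integrable (h : IsResolvent a G κ K) {t : ℝ} (ht : 0 ≤ t) :
    MeasureTheory.IntegrableOn (fun s : ℝ => G (t + s ^ 2)) (Set.Ioi 0) := by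
  refine MeasureTheory.Integrable.mono' (((integrable_inv_add_sq h.pos).const_mul K).integrableOn)
    ?_ (Filter.Eventually.of_forall fun s => h.bound_sq ht s)
  exact (h.continuous.comp (by fun_prop)).aestronglyMeasurable

theorem bound_mul (h : IsResolvent a G κ K) {t : ℝ} (ht : 0 ≤ t) (s : ℝ) :
    ‖G (t + s ^ 2) * G (t + s ^ 2)‖ ≤ (K * κ⁻¹) * (K * (κ + s ^ 2)⁻¹) := by
  refine (norm_mul_le _ _).trans ?_
  have h1 := h.norm_le (l := t + s ^ 2) (by positivity)
  have h2 := h.bound_sq ht s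
  gcongr
  exact (norm_nonneg _).trans h1

theorem integrable_mul (h : IsResolvent a G κ K) {t : ℝ} (ht : 0 ≤ t) :
    MeasureTheory.IntegrableOn (fun s : ℝ => G (t + s ^ 2) * G (t + s ^ 2)) (Set.Ioi 0) := by
  refine MeasureTheory.Integrable.mono'
    ((((integrable_inv_add_sq h.pos).const_mul K).const_mul (K * κ⁻¹)).integrableOn)
    ?_ (Filter.Eventually.of_forall fun s => h.bound_mul ht s)
  have : Continuous fun s : ℝ => G (t + s ^ 2) := h.continuous.comp (by fun_prop)
  exact (this.mul this).aestronglyMeasurable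

theorem continuousOn_sqrtInt (h : IsResolvent a G κ K) :
    ContinuousOn (sqrtInt G) (Set.Ici 0) := by
  have h1 : Continuous fun t => sqrtInt G (max t 0) := by
    unfold sqrtInt
    refine MeasureTheory.continuous_of_dominated (bound := fun s => K * (κ + s ^ 2)⁻¹) ?_ ?_ ?_ ?_
    · intro t
      exact (h.continuous.comp (by fun_prop)).aestronglyMeasurable
    · intro t
      exact Filter.Eventually.of_forall fun s => h.bound_sq (le_max_right _ _) s
    · exact ((integrable_inv_add_sq h.pos).const_mul K).integrableOn
    · refine Filter.Eventually.of_forall fun s => ?_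
      exact h.continuous.comp (by fun_prop)
  refine h1.continuousOn.congr fun t ht => ?_
  simp only [Set.mem_Ici] at ht
  simp only [max_eq_left ht]

theorem hasDerivAt_sqrtInt (h : IsResolvent a G κ K) {t : ℝ} (ht : 0 < t) :
    HasDerivAt (sqrtInt G) (-∫ s in Set.Ioi (0 : ℝ), G (t + s ^ 2) * G (t + s ^ 2)) t := by
  rw [← MeasureTheory.integral_neg]
  refine (hasDerivAt_integral_of_dominated_loc_of_deriv_le (s := Set.Ioi 0)
    (F := fun t s => G (t + s ^ 2)) (F' := fun t s => -(G (t + s ^ 2) * G (t + s ^ 2)))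
    (bound := fun s => (K * κ⁻¹) * (K * (κ + s ^ 2)⁻¹)) (Ioi_mem_nhds ht) ?_ (h.integrable ht.le)
    (h.integrable_mul ht.le).neg.aestronglyMeasurable ?_ ?_ ?_).2
  · refine Filter.Eventually.of_forall fun t => ?_
    exact (h.continuous.comp (by fun_prop)).aestronglyMeasurable
  · refine Filter.Eventually.of_forall fun s t ht => ?_
    rw [norm_neg]
    exact h.bound_mul (le_of_lt ht) s
  · exact (((integrable_inv_add_sq h.pos).const_mul K).const_mul (K * κ⁻¹)).integrableOn
  · refine Filter.Eventually.of_forall fun s t ht => ?_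
    have ht' : (0 : ℝ) < t := ht
    have h1 := h.hasDerivAt (l := t + s ^ 2) (by positivity)
    have h2 : HasDerivAt (fun t : ℝ => t + s ^ 2) 1 t := (hasDerivAt_id t).add_const _
    have h3 := h1.scomp t h2
    rw [one_smul] at h3
    exact h3

/-- The defining equation reads l G(l) = 1 - a G(l), and G(l) tends to 0. -/
theorem tendsto_smul_resolvent (h : IsResolvent a G κ K) :
    Tendsto (fun l : ℝ => l • G l) atTop (𝓝 1) := by
  have h1 : Tendsto (fun l : ℝ => 1 - a * G l) atTop (𝓝 (1 - a * 0)) := by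
    refine tendsto_const_nhds.sub (tendsto_const_nhds.mul ?_)
    refine squeeze_zero_norm' (a := fun l => K * l⁻¹) ?_ ?_
    · filter_upwards [eventually_gt_atTop 0] with l hl
      refine (h.bound l hl.le).trans ?_
      have := h.pos
      have := h.K_nonneg
      gcongr
      linarith
    · simpa using tendsto_inv_atTop_zero.const_mul K
  rw [mul_zero, sub_zero] at h1
  refine h1.congr' ?_
  filter_upwards [eventually_ge_atTop 0] with l hl
  have := h.left l hl
  rw [add_mul, smul_mul_assoc, one_mul, Complex.coe_smul] at this
  rw [← this]; abel

theorem commute_sqrtInt (h : IsResolvent a G κ K) {t : ℝ} (ht : 0 ≤ t) :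
    a * sqrtInt G t = sqrtInt G t * a := by
  unfold sqrtInt
  rw [← _root_.integral_const_mul_of_integrable (h.integrable ht),
    ← _root_.integral_mul_const_of_integrable (h.integrable ht)]
  congr 1
  ext s
  exact h.comm (by positivity)

variable [CompleteSpace 𝔸]

/-- Integration by parts: s G(t + s²) has derivative 2(a + t)G² - G and vanishes at both ends of the
half line. -/
theorem two_mul_integral_mul (h : IsResolvent a G κ K) {t : ℝ} (ht : 0 < t) :
    (2 : ℝ) • ((a + (t : ℂ) • (1 : 𝔸)) * ∫ s in Set.Ioi (0 : ℝ), G (t + s ^ 2) * G (t + s ^ 2)) =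
      sqrtInt G t := by
  have hder : ∀ s ∈ Set.Ioi (0 : ℝ), HasDerivAt (fun s : ℝ => s • G (t + s ^ 2))
      ((2 : ℝ) • ((a + (t : ℂ) • (1 : 𝔸)) * (G (t + s ^ 2) * G (t + s ^ 2))) - G (t + s ^ 2)) s := by
    intro s _
    have h1 := h.hasDerivAt (l := t + s ^ 2) (by positivity)
    have h2 : HasDerivAt (fun s : ℝ => t + s ^ 2) (2 * s) s := by
      have := (hasDerivAt_pow 2 s).const_add t
      simpa using this
    have h3 := (hasDerivAt_id s).smul (h1.scomp s h2)
    refine h3.congr_deriv ?_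
    have h4 := h.left (t + s ^ 2) (by positivity)
    have h5 : (a + (t : ℂ) • (1 : 𝔸)) * (G (t + s ^ 2) * G (t + s ^ 2)) =
        G (t + s ^ 2) - ((s ^ 2 : ℝ) : ℂ) • (G (t + s ^ 2) * G (t + s ^ 2)) := by
      have h6 : a + (t : ℂ) • (1 : 𝔸) = (a + ((t + s ^ 2 : ℝ) : ℂ) • (1 : 𝔸)) -
          ((s ^ 2 : ℝ) : ℂ) • (1 : 𝔸) := by
        push_cast
        rw [add_smul]; abel
      rw [h6, sub_mul, ← mul_assoc, h4, one_mul, smul_mul_assoc, one_mul]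
    rw [h5, Complex.coe_smul]
    simp only [id, one_smul, Function.comp]
    module
  have hI : MeasureTheory.IntegrableOn (fun s : ℝ => (2 : ℝ) • ((a + (t : ℂ) • (1 : 𝔸)) *
      (G (t + s ^ 2) * G (t + s ^ 2)))) (Set.Ioi 0) :=
    ((h.integrable_mul ht.le).const_mul (a + (t : ℂ) • (1 : 𝔸))).smul (2 : ℝ)
  have hf_int : MeasureTheory.IntegrableOn (fun s : ℝ => (2 : ℝ) • ((a + (t : ℂ) • (1 : 𝔸)) *
      (G (t + s ^ 2) * G (t + s ^ 2))) - G (t + s ^ 2)) (Set.Ioi 0) :=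
    hI.sub (h.integrable ht.le)
  have hlim : Tendsto (fun s : ℝ => s • G (t + s ^ 2)) atTop (𝓝 0) := by
    refine squeeze_zero_norm' (a := fun s => K * s⁻¹) ?_ ?_
    · filter_upwards [eventually_gt_atTop 0] with s hs
      rw [norm_smul, Real.norm_of_nonneg hs.le]
      have h1 := h.bound_sq ht.le s
      have h2 : (κ + s ^ 2)⁻¹ ≤ (s ^ 2)⁻¹ := by
        have := h.pos
        gcongr; linarith
      have h3 := h.K_nonneg
      calc s * ‖G (t + s ^ 2)‖ ≤ s * (K * (s ^ 2)⁻¹) := by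
            gcongr
            exact h1.trans (by gcongr)
        _ = K * s⁻¹ := by field_simp
    · simpa using tendsto_inv_atTop_zero.const_mul K
  have h0 : ContinuousWithinAt (fun s : ℝ => s • G (t + s ^ 2)) (Set.Ici 0) 0 := by
    apply Continuous.continuousWithinAt
    exact continuous_id.smul (h.continuous.comp (by fun_prop))
  have key := MeasureTheory.integral_Ioi_of_hasDerivAt_of_tendsto h0 hder hf_int hlim
  rw [MeasureTheory.integral_sub hI (h.integrable ht.le), MeasureTheory.integral_smul, zero_smul, sub_zero, sub_eq_zero] at key
  rw [sqrtInt, ← key]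
  congr 1
  exact (_root_.integral_const_mul_of_integrable (h.integrable_mul ht.le)).symm

theorem apply_sqrtInt (h : IsResolvent a G κ K) {t : ℝ} (ht : 0 ≤ t) [FiniteDimensional ℝ 𝔸]
    (φ : 𝔸 →ₗ[ℝ] ℂ) : φ (sqrtInt G t) = ∫ s in Set.Ioi (0 : ℝ), φ (G (t + s ^ 2)) := by
  have := (LinearMap.toContinuousLinearMap φ).integral_comp_comm (h.integrable ht)
  exact this.symm

/-- `(a + t) (∫₀^∞ (a + t + s²)⁻¹ ds)²` has derivative zero. -/
theorem hasDerivAt_mul_sqrtInt_sq (h : IsResolvent a G κ K) {t : ℝ} (ht : 0 < t) :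
    HasDerivAt (fun t : ℝ => (a + (t : ℂ) • (1 : 𝔸)) * (sqrtInt G t * sqrtInt G t)) 0 t := by
  have h1 := h.hasDerivAt_sqrtInt ht
  have h2 : HasDerivAt (fun t : ℝ => a + (t : ℂ) • (1 : 𝔸)) (1 : 𝔸) t := by
    have h3 : HasDerivAt (fun t : ℝ => a + t • (1 : 𝔸)) ((1 : ℝ) • (1 : 𝔸)) t :=
      ((hasDerivAt_id t).smul_const (1 : 𝔸)).const_add a
    simpa only [Complex.coe_smul, one_smul] using h3
  have h3 := h2.mul (h1.mul h1)
  refine h3.congr_deriv ?_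
  set I := ∫ s in Set.Ioi (0 : ℝ), G (t + s ^ 2) * G (t + s ^ 2)
  have h4 := h.two_mul_integral_mul ht
  have h5 := h.commute_sqrtInt ht.le
  set b := a + (t : ℂ) • (1 : 𝔸) with hb
  set R := sqrtInt G t
  have h6 : b * R = R * b := by rw [hb, add_mul, mul_add, h5]; simp
  change 1 * (R * R) + b * (-I * R + R * -I) = 0
  have h7 : b * (-I * R + R * -I) = -((b * I) * R) - R * (b * I) := by
    have : b * (R * -I) = -(R * (b * I)) := by
      rw [← mul_assoc, h6, mul_assoc, mul_neg, mul_neg]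
    rw [mul_add, this, neg_mul, mul_neg, mul_assoc]
    abel
  have h8 : b * I = (2⁻¹ : ℝ) • R := by
    rw [← h4, smul_smul]; norm_num [I]
  rw [h7, h8, one_mul, smul_mul_assoc, mul_smul_comm]
  module

/-- After the substitution s = lx the integrand is l² G(l²(1 + x²)), which tends to (1 + x²)⁻¹ and
is dominated by a multiple of it. -/
theorem tendsto_sqrt_smul_sqrtInt (h : IsResolvent a G κ K) :
    Tendsto (fun l : ℝ => l • sqrtInt G (l ^ 2)) atTop (𝓝 ((Real.pi / 2) • (1 : 𝔸))) := by
  have e1 : ∀ l : ℝ, 0 < l → l • sqrtInt G (l ^ 2) =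
      ∫ x in Set.Ioi (0 : ℝ), (l ^ 2) • G (l ^ 2 * (1 + x ^ 2)) := by
    intro l hl
    have h1 := MeasureTheory.integral_comp_mul_left_Ioi (fun s : ℝ => G (l ^ 2 + s ^ 2)) 0 hl
    rw [mul_zero] at h1
    rw [MeasureTheory.integral_smul]
    have h2 : ∫ x in Set.Ioi (0 : ℝ), G (l ^ 2 * (1 + x ^ 2)) =
        ∫ x in Set.Ioi (0 : ℝ), G (l ^ 2 + (l * x) ^ 2) := by
      congr 1; ext x; congr 1; ring
    rw [h2, h1, smul_smul]
    congr 1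
    field_simp
  have e2 : (Real.pi / 2) • (1 : 𝔸) = ∫ x in Set.Ioi (0 : ℝ), (1 + x ^ 2)⁻¹ • (1 : 𝔸) := by
    rw [integral_smul_const, integral_Ioi_inv_one_add_sq, Real.arctan_zero, sub_zero]
  rw [e2]
  have h3 : Tendsto (fun l : ℝ => ∫ x in Set.Ioi (0 : ℝ), (l ^ 2) • G (l ^ 2 * (1 + x ^ 2))) atTop
      (𝓝 (∫ x in Set.Ioi (0 : ℝ), (1 + x ^ 2)⁻¹ • (1 : 𝔸))) := by
    refine MeasureTheory.tendsto_integral_filter_of_dominated_convergence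
      (fun x => K * (1 + x ^ 2)⁻¹) ?_ ?_ ?_ ?_
    · refine Filter.Eventually.of_forall fun l => ?_
      exact ((h.continuous.comp (by fun_prop)).const_smul _).aestronglyMeasurable
    · filter_upwards [eventually_gt_atTop 0] with l hl
      refine Filter.Eventually.of_forall fun x => ?_
      rw [norm_smul, Real.norm_of_nonneg (by positivity)]
      have h4 := h.bound (l ^ 2 * (1 + x ^ 2)) (by positivity)
      have h5 := h.K_nonneg
      have h6 := h.pos
      calc l ^ 2 * ‖G (l ^ 2 * (1 + x ^ 2))‖ ≤ l ^ 2 * (K * (l ^ 2 * (1 + x ^ 2))⁻¹) := by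
            gcongr
            refine h4.trans ?_
            gcongr
            linarith
        _ = _ := by field_simp
    · exact (integrable_inv_one_add_sq.const_mul K).integrableOn
    · refine Filter.Eventually.of_forall fun x => ?_
      have hx : (0 : ℝ) < 1 + x ^ 2 := by positivity
      have h4 : Tendsto (fun l : ℝ => l ^ 2 * (1 + x ^ 2)) atTop atTop :=
        (tendsto_pow_atTop two_ne_zero).atTop_mul_const hx
      have h5 := (h.tendsto_smul_resolvent.comp h4).const_smul (1 + x ^ 2)⁻¹
      refine h5.congr fun l => ?_
      simp only [Function.comp, smul_smul]
      congr 1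
      field_simp
  refine h3.congr' ?_
  filter_upwards [eventually_gt_atTop 0] with l hl
  exact (e1 l hl).symm

/-- (a + t) times the squared integral has zero derivative for t > 0 and is continuous at t = 0, so
its value at 0 is its limit at infinity. This evaluates the square without diagonalising `a`. -/
theorem mul_sqrtInt_sq (h : IsResolvent a G κ K) :
    a * (sqrtInt G 0 * sqrtInt G 0) = ((Real.pi / 2) ^ 2) • (1 : 𝔸) := by
  set Φ : ℝ → 𝔸 := fun t => (a + (t : ℂ) • (1 : 𝔸)) * (sqrtInt G t * sqrtInt G t) with hΦ
  have hcont : ContinuousOn Φ (Set.Ici 0) := by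
    refine ContinuousOn.mul (by fun_prop) ?_
    exact h.continuousOn_sqrtInt.mul h.continuousOn_sqrtInt
  have hconst : ∀ t, 0 < t → Φ t = Φ 0 := by
    intro t ht
    have h1 : Tendsto Φ (𝓝[>] 0) (𝓝 (Φ 0)) :=
      (hcont 0 Set.self_mem_Ici).mono_left (nhdsWithin_mono _ Set.Ioi_subset_Ici_self)
    refine tendsto_nhds_unique (tendsto_const_nhds.congr' ?_) h1
    filter_upwards [Ioo_mem_nhdsGT ht] with e he
    exact constant_of_has_deriv_right_zero (f := Φ) (a := e) (b := t)
      (hcont.mono fun x hx => he.1.le.trans hx.1)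
      (fun x hx => (h.hasDerivAt_mul_sqrtInt_sq (he.1.trans_le hx.1)).hasDerivWithinAt) t
      ⟨he.2.le, le_rfl⟩
  have hlim : Tendsto (fun l : ℝ => Φ (l ^ 2)) atTop (𝓝 (((Real.pi / 2) ^ 2) • (1 : 𝔸))) := by
    have h1 : Tendsto (fun l : ℝ => ((l ^ 2)⁻¹ • a + 1) *
        ((l • sqrtInt G (l ^ 2)) * (l • sqrtInt G (l ^ 2)))) atTop
        (𝓝 (((0 : ℝ) • a + 1) * (((Real.pi / 2) • (1 : 𝔸)) * ((Real.pi / 2) • (1 : 𝔸))))) := by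
      refine Tendsto.mul (Tendsto.add (Tendsto.smul_const ?_ a) tendsto_const_nhds)
        (h.tendsto_sqrt_smul_sqrtInt.mul h.tendsto_sqrt_smul_sqrtInt)
      exact (tendsto_pow_atTop two_ne_zero).inv_tendsto_atTop
    have h2 : ((0 : ℝ) • a + 1) * (((Real.pi / 2) • (1 : 𝔸)) * ((Real.pi / 2) • (1 : 𝔸))) =
        ((Real.pi / 2) ^ 2) • (1 : 𝔸) := by
      rw [zero_smul, zero_add, one_mul, smul_mul_smul_comm, one_mul, sq]
    rw [h2] at h1
    refine h1.congr' ?_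
    filter_upwards [eventually_gt_atTop 0] with l hl
    simp only [hΦ]
    rw [smul_mul_smul_comm, mul_smul_comm, ← smul_mul_assoc, smul_add, smul_smul, ← sq,
      mul_inv_cancel₀ (by positivity), one_smul, Complex.coe_smul]
  have h3 : Tendsto (fun l : ℝ => Φ (l ^ 2)) atTop (𝓝 (Φ 0)) := by
    refine tendsto_const_nhds.congr' ?_
    filter_upwards [eventually_gt_atTop 0] with l hl
    exact (hconst _ (by positivity)).symm
  have h4 := tendsto_nhds_unique h3 hlim
  rw [← h4]
  simp [hΦ]

end IsResolvent

/-! ### The principal square root of the inverse of a matrix -/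

section SquareRoot

attribute [local instance] Matrix.linftyOpNormedRing Matrix.linftyOpNormedAlgebra
  Matrix.linftyOpNormedAddCommGroup Matrix.linftyOpNormedSpace

/-- The entries of a matrix are bounded by its operator norm, and conversely. -/
theorem linftyOpNorm_le_of_entries {ι : Type*} [Fintype ι] {A : Matrix ι ι ℂ} {W : ι → ι → ℝ}
    {c : ℝ} (hc : 0 ≤ c) (h : ∀ u u', ‖A u u'‖ ≤ W u u' * c) :
    ‖A‖ ≤ (∑ u, ∑ u', |W u u'|) * c := by
  rw [Matrix.linfty_opNorm_def]
  have h0 : (0 : ℝ) ≤ (∑ u, ∑ u', |W u u'|) * c := by positivity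
  have h1 : (Finset.univ.sup fun u => ∑ u', ‖A u u'‖₊) ≤
      (⟨(∑ u, ∑ u', |W u u'|) * c, h0⟩ : NNReal) := by
    refine Finset.sup_le fun u _ => ?_
    refine NNReal.coe_le_coe.1 ?_
    rw [NNReal.coe_sum]
    change ∑ u', ‖A u u'‖ ≤ (∑ u, ∑ u', |W u u'|) * c
    calc ∑ u', ‖A u u'‖ ≤ ∑ u', |W u u'| * c := by
          refine Finset.sum_le_sum fun u' _ => (h u u').trans ?_
          gcongr
          exact le_abs_self _
      _ = (∑ u', |W u u'|) * c := by rw [Finset.sum_mul]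
      _ ≤ (∑ u, ∑ u', |W u u'|) * c := by
          refine mul_le_mul_of_nonneg_right ?_ hc
          exact Finset.single_le_sum (f := fun u => ∑ u', |W u u'|)
            (fun u _ => by positivity) (Finset.mem_univ u)
  exact_mod_cast h1

/-- The principal square root of the inverse of a matrix, with bounds on its entries that follow
from bounds on the entries of the resolvent. -/
theorem exists_isPrincipalSqrt_inv {ι : Type*} [Fintype ι] [DecidableEq ι] {A : Matrix ι ι ℂ}
    {W W' : ι → ι → ℝ} {l : ℝ} (hl : 0 < l)
    (hu : ∀ t : ℝ, 0 ≤ t → IsUnit (A + (t : ℂ) • 1))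
    (hW : ∀ t : ℝ, 0 ≤ t → ∀ u u', ‖(A + (t : ℂ) • 1)⁻¹ u u'‖ ≤ W u u' * (l ^ 2 + t)⁻¹)
    (hW' : ∀ t : ℝ, 0 ≤ t → ∀ u u', ‖(A * (A + (t : ℂ) • 1)⁻¹) u u'‖ ≤ W' u u' * (l ^ 2 + t)⁻¹)
    (hspec : ∀ z ∈ spectrum ℂ A, 0 ≤ z.re) :
    ∃ R : Matrix ι ι ℂ, IsPrincipalSqrt R A⁻¹ ∧ IsUnit R ∧ (∀ u u', ‖R u u'‖ ≤ W u u' * l⁻¹) ∧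
      ∀ u u', ‖R⁻¹ u u'‖ ≤ W' u u' * l⁻¹ := by
  rcases isEmpty_or_nonempty ι with hι | hι
  · exact ⟨1, ⟨Subsingleton.elim _ _, fun z hz => by simp [spectrum.of_subsingleton] at hz⟩,
      isUnit_one, fun u => (hι.false u).elim, fun u => (hι.false u).elim⟩
  set G : ℝ → Matrix ι ι ℂ := fun t => (A + ((max t 0 : ℝ) : ℂ) • 1)⁻¹ with hG
  have hG0 : ∀ t, 0 ≤ t → G t = (A + (t : ℂ) • 1)⁻¹ := fun t ht => by simp [hG, max_eq_left ht]
  have hdet : ∀ t : ℝ, 0 ≤ t → IsUnit (A + (t : ℂ) • 1).det := fun t ht =>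
    (Matrix.isUnit_iff_isUnit_det _).1 (hu t ht)
  have hres : IsResolvent A G (l ^ 2) (∑ u, ∑ u', |W u u'|) :=
    { pos := by positivity
      left := fun t ht => by rw [hG0 t ht, Matrix.mul_nonsing_inv _ (hdet t ht)]
      right := fun t ht => by rw [hG0 t ht, Matrix.nonsing_inv_mul _ (hdet t ht)]
      neg := fun t ht => by simp [hG, ht]
      bound := fun t ht => by
        rw [hG0 t ht]
        exact linftyOpNorm_le_of_entries (by positivity) (hW t ht) }
  set R : Matrix ι ι ℂ := (2 / Real.pi) • IsResolvent.sqrtInt G 0 with hR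
  have hpi := Real.pi_pos
  have hRR : A * (R * R) = 1 := by
    rw [hR, smul_mul_smul_comm, mul_smul_comm, hres.mul_sqrtInt_sq, smul_smul]
    have : 2 / Real.pi * (2 / Real.pi) * (Real.pi / 2) ^ 2 = 1 := by field_simp
    rw [this, one_smul]
  have hRR' : R * R = A⁻¹ := (Matrix.inv_eq_right_inv hRR).symm
  have hAR : (A * R) * R = 1 := by rw [mul_assoc, hRR]
  have hRinv : R⁻¹ = A * R := Matrix.inv_eq_left_inv hAR
  have hRunit : IsUnit R := by
    rw [Matrix.isUnit_iff_isUnit_det]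
    exact Matrix.isUnit_det_of_left_inverse hAR
  have happ : ∀ φ : Matrix ι ι ℂ →ₗ[ℝ] ℂ, φ R = (2 / Real.pi) • ∫ s in Set.Ioi (0 : ℝ),
      φ ((A + ((s ^ 2 : ℝ) : ℂ) • 1)⁻¹) := by
    intro φ
    rw [hR, map_smul, hres.apply_sqrtInt le_rfl φ]
    congr 2
    ext s
    rw [zero_add, hG0 _ (sq_nonneg s)]
  have hbd : ∀ (φ : Matrix ι ι ℂ →ₗ[ℝ] ℂ) (w : ℝ), (∀ t : ℝ, 0 ≤ t →
      ‖φ ((A + (t : ℂ) • 1)⁻¹)‖ ≤ w * (l ^ 2 + t)⁻¹) → ‖φ R‖ ≤ w * l⁻¹ := by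
    intro φ w hw
    rw [happ, norm_smul, Real.norm_of_nonneg (by positivity)]
    have h1 := MeasureTheory.norm_integral_le_of_norm_le
      (((integrable_inv_add_sq (sq_pos_of_pos hl)).const_mul w).integrableOn (s := Set.Ioi 0))
      (Filter.Eventually.of_forall fun s => hw (s ^ 2) (sq_nonneg s))
    rw [MeasureTheory.integral_const_mul, integral_Ioi_inv_sq_add_sq hl] at h1
    calc _ ≤ 2 / Real.pi * (w * (Real.pi / 2 * l⁻¹)) := by gcongr
      _ = w * l⁻¹ := by field_simp
  refine ⟨R, ⟨hRR', ?_⟩, hRunit, ?_, ?_⟩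
  · intro z hz
    rw [← Matrix.spectrum_toLin', ← Module.End.hasEigenvalue_iff_mem_spectrum] at hz
    obtain ⟨v, hv⟩ := hz.exists_hasEigenvector
    have hv1 : R.mulVec v = z • v := by simpa using hv.apply_eq_smul
    have hv0 : v ≠ 0 := hv.2
    have hz0 : z ≠ 0 := by
      rintro rfl
      apply hv0
      have : (A * R * R).mulVec v = v := by rw [hAR, Matrix.one_mulVec]
      rw [← Matrix.mulVec_mulVec, hv1] at this
      simpa using this.symm
    have hAv : A.mulVec v = (z ^ 2)⁻¹ • v := by
      have h1 : (A * (R * R)).mulVec v = v := by rw [hRR, Matrix.one_mulVec]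
      rw [← Matrix.mulVec_mulVec, ← Matrix.mulVec_mulVec, hv1, Matrix.mulVec_smul, hv1, smul_smul,
        Matrix.mulVec_smul] at h1
      have h2 : A.mulVec v = (z ^ 2)⁻¹ • ((z * z) • A.mulVec v) := by
        rw [smul_smul, ← sq, inv_mul_cancel₀ (pow_ne_zero 2 hz0), one_smul]
      rw [h2, h1]
    have hspecA : 0 ≤ ((z ^ 2)⁻¹).re := by
      apply hspec
      rw [← Matrix.spectrum_toLin', ← Module.End.hasEigenvalue_iff_mem_spectrum]
      refine Module.End.hasEigenvalue_of_hasEigenvector (x := v) ⟨?_, hv0⟩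
      rw [Module.End.mem_eigenspace_iff]
      simpa using hAv
    -- An eigenvector of R for z is one of A for μ = z⁻². Applied to it, the integral formula gives
    -- z = (2/π) ∫ (μ + s²)⁻¹ ds, whose integrand has nonnegative real part because Re μ ≥ 0.
    set μ := (z ^ 2)⁻¹ with hμ
    obtain ⟨i, hi⟩ : ∃ i, v i ≠ 0 := by
      by_contra hcon
      push Not at hcon
      exact hv0 (funext hcon)
    have hGv : ∀ s : ℝ, ((A + ((s ^ 2 : ℝ) : ℂ) • 1)⁻¹).mulVec v =
        (μ + ((s ^ 2 : ℝ) : ℂ))⁻¹ • v := by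
      intro s
      have h1 : (A + ((s ^ 2 : ℝ) : ℂ) • 1).mulVec v = (μ + ((s ^ 2 : ℝ) : ℂ)) • v := by
        rw [Matrix.add_mulVec, hAv, Matrix.smul_mulVec, Matrix.one_mulVec, add_smul]
      have h2 : ((A + ((s ^ 2 : ℝ) : ℂ) • 1)⁻¹).mulVec ((A + ((s ^ 2 : ℝ) : ℂ) • 1).mulVec v) = v := by
        rw [Matrix.mulVec_mulVec, Matrix.nonsing_inv_mul _ (hdet _ (sq_nonneg s)),
          Matrix.one_mulVec]
      rw [h1, Matrix.mulVec_smul] at h2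
      have h3 : μ + ((s ^ 2 : ℝ) : ℂ) ≠ 0 := by
        intro h0
        rw [h0, zero_smul] at h2
        exact hv0 h2.symm
      nth_rewrite 2 [← h2]
      rw [smul_smul, inv_mul_cancel₀ h3, one_smul]
    let φ : Matrix ι ι ℂ →ₗ[ℝ] ℂ :=
      { toFun := fun X => X.mulVec v i / v i
        map_add' := fun X Y => by simp [Matrix.add_mulVec, add_div]
        map_smul' := fun c X => by simp [Matrix.smul_mulVec, mul_div_assoc] }
    have h1 := happ φ
    have h2 : z = (2 / Real.pi) • ∫ s in Set.Ioi (0 : ℝ), (μ + ((s ^ 2 : ℝ) : ℂ))⁻¹ := by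
      have e1 : φ R = z := by
        change R.mulVec v i / v i = z
        rw [hv1]
        simp [hi]
      rw [← e1]
      refine h1.trans ?_
      congr 2
      ext s
      change ((A + ((s ^ 2 : ℝ) : ℂ) • 1)⁻¹).mulVec v i / v i = _
      rw [hGv]
      simp [hi]
    have hre : 0 ≤ z.re := by
      -- A divergent integral would have the default value 0, and z ≠ 0 excludes that.
      have hI : MeasureTheory.IntegrableOn (fun s : ℝ => (μ + ((s ^ 2 : ℝ) : ℂ))⁻¹) (Set.Ioi 0) := by
        by_contra hcon
        rw [MeasureTheory.integral_undef hcon, smul_zero] at h2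
        exact hz0 h2
      rw [h2, Complex.smul_re]
      have h3 := Complex.reCLM.integral_comp_comm hI
      simp only [Complex.reCLM_apply] at h3
      rw [← h3]
      refine mul_nonneg (by positivity) (MeasureTheory.integral_nonneg fun s => ?_)
      simp only [Pi.zero_apply, Complex.inv_re]
      refine div_nonneg ?_ (Complex.normSq_nonneg _)
      rw [Complex.add_re, Complex.ofReal_re]
      positivity
    -- A nonzero purely imaginary z would have negative square, so μ would be a negative eigenvalue
    -- of A.
    refine lt_of_le_of_ne hre fun h0 => ?_
    have h4 : ((z ^ 2)).re < 0 := by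
      have him : z.im ≠ 0 := fun h => hz0 (Complex.ext h0.symm h)
      rw [sq, Complex.mul_re, ← h0]
      have := mul_self_pos.2 him
      linarith
    have h5 : μ.re < 0 := by
      rw [hμ, Complex.inv_re]
      exact div_neg_of_neg_of_pos h4 (Complex.normSq_pos.2 (pow_ne_zero 2 hz0))
    linarith
  · intro u u'
    let φ : Matrix ι ι ℂ →ₗ[ℝ] ℂ := Matrix.entryLinearMap ℝ ℂ u u'
    exact hbd φ _ fun t ht => hW t ht u u'
  · intro u u'
    let φ : Matrix ι ι ℂ →ₗ[ℝ] ℂ :=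
      { toFun := fun X => (A * X) u u'
        map_add' := fun X Y => by simp [mul_add]
        map_smul' := fun c X => by simp }
    rw [hRinv]
    exact hbd φ _ fun t ht => hW' t ht u u'

end SquareRoot

/-! ### Entire functions of several variables -/

section Entire

variable {E : Type*} [NormedAddCommGroup E] [NormedSpace ℂ E]

theorem hasDerivAt_comp_line {f : E → ℂ} (hf : Differentiable ℂ f) (p v : E) (z : ℂ) :
    HasDerivAt (fun z : ℂ => f (p + z • v)) (fderiv ℂ f (p + z • v) v) z := by
  have h1 : HasDerivAt (fun z : ℂ => p + z • v) v z := by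
    simpa using ((hasDerivAt_id z).smul_const v).const_add p
  exact ((hf (p + z • v)).hasFDerivAt).comp_hasDerivAt z h1

/-- Cauchy's formula on the complex line through p in direction v. The point p then enters only
through f, so the derivative can be differentiated under the integral sign. -/
theorem fderiv_apply_eq_circleIntegral {f : E → ℂ} (hf : Differentiable ℂ f) (p v : E) :
    fderiv ℂ f p v = (2 * Real.pi * Complex.I)⁻¹ • ∮ z in C(0, 1), (z ^ 2)⁻¹ • f (p + z • v) := by
  have hd : Differentiable ℂ fun z : ℂ => f (p + z • v) := fun z =>
    (hasDerivAt_comp_line hf p v z).differentiableAt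
  have h1 := (hasDerivAt_comp_line hf p v 0).deriv
  rw [zero_smul, add_zero] at h1
  rw [← h1, eq_inv_smul_iff₀ Complex.two_pi_I_ne_zero]
  have h2 := (hd.diffContOnCl (s := Metric.ball 0 1)).deriv_eq_smul_circleIntegral one_pos
  rw [← h2]
  refine circleIntegral.integral_congr zero_le_one fun z _ => ?_
  simp

variable [FiniteDimensional ℂ E]

/-- Cauchy's estimate on a circle of radius 1/‖v‖ in the line through p with direction v: it stays
in the ball of radius r + 1, where f is bounded by compactness. -/
theorem exists_fderiv_bound {f : E → ℂ} (hf : Differentiable ℂ f) (r : ℝ) :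
    ∃ C, 0 ≤ C ∧ ∀ p, ‖p‖ ≤ r → ‖fderiv ℂ f p‖ ≤ C := by
  have : ProperSpace E := FiniteDimensional.proper ℂ E
  obtain ⟨M, hM⟩ := (isCompact_closedBall (0 : E) (r + 1)).exists_bound_of_continuousOn
    hf.continuous.continuousOn
  refine ⟨max M 0, le_max_right _ _, fun p hp => ?_⟩
  refine ContinuousLinearMap.opNorm_le_bound _ (le_max_right _ _) fun v => ?_
  by_cases hv : v = 0
  · simp [hv]
  have hv' : 0 < ‖v‖ := norm_pos_iff.2 hv
  have hd : Differentiable ℂ fun z : ℂ => f (p + z • v) := fun z =>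
    (hasDerivAt_comp_line hf p v z).differentiableAt
  have h1 := (hasDerivAt_comp_line hf p v 0).deriv
  rw [zero_smul, add_zero] at h1
  have h2 := Complex.norm_deriv_le_of_forall_mem_sphere_norm_le (c := 0) (R := ‖v‖⁻¹)
    (C := max M 0) (by positivity) hd.diffContOnCl (by
      intro z hz
      refine (hM _ ?_).trans (le_max_left _ _)
      rw [mem_closedBall_zero_iff]
      refine (norm_add_le _ _).trans (add_le_add hp ?_)
      rw [mem_sphere_zero_iff_norm] at hz
      rw [norm_smul, hz, inv_mul_cancel₀ hv'.ne'])
  rw [h1, div_inv_eq_mul] at h2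
  exact h2

/-- Differentiation under the circle integral, with the uniform bound on the derivative of f as the
dominating constant. It leads to the second order Taylor expansion of ĥ at 0. -/
theorem differentiable_fderiv_apply {f : E → ℂ} (hf : Differentiable ℂ f) (v : E) :
    Differentiable ℂ fun p => fderiv ℂ f p v := by
  have hP : ProperSpace E := FiniteDimensional.proper ℂ E
  borelize E
  intro p₀
  simp only [fderiv_apply_eq_circleIntegral hf]
  suffices h : DifferentiableAt ℂ (fun p => ∮ z in C(0, 1), (z ^ 2)⁻¹ • f (p + z • v)) p₀ from
    h.const_smul (2 * Real.pi * Complex.I : ℂ)⁻¹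
  simp only [circleIntegral]
  obtain ⟨C, hC0, hC⟩ := exists_fderiv_bound hf (‖p₀‖ + 1 + ‖v‖)
  have hw : Continuous fun θ : ℝ => (deriv (circleMap 0 1) θ * ((circleMap 0 1 θ) ^ 2)⁻¹) := by
    simp only [deriv_circleMap]
    refine Continuous.mul (by fun_prop) (Continuous.inv₀ (by fun_prop) fun θ => ?_)
    exact pow_ne_zero 2 (circleMap_ne_center one_ne_zero)
  have hnorm : ∀ θ : ℝ, ‖deriv (circleMap 0 1) θ * ((circleMap 0 1 θ) ^ 2)⁻¹‖ = 1 := by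
    intro θ
    simp [deriv_circleMap]
  set w : ℝ → ℂ := fun θ => deriv (circleMap 0 1) θ * ((circleMap 0 1 θ) ^ 2)⁻¹
  have key := intervalIntegral.hasFDerivAt_integral_of_dominated_of_fderiv_le (𝕜 := ℂ)
    (μ := MeasureTheory.volume) (a := 0) (b := 2 * Real.pi) (x₀ := p₀) (s := Metric.ball p₀ 1)
    (F := fun p θ => w θ • f (p + circleMap 0 1 θ • v))
    (F' := fun p θ => w θ • fderiv ℂ f (p + circleMap 0 1 θ • v)) (bound := fun _ => C)
    (Metric.ball_mem_nhds p₀ one_pos) ?_ ?_ ?_ ?_ ?_ ?_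
  · refine key.differentiableAt.congr_of_eventuallyEq (Filter.Eventually.of_forall fun p => ?_)
    refine intervalIntegral.integral_congr fun θ _ => ?_
    simp only [w, smul_eq_mul]
    ring
  · refine Filter.Eventually.of_forall fun p => ?_
    refine Continuous.aestronglyMeasurable (hw.smul (hf.continuous.comp ?_))
    fun_prop
  · refine Continuous.intervalIntegrable (hw.smul (hf.continuous.comp ?_)) _ _
    fun_prop
  · refine (hw.aestronglyMeasurable).smul ?_
    refine (Measurable.stronglyMeasurable ?_).aestronglyMeasurable
    refine (measurable_fderiv ℂ f).comp ?_
    apply Continuous.measurable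
    fun_prop
  · refine Filter.Eventually.of_forall fun θ _ p hp => ?_
    rw [norm_smul, hnorm, one_mul]
    apply hC
    have h1 : ‖p‖ ≤ ‖p₀‖ + 1 := by
      have := norm_sub_norm_le p p₀
      rw [mem_ball_iff_norm] at hp
      linarith
    refine (norm_add_le _ _).trans (add_le_add h1 ?_)
    rw [norm_smul]; simp
  · simp
  · refine Filter.Eventually.of_forall fun θ _ p hp => ?_
    have h1 := (hasFDerivAt_comp_add_right (f := f) (circleMap 0 1 θ • v)).2
      (hf (p + circleMap 0 1 θ • v)).hasFDerivAt
    exact h1.const_smul (w θ)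

end Entire

/-- The derivative of an entire function of several variables is differentiable. -/
theorem differentiable_fderiv {ι : Type*} [Fintype ι] [DecidableEq ι] {f : (ι → ℂ) → ℂ}
    (hf : Differentiable ℂ f) : Differentiable ℂ (fderiv ℂ f) := by
  have h1 : fderiv ℂ f = fun p => ∑ i, (fderiv ℂ f p (Pi.single i 1)) •
      (ContinuousLinearMap.proj i : (ι → ℂ) →L[ℂ] ℂ) := by
    ext p v
    conv_lhs => rw [pi_eq_sum_univ' v, map_sum]
    simp only [map_smul, _root_.sum_apply, _root_.smul_apply,
      ContinuousLinearMap.proj_apply, smul_eq_mul]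
    refine Finset.sum_congr rfl fun i _ => ?_
    rw [mul_comm]
  rw [h1]
  refine Differentiable.fun_sum fun i _ => ?_
  exact (differentiable_fderiv_apply hf _).smul_const _

/-- An entire function of several variables that vanishes at all real points is zero. -/
theorem eq_zero_of_forall_real {n : ℕ} {f : (Fin n → ℂ) → ℂ} (hf : Differentiable ℂ f)
    (h : ∀ p : Fin n → ℝ, f (fun i => (p i : ℂ)) = 0) (p : Fin n → ℂ) : f p = 0 := by
  -- Induction on the set of coordinates allowed to be complex; each new coordinate is freed by the
  -- one variable identity theorem, with the real zeros 1/(n+1) accumulating at 0.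
  have key : ∀ s : Finset (Fin n), ∀ p : Fin n → ℂ, (∀ i ∉ s, (p i).im = 0) → f p = 0 := by
    intro s
    induction s using Finset.induction_on with
    | empty =>
      intro p hp
      have : p = fun i => ((p i).re : ℂ) := by
        ext i
        exact Complex.ext (by simp) (by simpa using hp i (by simp))
      rw [this]
      exact h _
    | insert i s _ ih =>
      intro p hp
      have hg : Differentiable ℂ fun z : ℂ => f (Function.update p i z) :=
        hf.comp (fun z => (hasFDerivAt_update p z).differentiableAt)
      have h1 : AnalyticOnNhd ℂ (fun z : ℂ => f (Function.update p i z)) Set.univ :=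
        hg.differentiableOn.analyticOnNhd isOpen_univ
      have h2 : ∃ᶠ z in 𝓝[≠] (0 : ℂ), f (Function.update p i z) = 0 := by
        have h3 : Tendsto (fun n : ℕ => ((1 / ((n : ℝ) + 1) : ℝ) : ℂ)) atTop (𝓝[≠] 0) := by
          rw [tendsto_nhdsWithin_iff]
          refine ⟨?_, Filter.Eventually.of_forall fun n => ?_⟩
          · have := tendsto_one_div_add_atTop_nhds_zero_nat (𝕜 := ℝ)
            have h4 := (Complex.continuous_ofReal.tendsto 0).comp this
            rwa [Complex.ofReal_zero] at h4
          · have : (1 / ((n : ℝ) + 1) : ℝ) ≠ 0 := by positivity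
            exact Complex.ofReal_ne_zero.2 this
        refine h3.frequently (Filter.Eventually.of_forall fun n => ?_).frequently
        apply ih
        intro j hj
        by_cases hij : j = i
        · subst hij
          rw [Function.update_self, Complex.ofReal_im]
        · rw [Function.update_of_ne hij]
          exact hp j (by simp [hij, hj])
      have h5 := h1.eqOn_zero_of_preconnected_of_frequently_eq_zero isPreconnected_univ
        (Set.mem_univ 0) h2 (Set.mem_univ (p i))
      simpa using h5
  exact key Finset.univ p (by simp)

/-! ### The symbol of the Hamiltonian -/

namespace IsHamiltonian

variable {h : (Fin 3 → ℤ) → ℂ} {hhat : (Fin 3 → ℂ) → ℂ}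

/-- At real momenta periodicity is visible from the Fourier series; it extends to complex momenta
because ĥ is entire. The series itself is given only at real momenta. -/
theorem periodic (H : IsHamiltonian h hhat) (p : Fin 3 → ℂ) (ν : Fin 3) :
    hhat (p + Pi.single ν (2 * Real.pi : ℂ)) = hhat p := by
  rw [← sub_eq_zero]
  refine eq_zero_of_forall_real (f := fun p => hhat (p + Pi.single ν (2 * Real.pi : ℂ)) - hhat p)
    ?_ ?_ p
  · exact (H.entire.comp (by fun_prop)).sub H.entire
  · intro q
    rw [sub_eq_zero]
    have h1 := H.hasSum (q + Pi.single ν (2 * Real.pi))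
    have e1 : (fun i => (((q + Pi.single ν (2 * Real.pi) : Fin 3 → ℝ) i : ℝ) : ℂ)) =
        (fun i => (q i : ℂ)) + Pi.single ν (2 * Real.pi : ℂ) := by
      ext i
      by_cases hi : i = ν
      · subst hi; simp
      · simp [hi]
    rw [e1] at h1
    refine h1.unique ((H.hasSum q).congr_fun fun x => ?_)
    congr 1
    rw [Complex.exp_eq_exp_iff_exists_int]
    refine ⟨-x ν, ?_⟩
    have e2 : ∀ i, (((q + Pi.single ν (2 * Real.pi) : Fin 3 → ℝ) i : ℝ) : ℂ) * (x i : ℂ) =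
        (q i : ℂ) * x i + if i = ν then (2 * Real.pi : ℂ) * x i else 0 := by
      intro i
      by_cases hi : i = ν
      · subst hi; simp [add_mul]
      · simp [hi]
    simp only [e2, Finset.sum_add_distrib, Finset.sum_ite_eq', Finset.mem_univ, if_true]
    push_cast
    ring

/-- The derivative of ĥ vanishes at 0 and is differentiable there, which gives a linear bound near
0; away from 0 boundedness suffices. -/
theorem exists_norm_fderiv_le (H : IsHamiltonian h hhat) (r : ℝ) :
    ∃ C, 0 ≤ C ∧ ∀ p, ‖p‖ ≤ r → ‖fderiv ℂ hhat p‖ ≤ C * ‖p‖ := by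
  have hg := differentiable_fderiv H.entire
  obtain ⟨C₂, hC₂, hb⟩ := exists_fderiv_bound H.entire r
  have h1 := (hg 0).hasFDerivAt.isBigO_sub
  rw [H.grad] at h1
  simp only [sub_zero] at h1
  obtain ⟨C₁, hC₁, h2⟩ := h1.exists_pos
  rw [Asymptotics.isBigOWith_iff, Metric.eventually_nhds_iff] at h2
  obtain ⟨δ, hδ, h3⟩ := h2
  refine ⟨C₁ + C₂ / δ, by positivity, fun p hp => ?_⟩
  rcases lt_or_ge ‖p‖ δ with hpd | hpd
  · refine (h3 (by simpa using hpd)).trans ?_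
    have : 0 ≤ C₂ / δ := by positivity
    nlinarith [norm_nonneg p]
  · refine (hb p hp).trans ?_
    have h4 : C₂ ≤ C₂ / δ * ‖p‖ := by
      rw [div_mul_eq_mul_div, le_div_iff₀ hδ]
      gcongr
    nlinarith [norm_nonneg p]

/-- Mean value inequality with the linear bound on the gradient. The factor ‖q‖ + |y|, due to the
vanishing gradient at 0, is what permits spatial strips of width √κ where time allows only κ. -/
theorem exists_norm_update_sub_le (H : IsHamiltonian h hhat) :
    ∃ C, 0 ≤ C ∧ ∀ (q : Fin 3 → ℝ) (ν : Fin 3) (y : ℝ), (∀ i, |q i| ≤ Real.pi) → |y| ≤ 1 →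
      ‖hhat (Function.update (fun i => (q i : ℂ)) ν (q ν + y * Complex.I)) -
        hhat (fun i => (q i : ℂ))‖ ≤ C * |y| * (‖q‖ + |y|) := by
  obtain ⟨C, hC0, hC⟩ := H.exists_norm_fderiv_le (Real.pi + 1)
  refine ⟨C, hC0, fun q ν y hq hy => ?_⟩
  set p : Fin 3 → ℂ := fun i => (q i : ℂ)
  set p' : Fin 3 → ℂ := Function.update p ν (q ν + y * Complex.I)
  have hp : ‖p‖ = ‖q‖ := by
    simp only [p, Pi.norm_def, Complex.nnnorm_real]
  have hpp : ‖p' - p‖ ≤ |y| := by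
    rw [pi_norm_le_iff_of_nonneg (abs_nonneg y)]
    intro i
    by_cases hi : i = ν
    · subst hi; simp [p', p]
    · simp [p', hi]
  have hqpi : ‖q‖ ≤ Real.pi := by
    rw [pi_norm_le_iff_of_nonneg Real.pi_pos.le]
    exact hq
  have hball : ∀ x ∈ Metric.closedBall p |y|, ‖x‖ ≤ ‖q‖ + |y| := by
    intro x hx
    rw [mem_closedBall_iff_norm] at hx
    have := norm_sub_norm_le x p
    linarith
  have key := (convex_closedBall p |y|).norm_image_sub_le_of_norm_fderiv_le (𝕜 := ℂ)
    (f := hhat) (C := C * (‖q‖ + |y|)) (fun x _ => H.entire x)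
    (fun x hx => (hC x ((hball x hx).trans (by linarith))).trans
      (by gcongr; exact hball x hx))
    (Metric.mem_closedBall_self (abs_nonneg y)) (by rw [mem_closedBall_iff_norm]; exact hpp)
  refine key.trans ?_
  calc C * (‖q‖ + |y|) * ‖p' - p‖ ≤ C * (‖q‖ + |y|) * |y| := by gcongr
    _ = _ := by ring

theorem exists_norm_le (H : IsHamiltonian h hhat) :
    ∃ C, 0 ≤ C ∧ ∀ q : Fin 3 → ℝ, (∀ i, |q i| ≤ Real.pi) →
      ‖hhat (fun i => (q i : ℂ))‖ ≤ C * ‖q‖ ^ 2 := by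
  obtain ⟨C, hC0, hC⟩ := H.exists_norm_fderiv_le Real.pi
  refine ⟨C, hC0, fun q hq => ?_⟩
  set p : Fin 3 → ℂ := fun i => (q i : ℂ)
  have hp : ‖p‖ = ‖q‖ := by
    simp only [p, Pi.norm_def, Complex.nnnorm_real]
  have hqpi : ‖q‖ ≤ Real.pi := by
    rw [pi_norm_le_iff_of_nonneg Real.pi_pos.le]
    exact hq
  have key := (convex_closedBall (0 : Fin 3 → ℂ) ‖q‖).norm_image_sub_le_of_norm_fderiv_le (𝕜 := ℂ)
    (f := hhat) (C := C * ‖q‖) (x := 0) (y := p) (fun x _ => H.entire x)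
    (fun x hx => by
      rw [mem_closedBall_zero_iff] at hx
      exact (hC x (hx.trans hqpi)).trans (by gcongr))
    (by simp) (by rw [mem_closedBall_zero_iff, hp])
  rw [H.zero, sub_zero, sub_zero, hp] at key
  rw [sq, ← mul_assoc]
  exact key

/-- Taylor at second order: the Hessian form is at least l‖q‖², so its half contributes l/2, and the
remainder is made at most (l/4)‖q‖² by differentiability of the gradient at 0. -/
theorem exists_near_zero_le (H : IsHamiltonian h hhat) :
    ∃ c δ : ℝ, 0 < c ∧ 0 < δ ∧ ∀ q : Fin 3 → ℝ, ‖q‖ < δ →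
      c * ‖q‖ ^ 2 ≤ (hhat fun i => (q i : ℂ)).re := by
  have hg := differentiable_fderiv H.entire
  set B := fderiv ℂ (fderiv ℂ hhat) 0 with hB
  set M : Matrix (Fin 3) (Fin 3) ℝ := Matrix.of fun μ ν : Fin 3 =>
    (iteratedFDeriv ℂ 2 hhat 0 ![Pi.single μ 1, Pi.single ν 1]).re with hM
  have hBq : ∀ q : Fin 3 → ℝ, (B (fun i => (q i : ℂ)) (fun i => (q i : ℂ))).re =
      q ⬝ᵥ M.mulVec q := by
    intro q
    have e1 : (fun i => (q i : ℂ)) = ∑ i, (q i : ℂ) • (Pi.single i 1 : Fin 3 → ℂ) :=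
      (pi_eq_sum_univ' _)
    rw [e1]
    simp only [map_sum, map_smul, _root_.sum_apply, _root_.smul_apply, smul_eq_mul,
      Complex.re_sum, dotProduct, Matrix.mulVec, Finset.mul_sum]
    rw [Finset.sum_comm]
    refine Finset.sum_congr rfl fun i _ => Finset.sum_congr rfl fun j _ => ?_
    simp only [hM, Matrix.of_apply, iteratedFDeriv_two_apply, Matrix.cons_val_zero,
      Matrix.cons_val_one, Complex.re_ofReal_mul, ← hB]
    ring
  obtain ⟨l, hl, hlq⟩ : ∃ l, 0 < l ∧ ∀ q : Fin 3 → ℝ, l * ‖q‖ ^ 2 ≤ q ⬝ᵥ M.mulVec q := by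
    have hc : Continuous fun q : Fin 3 → ℝ => q ⬝ᵥ M.mulVec q := by
      simp only [dotProduct, Matrix.mulVec]
      fun_prop
    obtain ⟨q₀, hq₀, hmin⟩ := (isCompact_sphere (0 : Fin 3 → ℝ) 1).exists_isMinOn
      (NormedSpace.sphere_nonempty.2 zero_le_one) hc.continuousOn
    have hpos : 0 < q₀ ⬝ᵥ M.mulVec q₀ := by
      have hne : q₀ ≠ 0 := by
        rintro rfl
        simp at hq₀
      have := H.hess.dotProduct_mulVec_pos hne
      simpa using this
    refine ⟨_, hpos, fun q => ?_⟩
    by_cases hq : q = 0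
    · simp [hq]
    have hq' : 0 < ‖q‖ := norm_pos_iff.2 hq
    have h1 := hmin (show ‖q‖⁻¹ • q ∈ Metric.sphere (0 : Fin 3 → ℝ) 1 by
      simp [norm_smul, hq'.ne'])
    simp only [Set.mem_ofPred_eq, Matrix.mulVec_smul, smul_dotProduct, dotProduct_smul,
      smul_eq_mul] at h1
    calc (q₀ ⬝ᵥ M.mulVec q₀) * ‖q‖ ^ 2 ≤
        (‖q‖⁻¹ * (‖q‖⁻¹ * (q ⬝ᵥ M.mulVec q))) * ‖q‖ ^ 2 := by gcongr
      _ = _ := by field_simp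
  have hlit := (hg 0).hasFDerivAt.isLittleO
  rw [H.grad, Asymptotics.isLittleO_iff] at hlit
  have hev := hlit (show 0 < l / 4 by positivity)
  rw [Metric.eventually_nhds_iff] at hev
  obtain ⟨δ, hδ, hev⟩ := hev
  refine ⟨l / 4, δ, by positivity, hδ, fun q hq => ?_⟩
  set p : Fin 3 → ℂ := fun i => (q i : ℂ) with hp
  have hpn : ‖p‖ = ‖q‖ := by
    simp only [p, Pi.norm_def, Complex.nnnorm_real]
  have hder : ∀ t ∈ Set.Icc (0 : ℝ) 1, HasDerivWithinAt
      (fun t : ℝ => hhat ((t : ℂ) • p) - (2⁻¹ * (t : ℂ) ^ 2) * B p p)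
      (fderiv ℂ hhat ((t : ℂ) • p) p - t * B p p) (Set.Icc 0 1) t := by
    intro t _
    have h1 := (hasDerivAt_comp_line H.entire 0 p (t : ℂ)).comp_ofReal
    simp only [zero_add] at h1
    have h2 : HasDerivAt (fun t : ℝ => (2⁻¹ * (t : ℂ) ^ 2) * B p p) (t * B p p) t := by
      have h3 : HasDerivAt (fun z : ℂ => (2⁻¹ * z ^ 2) * B p p) (t * B p p) (t : ℂ) := by
        have := ((hasDerivAt_pow 2 (t : ℂ)).const_mul (2⁻¹ : ℂ)).mul_const (B p p)
        refine this.congr_deriv ?_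
        push_cast
        ring
      exact h3.comp_ofReal
    exact (h1.sub h2).hasDerivWithinAt
  have hbound : ∀ t ∈ Set.Ico (0 : ℝ) 1,
      ‖fderiv ℂ hhat ((t : ℂ) • p) p - t * B p p‖ ≤ l / 4 * ‖q‖ ^ 2 := by
    intro t ht
    have h1 : ‖(t : ℂ) • p‖ ≤ ‖q‖ := by
      rw [norm_smul, hpn, Complex.norm_real, Real.norm_of_nonneg ht.1]
      exact mul_le_of_le_one_left (norm_nonneg _) ht.2.le
    have h2 := hev (y := (t : ℂ) • p) (by rw [dist_zero_right]; exact h1.trans_lt hq)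
    simp only [sub_zero] at h2
    have h3 : fderiv ℂ hhat ((t : ℂ) • p) p - t * B p p =
        (fderiv ℂ hhat ((t : ℂ) • p) - B ((t : ℂ) • p)) p := by
      simp
    rw [h3]
    refine (ContinuousLinearMap.le_opNorm _ _).trans ?_
    rw [hpn, sq, ← mul_assoc]
    gcongr
    exact h2.trans (by gcongr)
  have key := norm_image_sub_le_of_norm_deriv_le_segment_01' hder hbound
  simp only [Complex.ofReal_one, one_smul, one_pow, mul_one, Complex.ofReal_zero, zero_smul,
    H.zero, zero_pow two_ne_zero, mul_zero, zero_mul, sub_zero] at key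
  have h4 := (Complex.abs_re_le_norm _).trans key
  rw [Complex.sub_re, abs_le] at h4
  have h5 : (2⁻¹ * B p p).re = 2⁻¹ * (q ⬝ᵥ M.mulVec q) := by
    rw [← hBq q, ← hp]
    have : (2⁻¹ : ℂ) = ((2⁻¹ : ℝ) : ℂ) := by norm_num
    rw [this, Complex.re_ofReal_mul]
  have h6 := hlq q
  rw [h5] at h4
  linarith [h4.1]

/-- Near 0 this is the Hessian bound. On the rest of the cell, which contains no other point of the
lattice 2πℤ³, ĥ has a positive minimum by compactness. -/
theorem exists_le_re (H : IsHamiltonian h hhat) :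
    ∃ c : ℝ, 0 < c ∧ ∀ q : Fin 3 → ℝ, (∀ i, |q i| ≤ Real.pi) →
      c * ‖q‖ ^ 2 ≤ (hhat fun i => (q i : ℂ)).re := by
  obtain ⟨c, δ, hc, hδ, hnear⟩ := H.exists_near_zero_le
  have hpi := Real.pi_pos
  set S : Set (Fin 3 → ℝ) := Metric.closedBall 0 Real.pi \ Metric.ball 0 δ with hS
  have hScomp : IsCompact S := (isCompact_closedBall _ _).diff Metric.isOpen_ball
  have hcont : Continuous fun q : Fin 3 → ℝ => (hhat fun i => (q i : ℂ)).re :=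
    Complex.continuous_re.comp (H.entire.continuous.comp (by fun_prop))
  have hpos : ∀ q ∈ S, 0 < (hhat fun i => (q i : ℂ)).re := by
    intro q hq
    refine H.pos q ?_
    rintro ⟨z, hz⟩
    have hq1 : ‖q‖ ≤ Real.pi := by simpa using hq.1
    have hq2 : δ ≤ ‖q‖ := by simpa using hq.2
    have hz0 : ∀ ν, z ν = 0 := by
      intro ν
      have h1 := (norm_le_pi_norm q ν).trans hq1
      rw [hz ν, Real.norm_eq_abs, abs_mul, abs_of_pos Real.two_pi_pos] at h1
      have h2 : |(z ν : ℝ)| < 1 := by nlinarith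
      have h3 : |z ν| < 1 := by exact_mod_cast h2
      exact Int.abs_lt_one_iff.1 h3
    have : q = 0 := by
      ext ν
      simp [hz ν, hz0 ν]
    rw [this, norm_zero] at hq2
    linarith
  obtain ⟨e, he, hmin⟩ : ∃ e, 0 < e ∧ ∀ q ∈ S, e ≤ (hhat fun i => (q i : ℂ)).re := by
    rcases S.eq_empty_or_nonempty with hemp | hne
    · exact ⟨1, one_pos, by simp [hemp]⟩
    · obtain ⟨q₀, hq₀, hm⟩ := hScomp.exists_isMinOn hne hcont.continuousOn
      exact ⟨_, hpos q₀ hq₀, fun q hq => hm hq⟩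
  refine ⟨min c (e / Real.pi ^ 2), by positivity, fun q hq => ?_⟩
  have hqpi : ‖q‖ ≤ Real.pi := by
    rw [pi_norm_le_iff_of_nonneg Real.pi_pos.le]
    exact hq
  rcases lt_or_ge ‖q‖ δ with hlt | hge
  · refine le_trans ?_ (hnear q hlt)
    gcongr
    exact min_le_left _ _
  · refine le_trans ?_ (hmin q ⟨by simpa using hqpi, by simpa using hge⟩)
    calc min c (e / Real.pi ^ 2) * ‖q‖ ^ 2 ≤ e / Real.pi ^ 2 * Real.pi ^ 2 := by
          gcongr
          exact min_le_right _ _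
      _ = e := by field_simp

end IsHamiltonian

/-! ### Averages of exponentials over a block -/

/-- The average of `x ↦ e^{iθx}` over a centred block of `R` consecutive points. -/
def avg (R : ℕ) (θ : ℂ) : ℂ :=
  (R : ℂ)⁻¹ * ∑ x ∈ Finset.range R, Complex.exp (Complex.I * θ * (x - ((R : ℂ) - 1) / 2))

theorem sum_range_mul_eq {M : Type*} [AddCommMonoid M] (r s : ℕ) (f : ℕ → M) :
    ∑ x ∈ Finset.range (r * s), f x =
      ∑ d ∈ Finset.range s, ∑ c ∈ Finset.range r, f (c + r * d) := by
  induction s with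
  | zero => simp
  | succ s ih =>
    rw [Finset.sum_range_succ, ← ih, mul_add, mul_one, Finset.sum_range_add]
    congr 1
    exact Finset.sum_congr rfl fun x _ => by rw [add_comm]

/-- A block of rs points is a row of s blocks of r points, so its average is an average of averages.
In symbols this is the composition of successive block spin steps into one step with a larger block.
-/
theorem avg_mul (r s : ℕ) (θ : ℂ) : avg (r * s) θ = avg r θ * avg s (r * θ) := by
  unfold avg
  rw [sum_range_mul_eq, mul_mul_mul_comm, Finset.sum_mul_sum, Finset.sum_comm]
  push_cast
  rw [mul_inv]
  congr 1
  refine Finset.sum_congr rfl fun c _ => Finset.sum_congr rfl fun d _ => ?_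
  rw [← Complex.exp_add]
  congr 1
  ring

theorem avg_one (θ : ℂ) : avg 1 θ = 1 := by simp [avg]

/-- For odd R the centred positions x - (R-1)/2 are integers; for even R a sign would appear. -/
theorem avg_add_two_pi {R : ℕ} (hR : Odd R) (θ : ℂ) : avg R (θ + 2 * Real.pi) = avg R θ := by
  obtain ⟨k, rfl⟩ := hR
  unfold avg
  congr 1
  refine Finset.sum_congr rfl fun x _ => ?_
  rw [Complex.exp_eq_exp_iff_exists_int]
  refine ⟨x - k, ?_⟩
  push_cast
  ring

theorem avg_neg (R : ℕ) (θ : ℂ) : avg R (-θ) = avg R θ := by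
  unfold avg
  congr 1
  rw [← Finset.sum_range_reflect]
  refine Finset.sum_congr rfl fun x hx => ?_
  have hx' := Finset.mem_range.1 hx
  congr 1
  rw [Nat.cast_sub (by omega), Nat.cast_sub (by omega)]
  push_cast
  ring

theorem avg_conj (R : ℕ) (θ : ℂ) : starRingEnd ℂ (avg R θ) = avg R (starRingEnd ℂ θ) := by
  rw [← avg_neg R (starRingEnd ℂ θ)]
  unfold avg
  rw [map_mul, map_inv₀, map_natCast, map_sum]
  congr 1
  refine Finset.sum_congr rfl fun x _ => ?_
  rw [← Complex.exp_conj]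
  congr 1
  have h2 : starRingEnd ℂ (2 : ℂ) = 2 := Complex.conj_ofNat 2
  simp only [map_mul, map_sub, map_div₀, map_natCast, map_one, Complex.conj_I, h2]
  ring

theorem avg_im_eq_zero (R : ℕ) (θ : ℝ) : (avg R θ).im = 0 := by
  rw [← Complex.conj_eq_iff_im, avg_conj, Complex.conj_ofReal]

/-- The position of the `x`-th point of a block of unit length. -/
def blockPos (R x : ℕ) : ℝ := (x - ((R : ℝ) - 1) / 2) / R

theorem abs_blockPos_le {R x : ℕ} (hx : x < R) : |blockPos R x| ≤ 1 / 2 := by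
  have hR : (0 : ℝ) < R := by exact_mod_cast (Nat.zero_le x).trans_lt hx
  have hx' : (x : ℝ) + 1 ≤ R := by exact_mod_cast hx
  have h0 : (0 : ℝ) ≤ x := by positivity
  rw [blockPos, abs_div, abs_of_pos hR, div_le_iff₀ hR, abs_le]
  constructor <;> linarith

theorem avg_div (R : ℕ) (K : ℂ) : avg R (K / R) =
    (R : ℂ)⁻¹ * ∑ x ∈ Finset.range R, Complex.exp (Complex.I * K * blockPos R x) := by
  unfold avg blockPos
  congr 1
  refine Finset.sum_congr rfl fun x _ => ?_
  congr 1
  push_cast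
  ring

theorem norm_exp_I_mul_le {R x : ℕ} (hx : x < R) (K : ℂ) :
    ‖Complex.exp (Complex.I * K * blockPos R x)‖ ≤ Real.exp (|K.im| / 2) := by
  rw [Complex.norm_exp]
  apply Real.exp_le_exp.2
  have h1 : (Complex.I * K * blockPos R x).re = -(K.im * blockPos R x) := by simp
  rw [h1]
  have h2 := abs_blockPos_le hx
  calc -(K.im * blockPos R x) ≤ |K.im * blockPos R x| := neg_le_abs _
    _ = |K.im| * |blockPos R x| := abs_mul _ _
    _ ≤ |K.im| * (1 / 2) := by gcongr
    _ = |K.im| / 2 := by ring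

theorem norm_avg_div_le (R : ℕ) (K : ℂ) : ‖avg R (K / R)‖ ≤ Real.exp (|K.im| / 2) := by
  rcases Nat.eq_zero_or_pos R with rfl | hR
  · simp [avg, Real.exp_nonneg]
  rw [avg_div, norm_mul, norm_inv, Complex.norm_natCast, inv_mul_le_iff₀ (by positivity)]
  refine (norm_sum_le _ _).trans ?_
  refine (Finset.sum_le_sum fun x hx => norm_exp_I_mul_le (Finset.mem_range.1 hx) K).trans ?_
  simp

theorem sum_zmod_val {M : Type*} [AddCommMonoid M] (R : ℕ) [NeZero R] (F : ℕ → M) :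
    ∑ l : ZMod R, F l.val = ∑ l ∈ Finset.range R, F l := by
  obtain ⟨n, rfl⟩ := Nat.exists_eq_succ_of_ne_zero (NeZero.ne R)
  exact Fin.sum_univ_eq_sum_range F (n + 1)

theorem parseval_range {R : ℕ} (hR : R ≠ 0) (c : ℕ → ℂ) :
    ∑ l ∈ Finset.range R, ‖(R : ℂ)⁻¹ * ∑ x ∈ Finset.range R,
      c x * Complex.exp (2 * Real.pi * l / R * (x : ℤ) * Complex.I)‖ ^ 2 =
      (R : ℝ)⁻¹ * ∑ x ∈ Finset.range R, ‖c x‖ ^ 2 := by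
  have hR' : (R : ℂ) ≠ 0 := by exact_mod_cast hR
  have h1 : ∀ z : ℂ, ((‖z‖ ^ 2 : ℝ) : ℂ) = z * starRingEnd ℂ z := fun z => by
    rw [Complex.mul_conj, Complex.normSq_eq_norm_sq]
  rw [← Complex.ofReal_inj]
  push_cast [h1]
  have h2 : ∀ l ∈ Finset.range R, ((R : ℂ)⁻¹ * ∑ x ∈ Finset.range R,
      c x * Complex.exp (2 * Real.pi * l / R * x * Complex.I)) *
      ((starRingEnd ℂ) ((R : ℂ)⁻¹ * ∑ x ∈ Finset.range R,
        c x * Complex.exp (2 * Real.pi * l / R * x * Complex.I))) =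
      ((R : ℂ)⁻¹ * (R : ℂ)⁻¹) * ∑ x ∈ Finset.range R, ∑ y ∈ Finset.range R,
        (c x * starRingEnd ℂ (c y)) *
          Complex.exp (2 * Real.pi * l / R * (x - y : ℤ) * Complex.I) := by
    intro l _
    rw [map_mul, map_inv₀, map_natCast, map_sum, mul_mul_mul_comm, Finset.sum_mul_sum]
    congr 1
    refine Finset.sum_congr rfl fun x _ => Finset.sum_congr rfl fun y _ => ?_
    have h3 : starRingEnd ℂ (2 : ℂ) = 2 := Complex.conj_ofNat 2
    rw [map_mul, ← Complex.exp_conj, mul_mul_mul_comm, ← Complex.exp_add]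
    congr 2
    simp only [map_mul, map_div₀, map_natCast, Complex.conj_I, h3, Complex.conj_ofReal]
    push_cast
    ring
  rw [Finset.sum_congr rfl h2, ← Finset.mul_sum, Finset.sum_comm]
  have h4 : ∀ x ∈ Finset.range R, (∑ l ∈ Finset.range R, ∑ y ∈ Finset.range R,
      (c x * starRingEnd ℂ (c y)) *
          Complex.exp (2 * Real.pi * l / R * (x - y : ℤ) * Complex.I)) =
      R * (c x * starRingEnd ℂ (c x)) := by
    intro x hx
    rw [Finset.sum_comm]
    have h5 : ∀ y ∈ Finset.range R, (∑ l ∈ Finset.range R, (c x * starRingEnd ℂ (c y)) *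
          Complex.exp (2 * Real.pi * l / R * (x - y : ℤ) * Complex.I)) =
        if y = x then R * (c x * starRingEnd ℂ (c x)) else 0 := by
      intro y hy
      rw [← Finset.mul_sum, sum_exp_two_pi_div hR]
      have hx' := Finset.mem_range.1 hx
      have hy' := Finset.mem_range.1 hy
      by_cases hxy : y = x
      · subst hxy
        simp [mul_comm]
      · rw [if_neg hxy, if_neg, mul_zero]
        intro hdvd
        have := Int.eq_zero_of_abs_lt_dvd hdvd (by rw [abs_lt]; omega)
        omega
    rw [Finset.sum_congr rfl h5, Finset.sum_ite_eq', if_pos hx]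
  rw [Finset.sum_congr rfl h4, ← Finset.mul_sum, ← mul_assoc]
  congr 1
  field_simp

theorem sum_norm_sq_blockPos (R : ℕ) [NeZero R] (c : ℕ → ℂ) :
    ∑ l : ZMod R, ‖(R : ℂ)⁻¹ * ∑ x ∈ Finset.range R,
      c x * Complex.exp (Complex.I * (2 * Real.pi * l.val) * blockPos R x)‖ ^ 2 =
      (R : ℝ)⁻¹ * ∑ x ∈ Finset.range R, ‖c x‖ ^ 2 := by
  rw [← parseval_range (NeZero.ne R) c, sum_zmod_val R (fun l => ‖(R : ℂ)⁻¹ *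
    ∑ x ∈ Finset.range R, c x * Complex.exp (Complex.I * (2 * Real.pi * l) * blockPos R x)‖ ^ 2)]
  refine Finset.sum_congr rfl fun l _ => ?_
  have h1 : ∑ x ∈ Finset.range R, c x * Complex.exp (Complex.I * (2 * Real.pi * l) * blockPos R x) =
      Complex.exp (((-(2 * Real.pi * l / R * (((R : ℝ) - 1) / 2)) : ℝ) : ℂ) * Complex.I) *
      ∑ x ∈ Finset.range R, c x * Complex.exp (2 * Real.pi * l / R * (x : ℤ) * Complex.I) := by
    rw [Finset.mul_sum]
    refine Finset.sum_congr rfl fun x _ => ?_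
    rw [mul_left_comm (Complex.exp _) (c x), ← Complex.exp_add]
    congr 2
    unfold blockPos
    push_cast
    ring
  rw [h1, mul_left_comm, norm_mul, Complex.norm_exp_ofReal_mul_I, one_mul]

theorem avg_fiber (R : ℕ) (K : ℂ) (l : ℕ) : avg R ((K + 2 * Real.pi * l) / R) =
    (R : ℂ)⁻¹ * ∑ x ∈ Finset.range R, Complex.exp (Complex.I * K * blockPos R x) *
      Complex.exp (Complex.I * (2 * Real.pi * l) * blockPos R x) := by
  rw [avg_div]
  congr 1
  refine Finset.sum_congr rfl fun x _ => ?_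
  rw [← Complex.exp_add]
  congr 1
  ring

/-- Along a fibre the averages are the discrete Fourier coefficients of the plane wave with momentum
K on a block of unit length. By Parseval their squares sum to the mean of its squared modulus, at
most exp|Im K| as positions are at most 1/2. The bound does not depend on R. -/
theorem sum_norm_sq_avg_le (R : ℕ) [NeZero R] (K : ℂ) :
    ∑ l : ZMod R, ‖avg R ((K + 2 * Real.pi * l.val) / R)‖ ^ 2 ≤ Real.exp |K.im| := by
  simp only [avg_fiber]
  rw [sum_norm_sq_blockPos]
  have hR : (0 : ℝ) < R := by
    have := NeZero.ne R
    positivity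
  rw [inv_mul_le_iff₀ hR]
  calc ∑ x ∈ Finset.range R, ‖Complex.exp (Complex.I * K * blockPos R x)‖ ^ 2
      ≤ ∑ x ∈ Finset.range R, Real.exp |K.im| := by
        refine Finset.sum_le_sum fun x hx => ?_
        have h1 := norm_exp_I_mul_le (Finset.mem_range.1 hx) K
        calc _ ≤ Real.exp (|K.im| / 2) ^ 2 := by gcongr
          _ = Real.exp |K.im| := by rw [← Real.exp_nat_mul]; congr 1; push_cast; ring
    _ = R * Real.exp |K.im| := by simp

/-- Parseval for the difference of two plane waves on the block, whose modulus is |exp(-η·pos) - 1|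
≤ |η| since |pos| ≤ 1/2. -/
theorem sum_norm_sq_avg_sub_le (R : ℕ) [NeZero R] (K η : ℝ) (hη : |η| ≤ 1) :
    ∑ l : ZMod R, ‖avg R ((K + η * Complex.I + 2 * Real.pi * l.val) / R) -
      avg R ((K + 2 * Real.pi * l.val) / R)‖ ^ 2 ≤ η ^ 2 := by
  simp only [avg_fiber, ← mul_sub, ← Finset.sum_sub_distrib, ← sub_mul]
  rw [sum_norm_sq_blockPos]
  have hR : (0 : ℝ) < R := by
    have := NeZero.ne R
    positivity
  rw [inv_mul_le_iff₀ hR]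
  calc _ ≤ ∑ x ∈ Finset.range R, η ^ 2 := by
        refine Finset.sum_le_sum fun x hx => ?_
        have h1 : Complex.exp (Complex.I * (K + η * Complex.I) * blockPos R x) -
            Complex.exp (Complex.I * K * blockPos R x) =
            Complex.exp (((K * blockPos R x : ℝ) : ℂ) * Complex.I) *
              ((Real.exp (-(η * blockPos R x)) - 1 : ℝ) : ℂ) := by
          push_cast
          rw [mul_sub, mul_one, ← Complex.exp_add]
          congr 1
          · congr 1
            ring_nf
            simp
            ring
          · congr 1; ring
        rw [h1, norm_mul, Complex.norm_exp_ofReal_mul_I, one_mul, Complex.norm_real,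
          ← sq_abs η, Real.norm_eq_abs]
        have h2 := abs_blockPos_le (Finset.mem_range.1 hx)
        have h3 : |-(η * blockPos R x)| ≤ |η| * (1 / 2) := by
          rw [abs_neg, abs_mul]; gcongr
        have h4 := Real.abs_exp_sub_one_le (x := -(η * blockPos R x)) (by linarith)
        exact pow_le_pow_left₀ (abs_nonneg _) (by linarith) 2
    _ = R * η ^ 2 := by simp

theorem sum_range_sq_sub (R : ℕ) :
    ∑ x ∈ Finset.range R, ((x : ℝ) - ((R : ℝ) - 1) / 2) ^ 2 = R * ((R : ℝ) ^ 2 - 1) / 12 := by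
  have h : ∀ (n : ℕ) (c : ℝ), ∑ x ∈ Finset.range n, ((x : ℝ) - c) ^ 2 =
      n * (n - 1) * (2 * n - 1) / 6 - c * (n * (n - 1)) + n * c ^ 2 := by
    intro n c
    induction n with
    | zero => simp
    | succ n ih =>
      rw [Finset.sum_range_succ, ih]
      push_cast
      ring
  rw [h]
  ring

/-- By cos x ≥ 1 - x²/2 and the variance of the block positions, which is at most 1/12, the average
is at least 1 - K²/24; finally K² ≤ π² ≤ 12. -/
theorem half_le_avg_re {R : ℕ} (hR : R ≠ 0) {K : ℝ} (hK : |K| ≤ Real.pi) :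
    1 / 2 ≤ (avg R ((K : ℂ) / R)).re := by
  have hR' : (0 : ℝ) < R := by positivity
  have h1 : (avg R ((K : ℂ) / R)).re =
      (R : ℝ)⁻¹ * ∑ x ∈ Finset.range R, Real.cos (K * blockPos R x) := by
    rw [avg_div]
    have : (R : ℂ)⁻¹ = (((R : ℝ)⁻¹ : ℝ) : ℂ) := by push_cast; rfl
    rw [this, Complex.re_ofReal_mul, Complex.re_sum]
    congr 1
    refine Finset.sum_congr rfl fun x _ => ?_
    rw [← Complex.exp_ofReal_mul_I_re]
    congr 2
    push_cast
    ring
  rw [h1, ← div_eq_inv_mul, le_div_iff₀ hR']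
  have h2 : ∑ x ∈ Finset.range R, (1 - (K * blockPos R x) ^ 2 / 2) ≤
      ∑ x ∈ Finset.range R, Real.cos (K * blockPos R x) :=
    Finset.sum_le_sum fun x _ => Real.one_sub_sq_div_two_le_cos
  refine le_trans ?_ h2
  have h3 : ∑ x ∈ Finset.range R, (1 - (K * blockPos R x) ^ 2 / 2) =
      R - K ^ 2 / (2 * R ^ 2) * (R * ((R : ℝ) ^ 2 - 1) / 12) := by
    rw [← sum_range_sq_sub, Finset.sum_sub_distrib, Finset.mul_sum]
    simp only [Finset.sum_const, Finset.card_range, nsmul_eq_mul, mul_one]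
    congr 1
    refine Finset.sum_congr rfl fun x _ => ?_
    unfold blockPos
    field_simp
  rw [h3]
  have h4 : K ^ 2 ≤ 12 := by
    have h5 : K ^ 2 ≤ Real.pi ^ 2 := sq_le_sq' (by linarith [(abs_le.1 hK).1]) (abs_le.1 hK).2
    have := Real.pi_lt_d2
    have := Real.pi_pos
    nlinarith
  have h6 : K ^ 2 / (2 * R ^ 2) * (R * ((R : ℝ) ^ 2 - 1) / 12) ≤ R / 2 := by
    have h7 : K ^ 2 / (2 * R ^ 2) * (R * ((R : ℝ) ^ 2 - 1) / 12) =
        K ^ 2 / 12 * (R * ((R ^ 2 - 1) / R ^ 2)) / 2 := by field_simp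
    have h8 : ((R : ℝ) ^ 2 - 1) / R ^ 2 ≤ 1 := by
      rw [div_le_one (by positivity)]; linarith
    have h9 : (R : ℝ) * ((R ^ 2 - 1) / R ^ 2) ≤ R := mul_le_of_le_one_right hR'.le h8
    have h11 : 0 ≤ (R : ℝ) * ((R ^ 2 - 1) / R ^ 2) := by
      have : (1 : ℝ) ≤ R := by exact_mod_cast Nat.one_le_iff_ne_zero.2 hR
      have : (0 : ℝ) ≤ R ^ 2 - 1 := by nlinarith
      positivity
    have h12 : K ^ 2 / 12 ≤ 1 := by linarith
    rw [h7]
    have : K ^ 2 / 12 * (R * ((R ^ 2 - 1) / R ^ 2)) ≤ 1 * R :=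
      mul_le_mul h12 h9 h11 zero_le_one
    linarith
  linarith

/-! ### The symbol of the block average and its fibres -/

/-- The symbol of the averaging operator over blocks of side lengths `s`. -/
def blockSym (𝔮 : ℕ) (s : Fin 4 → ℕ) (θ : Fin 4 → ℂ) : ℂ := ∏ μ, avg (s μ) (θ μ) ^ 𝔮

/-- The momenta of the fine lattice that lie over the momentum `K` of the coarse one. -/
def fib (s : Fin 4 → ℕ) (K : Fin 4 → ℂ) (l : ∀ μ, ZMod (s μ)) : Fin 4 → ℂ :=
  fun μ => (K μ + 2 * Real.pi * (l μ).val) / s μ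

/-- A real momentum. -/
def toC (K : Fin 4 → ℝ) : Fin 4 → ℂ := fun μ => (K μ : ℂ)

/-- A real momentum shifted by `iη` in direction `μ`. -/
def shift (K : Fin 4 → ℝ) (μ : Fin 4) (η : ℝ) : Fin 4 → ℂ :=
  Function.update (toC K) μ (K μ + η * Complex.I)

theorem shift_self (K : Fin 4 → ℝ) (μ : Fin 4) (η : ℝ) :
    shift K μ η μ = K μ + η * Complex.I := Function.update_self _ _ _

theorem shift_of_ne (K : Fin 4 → ℝ) {μ ν : Fin 4} (h : ν ≠ μ) (η : ℝ) :
    shift K μ η ν = K ν := Function.update_of_ne h _ _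

theorem shift_zero (K : Fin 4 → ℝ) (μ : Fin 4) : shift K μ 0 = toC K := by
  ext ν
  by_cases h : ν = μ
  · subst h; simp [shift, toC]
  · rw [shift_of_ne K h]; rfl

theorem abs_shift_im_le (K : Fin 4 → ℝ) (μ ν : Fin 4) (η : ℝ) : |(shift K μ η ν).im| ≤ |η| := by
  by_cases h : ν = μ
  · subst h; rw [shift_self]; simp
  · rw [shift_of_ne K h]; simp

theorem norm_pow_sub_pow_le {a b : ℂ} (ha : ‖a‖ ≤ 2) (hb : ‖b‖ ≤ 2) (n : ℕ) :
    ‖a ^ n - b ^ n‖ ≤ n * 2 ^ n * ‖a - b‖ := by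
  induction n with
  | zero => simp
  | succ n ih =>
    have h1 : a ^ (n + 1) - b ^ (n + 1) = (a ^ n - b ^ n) * a + b ^ n * (a - b) := by ring
    rw [h1]
    refine (norm_add_le _ _).trans ?_
    rw [norm_mul, norm_mul, norm_pow]
    have h2 : ‖b‖ ^ n ≤ 2 ^ n := by gcongr
    have h3 : ‖a ^ n - b ^ n‖ * ‖a‖ ≤ (n * 2 ^ n * ‖a - b‖) * 2 := by gcongr
    have h4 : ‖b‖ ^ n * ‖a - b‖ ≤ 2 ^ n * ‖a - b‖ := by gcongr
    have h5 : 0 ≤ 2 ^ n * ‖a - b‖ := by positivity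
    push_cast
    rw [pow_succ]
    nlinarith

theorem exp_half_le_two {x : ℝ} (hx : x ≤ 1) : Real.exp (x / 2) ≤ 2 := by
  have h1 : Real.exp (x / 2) ≤ Real.exp (1 / 2) := Real.exp_le_exp.2 (by linarith)
  have h2 : Real.exp (1 / 2) ^ 2 ≤ 2 ^ 2 := by
    rw [← Real.exp_nat_mul]
    have := Real.exp_one_lt_d9
    norm_num
    linarith
  have h3 := (pow_le_pow_iff_left₀ (Real.exp_nonneg _) zero_le_two two_ne_zero).1 h2
  linarith

section Fiber

variable {s : Fin 4 → ℕ} [∀ μ, NeZero (s μ)] {𝔮 : ℕ}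

theorem norm_avg_fib_le (R : ℕ) (K : ℂ) (l : ℕ) :
    ‖avg R ((K + 2 * Real.pi * l) / R)‖ ≤ Real.exp (|K.im| / 2) := by
  refine (norm_avg_div_le R _).trans (le_of_eq ?_)
  simp

theorem sum_prod_fib {M : Type*} [CommSemiring M] (f : ∀ μ, ZMod (s μ) → M) :
    ∑ l : (∀ μ, ZMod (s μ)), ∏ μ, f μ (l μ) = ∏ μ, ∑ j, f μ j := by
  rw [Finset.prod_univ_sum, Fintype.piFinset_univ]

theorem blockSym_fib_im (K : Fin 4 → ℝ) (l : ∀ μ, ZMod (s μ)) :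
    (blockSym 𝔮 s (fib s (toC K) l)).im = 0 := by
  have h : ∀ μ, ∃ r : ℝ, avg (s μ) (fib s (toC K) l μ) = r := by
    intro μ
    have := avg_im_eq_zero (s μ) ((K μ + 2 * Real.pi * (l μ).val) / s μ)
    refine ⟨(avg (s μ) (fib s (toC K) l μ)).re, ?_⟩
    apply Complex.ext
    · simp
    · rw [Complex.ofReal_im, ← this]
      congr 2
      simp only [fib, toC]
      push_cast
      rfl
  choose r hr using h
  unfold blockSym
  simp only [hr]
  rw [show (∏ μ, ((r μ : ℂ)) ^ 𝔮) = ((∏ μ, r μ ^ 𝔮 : ℝ) : ℂ) by push_cast; rfl]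
  exact Complex.ofReal_im _

theorem sum_norm_sq_pow_avg_le (h𝔮 : 1 ≤ 𝔮) (R : ℕ) [NeZero R] (K : ℝ) :
    ∑ l : ZMod R, ‖avg R ((K + 2 * Real.pi * l.val) / R) ^ 𝔮‖ ^ 2 ≤ 1 := by
  have h1 := sum_norm_sq_avg_le R (K : ℂ)
  rw [Complex.ofReal_im, abs_zero, Real.exp_zero] at h1
  refine le_trans (Finset.sum_le_sum fun l _ => ?_) h1
  have h2 : ‖avg R ((K + 2 * Real.pi * l.val) / R)‖ ≤ 1 := by
    have := norm_avg_fib_le R (K : ℂ) l.val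
    simpa using this
  rw [norm_pow]
  gcongr
  exact pow_le_of_le_one (norm_nonneg _) h2 (by omega)

theorem sum_norm_sq_blockSym_le (h𝔮 : 1 ≤ 𝔮) (K : Fin 4 → ℝ) :
    ∑ l, ‖blockSym 𝔮 s (fib s (toC K) l)‖ ^ 2 ≤ 1 := by
  unfold blockSym
  simp only [norm_prod, ← Finset.prod_pow]
  simp only [fib]
  rw [sum_prod_fib (fun μ (j : ZMod (s μ)) =>
    ‖avg (s μ) ((toC K μ + 2 * Real.pi * j.val) / s μ) ^ 𝔮‖ ^ 2)]
  refine Finset.prod_le_one (fun μ _ => by positivity) fun μ _ => ?_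
  exact sum_norm_sq_pow_avg_le h𝔮 (s μ) (K μ)

/-- Only the factor of direction μ changes, so the sum factorises: the other directions contribute
at most 1, and in direction μ the difference of 𝔮-th powers costs 𝔮·2^𝔮. -/
theorem sum_norm_sq_blockSym_sub_le (h𝔮 : 1 ≤ 𝔮) (K : Fin 4 → ℝ) (μ : Fin 4) {η : ℝ}
    (hη : |η| ≤ 1) :
    ∑ l, ‖blockSym 𝔮 s (fib s (shift K μ η) l) - blockSym 𝔮 s (fib s (toC K) l)‖ ^ 2 ≤
      (𝔮 * 2 ^ 𝔮 * |η|) ^ 2 := by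
  set g : ∀ ν, ZMod (s ν) → ℝ := fun ν j =>
    if ν = μ then ‖avg (s ν) ((shift K μ η ν + 2 * Real.pi * j.val) / s ν) ^ 𝔮 -
      avg (s ν) ((K ν + 2 * Real.pi * j.val) / s ν) ^ 𝔮‖ ^ 2
    else ‖avg (s ν) ((K ν + 2 * Real.pi * j.val) / s ν) ^ 𝔮‖ ^ 2 with hg
  have h1 : ∀ l : (∀ ν, ZMod (s ν)), ‖blockSym 𝔮 s (fib s (shift K μ η) l) -
      blockSym 𝔮 s (fib s (toC K) l)‖ ^ 2 = ∏ ν, g ν (l ν) := by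
    intro l
    unfold blockSym
    rw [← Finset.mul_prod_erase _ _ (Finset.mem_univ μ),
      ← Finset.mul_prod_erase (a := μ) _ (fun ν => avg (s ν) (fib s (toC K) l ν) ^ 𝔮)
        (Finset.mem_univ μ), ← Finset.mul_prod_erase _ _ (Finset.mem_univ μ)]
    have h2 : ∏ ν ∈ Finset.univ.erase μ, avg (s ν) (fib s (shift K μ η) l ν) ^ 𝔮 =
        ∏ ν ∈ Finset.univ.erase μ, avg (s ν) (fib s (toC K) l ν) ^ 𝔮 := by
      refine Finset.prod_congr rfl fun ν hν => ?_
      simp only [fib, shift_of_ne K (Finset.ne_of_mem_erase hν), toC]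
    have h3 : ∏ ν ∈ Finset.univ.erase μ, g ν (l ν) =
        ‖∏ ν ∈ Finset.univ.erase μ, avg (s ν) (fib s (toC K) l ν) ^ 𝔮‖ ^ 2 := by
      rw [norm_prod, ← Finset.prod_pow]
      refine Finset.prod_congr rfl fun ν hν => ?_
      simp only [hg, if_neg (Finset.ne_of_mem_erase hν), fib, toC]
    rw [h2, h3, ← sub_mul, norm_mul, mul_pow]
    simp only [hg, if_true, fib, toC]
  rw [Finset.sum_congr rfl fun l _ => h1 l, sum_prod_fib,
    ← Finset.mul_prod_erase _ _ (Finset.mem_univ μ)]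
  have h4 : ∑ j, g μ j ≤ (𝔮 * 2 ^ 𝔮 * |η|) ^ 2 := by
    have h5 := sum_norm_sq_avg_sub_le (s μ) (K μ) η hη
    calc ∑ j, g μ j ≤ ∑ j : ZMod (s μ), (𝔮 * 2 ^ 𝔮) ^ 2 *
          ‖avg (s μ) ((K μ + η * Complex.I + 2 * Real.pi * j.val) / s μ) -
            avg (s μ) ((K μ + 2 * Real.pi * j.val) / s μ)‖ ^ 2 := by
          refine Finset.sum_le_sum fun j _ => ?_
          simp only [hg, if_true, shift_self]
          rw [← mul_pow]
          gcongr
          refine norm_pow_sub_pow_le ?_ ?_ 𝔮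
          · refine (norm_avg_fib_le _ _ _).trans (exp_half_le_two ?_)
            simpa using hη
          · refine (norm_avg_fib_le _ _ _).trans (exp_half_le_two ?_)
            simp
      _ ≤ (𝔮 * 2 ^ 𝔮) ^ 2 * η ^ 2 := by rw [← Finset.mul_sum]; gcongr
      _ = _ := by rw [← sq_abs η]; ring
  have h6 : ∏ ν ∈ Finset.univ.erase μ, ∑ j, g ν j ≤ 1 := by
    refine Finset.prod_le_one (fun ν _ => Finset.sum_nonneg fun j _ => ?_) fun ν hν => ?_
    · simp only [hg]; split_ifs <;> positivity
    · simp only [hg, if_neg (Finset.ne_of_mem_erase hν)]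
      exact sum_norm_sq_pow_avg_le h𝔮 (s ν) (K ν)
  calc _ ≤ (𝔮 * 2 ^ 𝔮 * |η|) ^ 2 * 1 := by
        refine mul_le_mul h4 h6 ?_ (by positivity)
        refine Finset.prod_nonneg fun ν _ => Finset.sum_nonneg fun j _ => ?_
        simp only [hg]; split_ifs <;> positivity
    _ = _ := mul_one _

/-- An ℓ¹ bound, for which 𝔮 ≥ 2 is needed: the 𝔮-th power of an average is dominated by its square,
which Parseval sums. The 3 bounds exp 1. -/
theorem sum_norm_blockSym_le (h𝔮 : 2 ≤ 𝔮) (K : Fin 4 → ℝ) (μ : Fin 4) {η : ℝ} (hη : |η| ≤ 1) :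
    ∑ l, ‖blockSym 𝔮 s (fib s (shift K μ η) l)‖ ≤ (2 ^ 𝔮 * 3) ^ 4 := by
  unfold blockSym
  simp only [norm_prod]
  simp only [fib]
  rw [sum_prod_fib (fun ν (j : ZMod (s ν)) =>
    ‖avg (s ν) ((shift K μ η ν + 2 * Real.pi * j.val) / s ν) ^ 𝔮‖)]
  have h1 : ∀ ν, ∑ j : ZMod (s ν),
      ‖avg (s ν) ((shift K μ η ν + 2 * Real.pi * j.val) / s ν) ^ 𝔮‖ ≤ 2 ^ 𝔮 * 3 := by
    intro ν
    have him := (abs_shift_im_le K μ ν η).trans hη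
    have h2 := sum_norm_sq_avg_le (s ν) (shift K μ η ν)
    have h3 : Real.exp |(shift K μ η ν).im| ≤ 3 := by
      have h4 := Real.exp_le_exp.2 him
      have := Real.exp_one_lt_d9
      linarith
    calc _ ≤ ∑ j : ZMod (s ν), 2 ^ 𝔮 *
          ‖avg (s ν) ((shift K μ η ν + 2 * Real.pi * j.val) / s ν)‖ ^ 2 := by
          refine Finset.sum_le_sum fun j _ => ?_
          obtain ⟨k, rfl⟩ : ∃ k, 𝔮 = k + 2 := ⟨𝔮 - 2, by omega⟩
          rw [norm_pow, pow_add]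
          have h5 : ‖avg (s ν) ((shift K μ η ν + 2 * Real.pi * j.val) / s ν)‖ ≤ 2 :=
            (norm_avg_fib_le _ _ _).trans (exp_half_le_two him)
          gcongr
          calc _ ≤ (2 : ℝ) ^ k := by gcongr
            _ ≤ 2 ^ (k + 2) := pow_le_pow_right₀ one_le_two (by omega)
      _ ≤ _ := by rw [← Finset.mul_sum]; gcongr; linarith
  calc _ ≤ ∏ _ν : Fin 4, ((2 : ℝ) ^ 𝔮 * 3) :=
        Finset.prod_le_prod (fun ν _ => by positivity) fun ν _ => h1 ν
    _ = _ := by simp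

theorem le_norm_blockSym (K : Fin 4 → ℝ) (hK : ∀ μ, |K μ| ≤ Real.pi) :
    (1 / 2) ^ (4 * 𝔮) ≤ ‖blockSym 𝔮 s (fib s (toC K) 0)‖ := by
  unfold blockSym
  rw [norm_prod]
  calc (1 / 2 : ℝ) ^ (4 * 𝔮) = ∏ _μ : Fin 4, (1 / 2 : ℝ) ^ 𝔮 := by
        simp [← pow_mul, mul_comm]
    _ ≤ _ := by
        refine Finset.prod_le_prod (fun ν _ => by positivity) fun μ _ => ?_
        rw [norm_pow]
        gcongr
        have h1 := half_le_avg_re (NeZero.ne (s μ)) (hK μ)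
        have h2 : fib s (toC K) 0 μ = (K μ : ℂ) / s μ := by simp [fib, toC]
        rw [h2]
        exact h1.trans (Complex.re_le_norm _)

end Fiber

/-! ### Parabolic symbols -/

/-- The parabolic size `|p₀| + |𝐩|²` of a momentum. -/
def parab (p : Fin 4 → ℝ) : ℝ := |p 0| + ∑ ν : Fin 3, p ν.succ ^ 2

theorem parab_nonneg (p : Fin 4 → ℝ) : 0 ≤ parab p := by
  unfold parab; positivity

/-- The width in direction `μ` of a parabolic strip. -/
def width (κ : ℝ) (μ : Fin 4) : ℝ := if μ = 0 then κ else √κ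

/-- `f` is a periodic symbol of parabolic type: it is comparable to `|θ₀| + |θ|²`, has nonnegative
real part, and continues analytically in each variable to a strip, the change being controlled. -/
structure ParabolicSymbol (c C m₀ κ : ℝ) (f : (Fin 4 → ℂ) → ℂ) : Prop where
  re_nonneg : ∀ θ : Fin 4 → ℝ, (∀ μ, |θ μ| ≤ Real.pi) → 0 ≤ (f (toC θ)).re
  lower : ∀ θ : Fin 4 → ℝ, (∀ μ, |θ μ| ≤ Real.pi) → c * parab θ ≤ ‖f (toC θ)‖
  upper : ∀ θ : Fin 4 → ℝ, (∀ μ, |θ μ| ≤ Real.pi) → ‖f (toC θ)‖ ≤ C * parab θ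
  sub_le : ∀ θ : Fin 4 → ℝ, (∀ μ, |θ μ| ≤ Real.pi) → ∀ (μ : Fin 4) (m η : ℝ), 0 ≤ m → m ≤ m₀ →
    |η| ≤ m * width κ μ → ‖f (shift θ μ η) - f (toC θ)‖ ≤ C * m * (parab θ + κ)
  diff : ∀ (θ : Fin 4 → ℝ) (μ : Fin 4) (η : ℝ), |η| ≤ m₀ * width κ μ →
    DifferentiableAt ℂ (fun z => f (Function.update (toC θ) μ z)) (θ μ + η * Complex.I)
  per : ∀ (θ : Fin 4 → ℂ) (μ : Fin 4), f (θ + Pi.single μ (2 * Real.pi : ℂ)) = f θ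

/-- The symbol `1 - e^{-ĥ} e^{iθ₀}` of `D_0`. -/
def heatSym (hhat : (Fin 3 → ℂ) → ℂ) (θ : Fin 4 → ℂ) : ℂ :=
  1 - Complex.exp (-hhat fun ν => θ ν.succ) * Complex.exp (Complex.I * θ 0)

theorem norm_sq_one_sub_mul_exp (ρ φ : ℝ) :
    ‖1 - (ρ : ℂ) * Complex.exp (Complex.I * φ)‖ ^ 2 = (1 - ρ) ^ 2 + 4 * ρ * Real.sin (φ / 2) ^ 2 := by
  have h1 : Complex.exp (Complex.I * φ) = Real.cos φ + Real.sin φ * Complex.I := by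
    rw [mul_comm, Complex.exp_mul_I]; push_cast; rfl
  rw [h1, ← Complex.normSq_eq_norm_sq, Complex.normSq_apply]
  have h2 := Real.sin_sq_add_cos_sq φ
  have h3 : Real.sin (φ / 2) ^ 2 = (1 - Real.cos φ) / 2 := by
    have := Real.cos_sq (φ / 2)
    have h4 := Real.sin_sq_add_cos_sq (φ / 2)
    rw [mul_div_cancel₀ φ two_ne_zero] at this
    linarith
  rw [h3]
  generalize Real.cos φ = x at *
  generalize Real.sin φ = y at *
  simp only [Complex.sub_re, Complex.sub_im, Complex.mul_re, Complex.mul_im, Complex.add_re,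
    Complex.add_im, Complex.ofReal_re, Complex.ofReal_im, Complex.I_re, Complex.I_im,
    Complex.one_re, Complex.one_im]
  linear_combination ρ ^ 2 * h2

/-- In |1 - ρe^{iφ}|² = (1-ρ)² + 4ρ sin²(φ/2) the first term controls x through 1 - ρ ≥ xρ, the
second controls |φ| through |sin y| ≥ 2|y|/π. The upper bound X on x keeps ρ away from 0. -/
theorem heatSym_lower {ρ φ x X : ℝ} (hρ : ρ = Real.exp (-x)) (hx : 0 ≤ x) (hxX : x ≤ X)
    (hφ : |φ| ≤ Real.pi) :
    (Real.exp (-X) / 4) * (x + |φ|) ≤ ‖1 - (ρ : ℂ) * Complex.exp (Complex.I * φ)‖ := by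
  have hn := norm_sq_one_sub_mul_exp ρ φ
  set n := ‖1 - (ρ : ℂ) * Complex.exp (Complex.I * φ)‖
  have hn0 : 0 ≤ n := norm_nonneg _
  have hρ0 : 0 < ρ := hρ ▸ Real.exp_pos _
  have hρ1 : ρ ≤ 1 := by rw [hρ]; exact Real.exp_le_one_iff.2 (by linarith)
  have hE : Real.exp (-X) ≤ ρ := by rw [hρ]; exact Real.exp_le_exp.2 (by linarith)
  have hE0 : 0 < Real.exp (-X) := Real.exp_pos _
  have h1 : 1 - ρ ≤ n := by
    refine le_of_sq_le_sq ?_ hn0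
    rw [hn]
    nlinarith [sq_nonneg (Real.sin (φ / 2))]
  have h2 : x * ρ ≤ 1 - ρ := by
    have := Real.add_one_le_exp x
    have h3 : ρ * Real.exp x = 1 := by rw [hρ, ← Real.exp_add]; simp
    nlinarith
  have h4 : ρ * |φ| * (2 / Real.pi) ≤ n := by
    refine le_of_sq_le_sq ?_ hn0
    have h5 := Real.mul_abs_le_abs_sin (x := φ / 2) (by
      rw [abs_div, abs_of_pos (zero_lt_two' ℝ)]; linarith)
    rw [abs_div, abs_of_pos (zero_lt_two' ℝ)] at h5
    have h6 : (2 / Real.pi * (|φ| / 2)) ^ 2 ≤ Real.sin (φ / 2) ^ 2 := by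
      rw [← sq_abs (Real.sin _)]
      have := Real.pi_pos
      gcongr
    rw [hn]
    have h7 : (ρ * |φ| * (2 / Real.pi)) ^ 2 = 4 * ρ ^ 2 * (2 / Real.pi * (|φ| / 2)) ^ 2 := by ring
    rw [h7]
    have h8 : ρ ^ 2 ≤ ρ := by nlinarith
    have h9 := sq_nonneg (1 - ρ)
    have h10 : 4 * ρ ^ 2 * (2 / Real.pi * (|φ| / 2)) ^ 2 ≤ 4 * ρ * Real.sin (φ / 2) ^ 2 := by
      gcongr
    linarith
  have h11 : (1 / 2 : ℝ) ≤ 2 / Real.pi := by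
    rw [div_le_div_iff₀ two_pos Real.pi_pos]
    linarith [Real.pi_le_four]
  have h12 : ρ * |φ| * (1 / 2) ≤ n := le_trans (by gcongr) h4
  have h13 : Real.exp (-X) * x ≤ ρ * x := by gcongr
  have h14 : Real.exp (-X) * |φ| ≤ ρ * |φ| := by gcongr
  linarith

theorem heatSym_upper {ρ φ x : ℝ} (hρ : ρ = Real.exp (-x)) (hx : 0 ≤ x) :
    ‖1 - (ρ : ℂ) * Complex.exp (Complex.I * φ)‖ ≤ x + |φ| := by
  have hn := norm_sq_one_sub_mul_exp ρ φ
  have hρ0 : 0 < ρ := hρ ▸ Real.exp_pos _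
  have hρ1 : ρ ≤ 1 := by rw [hρ]; exact Real.exp_le_one_iff.2 (by linarith)
  have h1 : 1 - ρ ≤ x := by
    have := Real.add_one_le_exp (-x)
    rw [hρ]; linarith
  refine le_of_sq_le_sq ?_ (by positivity)
  rw [hn]
  have h2 : Real.sin (φ / 2) ^ 2 ≤ (|φ| / 2) ^ 2 := by
    rw [← sq_abs]
    have : |Real.sin (φ / 2)| ≤ |φ / 2| := Real.abs_sin_le_abs
    rw [abs_div, abs_of_pos (zero_lt_two' ℝ)] at this
    gcongr
  have h3 : 4 * ρ * Real.sin (φ / 2) ^ 2 ≤ 4 * 1 * (|φ| / 2) ^ 2 := by gcongr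
  have h4 : (1 - ρ) ^ 2 ≤ x ^ 2 := by
    have : 0 ≤ 1 - ρ := by linarith
    gcongr
  nlinarith [mul_nonneg hx (abs_nonneg φ)]

theorem norm_exp_sub_one_le_mul_exp (w : ℂ) : ‖Complex.exp w - 1‖ ≤ ‖w‖ * Real.exp ‖w‖ := by
  have := Complex.norm_exp_sub_sum_le_norm_mul_exp w 1
  simpa using this

theorem norm_sq_le_sum (q : Fin 3 → ℝ) : ‖q‖ ^ 2 ≤ ∑ ν, q ν ^ 2 := by
  have h : ‖q‖ ≤ √(∑ ν, q ν ^ 2) := by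
    rw [pi_norm_le_iff_of_nonneg (Real.sqrt_nonneg _)]
    intro i
    rw [Real.norm_eq_abs]
    apply Real.abs_le_sqrt
    exact Finset.single_le_sum (f := fun ν => q ν ^ 2) (fun ν _ => sq_nonneg _) (Finset.mem_univ i)
  calc ‖q‖ ^ 2 ≤ √(∑ ν, q ν ^ 2) ^ 2 := by gcongr
    _ = _ := Real.sq_sqrt (by positivity)

theorem sum_sq_le_norm_sq (q : Fin 3 → ℝ) : ∑ ν, q ν ^ 2 ≤ 3 * ‖q‖ ^ 2 := by
  calc ∑ ν, q ν ^ 2 ≤ ∑ _ν : Fin 3, ‖q‖ ^ 2 := by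
        refine Finset.sum_le_sum fun ν _ => ?_
        rw [← sq_abs]
        have := norm_le_pi_norm q ν
        rw [Real.norm_eq_abs] at this
        gcongr
    _ = _ := by simp

theorem IsHamiltonian.differentiable_heatSym {h : (Fin 3 → ℤ) → ℂ} {hhat : (Fin 3 → ℂ) → ℂ}
    (H : IsHamiltonian h hhat) : Differentiable ℂ (heatSym hhat) := by
  have h3 : Differentiable ℂ fun θ : Fin 4 → ℂ => hhat fun ν => θ ν.succ :=
    H.entire.comp (by fun_prop)
  have h4 : Differentiable ℂ fun θ : Fin 4 → ℂ => Complex.I * θ 0 := by fun_prop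
  unfold heatSym
  exact (h3.neg.cexp.mul h4.cexp).const_sub 1

/-- The time variable enters through e^{iθ₀}, the space variables through ĥ, which is quadratic at
0. One pair of constants works for every κ ≤ 1; at scale n the strip is taken thinner by L^{-2n},
and this uniformity makes the later bounds independent of n. -/
theorem IsHamiltonian.exists_parabolicSymbol {h : (Fin 3 → ℤ) → ℂ} {hhat : (Fin 3 → ℂ) → ℂ}
    (H : IsHamiltonian h hhat) :
    ∃ c C : ℝ, 0 < c ∧ 0 < C ∧ ∀ κ : ℝ, 0 < κ → κ ≤ 1 → ParabolicSymbol c C 1 κ (heatSym hhat) := by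
  obtain ⟨c₁, hc₁, hlow⟩ := H.exists_le_re
  obtain ⟨C₁, hC₁, hup⟩ := H.exists_norm_le
  obtain ⟨C₂, hC₂, hsub⟩ := H.exists_norm_update_sub_le
  have hpi := Real.pi_pos
  set X := C₁ * Real.pi ^ 2 with hX
  -- Bounds the change of ĥ under an imaginary shift of size at most 1 over the cell, so that e^w -
  -- 1 is linear in w up to the factor e^W.
  set W := C₂ * (Real.pi + 1) with hW
  have hval : ∀ θ : Fin 4 → ℝ, heatSym hhat (toC θ) =
      1 - ((Real.exp (-(hhat fun ν => (θ ν.succ : ℂ)).re) : ℝ) : ℂ) *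
        Complex.exp (Complex.I * (θ 0 : ℝ)) := by
    intro θ
    have h1 : (hhat fun ν => (θ ν.succ : ℂ)) = (((hhat fun ν => (θ ν.succ : ℂ)).re : ℝ) : ℂ) :=
      Complex.ext (by simp) (by simpa using H.real fun ν => θ ν.succ)
    simp only [heatSym, toC]
    rw [h1]
    push_cast
    rfl
  have hx0 : ∀ θ : Fin 4 → ℝ, 0 ≤ (hhat fun ν => (θ ν.succ : ℂ)).re := fun θ =>
    H.nonneg fun ν => θ ν.succ
  have hq : ∀ θ : Fin 4 → ℝ, (∀ μ, |θ μ| ≤ Real.pi) → ‖fun ν : Fin 3 => θ ν.succ‖ ≤ Real.pi := by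
    intro θ hθ
    rw [pi_norm_le_iff_of_nonneg hpi.le]
    exact fun ν => hθ ν.succ
  -- The 3 in c₁/3 compares the sum of squares in `parab` with the sup norm. The upper constant
  -- covers the size of the symbol, the time shift (factor 2) and the space shift.
  refine ⟨Real.exp (-X) / 4 * min (c₁ / 3) 1, C₁ + 3 + Real.exp W * C₂ * 2, by positivity,
    by positivity, fun κ hκ hκ1 => ?_⟩
  refine ⟨?_, ?_, ?_, ?_, ?_, ?_⟩
  · intro θ _
    rw [hval θ, Complex.sub_re, Complex.re_ofReal_mul, mul_comm Complex.I,
      Complex.exp_ofReal_mul_I_re, Complex.one_re]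
    have h1 : Real.exp (-(hhat fun ν => (θ ν.succ : ℂ)).re) ≤ 1 :=
      Real.exp_le_one_iff.2 (by linarith [hx0 θ])
    have h2 := Real.cos_le_one (θ 0)
    have h3 := Real.exp_pos (-(hhat fun ν => (θ ν.succ : ℂ)).re)
    nlinarith
  · intro θ hθ
    rw [hval θ]
    have h1 := hlow (fun ν => θ ν.succ) fun ν => hθ ν.succ
    have h2 := hup (fun ν => θ ν.succ) fun ν => hθ ν.succ
    have h3 := (Complex.re_le_norm _).trans h2
    have h4 := hq θ hθ
    have h5 : (hhat fun ν => (θ ν.succ : ℂ)).re ≤ X := h3.trans (by rw [hX]; gcongr)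
    refine le_trans ?_ (heatSym_lower rfl (hx0 θ) h5 (hθ 0))
    rw [mul_assoc]
    have h6 := sum_sq_le_norm_sq fun ν : Fin 3 => θ ν.succ
    gcongr
    unfold parab
    rw [mul_add, add_comm]
    have h7 : min (c₁ / 3) 1 * |θ 0| ≤ 1 * |θ 0| := by
      gcongr
      exact min_le_right _ _
    have h8 : min (c₁ / 3) 1 * ∑ ν : Fin 3, θ ν.succ ^ 2 ≤
        c₁ / 3 * (3 * ‖fun ν : Fin 3 => θ ν.succ‖ ^ 2) := by
      gcongr
      exact min_le_left _ _
    linarith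
  · intro θ hθ
    rw [hval θ]
    refine (heatSym_upper rfl (hx0 θ)).trans ?_
    have h2 := (Complex.re_le_norm _).trans (hup (fun ν => θ ν.succ) fun ν => hθ ν.succ)
    have h3 := norm_sq_le_sum fun ν : Fin 3 => θ ν.succ
    have h4 : C₁ * ‖fun ν : Fin 3 => θ ν.succ‖ ^ 2 ≤ C₁ * ∑ ν : Fin 3, θ ν.succ ^ 2 := by gcongr
    have h5 : 0 ≤ ∑ ν : Fin 3, θ ν.succ ^ 2 := by positivity
    have h6 : 0 ≤ Real.exp W * C₂ * 2 := by positivity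
    unfold parab
    have := abs_nonneg (θ 0)
    nlinarith
  · intro θ hθ μ m η hm0 hm1 hη
    have hE := parab_nonneg θ
    have hexp1 : ‖Complex.exp (-hhat fun ν => (θ ν.succ : ℂ))‖ ≤ 1 := by
      rw [Complex.norm_exp, Real.exp_le_one_iff, Complex.neg_re]
      linarith [hx0 θ]
    have hexp2 : ‖Complex.exp (Complex.I * (θ 0 : ℂ))‖ = 1 := by
      rw [mul_comm, Complex.norm_exp_ofReal_mul_I]
    refine Fin.cases ?_ (fun ν => ?_) μ hη
    · intro hη
      simp only [width, if_true] at hη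
      have h1 : heatSym hhat (shift θ 0 η) - heatSym hhat (toC θ) =
          -(Complex.exp (-hhat fun ν => (θ ν.succ : ℂ)) * (Complex.exp (Complex.I * (θ 0 : ℂ)) *
            ((Real.exp (-η) - 1 : ℝ) : ℂ))) := by
        have h2 : (fun ν : Fin 3 => shift θ 0 η ν.succ) = fun ν => (θ ν.succ : ℂ) := by
          ext ν
          exact shift_of_ne θ (Fin.succ_ne_zero ν) η
        simp only [heatSym, h2, shift_self, toC]
        have h3 : Complex.exp (Complex.I * (θ 0 + η * Complex.I)) =
            Complex.exp (Complex.I * (θ 0 : ℂ)) * Complex.exp (-(η : ℂ)) := by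
          rw [← Complex.exp_add]
          congr 1
          linear_combination (η : ℂ) * Complex.I_mul_I
        rw [h3]
        push_cast
        ring
      rw [h1, norm_neg, norm_mul, norm_mul, hexp2, one_mul, Complex.norm_real, Real.norm_eq_abs]
      have hη1 : |η| ≤ 1 := hη.trans (by nlinarith)
      have h4 := Real.abs_exp_sub_one_le (x := -η) (by rwa [abs_neg])
      rw [abs_neg] at h4
      have h5 : ‖Complex.exp (-hhat fun ν => (θ ν.succ : ℂ))‖ * |Real.exp (-η) - 1| ≤
          1 * (2 * |η|) := by gcongr
      have h6 : 0 ≤ (C₁ + 1 + Real.exp W * C₂ * 2) * m * (parab θ + κ) := by positivity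
      nlinarith [mul_nonneg hm0 hE]
    · intro hη
      simp only [width, if_neg (Fin.succ_ne_zero ν)] at hη
      have hsq : √κ ≤ 1 := Real.sqrt_le_one.2 hκ1
      have hη1 : |η| ≤ 1 := hη.trans (by nlinarith [Real.sqrt_nonneg κ])
      set q : Fin 3 → ℝ := fun ν => θ ν.succ with hqdef
      have h2 : (fun i : Fin 3 => shift θ ν.succ η i.succ) =
          Function.update (fun i => (q i : ℂ)) ν (q ν + η * Complex.I) := by
        ext i
        by_cases hi : i = ν
        · subst hi; rw [shift_self, Function.update_self]
        · rw [shift_of_ne θ (by simpa using hi), Function.update_of_ne hi]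
      have hs := hsub q ν η (fun i => hθ i.succ) hη1
      set w := hhat (fun i => (q i : ℂ)) -
        hhat (Function.update (fun i => (q i : ℂ)) ν (q ν + η * Complex.I)) with hw
      have hwn : ‖w‖ ≤ C₂ * |η| * (‖q‖ + |η|) := by rw [hw, norm_sub_rev]; exact hs
      have h1 : heatSym hhat (shift θ ν.succ η) - heatSym hhat (toC θ) =
          -(Complex.exp (-hhat fun ν => (θ ν.succ : ℂ)) * (Complex.exp (Complex.I * (θ 0 : ℂ)) *
            (Complex.exp w - 1))) := by
        simp only [heatSym, h2]
        rw [shift_of_ne θ (Fin.succ_ne_zero ν).symm]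
        have h3 : Complex.exp (-hhat (Function.update (fun i => (q i : ℂ)) ν
            (q ν + η * Complex.I))) =
            Complex.exp (-hhat fun ν => (θ ν.succ : ℂ)) * Complex.exp w := by
          rw [← Complex.exp_add]
          congr 1
          rw [hw, hqdef]
          ring
        rw [h3]
        simp only [toC]
        ring
      rw [h1, norm_neg, norm_mul, norm_mul, hexp2, one_mul]
      have hqpi := hq θ hθ
      have hwW : ‖w‖ ≤ W := hwn.trans (by
        rw [hW]
        calc C₂ * |η| * (‖q‖ + |η|) ≤ C₂ * 1 * (Real.pi + 1) := by gcongr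
          _ = _ := by ring)
      have h4 := norm_exp_sub_one_le_mul_exp w
      have h5 : ‖Complex.exp w - 1‖ ≤ (C₂ * |η| * (‖q‖ + |η|)) * Real.exp W :=
        h4.trans (by gcongr)
      -- With |η| ≤ m√κ and m ≤ 1: √κ‖q‖ ≤ κ + ‖q‖², and η² ≤ m²κ ≤ mκ.
      have h6 : |η| * (‖q‖ + |η|) ≤ 2 * (m * (parab θ + κ)) := by
        have hk : √κ ^ 2 = κ := Real.sq_sqrt hκ.le
        have h7 := norm_sq_le_sum q
        have h8 : ‖q‖ ^ 2 ≤ parab θ := by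
          unfold parab
          have := abs_nonneg (θ 0)
          linarith
        have h9 : |η| * ‖q‖ ≤ m * √κ * ‖q‖ := by gcongr
        have h10 : √κ * ‖q‖ ≤ κ + ‖q‖ ^ 2 := by nlinarith [sq_nonneg (√κ - ‖q‖), sq_nonneg (√κ + ‖q‖)]
        have h11 : |η| * |η| ≤ (m * √κ) * (m * √κ) := by gcongr
        have h12 : (m * √κ) * (m * √κ) ≤ m * κ := by
          have : (m * √κ) * (m * √κ) = m * (m * κ) := by
            calc (m * √κ) * (m * √κ) = m * (m * √κ ^ 2) := by ring
              _ = _ := by rw [hk]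
          rw [this]
          gcongr
          nlinarith
        have h13 : m * (√κ * ‖q‖) ≤ m * (κ + parab θ) := by gcongr; linarith
        have h14 : 0 ≤ m * parab θ := by positivity
        nlinarith
      calc _ ≤ 1 * ((C₂ * |η| * (‖q‖ + |η|)) * Real.exp W) := by gcongr
        _ = Real.exp W * C₂ * (|η| * (‖q‖ + |η|)) := by ring
        _ ≤ Real.exp W * C₂ * (2 * (m * (parab θ + κ))) := by gcongr
        _ = (Real.exp W * C₂ * 2) * m * (parab θ + κ) := by ring
        _ ≤ _ := by
          gcongr
          linarith
  · intro θ μ η _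
    have h1 : Differentiable ℂ fun z : ℂ => Function.update (toC θ) μ z :=
      fun z => (hasFDerivAt_update (toC θ) z).differentiableAt
    exact (H.differentiable_heatSym.comp h1) _
  · intro θ μ
    unfold heatSym
    refine Fin.cases ?_ (fun ν => ?_) μ
    · have h1 : (fun ν : Fin 3 => (θ + Pi.single 0 (2 * Real.pi : ℂ) : Fin 4 → ℂ) ν.succ) =
          fun ν => θ ν.succ := by
        ext ν; simp
      rw [h1]
      congr 2
      rw [Complex.exp_eq_exp_iff_exists_int]
      exact ⟨1, by simp; ring⟩
    · have h1 : (fun i : Fin 3 => (θ + Pi.single ν.succ (2 * Real.pi : ℂ) : Fin 4 → ℂ) i.succ) =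
          (fun i => θ i.succ) + Pi.single ν (2 * Real.pi : ℂ) := by
        ext i
        by_cases hi : i = ν
        · subst hi; simp
        · simp [hi]
      rw [h1, H.periodic]
      simp

/-! ### Rank one perturbations of diagonal operators -/

section RankOne

variable {ι : Type} [Fintype ι]

/-- Write v'² - v² = 2(v' - v)v + (v' - v)²; Cauchy–Schwarz bounds the first sum by 2δ and the
second is at most δ² ≤ δ. -/
theorem sum_norm_sq_sub_sq_le {v v' : ι → ℂ} {δ : ℝ} (hδ0 : 0 ≤ δ) (hδ1 : δ ≤ 1)
    (hv : ∑ i, ‖v i‖ ^ 2 ≤ 1) (hvv : ∑ i, ‖v' i - v i‖ ^ 2 ≤ δ ^ 2) :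
    ∑ i, ‖v' i ^ 2 - v i ^ 2‖ ≤ 3 * δ := by
  have h1 : ∑ i, ‖v' i - v i‖ * ‖v i‖ ≤ δ := by
    have h2 := Real.sum_mul_le_sqrt_mul_sqrt Finset.univ (fun i => ‖v' i - v i‖) (fun i => ‖v i‖)
    refine h2.trans ?_
    have h3 : √(∑ i, ‖v' i - v i‖ ^ 2) ≤ δ := Real.sqrt_le_iff.2 ⟨hδ0, hvv⟩
    have h4 : √(∑ i, ‖v i‖ ^ 2) ≤ 1 := Real.sqrt_le_iff.2 ⟨zero_le_one, by simpa using hv⟩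
    calc _ ≤ δ * 1 := by gcongr
      _ = δ := mul_one δ
  calc ∑ i, ‖v' i ^ 2 - v i ^ 2‖ ≤
      ∑ i, (2 * (‖v' i - v i‖ * ‖v i‖) + ‖v' i - v i‖ ^ 2) := by
        refine Finset.sum_le_sum fun i _ => ?_
        have e : v' i ^ 2 - v i ^ 2 = 2 * ((v' i - v i) * v i) + (v' i - v i) ^ 2 := by ring
        rw [e]
        refine (norm_add_le _ _).trans ?_
        rw [norm_mul, norm_mul, norm_pow]
        simp
    _ = 2 * ∑ i, ‖v' i - v i‖ * ‖v i‖ + ∑ i, ‖v' i - v i‖ ^ 2 := by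
        rw [Finset.sum_add_distrib, Finset.mul_sum]
    _ ≤ 3 * δ := by nlinarith

variable [DecidableEq ι]

/-- `ρ + ∑_{i ≠ o} v_i² / d_i`. -/
def fiberX (o : ι) (ρ : ℂ) (v d : ι → ℂ) : ℂ := ρ + ∑ i ∈ Finset.univ.erase o, v i ^ 2 / d i

/-- `v_o² + d_o (ρ + ∑_{i ≠ o} v_i² / d_i)`. -/
def fiberZ (o : ι) (ρ : ℂ) (v d : ι → ℂ) : ℂ := v o ^ 2 + d o * fiberX o ρ v d

/-- The data `ρ, v, d` of a rank one perturbation at a real momentum, bounded by `r`, `B`, `c`, and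
the corresponding data `ρ', v', d'` at a nearby complex momentum. -/
structure FiberData (r B c δ : ℝ) (o : ι) (ρ ρ' : ℂ) (v v' d d' : ι → ℂ) : Prop where
  ρ_re : r ≤ ρ.re
  ρ_norm : ‖ρ‖ ≤ B
  ρ_sub : ‖ρ' - ρ‖ ≤ δ
  v_im : ∀ i, (v i).im = 0
  v_sum : ∑ i, ‖v i‖ ^ 2 ≤ 1
  v_o : c ≤ ‖v o‖
  v_sub : ∑ i, ‖v' i - v i‖ ^ 2 ≤ δ ^ 2
  d_re : ∀ i, 0 ≤ (d i).re
  d_norm : ∀ i, i ≠ o → c ≤ ‖d i‖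
  d_sub : ∀ i, i ≠ o → ‖d' i - d i‖ ≤ δ * ‖d i‖
  d_o : ‖d' o - d o‖ ≤ δ * (1 + ‖d o‖)

namespace FiberData

variable {r B c δ : ℝ} {o : ι} {ρ ρ' : ℂ} {v v' d d' : ι → ℂ}

/-- v is real, so v²/d is a nonnegative multiple of 1/d, which has the sign of Re d in its real
part. No lower bound on |d| is needed, as division by 0 gives 0. -/
theorem re_sq_div (hv : ∀ i, (v i).im = 0) (hd : ∀ i, 0 ≤ (d i).re) (i : ι) :
    0 ≤ (v i ^ 2 / d i).re := by
  have h1 : v i ^ 2 = (((v i).re ^ 2 : ℝ) : ℂ) := by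
    have : v i = ((v i).re : ℂ) := Complex.ext (by simp) (by simpa using hv i)
    rw [this]; push_cast; simp
  rw [h1, div_eq_mul_inv, Complex.re_ofReal_mul, Complex.inv_re]
  exact mul_nonneg (sq_nonneg _) (div_nonneg (hd i) (Complex.normSq_nonneg _))

theorem le_X_re (h : FiberData r B c δ o ρ ρ' v v' d d') : r ≤ (fiberX o ρ v d).re := by
  unfold fiberX
  rw [Complex.add_re, Complex.re_sum]
  have := Finset.sum_nonneg fun i (_ : i ∈ Finset.univ.erase o) => re_sq_div h.v_im h.d_re i
  linarith [h.ρ_re]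

theorem norm_X_le (h : FiberData r B c δ o ρ ρ' v v' d d') (hc : 0 < c) :
    ‖fiberX o ρ v d‖ ≤ B + 1 / c := by
  unfold fiberX
  refine (norm_add_le _ _).trans (add_le_add h.ρ_norm ?_)
  refine (norm_sum_le _ _).trans ?_
  calc _ ≤ ∑ i ∈ Finset.univ.erase o, ‖v i‖ ^ 2 * (1 / c) := by
        refine Finset.sum_le_sum fun i hi => ?_
        rw [norm_div, norm_pow, div_eq_mul_one_div]
        gcongr
        exact h.d_norm i (Finset.ne_of_mem_erase hi)
    _ ≤ ∑ i, ‖v i‖ ^ 2 * (1 / c) := Finset.sum_le_sum_of_subset_of_nonneg (Finset.erase_subset _ _)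
        fun i _ _ => by positivity
    _ ≤ 1 / c := by
        rw [← Finset.sum_mul]
        exact mul_le_of_le_one_left (by positivity) h.v_sum

theorem half_le_norm_d' (h : FiberData r B c δ o ρ ρ' v v' d d') (hδ1 : δ ≤ 1 / 2) {i : ι}
    (hi : i ≠ o) : ‖d i‖ / 2 ≤ ‖d' i‖ := by
  have h1 := h.d_sub i hi
  have h2 := norm_sub_norm_le (d i) (d' i)
  rw [norm_sub_rev] at h2
  have h3 : δ * ‖d i‖ ≤ 1 / 2 * ‖d i‖ := by gcongr
  linarith

/-- Away from `o` the d_i are bounded below and change by a relative amount δ, so each quotient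
changes by the change of v_i² plus δ|v_i|²; both are summable. -/
theorem norm_X_sub_le (h : FiberData r B c δ o ρ ρ' v v' d d') (hc : 0 < c) (hδ0 : 0 ≤ δ)
    (hδ1 : δ ≤ 1 / 2) : ‖fiberX o ρ' v' d' - fiberX o ρ v d‖ ≤ δ * (1 + 8 / c) := by
  unfold fiberX
  rw [add_sub_add_comm, ← Finset.sum_sub_distrib]
  refine (norm_add_le _ _).trans ?_
  have h1 : ∀ i ∈ Finset.univ.erase o, ‖v' i ^ 2 / d' i - v i ^ 2 / d i‖ ≤
      2 / c * (‖v' i ^ 2 - v i ^ 2‖ + δ * ‖v i‖ ^ 2) := by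
    intro i hi
    have hio := Finset.ne_of_mem_erase hi
    have hd := h.d_norm i hio
    have hd' := h.half_le_norm_d' hδ1 hio
    have hdpos : 0 < ‖d i‖ := hc.trans_le hd
    have hd'pos : 0 < ‖d' i‖ := by linarith
    have hd0 : d i ≠ 0 := norm_pos_iff.1 hdpos
    have hd0' : d' i ≠ 0 := norm_pos_iff.1 hd'pos
    have e : v' i ^ 2 / d' i - v i ^ 2 / d i =
        ((v' i ^ 2 - v i ^ 2) - v i ^ 2 * ((d' i - d i) / d i)) / d' i := by
      field_simp
      ring
    rw [e, norm_div, div_le_iff₀ hd'pos]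
    have h2 : ‖(v' i ^ 2 - v i ^ 2) - v i ^ 2 * ((d' i - d i) / d i)‖ ≤
        ‖v' i ^ 2 - v i ^ 2‖ + δ * ‖v i‖ ^ 2 := by
      refine (norm_sub_le _ _).trans ?_
      rw [norm_mul, norm_div, norm_pow, mul_comm δ]
      gcongr
      rw [div_le_iff₀ hdpos]
      exact h.d_sub i hio
    have h3 : 0 ≤ ‖v' i ^ 2 - v i ^ 2‖ + δ * ‖v i‖ ^ 2 := by positivity
    have h4 : 1 ≤ 2 / c * ‖d' i‖ := by
      rw [div_mul_eq_mul_div, le_div_iff₀ hc]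
      linarith
    calc _ ≤ (‖v' i ^ 2 - v i ^ 2‖ + δ * ‖v i‖ ^ 2) * 1 := by linarith
      _ ≤ (‖v' i ^ 2 - v i ^ 2‖ + δ * ‖v i‖ ^ 2) * (2 / c * ‖d' i‖) := by gcongr
      _ = _ := by ring
  have h5 : ‖∑ i ∈ Finset.univ.erase o, (v' i ^ 2 / d' i - v i ^ 2 / d i)‖ ≤
      2 / c * (3 * δ + δ) := by
    refine (norm_sum_le _ _).trans ((Finset.sum_le_sum h1).trans ?_)
    rw [← Finset.mul_sum]
    gcongr
    refine (Finset.sum_le_sum_of_subset_of_nonneg (Finset.subset_univ _)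
      fun i _ _ => by positivity).trans ?_
    rw [Finset.sum_add_distrib, ← Finset.mul_sum]
    have h6 := sum_norm_sq_sub_sq_le hδ0 (by linarith) h.v_sum h.v_sub
    have h7 : δ * ∑ i, ‖v i‖ ^ 2 ≤ δ * 1 := by
      have := h.v_sum
      gcongr
    linarith
  have e2 : 2 / c * (3 * δ + δ) = δ * (8 / c) := by ring
  have := h.ρ_sub
  rw [mul_add, mul_one]
  linarith

theorem norm_v_le_one (h : FiberData r B c δ o ρ ρ' v v' d d') (i : ι) : ‖v i‖ ≤ 1 := by
  have h1 := (Finset.single_le_sum (f := fun i => ‖v i‖ ^ 2) (fun i _ => sq_nonneg _)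
    (Finset.mem_univ i)).trans h.v_sum
  exact (sq_le_one_iff₀ (norm_nonneg _)).1 h1

theorem norm_Z_sub_le (h : FiberData r B c δ o ρ ρ' v v' d d') (hc : 0 < c) (hδ0 : 0 ≤ δ)
    (hδ1 : δ ≤ 1 / 2) : ‖fiberZ o ρ' v' d' - fiberZ o ρ v d‖ ≤
      δ * ((3 + (B + 1 / c) + 2 * (1 + 8 / c)) * (1 + ‖d o‖)) := by
  have hX := h.norm_X_le hc
  have hXX := h.norm_X_sub_le hc hδ0 hδ1
  set X := fiberX o ρ v d
  set X' := fiberX o ρ' v' d'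
  have e : fiberZ o ρ' v' d' - fiberZ o ρ v d = (v' o ^ 2 - v o ^ 2) + (d' o - d o) * X' +
      d o * (X' - X) := by
    simp only [fiberZ, X, X']; ring
  rw [e]
  have hX' : ‖X'‖ ≤ (B + 1 / c) + (1 + 8 / c) := by
    have h1 : ‖X'‖ ≤ ‖X' - X‖ + ‖X‖ := by
      have := norm_add_le (X' - X) X
      simpa using this
    have h2 : δ * (1 + 8 / c) ≤ 1 * (1 + 8 / c) := by
      have : 0 < 8 / c := by positivity
      gcongr
      linarith
    linarith
  have h1 : ‖v' o ^ 2 - v o ^ 2‖ ≤ 3 * δ :=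
    (Finset.single_le_sum (f := fun i => ‖v' i ^ 2 - v i ^ 2‖) (fun i _ => norm_nonneg _)
      (Finset.mem_univ o)).trans (sum_norm_sq_sub_sq_le hδ0 (by linarith) h.v_sum h.v_sub)
  have h2 : ‖(d' o - d o) * X'‖ ≤ δ * (1 + ‖d o‖) * ((B + 1 / c) + (1 + 8 / c)) := by
    rw [norm_mul]
    have := h.d_o
    gcongr
  have h3 : ‖d o * (X' - X)‖ ≤ ‖d o‖ * (δ * (1 + 8 / c)) := by
    rw [norm_mul]; gcongr
  have h4 := norm_add₃_le (a := v' o ^ 2 - v o ^ 2) (b := (d' o - d o) * X') (c := d o * (X' - X))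
  have h5 : 0 ≤ δ * ‖d o‖ := by positivity
  have h6 : 0 ≤ δ * (8 / c) := by positivity
  nlinarith

/-- Factor Z = X·Y with Y = v_o²/X + d_o. Re Y is at least y > 0, since Re X ≥ r and v_o is bounded
below; also |Y| ≥ |d_o| - 1/r. The first handles small d_o, the second large d_o, and a convex
combination gives a multiple of 1 + |d_o|. -/
theorem le_norm_Z (h : FiberData r B c δ o ρ ρ' v v' d d') (hr : 0 < r) (hc : 0 < c) (hB : 0 ≤ B) :
    r * (c ^ 2 * r / (B + 1 / c) ^ 2 / (1 + 1 / r + c ^ 2 * r / (B + 1 / c) ^ 2)) *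
      (1 + ‖d o‖) ≤ ‖fiberZ o ρ v d‖ := by
  have hX := h.norm_X_le hc
  have hXr := h.le_X_re
  set X := fiberX o ρ v d with hXdef
  have hB1 : 0 < B + 1 / c := by positivity
  set y := c ^ 2 * r / (B + 1 / c) ^ 2 with hy
  have hy0 : 0 < y := by positivity
  have hXn : r ≤ ‖X‖ := hXr.trans (Complex.re_le_norm _)
  have hX0 : X ≠ 0 := norm_pos_iff.1 (hr.trans_le hXn)
  set Y := v o ^ 2 / X + d o with hY
  have hZ : fiberZ o ρ v d = X * Y := by
    simp only [fiberZ, hY, ← hXdef]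
    field_simp
  have hv2 : v o ^ 2 = ((‖v o‖ ^ 2 : ℝ) : ℂ) := by
    have h1 : v o = ((v o).re : ℂ) := Complex.ext (by simp) (by simpa using h.v_im o)
    have h2 : ‖v o‖ ^ 2 = (v o).re ^ 2 := by
      rw [h1, Complex.norm_real, Real.norm_eq_abs, sq_abs]; simp
    rw [h2]
    nth_rewrite 1 [h1]
    push_cast; rfl
  have hYre : y ≤ ‖Y‖ := by
    refine le_trans ?_ (Complex.re_le_norm _)
    rw [hY, Complex.add_re, hv2, div_eq_mul_inv, Complex.re_ofReal_mul, Complex.inv_re]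
    have h1 : c ^ 2 * (r / (B + 1 / c) ^ 2) ≤ ‖v o‖ ^ 2 * (X.re / Complex.normSq X) := by
      have h2 := h.v_o
      rw [Complex.normSq_eq_norm_sq]
      gcongr
      linarith
    have h3 := h.d_re o
    rw [hy, mul_div_assoc]
    linarith
  have hYd : ‖d o‖ - 1 / r ≤ ‖Y‖ := by
    have h1 : ‖v o ^ 2 / X‖ ≤ 1 / r := by
      rw [norm_div, norm_pow]
      have := h.norm_v_le_one o
      have h2 : ‖v o‖ ^ 2 ≤ 1 := pow_le_one₀ (norm_nonneg _) this
      gcongr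
    have h2 := norm_sub_norm_le (d o) (-(v o ^ 2 / X))
    rw [norm_neg, sub_neg_eq_add, add_comm] at h2
    linarith
  have hr1 : 0 < 1 / r := by positivity
  have hD : 0 < 1 + 1 / r + y := by positivity
  have hYt : y / (1 + 1 / r + y) * (1 + ‖d o‖) ≤ ‖Y‖ := by
    rw [div_mul_eq_mul_div, div_le_iff₀ hD]
    have h3 : y * (‖d o‖ - 1 / r) ≤ y * ‖Y‖ := by gcongr
    have h4 : y * (1 + 1 / r) ≤ ‖Y‖ * (1 + 1 / r) := by gcongr
    nlinarith
  rw [hZ, norm_mul, mul_assoc]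
  have h5 : 0 ≤ y / (1 + 1 / r + y) * (1 + ‖d o‖) := by positivity
  exact mul_le_mul hXn hYt h5 (norm_nonneg _)

end FiberData

/-- Lower bounds for the denominators of rank one perturbations persist at complex momenta. -/
theorem exists_fiber_bounds {r B c : ℝ} (hr : 0 < r) (hB : 0 ≤ B) (hc : 0 < c) :
    ∃ c₂ C₂ δ₀ : ℝ, 0 < c₂ ∧ 0 < C₂ ∧ 0 < δ₀ ∧ δ₀ ≤ 1 / 2 ∧
      ∀ (ι : Type) [Fintype ι] [DecidableEq ι] (o : ι) (ρ ρ' : ℂ) (v v' d d' : ι → ℂ) (δ : ℝ),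
        0 ≤ δ → δ ≤ δ₀ → FiberData r B c δ o ρ ρ' v v' d d' →
        ‖fiberX o ρ' v' d'‖ ≤ C₂ ∧ c₂ * (1 + ‖d o‖) ≤ ‖fiberZ o ρ' v' d'‖ ∧
        c₂ * (1 + ‖d o‖) ≤ ‖fiberZ o ρ v d‖ ∧
        ‖fiberZ o ρ' v' d' - fiberZ o ρ v d‖ ≤ C₂ * δ * (1 + ‖d o‖) := by
  set a := r * (c ^ 2 * r / (B + 1 / c) ^ 2 / (1 + 1 / r + c ^ 2 * r / (B + 1 / c) ^ 2)) with ha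
  have ha0 : 0 < a := by positivity
  set C := 3 + (B + 1 / c) + 2 * (1 + 8 / c) with hC
  have hC0 : 0 < C := by positivity
  -- The smallness of δ₀ keeps the change of Z below half of its lower bound a(1 + |d_o|).
  refine ⟨a / 2, C, min (1 / 2) (a / (2 * C)), by positivity, hC0, by positivity, min_le_left _ _,
    ?_⟩
  intro ι _ _ o ρ ρ' v v' d d' δ hδ0 hδ h
  have hδ1 : δ ≤ 1 / 2 := hδ.trans (min_le_left _ _)
  have hδ2 : δ * C ≤ a / 2 := by
    have := hδ.trans (min_le_right _ _)
    rw [le_div_iff₀ (by positivity)] at this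
    linarith
  have h1 := h.le_norm_Z hr hc hB
  have h2 := h.norm_Z_sub_le hc hδ0 hδ1
  rw [← ha] at h1
  rw [← hC] at h2
  have hd : 0 ≤ ‖d o‖ := norm_nonneg _
  have h3 : δ * (C * (1 + ‖d o‖)) ≤ a / 2 * (1 + ‖d o‖) := by
    rw [← mul_assoc]; gcongr
  refine ⟨?_, ?_, ?_, ?_⟩
  · have h4 := h.norm_X_le hc
    have h5 := h.norm_X_sub_le hc hδ0 hδ1
    have h6 : ‖fiberX o ρ' v' d'‖ ≤ ‖fiberX o ρ' v' d' - fiberX o ρ v d‖ + ‖fiberX o ρ v d‖ := by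
      have := norm_add_le (fiberX o ρ' v' d' - fiberX o ρ v d) (fiberX o ρ v d)
      simpa using this
    have h7 : δ * (1 + 8 / c) ≤ 1 * (1 + 8 / c) := by
      have : 0 < 8 / c := by positivity
      gcongr
      linarith
    have : 0 < 8 / c := by positivity
    rw [hC]
    linarith
  · have h4 := norm_sub_norm_le (fiberZ o ρ v d) (fiberZ o ρ' v' d')
    rw [norm_sub_rev] at h4
    linarith
  · refine le_trans ?_ h1
    gcongr
    linarith
  · linarith

end RankOne

/-! ### Periodicity and centred fibres -/

/-- `f` has period `2π` in each variable. -/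
def IsPeriodic {β : Type*} (f : (Fin 4 → ℂ) → β) : Prop :=
  ∀ (θ : Fin 4 → ℂ) (μ : Fin 4), f (θ + Pi.single μ (2 * Real.pi : ℂ)) = f θ

theorem IsPeriodic.add_single {β : Type*} {f : (Fin 4 → ℂ) → β} (hf : IsPeriodic f)
    (θ : Fin 4 → ℂ) (μ : Fin 4) (z : ℤ) : f (θ + Pi.single μ (2 * Real.pi * z : ℂ)) = f θ := by
  have h : ∀ w : ℂ, f (θ + Pi.single μ (w + 2 * Real.pi)) = f (θ + Pi.single μ w) := fun w => by
    rw [Pi.single_add, ← add_assoc, hf]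
  induction z using Int.induction_on with
  | zero => simp
  | succ i ih =>
    rw [← ih, ← h (2 * Real.pi * ((i : ℤ) : ℂ))]
    congr 3
    push_cast; ring
  | pred i ih =>
    rw [← ih, ← h]
    congr 3
    push_cast; ring

theorem IsPeriodic.add_int {β : Type*} {f : (Fin 4 → ℂ) → β} (hf : IsPeriodic f)
    (θ : Fin 4 → ℂ) (z : Fin 4 → ℤ) : f (θ + fun μ => (2 * Real.pi * z μ : ℂ)) = f θ := by
  have h : ∀ s : Finset (Fin 4), f (θ + ∑ μ ∈ s, Pi.single μ (2 * Real.pi * z μ : ℂ)) = f θ := by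
    intro s
    induction s using Finset.induction_on with
    | empty => simp
    | insert μ s hμ ih =>
      rw [Finset.sum_insert hμ, add_comm (Pi.single _ _), ← add_assoc, hf.add_single, ih]
  rw [← h Finset.univ, Finset.univ_sum_single]

theorem IsPeriodic.congr_int {β : Type*} {f : (Fin 4 → ℂ) → β} (hf : IsPeriodic f)
    {θ θ' : Fin 4 → ℂ} (z : Fin 4 → ℤ) (h : ∀ μ, θ' μ = θ μ + 2 * Real.pi * z μ) : f θ' = f θ := by
  rw [← hf.add_int θ z]
  congr 1
  ext μ
  simp [h μ]

/-- Parabolic scaling factors. -/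
def pscale (S : ℕ) : Fin 4 → ℕ := fun μ => if μ = 0 then S ^ 2 else S

theorem pscale_zero (S : ℕ) : pscale S 0 = S ^ 2 := if_pos rfl

theorem pscale_succ (S : ℕ) (ν : Fin 3) : pscale S ν.succ = S := if_neg (Fin.succ_ne_zero ν)

instance (S : ℕ) [NeZero S] (μ : Fin 4) : NeZero (pscale S μ) :=
  ⟨by unfold pscale; split_ifs <;> simp [NeZero.ne S]⟩

theorem odd_pscale {S : ℕ} (hS : Odd S) (μ : Fin 4) : Odd (pscale S μ) := by
  unfold pscale
  split_ifs
  · exact hS.pow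
  · exact hS

theorem pscale_mul (S T : ℕ) (μ : Fin 4) : pscale (S * T) μ = pscale S μ * pscale T μ := by
  unfold pscale
  split_ifs
  · ring
  · rfl

theorem isPeriodic_blockSym (𝔮 : ℕ) {s : Fin 4 → ℕ} (hs : ∀ μ, Odd (s μ)) :
    IsPeriodic (blockSym 𝔮 s) := by
  intro θ μ
  unfold blockSym
  refine Finset.prod_congr rfl fun ν _ => ?_
  by_cases h : ν = μ
  · subst h
    rw [Pi.add_apply, Pi.single_eq_same, avg_add_two_pi (hs ν)]
  · rw [Pi.add_apply, Pi.single_eq_of_ne h, add_zero]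

/-- Translating the base point of a fibre permutes the fibre. -/
theorem IsPeriodic.fib_add {β : Type*} {f : (Fin 4 → ℂ) → β} (hf : IsPeriodic f)
    {s : Fin 4 → ℕ} [∀ μ, NeZero (s μ)] (K : Fin 4 → ℂ) (z : Fin 4 → ℤ) (l : ∀ μ, ZMod (s μ)) :
    f (fib s (K + fun μ => (2 * Real.pi * z μ : ℂ)) l) = f (fib s K (l + fun μ => (z μ : ZMod (s μ)))) := by
  have h : ∀ μ, ∃ y : ℤ, ((l μ).val : ℤ) + z μ = ((l μ + (z μ : ZMod (s μ))).val : ℤ) + s μ * y := by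
    intro μ
    have h1 : ((((l μ).val : ℤ) + z μ : ℤ) : ZMod (s μ)) =
        ((((l μ + (z μ : ZMod (s μ))).val : ℤ)) : ZMod (s μ)) := by
      push_cast
      rw [ZMod.natCast_zmod_val, ZMod.natCast_zmod_val]
    obtain ⟨y, hy⟩ := (ZMod.intCast_eq_intCast_iff_dvd_sub _ _ _).1 h1.symm
    exact ⟨y, by linarith⟩
  choose y hy using h
  refine hf.congr_int y fun μ => ?_
  have h2 : (s μ : ℂ) ≠ 0 := Nat.cast_ne_zero.2 (NeZero.ne _)
  have h3 : (((l μ).val : ℂ)) + z μ = ((l μ + (z μ : ZMod (s μ))).val : ℂ) + s μ * y μ := by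
    exact_mod_cast hy μ
  simp only [fib, Pi.add_apply]
  rw [div_add' _ _ _ h2, div_left_inj' h2]
  linear_combination 2 * Real.pi * h3

/-- The fibre over a real momentum, with centred representatives. -/
def cfib (s : Fin 4 → ℕ) (K : Fin 4 → ℝ) (l : ∀ μ, ZMod (s μ)) : Fin 4 → ℝ :=
  fun μ => (K μ + 2 * Real.pi * (l μ).valMinAbs) / s μ

theorem exists_val_eq_valMinAbs {N : ℕ} [NeZero N] (l : ZMod N) :
    ∃ y : ℤ, (l.val : ℤ) = l.valMinAbs + N * y := by
  have h1 : ((l.valMinAbs : ℤ) : ZMod N) = ((l.val : ℤ) : ZMod N) := by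
    rw [ZMod.coe_valMinAbs]; simp
  obtain ⟨y, hy⟩ := (ZMod.intCast_eq_intCast_iff_dvd_sub _ _ _).1 h1
  exact ⟨y, by linarith⟩

/-- Replacing `val` by the centred representative changes each fibre momentum by a multiple of 2π.
The centred momenta lie in the cell, where the parabolic bounds are available. -/
theorem IsPeriodic.fib_shift {β : Type*} {f : (Fin 4 → ℂ) → β} (hf : IsPeriodic f)
    {s : Fin 4 → ℕ} [∀ μ, NeZero (s μ)] (K : Fin 4 → ℝ) (μ : Fin 4) (η : ℝ)
    (l : ∀ μ, ZMod (s μ)) : f (fib s (shift K μ η) l) = f (shift (cfib s K l) μ (η / s μ)) := by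
  choose y hy using fun ν => exists_val_eq_valMinAbs (l ν)
  refine hf.congr_int y fun ν => ?_
  have h2 : (s ν : ℂ) ≠ 0 := Nat.cast_ne_zero.2 (NeZero.ne _)
  have h3 : ((l ν).val : ℂ) = (l ν).valMinAbs + s ν * y ν := by exact_mod_cast hy ν
  by_cases h : ν = μ
  · subst h
    simp only [fib, shift_self, cfib, h3]
    push_cast
    field_simp
    ring
  · simp only [fib, shift_of_ne _ h, cfib, h3]
    push_cast
    field_simp
    ring

theorem IsPeriodic.fib_toC {β : Type*} {f : (Fin 4 → ℂ) → β} (hf : IsPeriodic f)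
    {s : Fin 4 → ℕ} [∀ μ, NeZero (s μ)] (K : Fin 4 → ℝ) (l : ∀ μ, ZMod (s μ)) :
    f (fib s (toC K) l) = f (toC (cfib s K l)) := by
  have := hf.fib_shift K 0 0 l
  rwa [zero_div, shift_zero, shift_zero] at this

/-- For odd s the centred representative is at most (s-1)/2 in modulus, hence |K + 2πl| ≤ π + π(s-1)
= πs. -/
theorem abs_cfib_le {s : Fin 4 → ℕ} (hs : ∀ μ, Odd (s μ)) {K : Fin 4 → ℝ}
    (hK : ∀ μ, |K μ| ≤ Real.pi) (l : ∀ μ, ZMod (s μ)) (μ : Fin 4) :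
    |cfib s K l μ| ≤ Real.pi := by
  have : NeZero (s μ) := ⟨(hs μ).pos.ne'⟩
  have h1 : ((l μ).valMinAbs).natAbs ≤ s μ / 2 := ZMod.natAbs_valMinAbs_le _
  have h2 : 2 * ((l μ).valMinAbs).natAbs + 1 ≤ s μ := by
    obtain ⟨k, hk⟩ := hs μ
    omega
  have h3 : (2 : ℝ) * |((l μ).valMinAbs : ℝ)| + 1 ≤ s μ := by
    rw [← Int.cast_abs, ← Nat.cast_natAbs]
    exact_mod_cast h2
  have hs0 : (0 : ℝ) < s μ := by exact_mod_cast (hs μ).pos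
  have hpi := Real.pi_pos
  unfold cfib
  rw [abs_div, abs_of_pos hs0, div_le_iff₀ hs0]
  refine (abs_add_le _ _).trans ?_
  rw [abs_mul, abs_of_pos (by positivity : (0 : ℝ) < 2 * Real.pi)]
  have := hK μ
  nlinarith

theorem parab_div_pscale {S : ℕ} (hS : S ≠ 0) (x : Fin 4 → ℝ) :
    (S : ℝ) ^ 2 * parab (fun μ => x μ / pscale S μ) = parab x := by
  have hS' : (0 : ℝ) < S := by exact_mod_cast Nat.pos_of_ne_zero hS
  unfold parab
  simp only [pscale_zero, pscale_succ, mul_add, Finset.mul_sum]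
  congr 1
  · rw [abs_div]
    push_cast
    rw [abs_of_pos (by positivity : (0 : ℝ) < (S : ℝ) ^ 2)]
    field_simp
  · refine Finset.sum_congr rfl fun ν _ => ?_
    field_simp

/-- Some component of l has modulus at least 1, so that component of K + 2πl is at least 2π - π.
Thus `l = 0` is the only member of the fibre that can have a small symbol. -/
theorem one_le_parab {s : Fin 4 → ℕ} [∀ μ, NeZero (s μ)] {K : Fin 4 → ℝ}
    (hK : ∀ μ, |K μ| ≤ Real.pi) {l : ∀ μ, ZMod (s μ)} (hl : l ≠ 0) :
    1 ≤ parab fun μ => K μ + 2 * Real.pi * (l μ).valMinAbs := by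
  obtain ⟨μ, hμ⟩ := Function.ne_iff.1 hl
  have hz : (l μ).valMinAbs ≠ 0 := by
    rwa [Ne, ZMod.valMinAbs_eq_zero]
  have h1 : (1 : ℝ) ≤ |((l μ).valMinAbs : ℝ)| := by
    rw [← Int.cast_abs]
    exact_mod_cast Int.one_le_abs hz
  have hpi := Real.pi_gt_three
  have h2 : 1 ≤ |K μ + 2 * Real.pi * (l μ).valMinAbs| := by
    have h3 := abs_sub_abs_le_abs_sub (2 * Real.pi * ((l μ).valMinAbs : ℝ)) (-K μ)
    rw [abs_mul, abs_neg, abs_of_pos (by positivity : (0 : ℝ) < 2 * Real.pi), sub_neg_eq_add,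
      add_comm] at h3
    have := hK μ
    nlinarith
  unfold parab
  have h4 : 0 ≤ ∑ ν : Fin 3, (K ν.succ + 2 * Real.pi * (l ν.succ).valMinAbs) ^ 2 := by positivity
  revert h2
  refine Fin.cases ?_ (fun ν => ?_) μ
  · intro h2; linarith
  · intro h2
    have h5 := Finset.single_le_sum (f := fun ν : Fin 3 =>
      (K ν.succ + 2 * Real.pi * (l ν.succ).valMinAbs) ^ 2) (fun _ _ => sq_nonneg _)
      (Finset.mem_univ ν)
    have h6 : 1 ≤ (K ν.succ + 2 * Real.pi * (l ν.succ).valMinAbs) ^ 2 := by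
      rw [← sq_abs]; nlinarith
    have := abs_nonneg (K 0 + 2 * Real.pi * (l 0).valMinAbs)
    linarith

/-- Every real momentum is congruent to one in the fundamental cell. -/
theorem exists_cell (K : Fin 4 → ℝ) : ∃ (K' : Fin 4 → ℝ) (z : Fin 4 → ℤ),
    (∀ μ, |K' μ| ≤ Real.pi) ∧ ∀ μ, K μ = K' μ + 2 * Real.pi * z μ := by
  refine ⟨fun μ => K μ - 2 * Real.pi * round (K μ / (2 * Real.pi)),
    fun μ => round (K μ / (2 * Real.pi)), fun μ => ?_, fun μ => by ring⟩
  have hpi := Real.pi_pos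
  have h := abs_sub_round (K μ / (2 * Real.pi))
  have e : K μ - 2 * Real.pi * round (K μ / (2 * Real.pi)) =
      2 * Real.pi * (K μ / (2 * Real.pi) - round (K μ / (2 * Real.pi))) := by
    field_simp
  simp only
  rw [e, abs_mul, abs_of_pos (by positivity : (0 : ℝ) < 2 * Real.pi)]
  nlinarith

theorem width_nonneg {κ : ℝ} (hκ : 0 ≤ κ) (μ : Fin 4) : 0 ≤ width κ μ := by
  unfold width; split_ifs <;> positivity

theorem width_le_one {κ : ℝ} (hκ1 : κ ≤ 1) (μ : Fin 4) : width κ μ ≤ 1 := by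
  unfold width
  split_ifs
  · exact hκ1
  · exact Real.sqrt_le_one.2 hκ1

theorem width_div_sq {κ : ℝ} (S : ℕ) (μ : Fin 4) :
    width (κ / (S : ℝ) ^ 2) μ = width κ μ / pscale S μ := by
  unfold width pscale
  split_ifs
  · push_cast; rfl
  · rw [Real.sqrt_div' _ (by positivity), Real.sqrt_sq (by positivity)]

/-- The fibre of a shifted symbol over `K`. -/
def fibSym (S : ℕ) (f : (Fin 4 → ℂ) → ℂ) (lam : ℝ) (K : Fin 4 → ℂ) (l : ∀ μ, ZMod (pscale S μ)) :
    ℂ := (S : ℂ) ^ 2 * (f (fib (pscale S) K l) + lam)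

theorem norm_le_norm_add_ofReal {z : ℂ} (hz : 0 ≤ z.re) {x : ℝ} (hx : 0 ≤ x) :
    ‖z‖ ≤ ‖z + x‖ := by
  refine le_of_sq_le_sq ?_ (norm_nonneg _)
  rw [← Complex.normSq_eq_norm_sq, ← Complex.normSq_eq_norm_sq, Complex.normSq_apply,
    Complex.normSq_apply]
  simp only [Complex.add_re, Complex.add_im, Complex.ofReal_re, Complex.ofReal_im]
  nlinarith

theorem le_norm_add_ofReal {z : ℂ} (hz : 0 ≤ z.re) (x : ℝ) : x ≤ ‖z + x‖ := by
  refine le_trans ?_ (Complex.re_le_norm _)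
  simp [hz]

section

variable {c C m₀ κ : ℝ} {f : (Fin 4 → ℂ) → ℂ} {S : ℕ} [NeZero S]

theorem ParabolicSymbol.fibSym_re (hf : ParabolicSymbol c C m₀ κ f) (hS : Odd S) {K : Fin 4 → ℝ}
    (hK : ∀ μ, |K μ| ≤ Real.pi) {lam : ℝ} (hl : 0 ≤ lam) (l : ∀ μ, ZMod (pscale S μ)) :
    0 ≤ (fibSym S f lam (toC K) l).re := by
  unfold fibSym
  rw [IsPeriodic.fib_toC hf.per]
  have h1 := hf.re_nonneg _ (abs_cfib_le (odd_pscale hS) hK l)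
  rw [← Nat.cast_pow, ← Complex.ofReal_natCast, Complex.re_ofReal_mul, Complex.add_re,
    Complex.ofReal_re]
  positivity

theorem ParabolicSymbol.le_fibSym (hf : ParabolicSymbol c C m₀ κ f) (hS : Odd S) {K : Fin 4 → ℝ}
    (hK : ∀ μ, |K μ| ≤ Real.pi) {lam : ℝ} (hl : 0 ≤ lam) (l : ∀ μ, ZMod (pscale S μ)) :
    c * parab (fun μ => K μ + 2 * Real.pi * (l μ).valMinAbs) ≤ ‖fibSym S f lam (toC K) l‖ := by
  unfold fibSym
  rw [IsPeriodic.fib_toC hf.per, norm_mul, norm_pow, Complex.norm_natCast]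
  have h0 := abs_cfib_le (odd_pscale hS) hK l
  have h1 := hf.lower _ h0
  have h2 := norm_le_norm_add_ofReal (hf.re_nonneg _ h0) hl
  rw [← parab_div_pscale (NeZero.ne S)]
  calc _ = (S : ℝ) ^ 2 * (c * parab (cfib (pscale S) K l)) := by unfold cfib; ring
    _ ≤ _ := by gcongr; linarith

/-- The counterpart of `le_fibSym` for large λ: it is what makes the inverse fibre matrices decay in
λ. -/
theorem ParabolicSymbol.le_fibSym' (hf : ParabolicSymbol c C m₀ κ f) (hS : Odd S) {K : Fin 4 → ℝ}
    (hK : ∀ μ, |K μ| ≤ Real.pi) (lam : ℝ) (l : ∀ μ, ZMod (pscale S μ)) :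
    (S : ℝ) ^ 2 * lam ≤ ‖fibSym S f lam (toC K) l‖ := by
  unfold fibSym
  rw [IsPeriodic.fib_toC hf.per, norm_mul, norm_pow, Complex.norm_natCast]
  have h0 := abs_cfib_le (odd_pscale hS) hK l
  have h2 := le_norm_add_ofReal (hf.re_nonneg _ h0) lam
  gcongr

/-- Parabolic scaling: a shift η of the coarse momentum is a shift η/s_μ of the fine one, which fits
the strip of parameter κ/S², and the factor S² restores `parab` and κ at the coarse scale. The
constant λ cancels. -/
theorem ParabolicSymbol.fibSym_sub_le (hf : ParabolicSymbol c C m₀ (κ / (S : ℝ) ^ 2) f) (hS : Odd S)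
    {K : Fin 4 → ℝ} (hK : ∀ μ, |K μ| ≤ Real.pi) (lam : ℝ) (l : ∀ μ, ZMod (pscale S μ))
    (μ : Fin 4) {m η : ℝ} (hm : 0 ≤ m) (hm₀ : m ≤ m₀) (hη : |η| ≤ m * width κ μ) :
    ‖fibSym S f lam (shift K μ η) l - fibSym S f lam (toC K) l‖ ≤
      C * m * (parab (fun μ => K μ + 2 * Real.pi * (l μ).valMinAbs) + κ) := by
  unfold fibSym
  have hS0 : (0 : ℝ) < S := by exact_mod_cast hS.pos
  have hs0 : (0 : ℝ) < pscale S μ := by exact_mod_cast (odd_pscale hS μ).pos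
  rw [IsPeriodic.fib_toC hf.per, IsPeriodic.fib_shift hf.per, ← mul_sub, add_sub_add_right_eq_sub,
    norm_mul, norm_pow, Complex.norm_natCast]
  have h1 := hf.sub_le _ (abs_cfib_le (odd_pscale hS) hK l) μ m (η / pscale S μ) hm hm₀ (by
    rw [width_div_sq, abs_div, abs_of_pos hs0, ← mul_div_assoc]
    gcongr)
  calc _ ≤ (S : ℝ) ^ 2 * (C * m * (parab (cfib (pscale S) K l) + κ / (S : ℝ) ^ 2)) := by gcongr
    _ = C * m * ((S : ℝ) ^ 2 * parab (cfib (pscale S) K l) + κ) := by field_simp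
    _ = _ := by unfold cfib; rw [parab_div_pscale (NeZero.ne S)]

/-- The rank one data of the fibres of a parabolic symbol. -/
theorem ParabolicSymbol.fiberData {𝔮 : ℕ} (h𝔮 : 1 ≤ 𝔮) (hc : 0 < c) (hC : 0 < C)
    (hκ1 : κ ≤ 1) (hf : ParabolicSymbol c C m₀ (κ / (S : ℝ) ^ 2) f) (hS : Odd S)
    {K : Fin 4 → ℝ} (hK : ∀ μ, |K μ| ≤ Real.pi) {lam : ℝ} (hl : 0 ≤ lam)
    (μ : Fin 4) {m η : ℝ} (hm : 0 ≤ m) (hm₀ : m ≤ m₀) (hm1 : m ≤ 1) (hη : |η| ≤ m * width κ μ)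
    {r B M : ℝ} {ρ ρ' : ℂ} (hr : r ≤ ρ.re) (hB : ‖ρ‖ ≤ B) (hM : ‖ρ' - ρ‖ ≤ M * m) (hM0 : 0 ≤ M) :
    FiberData r B (min ((1 / 2) ^ (4 * 𝔮)) c) ((M + 𝔮 * 2 ^ 𝔮 + C + 2 * C / c) * m) 0 ρ ρ'
      (fun l => blockSym 𝔮 (pscale S) (fib (pscale S) (toC K) l))
      (fun l => blockSym 𝔮 (pscale S) (fib (pscale S) (shift K μ η) l))
      (fibSym S f lam (toC K)) (fibSym S f lam (shift K μ η)) := by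
  have hCc : 0 ≤ C / c := by positivity
  have hq : (0 : ℝ) ≤ 𝔮 * 2 ^ 𝔮 := by positivity
  have hηm : |η| ≤ m := hη.trans (mul_le_of_le_one_right hm (width_le_one hκ1 μ))
  refine ⟨hr, hB, hM.trans (by gcongr; linarith [show 0 ≤ 2 * C / c by positivity]), fun l => blockSym_fib_im K l,
    sum_norm_sq_blockSym_le h𝔮 K, (min_le_left _ _).trans (le_norm_blockSym K hK), ?_,
    hf.fibSym_re hS hK hl, ?_, ?_, ?_⟩
  · refine (sum_norm_sq_blockSym_sub_le h𝔮 K μ (hηm.trans hm1)).trans ?_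
    gcongr
    linarith [show 0 ≤ 2 * C / c by positivity]
  · intro l hl0
    refine (min_le_right _ _).trans (le_trans ?_ (hf.le_fibSym hS hK hl l))
    exact le_mul_of_one_le_right hc.le (one_le_parab hK hl0)
  · intro l hl0
    have h1 := hf.fibSym_sub_le hS hK lam l μ hm hm₀ hη
    have h2 := hf.le_fibSym hS hK hl l
    have h3 := one_le_parab hK hl0
    set P := parab fun μ => K μ + 2 * Real.pi * (l μ).valMinAbs
    refine h1.trans ?_
    -- Off the origin κ ≤ 1 ≤ P, so the additive error κ can be absorbed and the change is relative
    -- to d_l.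
    calc C * m * (P + κ) ≤ C * m * (2 * P) := by gcongr; linarith
      _ = 2 * C / c * m * (c * P) := by field_simp
      _ ≤ (M + 𝔮 * 2 ^ 𝔮 + C + 2 * C / c) * m * (c * P) := by gcongr; linarith
      _ ≤ _ := by gcongr
  · have h1 := hf.fibSym_sub_le hS hK lam 0 μ hm hm₀ hη
    have h2 := hf.le_fibSym hS hK hl 0
    have h3 := parab_nonneg fun μ => K μ + 2 * Real.pi * ((0 : ∀ μ, ZMod (pscale S μ)) μ).valMinAbs
    set P := parab fun μ => K μ + 2 * Real.pi * ((0 : ∀ μ, ZMod (pscale S μ)) μ).valMinAbs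
    refine h1.trans ?_
    -- At l = 0 there is no lower bound on P; the term κ ≤ 1 remains and the change is measured
    -- against 1 + |d_0|.
    have h4 : P ≤ ‖fibSym S f lam (toC K) 0‖ / c := by rw [le_div_iff₀ hc]; linarith
    calc C * m * (P + κ) ≤ C * m * (‖fibSym S f lam (toC K) 0‖ / c + 1) := by gcongr
      _ = (C * m) * 1 + (C / c * m) * ‖fibSym S f lam (toC K) 0‖ := by field_simp; ring
      _ ≤ ((M + 𝔮 * 2 ^ 𝔮 + C + 2 * C / c) * m) * 1 +
          ((M + 𝔮 * 2 ^ 𝔮 + C + 2 * C / c) * m) * ‖fibSym S f lam (toC K) 0‖ := by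
          have : 2 * C / c = C / c + C / c := by ring
          gcongr <;> linarith
      _ = _ := by ring

end

/-! ### The symbol of the effective operator -/

section

variable {ι : Type} [Fintype ι] [DecidableEq ι]

/-- `(∏ d) (ρ + ∑ v_i² / d_i)`, written as a polynomial. -/
def polyDen (ρ : ℂ) (v d : ι → ℂ) : ℂ :=
  ρ * ∏ i, d i + ∑ i, v i ^ 2 * ∏ j ∈ Finset.univ.erase i, d j

theorem polyDen_comp {ι' : Type} [Fintype ι'] [DecidableEq ι'] (e : ι' ≃ ι) (ρ : ℂ) (v d : ι → ℂ) :
    polyDen ρ (fun i => v (e i)) (fun i => d (e i)) = polyDen ρ v d := by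
  unfold polyDen
  rw [Equiv.prod_comp e d, ← Equiv.sum_comp e fun i => v i ^ 2 * ∏ j ∈ Finset.univ.erase i, d j]
  congr 1
  refine Finset.sum_congr rfl fun i _ => ?_
  congr 1
  refine Finset.prod_bij (fun j _ => e j) ?_ ?_ ?_ ?_
  · intro j hj; simpa using hj
  · intro j _ k _ h; exact e.injective h
  · intro j hj
    exact ⟨e.symm j, by simpa [Equiv.symm_apply_eq] using hj, by simp⟩
  · intro j _; rfl

/-- Clearing denominators puts d_o into numerators only, so the identity survives d_o = 0. This is
the case k = 0, where `D_n` kills the constants. -/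
theorem polyDen_eq (o : ι) (ρ : ℂ) (v : ι → ℂ) {d : ι → ℂ} (hd : ∀ i, i ≠ o → d i ≠ 0) :
    polyDen ρ v d = (∏ i ∈ Finset.univ.erase o, d i) * fiberZ o ρ v d := by
  unfold polyDen fiberZ fiberX
  rw [← Finset.mul_prod_erase _ _ (Finset.mem_univ o), ← Finset.add_sum_erase _ _ (Finset.mem_univ o)]
  set P := ∏ i ∈ Finset.univ.erase o, d i with hP
  have h1 : ∑ i ∈ Finset.univ.erase o, v i ^ 2 * ∏ j ∈ Finset.univ.erase i, d j =
      P * d o * ∑ i ∈ Finset.univ.erase o, v i ^ 2 / d i := by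
    rw [Finset.mul_sum]
    refine Finset.sum_congr rfl fun i hi => ?_
    have hi0 := hd i (Finset.ne_of_mem_erase hi)
    have h2 : P * d o = d i * ∏ j ∈ Finset.univ.erase i, d j := by
      rw [hP, mul_comm, Finset.mul_prod_erase _ _ (Finset.mem_univ o),
        Finset.mul_prod_erase _ _ (Finset.mem_univ i)]
    rw [h2]
    field_simp
  rw [h1]
  ring

theorem polyDen_ne_zero {o : ι} {ρ : ℂ} {v d : ι → ℂ} (hd : ∀ i, i ≠ o → d i ≠ 0)
    (hZ : fiberZ o ρ v d ≠ 0) : polyDen ρ v d ≠ 0 := by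
  rw [polyDen_eq o ρ v hd]
  exact mul_ne_zero (Finset.prod_ne_zero_iff.2 fun i hi => hd i (Finset.ne_of_mem_erase hi)) hZ

theorem prod_div_polyDen_eq (o : ι) (ρ : ℂ) (v : ι → ℂ) {d : ι → ℂ} (hd : ∀ i, i ≠ o → d i ≠ 0) :
    (∏ i, d i) / polyDen ρ v d = d o / fiberZ o ρ v d := by
  rw [polyDen_eq o ρ v hd, ← Finset.mul_prod_erase _ _ (Finset.mem_univ o), mul_comm (d o)]
  exact mul_div_mul_left _ _
    (Finset.prod_ne_zero_iff.2 fun i hi => hd i (Finset.ne_of_mem_erase hi))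

/-- When no d_i vanishes, as for t > 0, the polynomial form is the original expression of the
symbol. -/
theorem prod_div_polyDen_eq_inv (ρ : ℂ) (v : ι → ℂ) {d : ι → ℂ} (hd : ∀ i, d i ≠ 0) :
    (∏ i, d i) / polyDen ρ v d = (ρ + ∑ i, v i ^ 2 / d i)⁻¹ := by
  have hP : ∏ i, d i ≠ 0 := Finset.prod_ne_zero_iff.2 fun i _ => hd i
  have h1 : polyDen ρ v d = (∏ i, d i) * (ρ + ∑ i, v i ^ 2 / d i) := by
    unfold polyDen
    rw [mul_add, mul_comm ρ, Finset.mul_sum]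
    congr 1
    refine Finset.sum_congr rfl fun i _ => ?_
    rw [← Finset.mul_prod_erase _ _ (Finset.mem_univ i)]
    have := hd i
    field_simp
  rw [h1, div_mul_eq_div_div, div_self hP, one_div]

end

theorem IsPeriodic.of_int {β : Type*} {f : (Fin 4 → ℂ) → β}
    (h : ∀ (θ : Fin 4 → ℂ) (z : Fin 4 → ℤ), f (θ + fun μ => (2 * Real.pi * z μ : ℂ)) = f θ) :
    IsPeriodic f := by
  intro θ μ
  rw [← h θ (Pi.single μ 1)]
  congr 2
  ext ν
  by_cases hν : ν = μ
  · subst hν; simp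
  · simp [hν]

/-- The symbol of `𝔔_n⁻¹`. -/
def rhoSym (𝔮 L : ℕ) [NeZero L] (a : ℝ) (n : ℕ) (k : Fin 4 → ℂ) : ℂ :=
  (a : ℂ)⁻¹ * (1 + ∑ j ∈ Finset.Icc 1 (n - 1), ((L : ℂ) ^ (2 * j))⁻¹ *
    ∑ l, blockSym 𝔮 (pscale (L ^ j)) (fib (pscale (L ^ j)) k l) ^ 2)

/-- The numerator of the symbol of `Δ^{(n)}`. -/
def deltaNum (L : ℕ) [NeZero L] (f : (Fin 4 → ℂ) → ℂ) (n : ℕ) (t : ℝ) (k : Fin 4 → ℂ) : ℂ :=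
  ∏ l, fibSym (L ^ n) f t k l

/-- The denominator of the symbol of `Δ^{(n)}`. -/
def deltaPoly (𝔮 L : ℕ) [NeZero L] (a : ℝ) (f : (Fin 4 → ℂ) → ℂ) (n : ℕ) (t : ℝ)
    (k : Fin 4 → ℂ) : ℂ :=
  polyDen (rhoSym 𝔮 L a n k) (fun l => blockSym 𝔮 (pscale (L ^ n)) (fib (pscale (L ^ n)) k l))
    (fibSym (L ^ n) f t k)

/-- The symbol of `Δ^{(n)}`. -/
def deltaSym (𝔮 L : ℕ) [NeZero L] (a : ℝ) (f : (Fin 4 → ℂ) → ℂ) (n : ℕ) (k : Fin 4 → ℂ) : ℂ :=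
  if n = 0 then f k else deltaNum L f n 0 k / deltaPoly 𝔮 L a f n 0 k

theorem IsPeriodic.sum_fib {f : (Fin 4 → ℂ) → ℂ} (hf : IsPeriodic f) (s : Fin 4 → ℕ)
    [∀ μ, NeZero (s μ)] : IsPeriodic fun k => ∑ l, f (fib s k l) := by
  refine IsPeriodic.of_int fun k z => ?_
  simp only [hf.fib_add]
  exact Equiv.sum_comp (Equiv.addRight (fun μ => (z μ : ZMod (s μ)))) fun l => f (fib s k l)

theorem IsPeriodic.prod_fib {f : (Fin 4 → ℂ) → ℂ} (hf : IsPeriodic f) (s : Fin 4 → ℕ)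
    [∀ μ, NeZero (s μ)] : IsPeriodic fun k => ∏ l, f (fib s k l) := by
  refine IsPeriodic.of_int fun k z => ?_
  simp only [hf.fib_add]
  exact Equiv.prod_comp (Equiv.addRight (fun μ => (z μ : ZMod (s μ)))) fun l => f (fib s k l)

theorem IsPeriodic.polyDen_fib {u f : (Fin 4 → ℂ) → ℂ} (hu : IsPeriodic u) (hf : IsPeriodic f)
    (s : Fin 4 → ℕ) [∀ μ, NeZero (s μ)] (ρ : ℂ) :
    IsPeriodic fun k => polyDen ρ (fun l => u (fib s k l)) (fun l => f (fib s k l)) := by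
  refine IsPeriodic.of_int fun k z => ?_
  simp only [hf.fib_add, hu.fib_add]
  exact polyDen_comp (Equiv.addRight (fun μ => (z μ : ZMod (s μ)))) ρ (fun l => u (fib s k l))
    (fun l => f (fib s k l))

section Periodic

variable {𝔮 L : ℕ} [NeZero L] {a : ℝ} {f : (Fin 4 → ℂ) → ℂ} {n : ℕ}

theorem isPeriodic_rhoSym (hL : Odd L) : IsPeriodic (rhoSym 𝔮 L a n) := by
  intro k μ
  have key : ∀ j : ℕ, (∑ l, blockSym 𝔮 (pscale (L ^ j))
      (fib (pscale (L ^ j)) (k + Pi.single μ (2 * Real.pi : ℂ)) l) ^ 2) =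
      ∑ l, blockSym 𝔮 (pscale (L ^ j)) (fib (pscale (L ^ j)) k l) ^ 2 := fun j => by
    have h := isPeriodic_blockSym 𝔮 (odd_pscale (hL.pow (n := j)))
    have h2 : IsPeriodic fun k => blockSym 𝔮 (pscale (L ^ j)) k ^ 2 := fun k μ => by
      simp only [h k μ]
    exact h2.sum_fib _ k μ
  unfold rhoSym
  simp only [key]

theorem fibSym_eq (S : ℕ) (f : (Fin 4 → ℂ) → ℂ) (t : ℝ) (k : Fin 4 → ℂ) : fibSym S f t k =
    fun l => (fun θ => (S : ℂ) ^ 2 * (f θ + t)) (fib (pscale S) k l) := rfl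

theorem isPeriodic_deltaNum (hf : IsPeriodic f) (t : ℝ) : IsPeriodic (deltaNum L f n t) := by
  have h : IsPeriodic fun θ => ((L ^ n : ℕ) : ℂ) ^ 2 * (f θ + t) := fun k μ => by
    simp only [hf k μ]
  exact h.prod_fib _

theorem isPeriodic_deltaPoly (hL : Odd L) (hf : IsPeriodic f) (t : ℝ) :
    IsPeriodic (deltaPoly 𝔮 L a f n t) := by
  intro k μ
  have h : IsPeriodic fun θ => ((L ^ n : ℕ) : ℂ) ^ 2 * (f θ + t) := fun k μ => by
    simp only [hf k μ]
  have h1 := isPeriodic_blockSym 𝔮 (odd_pscale (hL.pow (n := n)))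
  unfold deltaPoly
  rw [isPeriodic_rhoSym hL, fibSym_eq, fibSym_eq]
  exact h1.polyDen_fib h _ _ k μ

theorem isPeriodic_deltaSym (hL : Odd L) (hf : IsPeriodic f) :
    IsPeriodic (deltaSym 𝔮 L a f n) := by
  intro k μ
  unfold deltaSym
  rw [hf, isPeriodic_deltaNum hf, isPeriodic_deltaPoly hL hf]

theorem differentiable_prod {ι : Type*} {s : Finset ι} {g : ι → (Fin 4 → ℂ) → ℂ}
    (hg : ∀ i ∈ s, Differentiable ℂ (g i)) : Differentiable ℂ fun k => ∏ i ∈ s, g i k := by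
  classical
  induction s using Finset.induction_on with
  | empty => simp
  | insert i s hi ih =>
    simp only [Finset.prod_insert hi]
    exact (hg i (Finset.mem_insert_self i s)).mul
      (ih fun j hj => hg j (Finset.mem_insert_of_mem hj))

theorem differentiable_avg (R : ℕ) : Differentiable ℂ (avg R) := by
  unfold avg; fun_prop

theorem differentiable_fib (s : Fin 4 → ℕ) (l : ∀ μ, ZMod (s μ)) :
    Differentiable ℂ fun K => fib s K l := by
  unfold fib; fun_prop

theorem differentiable_blockSym (𝔮 : ℕ) (s : Fin 4 → ℕ) : Differentiable ℂ (blockSym 𝔮 s) := by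
  unfold blockSym
  refine differentiable_prod fun μ _ => ?_
  have h : Differentiable ℂ fun θ : Fin 4 → ℂ => avg (s μ) (θ μ) :=
    (differentiable_avg (s μ)).comp (by fun_prop)
  exact h.pow 𝔮

theorem differentiable_fibSym {S : ℕ} (hf : Differentiable ℂ f) (t : ℝ)
    (l : ∀ μ, ZMod (pscale S μ)) : Differentiable ℂ fun k => fibSym S f t k l :=
  ((hf.comp (differentiable_fib _ l)).add_const _).const_mul _

theorem differentiable_rhoSym : Differentiable ℂ (rhoSym 𝔮 L a n) := by
  unfold rhoSym
  refine Differentiable.const_mul (Differentiable.const_add _ ?_) _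
  refine Differentiable.fun_sum fun j _ => Differentiable.const_mul ?_ _
  exact Differentiable.fun_sum fun l _ =>
    ((differentiable_blockSym 𝔮 _).comp (differentiable_fib _ l)).pow 2

theorem differentiable_deltaNum (hf : Differentiable ℂ f) (t : ℝ) :
    Differentiable ℂ (deltaNum L f n t) := by
  unfold deltaNum
  exact differentiable_prod fun l _ => differentiable_fibSym hf t l

theorem differentiable_deltaPoly (hf : Differentiable ℂ f) (t : ℝ) :
    Differentiable ℂ (deltaPoly 𝔮 L a f n t) := by
  unfold deltaPoly polyDen
  refine (differentiable_rhoSym.mul (differentiable_prod fun l _ =>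
    differentiable_fibSym hf t l)).add (Differentiable.fun_sum fun l _ => ?_)
  exact (((differentiable_blockSym 𝔮 _).comp (differentiable_fib _ l)).pow 2).mul
    (differentiable_prod fun l _ => differentiable_fibSym hf t l)

end Periodic

/-! ### Bounds for the symbol of `𝔔_n⁻¹` -/

theorem sum_inv_pow_le {L : ℕ} (hL : 2 ≤ L) (n : ℕ) :
    ∑ j ∈ Finset.Icc 1 (n - 1), ((L : ℝ) ^ (2 * j))⁻¹ ≤ 1 := by
  have h1 : ∀ N : ℕ, ∑ j ∈ Finset.Icc 1 N, ((L : ℝ) ^ (2 * j))⁻¹ ≤ 1 - (1 / 2) ^ N := by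
    intro N
    induction N with
    | zero => simp
    | succ N ih =>
      rw [Finset.sum_Icc_succ_top (by omega)]
      have hL' : (2 : ℝ) ≤ L := by exact_mod_cast hL
      have h2 : ((L : ℝ) ^ (2 * (N + 1)))⁻¹ ≤ (1 / 2) ^ (N + 1) := by
        rw [one_div, inv_pow]
        apply inv_anti₀ (by positivity)
        calc (2 : ℝ) ^ (N + 1) ≤ 2 ^ (2 * (N + 1)) := pow_le_pow_right₀ one_le_two (by omega)
          _ ≤ _ := by gcongr
      rw [pow_succ] at h2 ⊢
      linarith
  have := h1 (n - 1)
  have h3 : (0 : ℝ) ≤ (1 / 2) ^ (n - 1) := by positivity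
  linarith

section Rho

variable {𝔮 L : ℕ} [NeZero L] {a : ℝ} {n : ℕ}

theorem rhoSym_eq_ofReal (K : Fin 4 → ℝ) : rhoSym 𝔮 L a n (toC K) =
    ((a⁻¹ * (1 + ∑ j ∈ Finset.Icc 1 (n - 1), ((L : ℝ) ^ (2 * j))⁻¹ *
      ∑ l, ‖blockSym 𝔮 (pscale (L ^ j)) (fib (pscale (L ^ j)) (toC K) l)‖ ^ 2) : ℝ) : ℂ) := by
  unfold rhoSym
  push_cast
  congr 2
  refine Finset.sum_congr rfl fun j _ => ?_
  congr 1
  refine Finset.sum_congr rfl fun l _ => ?_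
  have h := blockSym_fib_im (𝔮 := 𝔮) (s := pscale (L ^ j)) K l
  set w := blockSym 𝔮 (pscale (L ^ j)) (fib (pscale (L ^ j)) (toC K) l)
  have h1 : w = (w.re : ℂ) := Complex.ext (by simp) (by simpa using h)
  rw [h1, Complex.norm_real, Real.norm_eq_abs, ← Complex.ofReal_pow, ← Complex.ofReal_pow, sq_abs]

/-- At a real momentum each inner sum lies in [0, 1] by Parseval, and the weights L^{-2j} with j ≥ 1
sum to at most 1 when L ≥ 2. -/
theorem rhoSym_bounds (ha : 0 < a) (hL : 2 ≤ L) (h𝔮 : 1 ≤ 𝔮) (K : Fin 4 → ℝ) :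
    a⁻¹ ≤ (rhoSym 𝔮 L a n (toC K)).re ∧ ‖rhoSym 𝔮 L a n (toC K)‖ ≤ 2 * a⁻¹ := by
  have h0 : 0 ≤ ∑ j ∈ Finset.Icc 1 (n - 1), ((L : ℝ) ^ (2 * j))⁻¹ *
      ∑ l, ‖blockSym 𝔮 (pscale (L ^ j)) (fib (pscale (L ^ j)) (toC K) l)‖ ^ 2 := by positivity
  have h1 : ∑ j ∈ Finset.Icc 1 (n - 1), ((L : ℝ) ^ (2 * j))⁻¹ *
      ∑ l, ‖blockSym 𝔮 (pscale (L ^ j)) (fib (pscale (L ^ j)) (toC K) l)‖ ^ 2 ≤ 1 := by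
    refine le_trans (Finset.sum_le_sum fun j _ => ?_) (sum_inv_pow_le hL n)
    exact mul_le_of_le_one_right (by positivity) (sum_norm_sq_blockSym_le h𝔮 K)
  have ha' : 0 < a⁻¹ := inv_pos.2 ha
  rw [rhoSym_eq_ofReal, Complex.ofReal_re, Complex.norm_real, Real.norm_eq_abs,
    abs_of_nonneg (by positivity)]
  constructor <;> nlinarith

theorem rhoSym_sub_le (ha : 0 < a) (hL : 2 ≤ L) (h𝔮 : 1 ≤ 𝔮) (K : Fin 4 → ℝ) (μ : Fin 4) {η : ℝ}
    (hη : (𝔮 * 2 ^ 𝔮) * |η| ≤ 1) (hη1 : |η| ≤ 1) :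
    ‖rhoSym 𝔮 L a n (shift K μ η) - rhoSym 𝔮 L a n (toC K)‖ ≤
      a⁻¹ * (3 * (𝔮 * 2 ^ 𝔮)) * |η| := by
  have ha' : 0 < a⁻¹ := inv_pos.2 ha
  unfold rhoSym
  rw [← mul_sub, add_sub_add_left_eq_sub, norm_mul, norm_inv, Complex.norm_real, Real.norm_eq_abs,
    abs_of_pos ha, ← Finset.sum_sub_distrib, mul_assoc a⁻¹]
  gcongr
  refine (norm_sum_le _ _).trans ?_
  have h1 : ∀ j ∈ Finset.Icc 1 (n - 1), ‖((L : ℂ) ^ (2 * j))⁻¹ *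
      ∑ l, blockSym 𝔮 (pscale (L ^ j)) (fib (pscale (L ^ j)) (shift K μ η) l) ^ 2 -
      ((L : ℂ) ^ (2 * j))⁻¹ *
      ∑ l, blockSym 𝔮 (pscale (L ^ j)) (fib (pscale (L ^ j)) (toC K) l) ^ 2‖ ≤
      ((L : ℝ) ^ (2 * j))⁻¹ * (3 * (𝔮 * 2 ^ 𝔮 * |η|)) := by
    intro j _
    rw [← mul_sub, norm_mul, norm_inv, norm_pow, Complex.norm_natCast, ← Finset.sum_sub_distrib]
    gcongr
    refine (norm_sum_le _ _).trans ?_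
    exact sum_norm_sq_sub_sq_le (by positivity) hη (sum_norm_sq_blockSym_le h𝔮 K)
      (sum_norm_sq_blockSym_sub_le h𝔮 K μ hη1)
  refine (Finset.sum_le_sum h1).trans ?_
  rw [← Finset.sum_mul]
  have := sum_inv_pow_le hL n
  calc _ ≤ 1 * (3 * (𝔮 * 2 ^ 𝔮 * |η|)) := by gcongr
    _ = _ := by ring

end Rho

/-! ### The symbol of Δ^{(n)} is of parabolic type, uniformly in n and L -/

theorem ParabolicSymbol.mono {c C m₀ c' C' m₀' κ : ℝ} {f : (Fin 4 → ℂ) → ℂ}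
    (hf : ParabolicSymbol c C m₀ κ f) (hκ : 0 ≤ κ) (hc : c' ≤ c) (hC : C ≤ C') (hm : m₀' ≤ m₀) :
    ParabolicSymbol c' C' m₀' κ f where
  re_nonneg := hf.re_nonneg
  lower θ hθ := (mul_le_mul_of_nonneg_right hc (parab_nonneg θ)).trans (hf.lower θ hθ)
  upper θ hθ := (hf.upper θ hθ).trans (mul_le_mul_of_nonneg_right hC (parab_nonneg θ))
  sub_le θ hθ μ m η hm0 hm1 hη := (hf.sub_le θ hθ μ m η hm0 (hm1.trans hm) hη).trans (by
    have := parab_nonneg θ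
    gcongr)
  diff θ μ η hη := hf.diff θ μ η (hη.trans (mul_le_mul_of_nonneg_right hm (width_nonneg hκ μ)))
  per := hf.per

theorem parab_le_of_cell {K : Fin 4 → ℝ} (hK : ∀ μ, |K μ| ≤ Real.pi) : parab K ≤ 52 := by
  have hpi := Real.pi_le_four
  unfold parab
  have h1 : ∀ ν : Fin 3, K ν.succ ^ 2 ≤ 4 ^ 2 := fun ν => by
    rw [← sq_abs]
    have := (hK ν.succ).trans hpi
    gcongr
  have h2 : ∑ ν : Fin 3, K ν.succ ^ 2 ≤ ∑ _ν : Fin 3, (4 : ℝ) ^ 2 :=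
    Finset.sum_le_sum fun ν _ => h1 ν
  simp only [Finset.sum_const, Finset.card_univ, Fintype.card_fin, nsmul_eq_mul] at h2
  have := (hK 0).trans hpi
  norm_num at h2
  linarith

theorem ParabolicSymbol.fibSym_zero_le {c C m₀ κ : ℝ} {f : (Fin 4 → ℂ) → ℂ} {S : ℕ} [NeZero S]
    (hf : ParabolicSymbol c C m₀ κ f) (hS : Odd S) {K : Fin 4 → ℝ} (hK : ∀ μ, |K μ| ≤ Real.pi) :
    ‖fibSym S f 0 (toC K) 0‖ ≤ C * parab K := by
  unfold fibSym
  rw [IsPeriodic.fib_toC hf.per, norm_mul, norm_pow, Complex.norm_natCast, Complex.ofReal_zero,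
    add_zero]
  have h1 := hf.upper _ (abs_cfib_le (odd_pscale hS) hK 0)
  rw [← parab_div_pscale (NeZero.ne S)]
  calc _ ≤ (S : ℝ) ^ 2 * (C * parab (cfib (pscale S) K 0)) := by gcongr
    _ = _ := by unfold cfib; simp; ring

theorem ParabolicSymbol.le_fibSym_zero {c C m₀ κ : ℝ} {f : (Fin 4 → ℂ) → ℂ} {S : ℕ} [NeZero S]
    (hf : ParabolicSymbol c C m₀ κ f) (hS : Odd S) {K : Fin 4 → ℝ} (hK : ∀ μ, |K μ| ≤ Real.pi)
    {lam : ℝ} (hl : 0 ≤ lam) : c * parab K ≤ ‖fibSym S f lam (toC K) 0‖ := by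
  have := hf.le_fibSym hS hK hl 0
  simpa using this

theorem ParabolicSymbol.fibSym_zero_sub_le {c C m₀ κ : ℝ} {f : (Fin 4 → ℂ) → ℂ} {S : ℕ} [NeZero S]
    (hf : ParabolicSymbol c C m₀ (κ / (S : ℝ) ^ 2) f) (hS : Odd S)
    {K : Fin 4 → ℝ} (hK : ∀ μ, |K μ| ≤ Real.pi) (lam : ℝ)
    (μ : Fin 4) {m η : ℝ} (hm : 0 ≤ m) (hm₀ : m ≤ m₀) (hη : |η| ≤ m * width κ μ) :
    ‖fibSym S f lam (shift K μ η) 0 - fibSym S f lam (toC K) 0‖ ≤ C * m * (parab K + κ) := by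
  have := hf.fibSym_sub_le hS hK lam 0 μ hm hm₀ hη
  simpa using this

/-- The quotient `d_o / Z` of a rank one perturbation has nonnegative real part. -/
theorem FiberData.div_re_nonneg {ι : Type} [Fintype ι] [DecidableEq ι] {r B c δ : ℝ} {o : ι}
    {ρ ρ' : ℂ} {v v' d d' : ι → ℂ} (h : FiberData r B c δ o ρ ρ' v v' d d') (hr : 0 ≤ r) :
    0 ≤ (d o / fiberZ o ρ v d).re := by
  by_cases hd : d o = 0
  · simp [hd]
  have h1 : d o / fiberZ o ρ v d = (v o ^ 2 / d o + fiberX o ρ v d)⁻¹ := by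
    have h2 : v o ^ 2 / d o + fiberX o ρ v d = fiberZ o ρ v d / d o := by
      unfold fiberZ; field_simp
    rw [h2, inv_div]
  rw [h1, Complex.inv_re]
  refine div_nonneg ?_ (Complex.normSq_nonneg _)
  rw [Complex.add_re]
  have := h.le_X_re
  have := FiberData.re_sq_div h.v_im h.d_re o
  linarith

theorem norm_div_sub_div_le {x x' z z' : ℂ} {A P : ℝ} (hz : z ≠ 0) (hz' : z' ≠ 0)
    (h1 : ‖x' - x‖ / ‖z'‖ ≤ A) (h2 : ‖x‖ * ‖z' - z‖ / (‖z‖ * ‖z'‖) ≤ P) :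
    ‖x' / z' - x / z‖ ≤ A + P := by
  have e : x' / z' - x / z = (x' - x) / z' - x * (z' - z) / (z * z') := by
    field_simp; ring
  rw [e]
  refine (norm_sub_le _ _).trans (add_le_add ?_ ?_)
  · rw [norm_div]; exact h1
  · rw [norm_div, norm_mul, norm_mul]; exact h2

theorem shift_add_int {K K' : Fin 4 → ℝ} {z : Fin 4 → ℤ}
    (h : ∀ μ, K μ = K' μ + 2 * Real.pi * z μ) (μ : Fin 4) (η : ℝ) :
    shift K μ η = shift K' μ η + fun ν => (2 * Real.pi * z ν : ℂ) := by
  ext ν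
  by_cases hν : ν = μ
  · subst hν
    rw [Pi.add_apply, shift_self, shift_self, h ν]
    push_cast; ring
  · rw [Pi.add_apply, shift_of_ne _ hν, shift_of_ne _ hν, h ν]
    push_cast; ring

theorem update_toC_eq_shift (θ : Fin 4 → ℝ) (μ : Fin 4) (η : ℝ) :
    Function.update (toC θ) μ (θ μ + η * Complex.I) = shift θ μ η := rfl

theorem differentiableAt_deltaSym {𝔮 L : ℕ} [NeZero L] {a : ℝ} {f : (Fin 4 → ℂ) → ℂ} {n : ℕ}
    (hn : n ≠ 0) (hf : Differentiable ℂ f) {k : Fin 4 → ℂ} (hk : deltaPoly 𝔮 L a f n 0 k ≠ 0) :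
    DifferentiableAt ℂ (deltaSym 𝔮 L a f n) k := by
  have h : deltaSym 𝔮 L a f n = fun k => deltaNum L f n 0 k / deltaPoly 𝔮 L a f n 0 k := by
    ext k; unfold deltaSym; rw [if_neg hn]
  rw [h]
  simp only [div_eq_mul_inv]
  exact ((differentiable_deltaNum hf 0) k).mul (((differentiable_deltaPoly hf 0) k).fun_inv hk)

-- For n ≥ 1 the symbol is d_0/Z, where d_0 is the rescaled symbol of `D_0` and hence of size `parab
-- K`, while |Z| lies between multiples of 1 + |d_0|; on the cell `parab` is bounded, so the
-- quotient is again of size `parab K`. The changes of d_0 and Z under an imaginary shift are both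
-- controlled by `exists_fiber_bounds` data, independent of n and L.
set_option maxHeartbeats 1000000 in
theorem exists_parabolicSymbol_deltaSym {𝔮 : ℕ} {a c C : ℝ} (h𝔮 : 1 ≤ 𝔮) (ha : 0 < a) (hc : 0 < c)
    (hC : 0 < C) : ∃ c' C' m' : ℝ, 0 < c' ∧ 0 < C' ∧ 0 < m' ∧ ∀ f : (Fin 4 → ℂ) → ℂ,
      Differentiable ℂ f → (∀ κ : ℝ, 0 < κ → κ ≤ 1 → ParabolicSymbol c C 1 κ f) →
      ∀ (L : ℕ) [NeZero L], Odd L → 2 ≤ L → ∀ n : ℕ,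
        ParabolicSymbol c' C' m' ((L : ℝ) ^ 2)⁻¹ (deltaSym 𝔮 L a f n) ∧
        (1 ≤ n → ∀ K : Fin 4 → ℝ, deltaPoly 𝔮 L a f n 0 (toC K) ≠ 0) := by
  have ha' : 0 < a⁻¹ := inv_pos.2 ha
  set q : ℝ := 𝔮 * 2 ^ 𝔮 with hq
  have hq0 : 1 ≤ q := by
    have h1 : (1 : ℝ) ≤ 𝔮 := by exact_mod_cast h𝔮
    have h2 : (1 : ℝ) ≤ 2 ^ 𝔮 := one_le_pow₀ one_le_two
    nlinarith
  have hcc : 0 < min ((1 / 2 : ℝ) ^ (4 * 𝔮)) c := by positivity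
  obtain ⟨c₂, C₂, δ₀, hc₂, hC₂, hδ₀, hδh, key⟩ :=
    exists_fiber_bounds (r := a⁻¹) (B := 2 * a⁻¹) ha' (by positivity) hcc
  set M := a⁻¹ * (3 * q) with hM
  set T := M + q + C + 2 * C / c with hT
  have hM0 : 0 < M := by positivity
  have hT0 : 0 < T := by positivity
  -- The bound 1/q is what `rhoSym_sub_le` requires, and δ₀/T makes δ = Tm admissible for
  -- `exists_fiber_bounds`.
  set m' := min (1 / q) (δ₀ / T) with hm'
  have hm'0 : 0 < m' := by positivity
  have hm'1 : m' ≤ 1 := (min_le_left _ _).trans (by rw [div_le_one (by linarith)]; exact hq0)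
  -- From |Z| ≤ 1 + C₂|d_0|, `parab` ≤ |d_0|/c and `parab` ≤ 52 on the cell.
  set c' := min c (1 / (1 / c + 52 * C₂)) with hc'
  set C' := C + C / c₂ + (C / c₂ + C * (C₂ * T) / c₂ ^ 2) with hC'
  have hc'0 : 0 < c' := by positivity
  have hC'0 : 0 < C' := by positivity
  refine ⟨c', C', m', hc'0, hC'0, hm'0, fun f hfd hf L _ hL hL2 n => ?_⟩
  have hL0 : (2 : ℝ) ≤ L := by exact_mod_cast hL2
  set κ := ((L : ℝ) ^ 2)⁻¹ with hκ
  have hκ0 : 0 < κ := by positivity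
  have hκ1 : κ ≤ 1 := inv_le_one_of_one_le₀ (by nlinarith)
  rcases Nat.eq_zero_or_pos n with rfl | hn
  · refine ⟨?_, fun h => absurd h (by omega)⟩
    have h1 : deltaSym 𝔮 L a f 0 = f := by ext k; simp [deltaSym]
    rw [h1]
    refine (hf κ hκ0 hκ1).mono hκ0.le (min_le_left _ _) ?_ hm'1
    have : 0 ≤ C / c₂ + (C / c₂ + C * (C₂ * T) / c₂ ^ 2) := by positivity
    rw [hC']; linarith
  have hS : Odd (L ^ n) := hL.pow
  have hSκ : κ / ((L ^ n : ℕ) : ℝ) ^ 2 ≤ 1 := by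
    rw [div_le_one (by positivity)]
    refine hκ1.trans (one_le_pow₀ ?_)
    exact_mod_cast Nat.one_le_pow n L (by omega)
  -- The thin strip in the fine momenta which becomes a strip of parameter κ = L⁻² in the momenta of
  -- the unit lattice.
  have hfS := hf (κ / ((L ^ n : ℕ) : ℝ) ^ 2) (by positivity) hSκ
  have hper : IsPeriodic f := hfS.per
  have hdn : ∀ k, deltaSym 𝔮 L a f n k = deltaNum L f n 0 k / deltaPoly 𝔮 L a f n 0 k := fun k => by
    unfold deltaSym; rw [if_neg (by omega)]
  -- the fibre data over the cell
  have data : ∀ K : Fin 4 → ℝ, (∀ μ, |K μ| ≤ Real.pi) → ∀ (μ : Fin 4) (m η : ℝ), 0 ≤ m → m ≤ m' →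
      |η| ≤ m * width κ μ → T * m ≤ δ₀ ∧
      FiberData a⁻¹ (2 * a⁻¹) (min ((1 / 2) ^ (4 * 𝔮)) c) (T * m) 0
        (rhoSym 𝔮 L a n (toC K)) (rhoSym 𝔮 L a n (shift K μ η))
        (fun l => blockSym 𝔮 (pscale (L ^ n)) (fib (pscale (L ^ n)) (toC K) l))
        (fun l => blockSym 𝔮 (pscale (L ^ n)) (fib (pscale (L ^ n)) (shift K μ η) l))
        (fibSym (L ^ n) f 0 (toC K)) (fibSym (L ^ n) f 0 (shift K μ η)) := by
    intro K hK μ m η hm0 hm1 hη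
    have hηm : |η| ≤ m := hη.trans (mul_le_of_le_one_right hm0 (width_le_one hκ1 μ))
    have hmq : q * m ≤ 1 := by
      have := hm1.trans (min_le_left _ _)
      rw [le_div_iff₀ (by linarith)] at this
      linarith
    have hρ := rhoSym_bounds (n := n) ha hL2 h𝔮 K
    have hρs := rhoSym_sub_le (n := n) ha hL2 h𝔮 K μ (η := η)
      ((by gcongr : q * |η| ≤ q * m).trans hmq) (hηm.trans (hm1.trans hm'1))
    constructor
    · have := hm1.trans (min_le_right _ _)
      rw [le_div_iff₀ hT0] at this
      linarith
    · refine hfS.fiberData h𝔮 hc hC hκ1 hS hK le_rfl μ hm0 (hm1.trans hm'1) (hm1.trans hm'1) hη hρ.1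
        hρ.2 (hρs.trans ?_) hM0.le
      rw [hM]
      gcongr
  have key2 : ∀ K : Fin 4 → ℝ, (∀ μ, |K μ| ≤ Real.pi) → ∀ (μ : Fin 4) (m η : ℝ), 0 ≤ m → m ≤ m' →
      |η| ≤ m * width κ μ → ∃ Z Z' : ℂ, deltaPoly 𝔮 L a f n 0 (shift K μ η) ≠ 0 ∧
        deltaSym 𝔮 L a f n (toC K) = fibSym (L ^ n) f 0 (toC K) 0 / Z ∧
        deltaSym 𝔮 L a f n (shift K μ η) = fibSym (L ^ n) f 0 (shift K μ η) 0 / Z' ∧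
        0 ≤ (fibSym (L ^ n) f 0 (toC K) 0 / Z).re ∧
        c₂ * (1 + ‖fibSym (L ^ n) f 0 (toC K) 0‖) ≤ ‖Z'‖ ∧
        c₂ * (1 + ‖fibSym (L ^ n) f 0 (toC K) 0‖) ≤ ‖Z‖ ∧
        ‖Z' - Z‖ ≤ C₂ * (T * m) * (1 + ‖fibSym (L ^ n) f 0 (toC K) 0‖) ∧
        ‖Z‖ ≤ 1 + C₂ * ‖fibSym (L ^ n) f 0 (toC K) 0‖ := by
    intro K hK μ m η hm0 hm1 hη
    obtain ⟨hδ, hd⟩ := data K hK μ m η hm0 hm1 hη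
    -- The zero shift: `exists_fiber_bounds` bounds X only at the shifted momentum, and this makes
    -- it a bound at the real one.
    obtain ⟨-, hd0⟩ := data K hK μ 0 0 le_rfl hm'0.le (by simp)
    obtain ⟨hX', hZ', hZ, hZZ⟩ := key _ 0 _ _ _ _ _ _ _ (by positivity) hδ hd
    rw [shift_zero] at hd0
    obtain ⟨hX, -, -, -⟩ := key _ 0 _ _ _ _ _ _ _ (by simp) (by simpa using hδ₀.le) hd0
    have hne : ∀ l, l ≠ 0 → fibSym (L ^ n) f 0 (toC K) l ≠ 0 := fun l hl =>
      norm_pos_iff.1 (hcc.trans_le (hd.d_norm l hl))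
    have hne' : ∀ l, l ≠ 0 → fibSym (L ^ n) f 0 (shift K μ η) l ≠ 0 := fun l hl => by
      refine norm_pos_iff.1 (lt_of_lt_of_le ?_ (hd.half_le_norm_d' (hδ.trans hδh) hl))
      have := hcc.trans_le (hd.d_norm l hl)
      positivity
    refine ⟨_, _, ?_, ?_, ?_, hd.div_re_nonneg ha'.le, hZ', hZ, hZZ, ?_⟩
    · refine polyDen_ne_zero hne' (norm_pos_iff.1 (lt_of_lt_of_le ?_ hZ'))
      positivity
    · rw [hdn]
      exact prod_div_polyDen_eq _ _ _ hne
    · rw [hdn]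
      exact prod_div_polyDen_eq _ _ _ hne'
    · unfold fiberZ
      refine (norm_add_le _ _).trans (add_le_add ?_ ?_)
      · rw [norm_pow]
        exact pow_le_one₀ (norm_nonneg _) (hd.norm_v_le_one 0)
      · rw [norm_mul, mul_comm]
        gcongr
  -- Periodicity extends the nonvanishing of the denominator from the cell to all real parts, as
  -- differentiability in the whole strip requires.
  have hne : ∀ (K : Fin 4 → ℝ) (μ : Fin 4) (η : ℝ), |η| ≤ m' * width κ μ →
      deltaPoly 𝔮 L a f n 0 (shift K μ η) ≠ 0 := by
    intro K μ η hη
    obtain ⟨K', z, hK', hz⟩ := exists_cell K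
    rw [shift_add_int hz, (isPeriodic_deltaPoly hL hper 0).add_int]
    obtain ⟨_, _, h, _⟩ := key2 K' hK' μ m' η hm'0.le le_rfl hη
    exact h
  refine ⟨⟨?_, ?_, ?_, ?_, ?_, isPeriodic_deltaSym hL hper⟩, fun _ K => ?_⟩
  · intro K hK
    obtain ⟨Z, Z', -, h1, -, h2, -⟩ := key2 K hK 0 0 0 le_rfl hm'0.le (by simp)
    rw [h1]; exact h2
  · intro K hK
    obtain ⟨Z, Z', -, h1, -, -, -, hZ, -, hZu⟩ := key2 K hK 0 0 0 le_rfl hm'0.le (by simp)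
    have hlow := hfS.le_fibSym_zero hS hK (lam := 0) le_rfl
    have hP := parab_nonneg K
    have hP2 := parab_le_of_cell hK
    rw [h1, norm_div]
    set x := ‖fibSym (L ^ n) f 0 (toC K) 0‖
    have hx : 0 ≤ x := norm_nonneg _
    have hZpos : 0 < ‖Z‖ := lt_of_lt_of_le (by positivity) hZ
    rw [le_div_iff₀ hZpos]
    have h3 : c' * (1 / c + 52 * C₂) ≤ 1 := by
      have := min_le_right c (1 / (1 / c + 52 * C₂))
      rw [← hc', le_div_iff₀ (by positivity)] at this
      exact this
    have h4 : parab K ≤ x / c := by rw [le_div_iff₀ hc]; linarith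
    calc c' * parab K * ‖Z‖ ≤ c' * parab K * (1 + C₂ * x) := by gcongr
      _ = c' * (parab K + parab K * (C₂ * x)) := by ring
      _ ≤ c' * (x / c + 52 * (C₂ * x)) := by gcongr
      _ = c' * (1 / c + 52 * C₂) * x := by ring
      _ ≤ 1 * x := by gcongr
      _ = x := one_mul x
  · intro K hK
    obtain ⟨Z, Z', -, h1, -, -, -, hZ, -⟩ := key2 K hK 0 0 0 le_rfl hm'0.le (by simp)
    have hup := hfS.fibSym_zero_le hS hK
    have hP := parab_nonneg K
    rw [h1, norm_div]
    set x := ‖fibSym (L ^ n) f 0 (toC K) 0‖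
    have hx : 0 ≤ x := norm_nonneg _
    have h2 : c₂ ≤ ‖Z‖ := le_trans (by nlinarith) hZ
    calc x / ‖Z‖ ≤ (C * parab K) / c₂ := by gcongr
      _ = C / c₂ * parab K := by ring
      _ ≤ C' * parab K := by
        have : 0 ≤ C / c₂ + C * (C₂ * T) / c₂ ^ 2 := by positivity
        gcongr
        rw [hC']
        linarith
  · intro K hK μ m η hm0 hm1 hη
    obtain ⟨Z, Z', -, h1, h1', -, hZ', hZ, hZZ, -⟩ := key2 K hK μ m η hm0 hm1 hη
    have hup := hfS.fibSym_zero_le hS hK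
    have hsub := hfS.fibSym_zero_sub_le hS hK 0 μ hm0 (hm1.trans hm'1) hη
    have hP := parab_nonneg K
    rw [h1, h1']
    set x := fibSym (L ^ n) f 0 (toC K) 0
    have hx : 0 ≤ ‖x‖ := norm_nonneg _
    have hc1 : c₂ ≤ c₂ * (1 + ‖x‖) := by nlinarith
    have hZ0 : 0 < ‖Z‖ := hc₂.trans_le (hc1.trans hZ)
    have hZ0' : 0 < ‖Z'‖ := hc₂.trans_le (hc1.trans hZ')
    refine (norm_div_sub_div_le (A := C / c₂ * m * (parab K + κ))
      (P := C * (C₂ * T) / c₂ ^ 2 * m * (parab K + κ)) (norm_pos_iff.1 hZ0) (norm_pos_iff.1 hZ0')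
      ?_ ?_).trans ?_
    · rw [div_le_iff₀ hZ0']
      calc _ ≤ C * m * (parab K + κ) := hsub
        _ = C / c₂ * m * (parab K + κ) * c₂ := by field_simp
        _ ≤ _ := by
          gcongr
          exact hc1.trans hZ'
    · rw [div_le_iff₀ (by positivity)]
      calc ‖x‖ * ‖Z' - Z‖ ≤ (C * parab K) * (C₂ * (T * m) * (1 + ‖x‖)) := by gcongr
        _ = C * (C₂ * T) / c₂ ^ 2 * m * parab K * (c₂ * (c₂ * (1 + ‖x‖))) := by field_simp
        _ ≤ C * (C₂ * T) / c₂ ^ 2 * m * (parab K + κ) * (‖Z‖ * ‖Z'‖) := by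
          gcongr
          · linarith
          · exact hc1.trans hZ
    · rw [← add_mul, ← add_mul]
      gcongr
      rw [hC']
      have : 0 ≤ C + C / c₂ := by positivity
      linarith
  · intro θ μ η hη
    have h1 : DifferentiableAt ℂ (fun z : ℂ => Function.update (toC θ) μ z)
        (θ μ + η * Complex.I) := (hasFDerivAt_update (toC θ) _).differentiableAt
    have h2 : DifferentiableAt ℂ (deltaSym 𝔮 L a f n)
        (Function.update (toC θ) μ (θ μ + η * Complex.I)) :=
      differentiableAt_deltaSym (by omega) hfd (hne θ μ η hη)
    exact DifferentiableAt.comp (θ μ + η * Complex.I : ℂ) h2 h1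
  · rw [← shift_zero K 0]
    exact hne K 0 0 (by simpa using mul_nonneg hm'0.le (width_nonneg hκ0.le 0))

/-! ### The inverse of a rank one perturbation of a diagonal matrix -/

section

variable {ι : Type} [Fintype ι] [DecidableEq ι]

/-- The inverse of `diag d + ρ⁻¹ v vᵀ`. -/
def rankOneInv (o : ι) (ρ : ℂ) (v d : ι → ℂ) : Matrix ι ι ℂ := fun i j =>
  if j = o then if i = o then fiberX o ρ v d / fiberZ o ρ v d else
    -(v o * v i / (d i * fiberZ o ρ v d))
  else if i = o then -(v o * v j / (d j * fiberZ o ρ v d)) else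
    (if i = j then (d j)⁻¹ else 0) - v i * v j * d o / (d i * d j * fiberZ o ρ v d)

/-- The pairing of v with a column of the proposed inverse; the terms containing X cancel and leave
ρ/Z, so that multiplication by the rank one part becomes explicit. -/
theorem sum_mul_rankOneInv (o : ι) {ρ : ℂ} (v : ι → ℂ) {d : ι → ℂ}
    (hd : ∀ i, i ≠ o → d i ≠ 0) (hZ : fiberZ o ρ v d ≠ 0) (j : ι) :
    ∑ i, v i * rankOneInv o ρ v d i j = if j = o then v o * ρ / fiberZ o ρ v d else
      v j * d o * ρ / (d j * fiberZ o ρ v d) := by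
  have hX : ∑ i ∈ Finset.univ.erase o, v i ^ 2 / d i = fiberX o ρ v d - ρ := by
    unfold fiberX; ring
  rw [← Finset.add_sum_erase _ _ (Finset.mem_univ o)]
  by_cases hj : j = o
  · subst hj
    simp only [rankOneInv, if_true]
    have h1 : ∑ i ∈ Finset.univ.erase j, v i * (if i = j then fiberX j ρ v d / fiberZ j ρ v d else
        -(v j * v i / (d i * fiberZ j ρ v d))) =
        -(v j / fiberZ j ρ v d) * ∑ i ∈ Finset.univ.erase j, v i ^ 2 / d i := by
      rw [Finset.mul_sum]
      refine Finset.sum_congr rfl fun i hi => ?_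
      have hi' := Finset.ne_of_mem_erase hi
      have := hd i hi'
      rw [if_neg hi']
      field_simp
    rw [h1, hX]
    field_simp
    ring
  · simp only [rankOneInv, if_neg hj, if_true]
    have hdj := hd j hj
    have h1 : ∑ i ∈ Finset.univ.erase o, v i * (if i = o then -(v o * v j / (d j * fiberZ o ρ v d))
        else (if i = j then (d j)⁻¹ else 0) - v i * v j * d o / (d i * d j * fiberZ o ρ v d)) =
        v j * (d j)⁻¹ - v j * d o / (d j * fiberZ o ρ v d) *
          ∑ i ∈ Finset.univ.erase o, v i ^ 2 / d i := by
      have h2 : v j * (d j)⁻¹ = ∑ i ∈ Finset.univ.erase o, v i * (if i = j then (d j)⁻¹ else 0) := by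
        simp [hj]
      rw [Finset.mul_sum, h2, ← Finset.sum_sub_distrib]
      refine Finset.sum_congr rfl fun i hi => ?_
      have hi' := Finset.ne_of_mem_erase hi
      have := hd i hi'
      rw [if_neg hi', mul_sub]
      congr 1
      field_simp
    rw [h1, hX]
    have hZ2 : v o ^ 2 = fiberZ o ρ v d - d o * fiberX o ρ v d := by unfold fiberZ; ring
    field_simp
    linear_combination -(v j) * hZ2

/-- Sherman–Morrison with the index `o` singled out: d_o is multiplied through, so that it never
stands in a denominator and the formula holds even if d_o = 0. -/
theorem mul_rankOneInv (o : ι) {ρ : ℂ} (hρ : ρ ≠ 0) (v : ι → ℂ) {d : ι → ℂ}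
    (hd : ∀ i, i ≠ o → d i ≠ 0) (hZ : fiberZ o ρ v d ≠ 0) :
    (Matrix.diagonal d + ρ⁻¹ • Matrix.vecMulVec v v) * rankOneInv o ρ v d = 1 := by
  ext i j
  rw [add_mul, Matrix.add_apply, Matrix.diagonal_mul, Matrix.smul_mul, Matrix.smul_apply,
    Matrix.mul_apply]
  have h1 : ∑ k, Matrix.vecMulVec v v i k * rankOneInv o ρ v d k j =
      v i * ∑ k, v k * rankOneInv o ρ v d k j := by
    rw [Finset.mul_sum]
    refine Finset.sum_congr rfl fun k _ => ?_
    rw [Matrix.vecMulVec_apply]; ring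
  rw [h1, sum_mul_rankOneInv o v hd hZ, smul_eq_mul, Matrix.one_apply]
  by_cases hj : j = o
  · subst hj
    by_cases hi : i = j
    · subst hi
      simp only [rankOneInv, if_true]
      field_simp
      unfold fiberZ; ring
    · have := hd i hi
      simp only [rankOneInv, if_true, if_neg hi]
      field_simp
      ring
  · have hdj := hd j hj
    by_cases hi : i = o
    · subst hi
      simp only [rankOneInv, if_true, if_neg hj, if_neg (Ne.symm hj)]
      field_simp
      ring
    · have hdi := hd i hi
      simp only [rankOneInv, if_neg hj, if_neg hi]
      by_cases hij : i = j
      · subst hij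
        simp only [if_true]
        field_simp
        ring
      · simp only [if_neg hij]
        field_simp
        ring

/-- Each entry off the row `o` carries a factor v_i, so the ℓ¹ bound on v sums the columns uniformly
in the size of the fibre. Since d_o occurs only as d_o/Z, it needs an upper bound relative to Z but
no lower bound. -/
theorem sum_norm_rankOneInv_le (o : ι) {ρ : ℂ} {v d : ι → ℂ} {V e z y C : ℝ} (hV : 0 ≤ V)
    (hv : ∀ i, ‖v i‖ ≤ V) (hvs : ∑ i, ‖v i‖ ≤ V) (he : 0 < e) (hd : ∀ i, i ≠ o → e ≤ ‖d i‖)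
    (hz : 0 < z) (hZ : z ≤ ‖fiberZ o ρ v d‖) (hy : ‖d o‖ ≤ y * ‖fiberZ o ρ v d‖) (hy0 : 0 ≤ y)
    (hX : ‖fiberX o ρ v d‖ ≤ C) (j : ι) :
    ∑ i, ‖rankOneInv o ρ v d i j‖ ≤ C / z + V ^ 2 / (e * z) + 1 / e + V ^ 2 * y / e ^ 2 := by
  have hC : 0 ≤ C := (norm_nonneg _).trans hX
  have hZ0 : 0 < ‖fiberZ o ρ v d‖ := hz.trans_le hZ
  set Z := fiberZ o ρ v d with hZdef
  have hsub : ∑ i ∈ Finset.univ.erase o, ‖v i‖ ≤ V :=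
    (Finset.sum_le_sum_of_subset_of_nonneg (Finset.erase_subset _ _)
      fun i _ _ => norm_nonneg _).trans hvs
  rw [← Finset.add_sum_erase _ _ (Finset.mem_univ o)]
  have p1 : 0 ≤ C / z := by positivity
  have p2 : 0 ≤ V ^ 2 / (e * z) := by positivity
  have p3 : 0 ≤ 1 / e := by positivity
  have p4 : 0 ≤ V ^ 2 * y / e ^ 2 := by positivity
  by_cases hj : j = o
  · subst hj
    have h1 : ‖rankOneInv j ρ v d j j‖ ≤ C / z := by
      simp only [rankOneInv, if_true, ← hZdef]
      rw [norm_div]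
      gcongr
    have h2 : ∑ i ∈ Finset.univ.erase j, ‖rankOneInv j ρ v d i j‖ ≤ V ^ 2 / (e * z) := by
      calc _ ≤ ∑ i ∈ Finset.univ.erase j, V * ‖v i‖ / (e * z) := by
            refine Finset.sum_le_sum fun i hi => ?_
            have hi' := Finset.ne_of_mem_erase hi
            simp only [rankOneInv, if_true, if_neg hi', ← hZdef]
            rw [norm_neg, norm_div, norm_mul, norm_mul]
            have := hd i hi'
            have := hv j
            gcongr
        _ = V * (∑ i ∈ Finset.univ.erase j, ‖v i‖) / (e * z) := by
            rw [Finset.mul_sum, Finset.sum_div]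
        _ ≤ V * V / (e * z) := by gcongr
        _ = _ := by ring
    linarith
  · have hdj := hd j hj
    have hvj := hv j
    have h1 : ‖rankOneInv o ρ v d o j‖ ≤ V ^ 2 / (e * z) := by
      simp only [rankOneInv, if_true, if_neg hj, ← hZdef]
      rw [norm_neg, norm_div, norm_mul, norm_mul, sq]
      have := hv o
      gcongr
    have h2 : ∑ i ∈ Finset.univ.erase o, ‖rankOneInv o ρ v d i j‖ ≤ 1 / e + V ^ 2 * y / e ^ 2 := by
      calc _ ≤ ∑ i ∈ Finset.univ.erase o,
            ((if i = j then 1 / e else 0) + ‖v i‖ * (V * y / e ^ 2)) := by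
            refine Finset.sum_le_sum fun i hi => ?_
            have hi' := Finset.ne_of_mem_erase hi
            simp only [rankOneInv, if_neg hj, if_neg hi', ← hZdef]
            refine (norm_sub_le _ _).trans (add_le_add ?_ ?_)
            · split_ifs
              · rw [norm_inv, one_div]
                exact inv_anti₀ he hdj
              · simp
            · rw [norm_div, norm_mul, norm_mul, norm_mul, norm_mul]
              have := hd i hi'
              calc ‖v i‖ * ‖v j‖ * ‖d o‖ / (‖d i‖ * ‖d j‖ * ‖Z‖) ≤
                  ‖v i‖ * V * (y * ‖Z‖) / (e * e * ‖Z‖) := by gcongr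
                _ = ‖v i‖ * (V * y / e ^ 2) := by field_simp
        _ = 1 / e + (∑ i ∈ Finset.univ.erase o, ‖v i‖) * (V * y / e ^ 2) := by
            rw [Finset.sum_add_distrib, Finset.sum_mul]
            congr 1
            simp [hj]
        _ ≤ 1 / e + V * (V * y / e ^ 2) := by gcongr
        _ = _ := by ring
    linarith

theorem differentiableAt_det {M : ℂ → Matrix ι ι ℂ} {z : ℂ}
    (hM : ∀ i j, DifferentiableAt ℂ (fun z => M z i j) z) :
    DifferentiableAt ℂ (fun z => (M z).det) z := by
  simp only [Matrix.det_apply]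
  exact DifferentiableAt.fun_sum fun σ _ =>
    (DifferentiableAt.fun_finsetProd fun i _ => hM _ _).const_smul _

/-- Cramer's rule: the entries of the inverse are quotients of polynomials in the entries. -/
theorem differentiableAt_inv_apply {M : ℂ → Matrix ι ι ℂ} {z : ℂ}
    (hM : ∀ i j, DifferentiableAt ℂ (fun z => M z i j) z) (hu : IsUnit (M z)) (i j : ι) :
    DifferentiableAt ℂ (fun z => (M z)⁻¹ i j) z := by
  have h0 : (M z).det ≠ 0 := ((Matrix.isUnit_iff_isUnit_det _).1 hu).ne_zero
  simp only [Matrix.inv_def, Matrix.smul_apply, Ring.inverse_eq_inv', smul_eq_mul,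
    Matrix.adjugate_apply]
  refine ((differentiableAt_det hM).fun_inv h0).mul (differentiableAt_det fun k l => ?_)
  simp only [Matrix.updateRow_apply]
  split_ifs
  · exact differentiableAt_const _
  · exact hM _ _

end

/-! ### The fibre matrices of the inverse covariance -/

/-- The action of `(a/L²) Q^*Q + Δ + λ` on the characters over the coarse momentum `K`, if `f` is
the symbol of `Δ`. -/
def fibMat (𝔮 L : ℕ) (a : ℝ) (f : (Fin 4 → ℂ) → ℂ) (lam : ℝ) (K : Fin 4 → ℂ) :
    Matrix (∀ μ, ZMod (pscale L μ)) (∀ μ, ZMod (pscale L μ)) ℂ :=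
  Matrix.diagonal (fun l => f (fib (pscale L) K l) + lam) +
    ((a / (L : ℝ) ^ 2 : ℝ) : ℂ) • Matrix.vecMulVec
      (fun l => blockSym 𝔮 (pscale L) (fib (pscale L) K l))
      (fun l => blockSym 𝔮 (pscale L) (fib (pscale L) K l))

section

variable {𝔮 L : ℕ} [NeZero L] {a : ℝ} {f : (Fin 4 → ℂ) → ℂ}

/-- Translation of the base point permutes the fibre, so the matrix is periodic only up to a
permutation of its indices; column sums do not see it. -/
theorem fibMat_add_int (hL : Odd L) (hf : IsPeriodic f) (lam : ℝ) (K : Fin 4 → ℂ)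
    (z : Fin 4 → ℤ) :
    fibMat 𝔮 L a f lam (K + fun μ => (2 * Real.pi * z μ : ℂ)) =
      (fibMat 𝔮 L a f lam K).submatrix
        (Equiv.addRight fun μ => (z μ : ZMod (pscale L μ)))
        (Equiv.addRight fun μ => (z μ : ZMod (pscale L μ))) := by
  have h := isPeriodic_blockSym 𝔮 (odd_pscale hL)
  ext i j
  simp only [fibMat, Matrix.add_apply, Matrix.submatrix_apply, Matrix.smul_apply,
    Matrix.vecMulVec_apply, h.fib_add, Matrix.diagonal_apply, hf.fib_add, Equiv.coe_addRight,
    add_left_inj]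

/-- Multiplication by L² brings the matrix to the rank one form with ρ = 1/a and fibre symbols of
block size `L`, so that the estimates made for Δ^{(n)} apply again. -/
theorem sq_smul_fibMat (lam : ℝ) (K : Fin 4 → ℂ) :
    (L : ℂ) ^ 2 • fibMat 𝔮 L a f lam K = Matrix.diagonal (fibSym L f lam K) +
      ((a⁻¹ : ℝ) : ℂ)⁻¹ • Matrix.vecMulVec
        (fun l => blockSym 𝔮 (pscale L) (fib (pscale L) K l))
        (fun l => blockSym 𝔮 (pscale L) (fib (pscale L) K l)) := by
  have hL : (L : ℂ) ≠ 0 := Nat.cast_ne_zero.2 (NeZero.ne L)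
  unfold fibMat
  rw [smul_add, smul_smul]
  congr 1
  · rw [← Matrix.diagonal_smul]
    rfl
  · congr 1
    push_cast
    field_simp

theorem sum_norm_fibMat_le (K : Fin 4 → ℂ) {V F : ℝ} (ha : 0 < a)
    (hv : ∑ l, ‖blockSym 𝔮 (pscale L) (fib (pscale L) K l)‖ ≤ V)
    (hF : ∀ l, ‖f (fib (pscale L) K l)‖ ≤ F) (j : ∀ μ, ZMod (pscale L μ)) :
    ∑ i, ‖fibMat 𝔮 L a f 0 K i j‖ ≤ F + a * V ^ 2 := by
  have hL : (1 : ℝ) ≤ L := by exact_mod_cast Nat.one_le_iff_ne_zero.2 (NeZero.ne L)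
  have hV : 0 ≤ V := le_trans (Finset.sum_nonneg fun i _ => norm_nonneg _) hv
  have hj : ‖blockSym 𝔮 (pscale L) (fib (pscale L) K j)‖ ≤ V :=
    (Finset.single_le_sum (f := fun l => ‖blockSym 𝔮 (pscale L) (fib (pscale L) K l)‖)
      (fun _ _ => norm_nonneg _) (Finset.mem_univ j)).trans hv
  have haL : a / (L : ℝ) ^ 2 ≤ a := div_le_self ha.le (one_le_pow₀ hL)
  calc _ ≤ ∑ i, ((if i = j then ‖f (fib (pscale L) K j)‖ else 0) +
        (a / (L : ℝ) ^ 2) * (‖blockSym 𝔮 (pscale L) (fib (pscale L) K i)‖ *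
          ‖blockSym 𝔮 (pscale L) (fib (pscale L) K j)‖)) := by
        refine Finset.sum_le_sum fun i _ => ?_
        simp only [fibMat, Matrix.add_apply, Matrix.smul_apply, Matrix.vecMulVec_apply,
          Matrix.diagonal_apply, smul_eq_mul, Complex.ofReal_zero, add_zero]
        refine (norm_add_le _ _).trans (add_le_add ?_ ?_)
        · split_ifs with h
          · rw [h]
          · simp
        · rw [norm_mul, norm_mul, Complex.norm_real, Real.norm_eq_abs, abs_of_nonneg (by positivity)]
    _ = ‖f (fib (pscale L) K j)‖ + (a / (L : ℝ) ^ 2) *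
        ((∑ i, ‖blockSym 𝔮 (pscale L) (fib (pscale L) K i)‖) *
          ‖blockSym 𝔮 (pscale L) (fib (pscale L) K j)‖) := by
        rw [Finset.sum_add_distrib, ← Finset.mul_sum, ← Finset.sum_mul]
        simp
    _ ≤ F + a * (V * V) := by
        have := hF j
        gcongr
    _ = _ := by ring

end

theorem column_bound_le {C₂ c₂ V e₁ Λ : ℝ} (hc₂ : 0 < c₂) (he₁ : 0 < e₁) (hΛ : 0 ≤ Λ) :
    C₂ / (c₂ * (1 + Λ)) + V ^ 2 / (e₁ * (1 + Λ) * (c₂ * (1 + Λ))) + 1 / (e₁ * (1 + Λ)) +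
        V ^ 2 * (2 / c₂) / (e₁ * (1 + Λ)) ^ 2 ≤
      (C₂ / c₂ + V ^ 2 / (e₁ * c₂) + 1 / e₁ + V ^ 2 * (2 / c₂) / e₁ ^ 2) / (1 + Λ) := by
  have h0 : (1 + Λ) ≤ (1 + Λ) ^ 2 := by nlinarith
  have h3 : V ^ 2 / (e₁ * (1 + Λ) * (c₂ * (1 + Λ))) ≤ V ^ 2 / (e₁ * c₂) / (1 + Λ) := by
    rw [div_div, show e₁ * (1 + Λ) * (c₂ * (1 + Λ)) = e₁ * c₂ * (1 + Λ) ^ 2 by ring]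
    gcongr
  have h4 : V ^ 2 * (2 / c₂) / (e₁ * (1 + Λ)) ^ 2 ≤ V ^ 2 * (2 / c₂) / e₁ ^ 2 / (1 + Λ) := by
    rw [div_div, mul_pow]
    gcongr
  have h5 : C₂ / (c₂ * (1 + Λ)) = C₂ / c₂ / (1 + Λ) := by rw [div_div]
  have h6 : 1 / (e₁ * (1 + Λ)) = 1 / e₁ / (1 + Λ) := by rw [div_div]
  rw [add_div, add_div, add_div]
  linarith

set_option maxHeartbeats 1000000 in
/-- Uniform bounds for the inverses of the fibre matrices near real momenta in the cell. -/
theorem exists_fibMat_bounds_cell {𝔮 : ℕ} {a c C m₀ : ℝ} (h𝔮 : 2 ≤ 𝔮) (ha : 0 < a) (hc : 0 < c)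
    (hC : 0 < C) (hm₀ : 0 < m₀) : ∃ m₁ B : ℝ, 0 < m₁ ∧ m₁ ≤ 1 ∧ m₁ ≤ m₀ ∧ 0 < B ∧
      ∀ (L : ℕ) [NeZero L] (f : (Fin 4 → ℂ) → ℂ), Odd L →
      ParabolicSymbol c C m₀ ((L : ℝ) ^ 2)⁻¹ f → ∀ K : Fin 4 → ℝ, (∀ μ, |K μ| ≤ Real.pi) →
      ∀ (μ : Fin 4) (η lam : ℝ), |η| ≤ m₁ → 0 ≤ lam →
      IsUnit (fibMat 𝔮 L a f lam (shift K μ η)) ∧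
      (∀ j, ∑ i, ‖(fibMat 𝔮 L a f lam (shift K μ η))⁻¹ i j‖ ≤ B * (((L : ℝ) ^ 2)⁻¹ + lam)⁻¹) ∧
      ∀ j, ∑ i, ‖fibMat 𝔮 L a f 0 (shift K μ η) i j‖ ≤ B := by
  have ha' : 0 < a⁻¹ := inv_pos.2 ha
  set e₀ := min ((1 / 2 : ℝ) ^ (4 * 𝔮)) c with he₀
  have he₀0 : 0 < e₀ := by positivity
  obtain ⟨c₂, C₂, δ₀, hc₂, hC₂, hδ₀, hδh, key⟩ :=
    exists_fiber_bounds (r := a⁻¹) (B := a⁻¹) ha' ha'.le he₀0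
  set T : ℝ := 0 + 𝔮 * 2 ^ 𝔮 + C + 2 * C / c with hT
  have hT0 : 0 < T := by positivity
  set m₁ := min 1 (min m₀ (δ₀ / T)) with hm₁
  have hm₁0 : 0 < m₁ := by positivity
  have hm₁1 : m₁ ≤ 1 := min_le_left _ _
  have hm₁m : m₁ ≤ m₀ := (min_le_right _ _).trans (min_le_left _ _)
  have hTm : T * m₁ ≤ δ₀ := by
    have := (min_le_right 1 (min m₀ (δ₀ / T))).trans (min_le_right _ _)
    rw [← hm₁, le_div_iff₀ hT0] at this
    linarith
  set V : ℝ := (2 ^ 𝔮 * 3) ^ 4 with hV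
  have hV0 : 0 < V := by positivity
  -- Shifting at most halves |d_i|, and |d_i| is at least both e₀ and Λ = L²λ, hence at least their
  -- mean.
  set e₁ := min (e₀ / 4) (1 / 4) with he₁
  have he₁0 : 0 < e₁ := by positivity
  set b := C₂ / c₂ + V ^ 2 / (e₁ * c₂) + 1 / e₁ + V ^ 2 * (2 / c₂) / e₁ ^ 2 with hb
  have hb0 : 0 < b := by positivity
  -- A bound for the symbol on the shifted fibre: `parab` ≤ 52 on the cell, and 53 = 52 + 1 with L⁻²
  -- ≤ 1.
  set F := C * 52 + C * m₁ * 53 with hF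
  refine ⟨m₁, b + (F + a * V ^ 2), hm₁0, hm₁1, hm₁m, by positivity, ?_⟩
  intro L _ f hL hf K hK μ η lam hη hlam
  have hL0 : (0 : ℝ) < L := by exact_mod_cast hL.pos
  have hL1 : (1 : ℝ) ≤ L := by exact_mod_cast hL.pos
  have hL0' : (L : ℂ) ≠ 0 := Nat.cast_ne_zero.2 (NeZero.ne L)
  -- With κ = 1 on the coarse lattice, the strip of f has parameter 1/L² and the admissible shift of
  -- the coarse momentum is the same in all directions.
  have hf1 : ParabolicSymbol c C m₀ (1 / (L : ℝ) ^ 2) f := by rwa [one_div]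
  have hη' : |η| ≤ m₁ * width 1 μ := by
    have : width 1 μ = 1 := by unfold width; split_ifs <;> simp
    rwa [this, mul_one]
  have hd := hf1.fiberData (𝔮 := 𝔮) (r := a⁻¹) (B := a⁻¹) (M := 0) (ρ := ((a⁻¹ : ℝ) : ℂ))
    (ρ' := ((a⁻¹ : ℝ) : ℂ)) (by omega) hc hC le_rfl hL hK hlam μ hm₁0.le hm₁m hm₁1 hη'
    (by simp) (by rw [Complex.norm_real, Real.norm_eq_abs, abs_of_pos ha']) (by simp) le_rfl
  obtain ⟨hX', hZ', hZ, -⟩ := key _ 0 _ _ _ _ _ _ _ (by positivity) hTm hd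
  have hvs := sum_norm_blockSym_le (s := pscale L) h𝔮 K μ (hη.trans hm₁1)
  set v' := fun l => blockSym 𝔮 (pscale L) (fib (pscale L) (shift K μ η) l) with hv'
  set d := fibSym L f lam (toC K) with hddef
  set d' := fibSym L f lam (shift K μ η) with hd'def
  have hv : ∀ i, ‖v' i‖ ≤ V := fun i =>
    (Finset.single_le_sum (f := fun l => ‖v' l‖) (fun _ _ => norm_nonneg _)
      (Finset.mem_univ i)).trans hvs
  have hΛ : ∀ i, (L : ℝ) ^ 2 * lam ≤ ‖d i‖ := fun i => hf.le_fibSym' hL hK lam i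
  set Λ := (L : ℝ) ^ 2 * lam with hΛdef
  have hΛ0 : 0 ≤ Λ := by positivity
  have hde : ∀ i, i ≠ 0 → e₁ * (1 + Λ) ≤ ‖d' i‖ := by
    intro i hi
    have h1 := hd.half_le_norm_d' (hTm.trans hδh) hi
    have h2 := hd.d_norm i hi
    have h3 := hΛ i
    have h4 : e₁ ≤ e₀ / 4 := min_le_left _ _
    have h5 : e₁ * Λ ≤ 1 / 4 * Λ := by gcongr; exact min_le_right _ _
    linarith
  have hz : c₂ * (1 + Λ) ≤ ‖fiberZ 0 ((a⁻¹ : ℝ) : ℂ) v' d'‖ := by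
    refine le_trans ?_ hZ'
    have := hΛ 0
    gcongr
  have hdo : ‖d' 0‖ ≤ 2 / c₂ * ‖fiberZ 0 ((a⁻¹ : ℝ) : ℂ) v' d'‖ := by
    have h1 := hd.d_o
    have h2 : ‖d' 0‖ ≤ ‖d' 0 - d 0‖ + ‖d 0‖ := by
      have := norm_add_le (d' 0 - d 0) (d 0)
      simpa using this
    have h3 : T * m₁ * (1 + ‖d 0‖) ≤ 1 * (1 + ‖d 0‖) := by
      gcongr
      linarith
    rw [div_mul_eq_mul_div, le_div_iff₀ hc₂]
    nlinarith [norm_nonneg (d 0)]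
  have hZ0 : fiberZ 0 ((a⁻¹ : ℝ) : ℂ) v' d' ≠ 0 :=
    norm_pos_iff.1 (lt_of_lt_of_le (by positivity) hz)
  have hd0 : ∀ i, i ≠ 0 → d' i ≠ 0 := fun i hi =>
    norm_pos_iff.1 (lt_of_lt_of_le (by positivity) (hde i hi))
  have hmul := mul_rankOneInv 0 (ρ := ((a⁻¹ : ℝ) : ℂ)) (by exact_mod_cast ha'.ne') v' hd0 hZ0
  rw [← sq_smul_fibMat lam (shift K μ η)] at hmul
  set N := rankOneInv 0 ((a⁻¹ : ℝ) : ℂ) v' d' with hN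
  have hinv : fibMat 𝔮 L a f lam (shift K μ η) * ((L : ℂ) ^ 2 • N) = 1 := by
    rw [Matrix.mul_smul, ← Matrix.smul_mul]; exact hmul
  have hinv' := Matrix.inv_eq_right_inv hinv
  refine ⟨IsUnit.of_mul_eq_one _ hinv, ?_, ?_⟩
  · intro j
    rw [hinv']
    have h1 := sum_norm_rankOneInv_le 0 hV0.le hv hvs (by positivity) hde (by positivity) hz hdo
      (by positivity) hX' j
    have h2 : C₂ / (c₂ * (1 + Λ)) + V ^ 2 / (e₁ * (1 + Λ) * (c₂ * (1 + Λ))) + 1 / (e₁ * (1 + Λ)) +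
        V ^ 2 * (2 / c₂) / (e₁ * (1 + Λ)) ^ 2 ≤ b / (1 + Λ) :=
      column_bound_le hc₂ he₁0 hΛ0
    -- The factor L² of `sq_smul_fibMat` turns (1 + L²λ)⁻¹ into (L⁻² + λ)⁻¹.
    have h7 : (L : ℝ) ^ 2 * (b / (1 + Λ)) = b * (((L : ℝ) ^ 2)⁻¹ + lam)⁻¹ := by
      rw [hΛdef]
      field_simp
    calc ∑ i, ‖((L : ℂ) ^ 2 • N) i j‖ = (L : ℝ) ^ 2 * ∑ i, ‖N i j‖ := by
          rw [Finset.mul_sum]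
          refine Finset.sum_congr rfl fun i _ => ?_
          rw [Matrix.smul_apply, norm_smul, norm_pow, Complex.norm_natCast]
      _ ≤ (L : ℝ) ^ 2 * (b / (1 + Λ)) := by gcongr; exact h1.trans h2
      _ = b * (((L : ℝ) ^ 2)⁻¹ + lam)⁻¹ := h7
      _ ≤ _ := by
        gcongr
        have : 0 ≤ F + a * V ^ 2 := by positivity
        linarith
  · intro j
    have hFb : ∀ l, ‖f (fib (pscale L) (shift K μ η) l)‖ ≤ F := by
      intro l
      have hs0 : (0 : ℝ) < pscale L μ := by exact_mod_cast (odd_pscale hL μ).pos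
      rw [IsPeriodic.fib_shift hf1.per]
      have hcell := abs_cfib_le (odd_pscale hL) hK l
      have h1 := hf1.sub_le _ hcell μ m₁ (η / pscale L μ) hm₁0.le hm₁m (by
        rw [width_div_sq, abs_div, abs_of_pos hs0, ← mul_div_assoc]
        gcongr)
      have h2 := hf1.upper _ hcell
      have h3 := parab_le_of_cell hcell
      have h4 : (1 : ℝ) / (L : ℝ) ^ 2 ≤ 1 := by
        rw [div_le_one (by positivity)]
        exact one_le_pow₀ hL1
      have h5 : ‖f (shift (cfib (pscale L) K l) μ (η / pscale L μ))‖ ≤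
          ‖f (shift (cfib (pscale L) K l) μ (η / pscale L μ)) - f (toC (cfib (pscale L) K l))‖ +
          ‖f (toC (cfib (pscale L) K l))‖ := by
        have := norm_add_le (f (shift (cfib (pscale L) K l) μ (η / pscale L μ)) -
          f (toC (cfib (pscale L) K l))) (f (toC (cfib (pscale L) K l)))
        simpa using this
      have h6 : C * m₁ * (parab (cfib (pscale L) K l) + 1 / (L : ℝ) ^ 2) ≤ C * m₁ * 53 := by
        gcongr
        linarith
      have h7 : C * parab (cfib (pscale L) K l) ≤ C * 52 := by gcongr
      rw [hF]
      linarith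
    have := sum_norm_fibMat_le (shift K μ η) ha hvs hFb j
    linarith

theorem sum_norm_mul_le {ι : Type*} [Fintype ι] {A B : Matrix ι ι ℂ} {α β : ℝ}
    (hA : ∀ j, ∑ i, ‖A i j‖ ≤ α) (hB : ∀ j, ∑ i, ‖B i j‖ ≤ β) (j : ι) :
    ∑ i, ‖(A * B) i j‖ ≤ α * β := by
  have hα : 0 ≤ α := (Finset.sum_nonneg fun _ _ => norm_nonneg _).trans (hA j)
  calc ∑ i, ‖(A * B) i j‖ ≤ ∑ i, ∑ k, ‖A i k‖ * ‖B k j‖ := by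
        refine Finset.sum_le_sum fun i _ => ?_
        rw [Matrix.mul_apply]
        refine (norm_sum_le _ _).trans (Finset.sum_le_sum fun k _ => ?_)
        rw [norm_mul]
    _ = ∑ k, (∑ i, ‖A i k‖) * ‖B k j‖ := by
        rw [Finset.sum_comm]
        exact Finset.sum_congr rfl fun k _ => (Finset.sum_mul _ _ _).symm
    _ ≤ ∑ k, α * ‖B k j‖ := by
        refine Finset.sum_le_sum fun k _ => ?_
        have := hA k
        gcongr
    _ ≤ α * β := by
        rw [← Finset.mul_sum]
        have := hB j
        gcongr

/-- Uniform bounds for the inverses of the fibre matrices near real momenta. -/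
theorem exists_fibMat_bounds {𝔮 : ℕ} {a c C m₀ : ℝ} (h𝔮 : 2 ≤ 𝔮) (ha : 0 < a) (hc : 0 < c)
    (hC : 0 < C) (hm₀ : 0 < m₀) : ∃ m₁ B : ℝ, 0 < m₁ ∧ m₁ ≤ 1 ∧ m₁ ≤ m₀ ∧ 0 < B ∧
      ∀ (L : ℕ) [NeZero L] (f : (Fin 4 → ℂ) → ℂ), Odd L →
      ParabolicSymbol c C m₀ ((L : ℝ) ^ 2)⁻¹ f → ∀ (K : Fin 4 → ℝ) (μ : Fin 4) (η lam : ℝ),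
      |η| ≤ m₁ → 0 ≤ lam →
      IsUnit (fibMat 𝔮 L a f lam (shift K μ η)) ∧
      (∀ j, ∑ i, ‖(fibMat 𝔮 L a f lam (shift K μ η))⁻¹ i j‖ ≤ B * (((L : ℝ) ^ 2)⁻¹ + lam)⁻¹) ∧
      ∀ j, ∑ i, ‖(fibMat 𝔮 L a f 0 (shift K μ η) *
        (fibMat 𝔮 L a f lam (shift K μ η))⁻¹) i j‖ ≤ B * (((L : ℝ) ^ 2)⁻¹ + lam)⁻¹ := by
  obtain ⟨m₁, B, hm₁, hm₁1, hm₁m, hB, key⟩ := exists_fibMat_bounds_cell h𝔮 ha hc hC hm₀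
  refine ⟨m₁, B + B * B, hm₁, hm₁1, hm₁m, by positivity, ?_⟩
  intro L _ f hL hf K μ η lam hη hlam
  obtain ⟨K', z, hK', hz⟩ := exists_cell K
  obtain ⟨hu, h1, h2⟩ := key L f hL hf K' hK' μ η lam hη hlam
  have hL0 : (0 : ℝ) < L := by exact_mod_cast hL.pos
  have hp : 0 ≤ (((L : ℝ) ^ 2)⁻¹ + lam)⁻¹ := by positivity
  have h3 := sum_norm_mul_le h2 h1
  rw [shift_add_int hz, fibMat_add_int hL hf.per, fibMat_add_int hL hf.per]
  set e := Equiv.addRight fun μ => (z μ : ZMod (pscale L μ))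
  set A := fibMat 𝔮 L a f lam (shift K' μ η)
  set A₀ := fibMat 𝔮 L a f 0 (shift K' μ η)
  rw [Matrix.inv_submatrix_equiv, Matrix.submatrix_mul_equiv]
  refine ⟨(Matrix.isUnit_submatrix_equiv e e).2 hu, fun j => ?_, fun j => ?_⟩
  · simp only [Matrix.submatrix_apply]
    rw [Equiv.sum_comp e fun i => ‖A⁻¹ i (e j)‖]
    refine (h1 _).trans ?_
    gcongr
    nlinarith
  · simp only [Matrix.submatrix_apply]
    rw [Equiv.sum_comp e fun i => ‖(A₀ * A⁻¹) i (e j)‖]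
    refine (h3 _).trans ?_
    rw [← mul_assoc]
    gcongr
    linarith

/-! ### Exponential decay of averages over discrete momenta -/

/-- The momentum `2π w / N`. -/
def mom (N : Fin 4 → ℕ) (w : ∀ μ, ZMod (N μ)) : Fin 4 → ℝ :=
  fun μ => 2 * Real.pi * (w μ).val / N μ

theorem sum_add_right {G M : Type*} [AddGroup G] [Fintype G] [AddCommMonoid M] (H : G → M) (u : G) :
    ∑ w, H (w + u) = ∑ w, H w := Equiv.sum_comp (Equiv.addRight u) H

-- For fixed other components, the sum over the component μ is controlled by the one variable
-- aliasing bound. The plane wave is absorbed into a periodic function G, and translating w in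
-- direction μ leaves the total sum unchanged; averaging over these translations isolates the one
-- variable sums.
set_option maxHeartbeats 400000 in
theorem norm_sum_mom_le {g : (Fin 4 → ℂ) → ℂ} (hg : IsPeriodic g) {μ : Fin 4} {b M : ℝ}
    (hb : 0 < b)
    (hd : ∀ (θ : Fin 4 → ℝ) (η : ℝ), |η| ≤ b →
      DifferentiableAt ℂ (fun z => g (Function.update (toC θ) μ z)) (θ μ + η * Complex.I))
    (hM : ∀ (θ : Fin 4 → ℝ) (η : ℝ), |η| ≤ b → ‖g (shift θ μ η)‖ ≤ M)
    (N : Fin 4 → ℕ) [∀ ν, NeZero (N ν)] (x : Fin 4 → ℤ) (hx : 2 * |x μ| ≤ N μ) :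
    ‖∑ w, g (toC (mom N w)) * Complex.exp (Complex.I * ∑ ν, (mom N w ν : ℂ) * x ν)‖ ≤
      (∏ ν, (N ν : ℝ)) * (M * (1 + 2 / (1 - Real.exp (-(b * N μ)))) *
        Real.exp (-(b * |(x μ : ℝ)|))) := by
  set G : (Fin 4 → ℂ) → ℂ := fun θ => g θ * Complex.exp (Complex.I * ∑ ν, θ ν * x ν) with hG
  have hGp : IsPeriodic G := by
    intro θ ν
    simp only [hG, hg θ ν]
    congr 1
    rw [Complex.exp_eq_exp_iff_exists_int]
    refine ⟨x ν, ?_⟩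
    have : ∑ ν', (θ + Pi.single ν (2 * Real.pi : ℂ) : Fin 4 → ℂ) ν' * (x ν' : ℂ) =
        ∑ ν', θ ν' * x ν' + 2 * Real.pi * x ν := by
      simp [add_mul, Finset.sum_add_distrib, Pi.single_apply]
    rw [this]
    ring
  have hN0 : (N μ : ℂ) ≠ 0 := Nat.cast_ne_zero.2 (NeZero.ne _)
  have hNr : (0 : ℝ) < N μ := by exact_mod_cast Nat.pos_of_ne_zero (NeZero.ne (N μ))
  set R := N μ * (M * (1 + 2 / (1 - Real.exp (-(b * N μ)))) * Real.exp (-(b * |(x μ : ℝ)|))) with hR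
  have hup : ∀ (θ : Fin 4 → ℝ) (z : ℂ), Function.update (toC θ) μ z =
      shift (Function.update θ μ z.re) μ z.im := by
    intro θ z
    ext ν
    by_cases h : ν = μ
    · subst h; simp [shift_self, Complex.re_add_im]
    · simp [shift_of_ne _ h, h, toC]
  have hup2 : ∀ (θ : Fin 4 → ℝ) (r : ℝ), (fun z => g (Function.update (toC θ) μ z)) =
      fun z => g (Function.update (toC (Function.update θ μ r)) μ z) := by
    intro θ r
    ext z
    congr 1
    ext ν
    by_cases h : ν = μ
    · subst h; simp
    · simp [h, toC]
  have inner : ∀ w : (∀ ν, ZMod (N ν)), ‖∑ j : ZMod (N μ), G (toC (mom N (w + Pi.single μ j)))‖ ≤ R := by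
    intro w
    set t := mom N w μ with ht
    have h1 : ∀ j : ZMod (N μ), G (toC (mom N (w + Pi.single μ j))) =
        Complex.exp (Complex.I * ∑ ν ∈ Finset.univ.erase μ, (mom N w ν : ℂ) * x ν) *
        (g (Function.update (toC (mom N w)) μ (t + 2 * Real.pi * (j.val : ℕ) / N μ)) *
          Complex.exp ((t + 2 * Real.pi * (j.val : ℕ) / N μ) * x μ * Complex.I)) := by
      intro j
      have h2 : ∃ y : ℤ, ((w μ + j).val : ℤ) = (w μ).val + j.val + N μ * y := by
        have h3 : ((((w μ).val + j.val : ℕ) : ℤ) : ZMod (N μ)) = (((w μ + j).val : ℤ) : ZMod (N μ)) := by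
          push_cast
          simp
        obtain ⟨y, hy⟩ := (ZMod.intCast_eq_intCast_iff_dvd_sub _ _ _).1 h3
        exact ⟨y, by push_cast at hy; linarith⟩
      obtain ⟨y, hy⟩ := h2
      have hy' : ((w μ + j).val : ℂ) = (w μ).val + j.val + N μ * y := by exact_mod_cast hy
      have h4 : G (toC (mom N (w + Pi.single μ j))) =
          G (Function.update (toC (mom N w)) μ (t + 2 * Real.pi * (j.val : ℕ) / N μ)) := by
        refine hGp.congr_int (Pi.single μ y) fun ν => ?_
        by_cases h : ν = μ
        · subst h
          simp only [toC, mom, Pi.add_apply, Pi.single_eq_same, Function.update_self, ht]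
          push_cast
          rw [hy']
          field_simp
        · simp [h, toC, mom]
      rw [h4]
      simp only [hG]
      rw [← Finset.add_sum_erase _ _ (Finset.mem_univ μ), Function.update_self]
      have h5 : ∑ ν ∈ Finset.univ.erase μ, Function.update (toC (mom N w)) μ
          ((t : ℂ) + 2 * Real.pi * (j.val : ℕ) / N μ) ν * (x ν : ℂ) =
          ∑ ν ∈ Finset.univ.erase μ, (mom N w ν : ℂ) * x ν := by
        refine Finset.sum_congr rfl fun ν hν => ?_
        rw [Function.update_of_ne (Finset.ne_of_mem_erase hν)]
        rfl
      rw [h5, mul_add, Complex.exp_add]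
      rw [show Complex.I * (((t : ℂ) + 2 * Real.pi * (j.val : ℕ) / N μ) * x μ) =
        (t + 2 * Real.pi * (j.val : ℕ) / N μ) * x μ * Complex.I by ring]
      ring
    rw [Finset.sum_congr rfl fun j _ => h1 j, ← Finset.mul_sum, norm_mul]
    have h6 : ‖Complex.exp (Complex.I * ∑ ν ∈ Finset.univ.erase μ, (mom N w ν : ℂ) * x ν)‖ = 1 := by
      have : Complex.I * ∑ ν ∈ Finset.univ.erase μ, (mom N w ν : ℂ) * x ν =
          ((∑ ν ∈ Finset.univ.erase μ, mom N w ν * x ν : ℝ) : ℂ) * Complex.I := by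
        push_cast; ring
      rw [this, Complex.norm_exp_ofReal_mul_I]
    rw [h6, one_mul, sum_zmod_val (N μ) (fun j => g (Function.update (toC (mom N w)) μ
      (t + 2 * Real.pi * (j : ℕ) / N μ)) *
        Complex.exp ((t + 2 * Real.pi * (j : ℕ) / N μ) * x μ * Complex.I))]
    refine norm_sum_range_mul_exp_le (f := fun z => g (Function.update (toC (mom N w)) μ z)) hb
      ?_ ?_ ?_ (NeZero.ne _) (x μ) hx t
    · intro z hz
      have := hd (Function.update (mom N w) μ z.re) z.im hz
      rw [Function.update_self, Complex.re_add_im] at this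
      rw [hup2 _ z.re]
      exact this
    · intro z
      rw [← hg (Function.update (toC (mom N w)) μ z) μ]
      congr 1
      ext ν
      by_cases h : ν = μ
      · subst h; simp
      · simp [h]
    · intro z hz
      simp only [hup]
      exact hM _ _ hz
  -- Each momentum is counted N_μ times on the right.
  have htrans : (N μ : ℂ) * ∑ w, G (toC (mom N w)) =
      ∑ w : (∀ ν, ZMod (N ν)), ∑ j : ZMod (N μ), G (toC (mom N (w + Pi.single μ j))) := by
    rw [Finset.sum_comm]
    have : ∀ j : ZMod (N μ), ∑ w : (∀ ν, ZMod (N ν)), G (toC (mom N (w + Pi.single μ j))) =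
        ∑ w, G (toC (mom N w)) := fun j =>
      sum_add_right (fun w => G (toC (mom N w))) (Pi.single μ j)
    simp only [this, Finset.sum_const, Finset.card_univ, ZMod.card, nsmul_eq_mul]
  have h7 : (N μ : ℝ) * ‖∑ w, G (toC (mom N w))‖ ≤ (∏ ν, (N ν : ℝ)) * R := by
    have h8 := congrArg norm htrans
    rw [norm_mul, Complex.norm_natCast] at h8
    rw [h8]
    refine (norm_sum_le _ _).trans ((Finset.sum_le_sum fun w _ => inner w).trans ?_)
    simp [Fintype.card_pi, ZMod.card]
  rw [hR, mul_left_comm] at h7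
  exact le_of_mul_le_mul_left h7 hNr

/-! ### Exponential decay of operators with given fibre matrices -/

/-- The fibre matrix over a momentum of the fine lattice. -/
def fineMat (𝔮 L : ℕ) (a : ℝ) (f : (Fin 4 → ℂ) → ℂ) (lam : ℝ) (θ : Fin 4 → ℂ) :
    Matrix (∀ μ, ZMod (pscale L μ)) (∀ μ, ZMod (pscale L μ)) ℂ :=
  fibMat 𝔮 L a f lam fun μ => pscale L μ * θ μ

section

variable {𝔮 L : ℕ} {a : ℝ} {f : (Fin 4 → ℂ) → ℂ}

/-- A shift of the fine momentum by 2π moves every member of the fibre by exactly 2π, without the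
permutation that occurs for `fibMat`; single entries are therefore periodic functions. -/
theorem isPeriodic_fineMat [NeZero L] (hL : Odd L) (hf : IsPeriodic f) (lam : ℝ) :
    IsPeriodic (fineMat 𝔮 L a f lam) := by
  intro θ μ
  have h := isPeriodic_blockSym 𝔮 (odd_pscale hL)
  have h1 : ∀ l, fib (pscale L) (fun ν => pscale L ν * (θ + Pi.single μ (2 * Real.pi : ℂ) : Fin 4 → ℂ) ν) l =
      fib (pscale L) (fun ν => pscale L ν * θ ν) l + Pi.single μ (2 * Real.pi : ℂ) := by
    intro l
    ext ν
    have : (pscale L ν : ℂ) ≠ 0 := Nat.cast_ne_zero.2 (NeZero.ne _)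
    by_cases hν : ν = μ
    · subst hν
      simp only [fib, Pi.add_apply, Pi.single_eq_same]
      field_simp
      ring
    · simp [fib, hν]
  unfold fineMat fibMat
  simp only [h1, hf _ _, h _ _]

theorem fineMat_shift (lam : ℝ) (θ : Fin 4 → ℝ) (μ : Fin 4) (η : ℝ) :
    fineMat 𝔮 L a f lam (shift θ μ η) =
      fibMat 𝔮 L a f lam (shift (fun ν => pscale L ν * θ ν) μ (pscale L μ * η)) := by
  unfold fineMat
  congr 1
  ext ν
  by_cases h : ν = μ
  · subst h; rw [shift_self, shift_self]; push_cast; ring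
  · rw [shift_of_ne _ h, shift_of_ne _ h]; push_cast; rfl

theorem differentiableAt_fineMat [NeZero L] {c C m₀ κ : ℝ} (hf : ParabolicSymbol c C m₀ κ f) (lam : ℝ)
    (θ : Fin 4 → ℝ) (μ : Fin 4) {η : ℝ} (hη : |η| ≤ m₀ * width κ μ)
    (i j : ∀ μ, ZMod (pscale L μ)) :
    DifferentiableAt ℂ (fun z => fineMat 𝔮 L a f lam (Function.update (toC θ) μ z) i j)
      (θ μ + η * Complex.I) := by
  have hs : ∀ ν, (pscale L ν : ℂ) ≠ 0 := fun ν => Nat.cast_ne_zero.2 (NeZero.ne _)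
  have hfib : ∀ (l : ∀ μ, ZMod (pscale L μ)) (z : ℂ),
      fib (pscale L) (fun ν => pscale L ν * Function.update (toC θ) μ z ν) l =
        Function.update (toC fun ν => θ ν + 2 * Real.pi * (l ν).val / pscale L ν) μ
          (z + 2 * Real.pi * (l μ).val / pscale L μ) := by
    intro l z
    ext ν
    have := hs ν
    by_cases h : ν = μ
    · subst h
      simp only [fib, Function.update_self]
      field_simp
    · simp only [fib, Function.update_of_ne h, toC]
      push_cast
      field_simp
  have h1 : ∀ l : ∀ μ, ZMod (pscale L μ), DifferentiableAt ℂ (fun z =>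
      f (fib (pscale L) (fun ν => pscale L ν * Function.update (toC θ) μ z ν) l))
      (θ μ + η * Complex.I) := by
    intro l
    simp only [hfib]
    have h2 := hf.diff (fun ν => θ ν + 2 * Real.pi * (l ν).val / pscale L ν) μ η hη
    have h3 : DifferentiableAt ℂ (fun z : ℂ => z + 2 * Real.pi * (l μ).val / pscale L μ)
        (θ μ + η * Complex.I) := by fun_prop
    refine DifferentiableAt.comp (g := fun z => f (Function.update
      (toC fun ν => θ ν + 2 * Real.pi * (l ν).val / pscale L ν) μ z)) (θ μ + η * Complex.I : ℂ) ?_ h3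
    have e : (θ μ + η * Complex.I : ℂ) + 2 * Real.pi * (l μ).val / pscale L μ =
        ((θ μ + 2 * Real.pi * (l μ).val / pscale L μ : ℝ) : ℂ) + η * Complex.I := by
      push_cast; ring
    simp only [e]
    exact h2
  have h4 : ∀ l : ∀ μ, ZMod (pscale L μ), DifferentiableAt ℂ (fun z => blockSym 𝔮 (pscale L)
      (fib (pscale L) (fun ν => pscale L ν * Function.update (toC θ) μ z ν) l))
      (θ μ + η * Complex.I) := by
    intro l
    simp only [hfib]
    refine DifferentiableAt.comp (g := blockSym 𝔮 (pscale L)) (θ μ + η * Complex.I : ℂ)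
      ((differentiable_blockSym 𝔮 _) _) ?_
    have hU : ∀ z : ℂ, DifferentiableAt ℂ (fun z : ℂ => Function.update
        (toC fun ν => θ ν + 2 * Real.pi * (l ν).val / pscale L ν) μ z) z := fun z =>
      (hasFDerivAt_update (toC fun ν => θ ν + 2 * Real.pi * (l ν).val / pscale L ν)
        z).differentiableAt
    exact DifferentiableAt.comp (θ μ + η * Complex.I : ℂ) (hU _) (by fun_prop)
  unfold fineMat fibMat
  simp only [Matrix.add_apply, Matrix.smul_apply, Matrix.vecMulVec_apply, Matrix.diagonal_apply,
    smul_eq_mul]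
  refine DifferentiableAt.add ?_ (((h4 i).mul (h4 j)).const_mul _)
  split_ifs
  · exact (h1 i).add_const _
  · exact differentiableAt_const _

end

/-- The momentum average that represents an entry of an operator with fibre matrices `M`. -/
def fibAvg (L : ℕ) (N : Fin 4 → ℕ) [∀ ν, NeZero (N ν)] [NeZero L]
    (M : (Fin 4 → ℂ) → Matrix (∀ μ, ZMod (pscale L μ)) (∀ μ, ZMod (pscale L μ)) ℂ)
    (φ : (∀ μ, ZMod (pscale L μ)) → ℂ) (x : Fin 4 → ℤ) : ℂ :=
  (∏ ν, (N ν : ℂ))⁻¹ * ∑ w, (∑ l, φ l * M (toC (mom N w)) l 0) *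
    Complex.exp (Complex.I * ∑ ν, (mom N w ν : ℂ) * x ν)

/-- The strip in the fine variable has width m/s_μ. Since the torus has at least s_μ points in this
direction, the aliasing factor is bounded in terms of m alone. The weights φ have modulus at most 1,
so a column sum bounds the integrand. -/
theorem norm_fibAvg_le {L : ℕ} [NeZero L]
    {M : (Fin 4 → ℂ) → Matrix (∀ μ, ZMod (pscale L μ)) (∀ μ, ZMod (pscale L μ)) ℂ}
    (hM : IsPeriodic M) {μ : Fin 4} {m B : ℝ} (hm : 0 < m)
    (hd : ∀ (θ : Fin 4 → ℝ) (η : ℝ), |η| ≤ m / pscale L μ → ∀ i j,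
      DifferentiableAt ℂ (fun z => M (Function.update (toC θ) μ z) i j) (θ μ + η * Complex.I))
    (hB : ∀ (θ : Fin 4 → ℝ) (η : ℝ), |η| ≤ m / pscale L μ → ∀ j, ∑ i, ‖M (shift θ μ η) i j‖ ≤ B)
    (N : Fin 4 → ℕ) [∀ ν, NeZero (N ν)] (hN : pscale L μ ≤ N μ)
    {φ : (∀ μ, ZMod (pscale L μ)) → ℂ} (hφ : ∀ l, ‖φ l‖ ≤ 1) (x : Fin 4 → ℤ)
    (hx : 2 * |x μ| ≤ N μ) :
    ‖fibAvg L N M φ x‖ ≤ B * (1 + 2 / (1 - Real.exp (-m))) *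
      Real.exp (-(m / pscale L μ * |(x μ : ℝ)|)) := by
  have hs : (0 : ℝ) < pscale L μ := by exact_mod_cast Nat.pos_of_ne_zero (NeZero.ne (pscale L μ))
  have hB0 : 0 ≤ B := (Finset.sum_nonneg fun i _ => norm_nonneg _).trans
    (hB 0 0 (by rw [abs_zero]; positivity) 0)
  have hP : (0 : ℝ) < ∏ ν, (N ν : ℝ) :=
    Finset.prod_pos fun ν _ => by exact_mod_cast Nat.pos_of_ne_zero (NeZero.ne (N ν))
  have h1 := norm_sum_mom_le (g := fun θ => ∑ l, φ l * M θ l 0) (μ := μ) (b := m / pscale L μ)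
    (M := B) (fun θ ν => by simp only [hM θ ν]) (by positivity)
    (fun θ η hη => DifferentiableAt.fun_sum fun l _ => (hd θ η hη l 0).const_mul _)
    (fun θ η hη => by
      refine (norm_sum_le _ _).trans (le_trans (Finset.sum_le_sum fun l _ => ?_) (hB θ η hη 0))
      rw [norm_mul]
      exact mul_le_of_le_one_left (norm_nonneg _) (hφ l)) N x hx
  unfold fibAvg
  rw [norm_mul, norm_inv, norm_prod]
  simp only [Complex.norm_natCast]
  rw [inv_mul_le_iff₀ hP]
  refine h1.trans ?_
  have h2 : Real.exp (-(m / pscale L μ * N μ)) ≤ Real.exp (-m) := by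
    apply Real.exp_le_exp.2
    have : (pscale L μ : ℝ) ≤ N μ := by exact_mod_cast hN
    rw [neg_le_neg_iff, div_mul_eq_mul_div, le_div_iff₀ hs]
    gcongr
  have h3 : Real.exp (-m) < 1 := Real.exp_lt_one_iff.2 (by linarith)
  gcongr

/-- Kernel bounds for the resolvent of the inverse covariance. -/
theorem exists_fibAvg_bounds {𝔮 : ℕ} {a c C m₀ : ℝ} (h𝔮 : 2 ≤ 𝔮) (ha : 0 < a) (hc : 0 < c)
    (hC : 0 < C) (hm₀ : 0 < m₀) : ∃ m B : ℝ, 0 < m ∧ 0 < B ∧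
      ∀ (L : ℕ) [NeZero L] (f : (Fin 4 → ℂ) → ℂ), Odd L →
      ParabolicSymbol c C m₀ ((L : ℝ) ^ 2)⁻¹ f → ∀ lam : ℝ, 0 ≤ lam →
      (∀ θ : Fin 4 → ℝ, IsUnit (fineMat 𝔮 L a f lam (toC θ))) ∧
      ∀ (N : Fin 4 → ℕ) [∀ ν, NeZero (N ν)] (μ : Fin 4), pscale L μ ≤ N μ →
      ∀ φ : (∀ μ, ZMod (pscale L μ)) → ℂ, (∀ l, ‖φ l‖ ≤ 1) →
      ∀ x : Fin 4 → ℤ, 2 * |x μ| ≤ N μ →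
      ‖fibAvg L N (fun θ => (fineMat 𝔮 L a f lam θ)⁻¹) φ x‖ ≤
        B * (((L : ℝ) ^ 2)⁻¹ + lam)⁻¹ * Real.exp (-(m / pscale L μ * |(x μ : ℝ)|)) ∧
      ‖fibAvg L N (fun θ => fineMat 𝔮 L a f 0 θ * (fineMat 𝔮 L a f lam θ)⁻¹) φ x‖ ≤
        B * (((L : ℝ) ^ 2)⁻¹ + lam)⁻¹ * Real.exp (-(m / pscale L μ * |(x μ : ℝ)|)) := by
  obtain ⟨m, B, hm, -, hmm, hB, key⟩ := exists_fibMat_bounds h𝔮 ha hc hC hm₀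
  have h3 : Real.exp (-m) < 1 := Real.exp_lt_one_iff.2 (by linarith)
  have h4 : 0 < 1 - Real.exp (-m) := by linarith
  refine ⟨m, B * (1 + 2 / (1 - Real.exp (-m))), hm, by positivity, ?_⟩
  intro L _ f hL hf lam hlam
  have hs : ∀ μ, (0 : ℝ) < pscale L μ := fun μ => by
    exact_mod_cast Nat.pos_of_ne_zero (NeZero.ne (pscale L μ))
  have hkey : ∀ (θ : Fin 4 → ℝ) (μ : Fin 4) (η : ℝ), |η| ≤ m / pscale L μ →
      |(pscale L μ : ℝ) * η| ≤ m := by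
    intro θ μ η hη
    rw [abs_mul, abs_of_pos (hs μ)]
    rw [le_div_iff₀ (hs μ)] at hη
    linarith
  -- The parabolic strip of parameter L⁻² has width exactly 1/s_μ in direction μ: L⁻² in time, L⁻¹
  -- in space.
  have hw : ∀ (μ : Fin 4) (η : ℝ), |η| ≤ m / pscale L μ → |η| ≤ m₀ * width ((L : ℝ) ^ 2)⁻¹ μ := by
    intro μ η hη
    have h1 : width ((L : ℝ) ^ 2)⁻¹ μ = 1 / pscale L μ := by
      rw [← one_div, width_div_sq]
      congr 1
      unfold width
      split_ifs <;> simp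
    rw [h1, mul_one_div]
    refine hη.trans ?_
    have := (hs μ).le
    gcongr
  refine ⟨fun θ => ?_, ?_⟩
  · rw [← shift_zero θ 0, fineMat_shift]
    exact (key L f hL hf _ 0 _ lam (by simpa using hm.le) hlam).1
  intro N _ μ hN φ hφ x hx
  have hper := fun lam => isPeriodic_fineMat (𝔮 := 𝔮) (a := a) hL hf.per lam
  have hunit : ∀ (θ : Fin 4 → ℝ) (η : ℝ), |η| ≤ m / pscale L μ →
      IsUnit (fineMat 𝔮 L a f lam (Function.update (toC θ) μ (θ μ + η * Complex.I))) := by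
    intro θ η hη
    rw [update_toC_eq_shift, fineMat_shift]
    exact (key L f hL hf _ μ _ lam (hkey θ μ η hη) hlam).1
  have hdinv : ∀ (θ : Fin 4 → ℝ) (η : ℝ), |η| ≤ m / pscale L μ → ∀ i j,
      DifferentiableAt ℂ (fun z => (fineMat 𝔮 L a f lam (Function.update (toC θ) μ z))⁻¹ i j)
        (θ μ + η * Complex.I) := fun θ η hη i j =>
    differentiableAt_inv_apply
      (fun i j => differentiableAt_fineMat hf lam θ μ (hw μ η hη) i j) (hunit θ η hη) i j
  constructor
  · refine (norm_fibAvg_le (B := B * (((L : ℝ) ^ 2)⁻¹ + lam)⁻¹) (fun θ ν => by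
      simp only [hper lam θ ν]) hm hdinv ?_ N hN hφ x hx).trans (le_of_eq (by ring))
    intro θ η hη j
    simp only [fineMat_shift]
    exact (key L f hL hf _ μ _ lam (hkey θ μ η hη) hlam).2.1 j
  · refine (norm_fibAvg_le (B := B * (((L : ℝ) ^ 2)⁻¹ + lam)⁻¹) (fun θ ν => by
      simp only [hper lam θ ν, hper 0 θ ν]) hm ?_ ?_ N hN hφ x hx).trans (le_of_eq (by ring))
    · intro θ η hη i j
      simp only [Matrix.mul_apply]
      exact DifferentiableAt.fun_sum fun k _ =>
        (differentiableAt_fineMat hf 0 θ μ (hw μ η hη) i k).mul (hdinv θ η hη k j)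
    · intro θ η hη j
      simp only [fineMat_shift]
      exact (key L f hL hf _ μ _ lam (hkey θ μ η hη) hlam).2.2 j

/-! ### Characters of the discrete tori -/

/-- The number of points of the lattice in each direction. -/
def size (L τ σ i : ℕ) : Fin 4 → ℕ := fun μ => if μ = 0 then L ^ (2 * i + τ) else L ^ (i + σ)

theorem size_zero (L τ σ i : ℕ) : size L τ σ i 0 = L ^ (2 * i + τ) := if_pos rfl

theorem size_succ (L τ σ i : ℕ) (ν : Fin 3) : size L τ σ i ν.succ = L ^ (i + σ) :=
  if_neg (Fin.succ_ne_zero ν)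

instance (L τ σ i : ℕ) [NeZero L] (μ : Fin 4) : NeZero (size L τ σ i μ) :=
  ⟨by unfold size; split_ifs <;> exact pow_ne_zero _ (NeZero.ne L)⟩

theorem size_add (L τ σ i k : ℕ) (μ : Fin 4) :
    size L τ σ (k + i) μ = pscale (L ^ k) μ * size L τ σ i μ := by
  unfold size pscale
  split_ifs <;> ring

/-- The plane wave `e^{iθ·x}` on integer vectors. -/
def phase (θ : Fin 4 → ℝ) (x : ℤ × (Fin 3 → ℤ)) : ℂ :=
  Complex.exp (Complex.I * ((θ 0 : ℂ) * x.1 + ∑ ν : Fin 3, (θ ν.succ : ℂ) * x.2 ν))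

theorem phase_add (θ : Fin 4 → ℝ) (x y : ℤ × (Fin 3 → ℤ)) :
    phase θ (x + y) = phase θ x * phase θ y := by
  unfold phase
  rw [← Complex.exp_add, ← mul_add]
  congr 2
  simp only [Prod.fst_add, Prod.snd_add, Pi.add_apply, Int.cast_add, mul_add,
    Finset.sum_add_distrib]
  ring

theorem phase_zero_right (θ : Fin 4 → ℝ) : phase θ 0 = 1 := by simp [phase]

theorem norm_phase (θ : Fin 4 → ℝ) (x : ℤ × (Fin 3 → ℤ)) : ‖phase θ x‖ = 1 := by
  have h : Complex.I * ((θ 0 : ℂ) * x.1 + ∑ ν : Fin 3, (θ ν.succ : ℂ) * x.2 ν) =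
      ((θ 0 * x.1 + ∑ ν : Fin 3, θ ν.succ * x.2 ν : ℝ) : ℂ) * Complex.I := by
    push_cast; ring
  unfold phase
  rw [h, Complex.norm_exp_ofReal_mul_I]

theorem phase_eq_one {θ : Fin 4 → ℝ} {x : ℤ × (Fin 3 → ℤ)} (z : Fin 4 → ℤ)
    (h0 : θ 0 * x.1 = 2 * Real.pi * z 0) (hs : ∀ ν : Fin 3, θ ν.succ * x.2 ν = 2 * Real.pi * z ν.succ) :
    phase θ x = 1 := by
  unfold phase
  rw [Complex.exp_eq_one_iff]
  refine ⟨z 0 + ∑ ν : Fin 3, z ν.succ, ?_⟩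
  have h0' : (θ 0 : ℂ) * x.1 = 2 * Real.pi * z 0 := by exact_mod_cast h0
  have hs' : ∀ ν : Fin 3, (θ ν.succ : ℂ) * x.2 ν = 2 * Real.pi * z ν.succ := fun ν => by
    exact_mod_cast hs ν
  simp only [h0', hs']
  rw [← Finset.mul_sum]
  push_cast
  ring

/-- The momentum `2π w / N`. -/
def momZ (N : Fin 4 → ℕ) (w : Fin 4 → ℤ) : Fin 4 → ℝ := fun μ => 2 * Real.pi * w μ / N μ

/-- The representative of a site with coordinates in `[0, N)`. -/
def Site.rep {L τ σ : ℕ} {j : ℤ} {i : ℕ} (u : Site L τ σ j i) : ℤ × (Fin 3 → ℤ) :=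
  ((u.1.val : ℤ), fun ν => ((u.2 ν).val : ℤ))

/-- The integer representative of a class of momenta. -/
def wrep {N : Fin 4 → ℕ} (w : ∀ μ, ZMod (N μ)) : Fin 4 → ℤ := fun μ => ((w μ).val : ℤ)

theorem momZ_wrep {N : Fin 4 → ℕ} (w : ∀ μ, ZMod (N μ)) : momZ N (wrep w) = mom N w := by
  ext μ; simp [momZ, mom, wrep]

/-- The character of the torus with momentum `2π w / N`. -/
def chi {L τ σ : ℕ} {j : ℤ} {i : ℕ} (w : Fin 4 → ℤ) (u : Site L τ σ j i) : ℂ :=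
  phase (momZ (size L τ σ i) w) u.rep

section

variable {L τ σ : ℕ} [NeZero L] {j : ℤ} {i : ℕ}

theorem Site.ofInt_add (x y : ℤ × (Fin 3 → ℤ)) :
    (Site.ofInt (x + y) : Site L τ σ j i) = Site.ofInt x + Site.ofInt y := by
  refine Prod.ext ?_ (funext fun ν => ?_)
  · exact Int.cast_add _ _
  · exact Int.cast_add _ _

theorem Site.ofInt_rep (u : Site L τ σ j i) : Site.ofInt u.rep = u := by
  refine Prod.ext ?_ (funext fun ν => ?_)
  · simp [Site.ofInt, Site.rep]
  · simp [Site.ofInt, Site.rep]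

theorem size_cast_ne_zero (μ : Fin 4) : (size L τ σ i μ : ℝ) ≠ 0 := Nat.cast_ne_zero.2 (NeZero.ne _)

theorem phase_momZ_eq_one (w : Fin 4 → ℤ) {x : ℤ × (Fin 3 → ℤ)}
    (h : (Site.ofInt x : Site L τ σ j i) = 0) : phase (momZ (size L τ σ i) w) x = 1 := by
  have h0 : ((x.1 : ℤ) : ZMod (L ^ (2 * i + τ))) = 0 := congrArg Prod.fst h
  have hs : ∀ ν, ((x.2 ν : ℤ) : ZMod (L ^ (i + σ))) = 0 := fun ν => congrFun (congrArg Prod.snd h) ν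
  rw [ZMod.intCast_zmod_eq_zero_iff_dvd] at h0
  obtain ⟨y, hy⟩ := h0
  have hs' : ∀ ν, ∃ y : ℤ, x.2 ν = (L ^ (i + σ) : ℕ) * y := fun ν => by
    have := hs ν
    rw [ZMod.intCast_zmod_eq_zero_iff_dvd] at this
    exact this
  choose ys hys using hs'
  have hn := size_cast_ne_zero (L := L) (τ := τ) (σ := σ) (i := i)
  refine phase_eq_one (Fin.cons (w 0 * y) fun ν => w ν.succ * ys ν) ?_ fun ν => ?_
  · rw [hy]
    have := hn 0
    simp only [momZ, Fin.cons_zero]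
    rw [size_zero] at *
    push_cast at *
    field_simp
  · rw [hys ν]
    have := hn ν.succ
    simp only [momZ, Fin.cons_succ]
    rw [size_succ] at *
    push_cast at *
    field_simp

/-- The momentum is a multiple of 2π/N in each direction, so the plane wave takes the same value at
all representatives of a site. -/
theorem chi_ofInt (w : Fin 4 → ℤ) (x : ℤ × (Fin 3 → ℤ)) :
    chi w (Site.ofInt x : Site L τ σ j i) = phase (momZ (size L τ σ i) w) x := by
  unfold chi
  set u : Site L τ σ j i := Site.ofInt x with hu
  have h1 : (Site.ofInt (u.rep - x) : Site L τ σ j i) = 0 := by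
    have h2 : (Site.ofInt (u.rep - x + x) : Site L τ σ j i) = Site.ofInt (u.rep - x) + u :=
      Site.ofInt_add _ _
    rw [sub_add_cancel, Site.ofInt_rep] at h2
    simpa using h2.symm
  have h3 := phase_momZ_eq_one w h1
  have h4 := phase_add (momZ (size L τ σ i) w) (u.rep - x) x
  rw [sub_add_cancel, h3, one_mul] at h4
  exact h4

theorem chi_add (w : Fin 4 → ℤ) (u v : Site L τ σ j i) : chi w (u + v) = chi w u * chi w v := by
  conv_lhs => rw [← Site.ofInt_rep u, ← Site.ofInt_rep v, ← Site.ofInt_add, chi_ofInt, phase_add]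
  rfl

theorem chi_zero (w : Fin 4 → ℤ) : chi w (0 : Site L τ σ j i) = 1 := by
  have h := chi_ofInt (L := L) (τ := τ) (σ := σ) (j := j) (i := i) w 0
  rw [phase_zero_right] at h
  rw [← h]
  congr 1
  refine Prod.ext ?_ (funext fun ν => ?_)
  · exact Int.cast_zero.symm
  · exact Int.cast_zero.symm

theorem norm_chi (w : Fin 4 → ℤ) (u : Site L τ σ j i) : ‖chi w u‖ = 1 := norm_phase _ _

theorem chi_add_left (w w' : Fin 4 → ℤ) (u : Site L τ σ j i) :
    chi (w + w') u = chi w u * chi w' u := by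
  unfold chi phase
  rw [← Complex.exp_add, ← mul_add]
  congr 2
  rw [add_add_add_comm, ← Finset.sum_add_distrib]
  simp only [momZ, Pi.add_apply]
  push_cast
  congr 1
  · ring
  · exact Finset.sum_congr rfl fun ν _ => by ring

theorem chi_zero_left (u : Site L τ σ j i) : chi 0 u = 1 := by simp [chi, phase, momZ]

theorem chi_neg_left (w : Fin 4 → ℤ) (u : Site L τ σ j i) : chi (-w) u = (chi w u)⁻¹ := by
  refine eq_inv_of_mul_eq_one_left ?_
  rw [← chi_add_left, neg_add_cancel, chi_zero_left]

theorem conj_chi (w : Fin 4 → ℤ) (u : Site L τ σ j i) :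
    (starRingEnd ℂ) (chi w u) = chi (-w) u := by
  rw [chi_neg_left, Complex.inv_def, Complex.normSq_eq_norm_sq, norm_chi]
  simp

theorem chi_neg (w : Fin 4 → ℤ) (u : Site L τ σ j i) : chi w (-u) = chi (-w) u := by
  rw [chi_neg_left]
  refine eq_inv_of_mul_eq_one_left ?_
  rw [← chi_add, neg_add_cancel, chi_zero]

theorem chi_size_mul (z : Fin 4 → ℤ) (u : Site L τ σ j i) :
    chi (fun μ => (size L τ σ i μ : ℤ) * z μ) u = 1 := by
  have hn := size_cast_ne_zero (L := L) (τ := τ) (σ := σ) (i := i)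
  refine phase_eq_one (Fin.cons (z 0 * u.rep.1) fun ν => z ν.succ * u.rep.2 ν) ?_ fun ν => ?_
  · have := hn 0
    simp only [momZ, Fin.cons_zero]
    push_cast
    field_simp
  · have := hn ν.succ
    simp only [momZ, Fin.cons_succ]
    push_cast
    field_simp

theorem chi_congr {w w' : Fin 4 → ℤ} (h : ∀ μ, (size L τ σ i μ : ℤ) ∣ w' μ - w μ)
    (u : Site L τ σ j i) : chi w' u = chi w u := by
  choose z hz using h
  have : w' = w + fun μ => (size L τ σ i μ : ℤ) * z μ := by
    ext μ; rw [Pi.add_apply, ← hz μ]; ring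
  rw [this, chi_add_left, chi_size_mul, mul_one]

theorem sum_zmod_exp (N : ℕ) [NeZero N] (k : ℤ) :
    ∑ x : ZMod N, Complex.exp (Complex.I * (((2 * Real.pi * k / N : ℝ) : ℂ) * ((x.val : ℤ) : ℂ))) =
      if (N : ℤ) ∣ k then (N : ℂ) else 0 := by
  rw [← sum_exp_two_pi_div (NeZero.ne N) k, ← sum_zmod_val N]
  refine Finset.sum_congr rfl fun x _ => ?_
  congr 1
  push_cast
  ring

theorem sum_site_prod {R : Type*} [CommSemiring R] (g : ZMod (L ^ (2 * i + τ)) → R)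
    (k : Fin 3 → ZMod (L ^ (i + σ)) → R) :
    ∑ u : Site L τ σ j i, g u.1 * ∏ ν, k ν (u.2 ν) = (∑ x, g x) * ∏ ν, ∑ x, k ν x := by
  rw [Finset.prod_univ_sum, Fintype.piFinset_univ, Finset.sum_mul_sum]
  exact Fintype.sum_prod_type
    (fun u : ZMod (L ^ (2 * i + τ)) × (Fin 3 → ZMod (L ^ (i + σ))) => g u.1 * ∏ ν, k ν (u.2 ν))

theorem sum_chi (w : Fin 4 → ℤ) : ∑ u : Site L τ σ j i, chi w u =
    if ∀ μ, (size L τ σ i μ : ℤ) ∣ w μ then ∏ μ, (size L τ σ i μ : ℂ) else 0 := by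
  have h1 : ∀ u : Site L τ σ j i, chi w u =
      Complex.exp (Complex.I * (((2 * Real.pi * w 0 / (L ^ (2 * i + τ) : ℕ) : ℝ) : ℂ) *
        ((u.1.val : ℤ) : ℂ))) * ∏ ν : Fin 3, Complex.exp (Complex.I *
        (((2 * Real.pi * w ν.succ / (L ^ (i + σ) : ℕ) : ℝ) : ℂ) * (((u.2 ν).val : ℤ) : ℂ))) := by
    intro u
    rw [← Complex.exp_sum, ← Complex.exp_add, ← Finset.mul_sum, ← mul_add]
    simp only [chi, phase, momZ, size_zero, size_succ, Site.rep]
  rw [Finset.sum_congr rfl fun u _ => h1 u]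
  rw [sum_site_prod (fun x => Complex.exp (Complex.I * (((2 * Real.pi * w 0 / (L ^ (2 * i + τ) : ℕ) : ℝ) : ℂ) *
        ((x.val : ℤ) : ℂ)))) fun ν x => Complex.exp (Complex.I *
        (((2 * Real.pi * w ν.succ / (L ^ (i + σ) : ℕ) : ℝ) : ℂ) * ((x.val : ℤ) : ℂ)))]
  simp only [sum_zmod_exp]
  rw [← size_zero L τ σ i]
  have h3 : ∀ ν : Fin 3, (if ((L ^ (i + σ) : ℕ) : ℤ) ∣ w ν.succ then ((L ^ (i + σ) : ℕ) : ℂ) else 0) =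
      if (size L τ σ i ν.succ : ℤ) ∣ w ν.succ then (size L τ σ i ν.succ : ℂ) else 0 := fun ν => by
    rw [size_succ]
  simp only [h3]
  rw [← Fin.prod_univ_succ (fun μ => if (size L τ σ i μ : ℤ) ∣ w μ then (size L τ σ i μ : ℂ) else 0)]
  rw [Finset.prod_ite_zero]
  simp

theorem sum_chi_wrep (u : Site L τ σ j i) :
    ∑ w : (∀ μ, ZMod (size L τ σ i μ)), chi (wrep w) u =
      if u = 0 then ∏ μ, (size L τ σ i μ : ℂ) else 0 := by
  set x : Fin 4 → ℤ := Fin.cons u.rep.1 u.rep.2 with hx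
  have h1 : ∀ w : (∀ μ, ZMod (size L τ σ i μ)), chi (wrep w) u =
      ∏ μ, Complex.exp (Complex.I * (((2 * Real.pi * x μ / size L τ σ i μ : ℝ) : ℂ) *
        (((w μ).val : ℤ) : ℂ))) := by
    intro w
    rw [← Complex.exp_sum, ← Finset.mul_sum, Fin.sum_univ_succ]
    simp only [chi, phase, momZ, wrep, hx, Fin.cons_zero, Fin.cons_succ]
    congr 2
    congr 1
    · push_cast; ring
    · refine Finset.sum_congr rfl fun ν _ => ?_
      push_cast; ring
  rw [Finset.sum_congr rfl fun w _ => h1 w,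
    sum_prod_fib (fun μ (y : ZMod (size L τ σ i μ)) => Complex.exp (Complex.I *
      (((2 * Real.pi * x μ / size L τ σ i μ : ℝ) : ℂ) * ((y.val : ℤ) : ℂ))))]
  simp only [sum_zmod_exp]
  rw [Finset.prod_ite_zero]
  simp only [Finset.mem_univ, true_imp_iff]
  congr 1
  rw [eq_iff_iff]
  constructor
  · intro h
    refine Prod.ext ?_ (funext fun ν => ?_)
    · have h0 := h 0
      rw [size_zero, hx, Fin.cons_zero, ← ZMod.intCast_zmod_eq_zero_iff_dvd] at h0
      have h1 : u.1 = 0 := by simpa [Site.rep] using h0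
      exact h1
    · have h0 := h ν.succ
      rw [size_succ, hx, Fin.cons_succ, ← ZMod.intCast_zmod_eq_zero_iff_dvd] at h0
      have h1 : u.2 ν = 0 := by simpa [Site.rep] using h0
      exact h1
  · rintro rfl μ
    refine Fin.cases ?_ (fun ν => ?_) μ
    · simp only [hx, Fin.cons_zero, Site.rep]
      have : ((0 : Site L τ σ j i).1).val = 0 := ZMod.val_zero
      rw [this]; simp
    · simp only [hx, Fin.cons_succ, Site.rep]
      have : ((0 : Site L τ σ j i).2 ν).val = 0 := ZMod.val_zero
      rw [this]; simp

end

/-! ### Operators and characters -/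

section

variable {L τ σ : ℕ} [NeZero L] {j : ℤ} {i : ℕ} {ι : Type*}

theorem prod_size_ne_zero : (∏ μ, (size L τ σ i μ : ℂ)) ≠ 0 :=
  Finset.prod_ne_zero_iff.2 fun _ _ => Nat.cast_ne_zero.2 (NeZero.ne _)

/-- The operator that maps the characters `χ_w` to the functions `F w`. -/
def ofChar (F : (∀ μ, ZMod (size L τ σ i μ)) → ι → ℂ) : Matrix ι (Site L τ σ j i) ℂ :=
  fun u v => (∏ μ, (size L τ σ i μ : ℂ))⁻¹ * ∑ w, F w u * chi (-wrep w) v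

/-- Operators are recorded by their values on the characters, and composition on the left acts on
these values one by one. -/
theorem mul_ofChar {ι' : Type*} [Fintype ι] (A : Matrix ι' ι ℂ)
    (F : (∀ μ, ZMod (size L τ σ i μ)) → ι → ℂ) :
    A * (ofChar F : Matrix ι (Site L τ σ j i) ℂ) = ofChar fun w => A.mulVec (F w) := by
  ext u v
  simp only [Matrix.mul_apply, ofChar, Matrix.mulVec, dotProduct, Finset.mul_sum, Finset.sum_mul]
  rw [Finset.sum_comm]
  refine Finset.sum_congr rfl fun w _ => Finset.sum_congr rfl fun k _ => ?_
  ring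

theorem ofChar_chi : (ofChar fun w => chi (wrep w) : Matrix (Site L τ σ j i) (Site L τ σ j i) ℂ) =
    1 := by
  ext u v
  have h : ∀ w : (∀ μ, ZMod (size L τ σ i μ)), chi (wrep w) u * chi (-wrep w) v =
      chi (wrep w) (u - v) := fun w => by
    rw [sub_eq_add_neg, chi_add, chi_neg]
  simp only [ofChar, h, sum_chi_wrep, Matrix.one_apply, sub_eq_zero]
  split_ifs
  · exact inv_mul_cancel₀ prod_size_ne_zero
  · exact mul_zero _

theorem eq_ofChar (A : Matrix ι (Site L τ σ j i) ℂ) :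
    A = ofChar fun w => A.mulVec (chi (wrep w)) := by
  rw [← mul_ofChar, ofChar_chi, Matrix.mul_one]

theorem ext_chi {A B : Matrix ι (Site L τ σ j i) ℂ}
    (h : ∀ w : Fin 4 → ℤ, A.mulVec (chi w) = B.mulVec (chi w)) : A = B := by
  rw [eq_ofChar A, eq_ofChar B]
  simp only [h]

/-- An operator diagonal in the characters with nonzero eigenvalues; the inverse is written down on
the characters, and a one sided inverse of a square matrix is two sided. -/
theorem isUnit_of_mulVec_chi {A : Matrix (Site L τ σ j i) (Site L τ σ j i) ℂ}
    {α : (Fin 4 → ℤ) → ℂ} (hA : ∀ w, A.mulVec (chi w) = α w • chi w) (hα : ∀ w, α w ≠ 0) :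
    IsUnit A ∧ ∀ w, A⁻¹.mulVec (chi w) = (α w)⁻¹ • chi w := by
  have h1 : ∀ w, A.mulVec ((α w)⁻¹ • chi w) = chi w := fun w => by
    rw [Matrix.mulVec_smul, hA, smul_smul, inv_mul_cancel₀ (hα w), one_smul]
  have h2 : A * (ofChar fun w => (α (wrep w))⁻¹ • chi (wrep w)) = 1 := by
    rw [mul_ofChar, ← ofChar_chi]
    simp only [h1]
  have hu : IsUnit A := IsUnit.of_mul_eq_one _ h2
  refine ⟨hu, fun w => ?_⟩
  have hdet := (Matrix.isUnit_iff_isUnit_det A).1 hu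
  conv_lhs => rw [← h1 w]
  rw [Matrix.mulVec_mulVec, Matrix.nonsing_inv_mul A hdet, Matrix.one_mulVec]

/-- A function on the torus is determined by its pairings with the characters. -/
theorem funext_chi {g g' : Site L τ σ j i → ℂ}
    (h : ∀ w : Fin 4 → ℤ, ∑ u, g u * chi w u = ∑ u, g' u * chi w u) : g = g' := by
  have h1 : (Matrix.of fun (_ : Unit) u => g u) = Matrix.of fun (_ : Unit) u => g' u := by
    refine ext_chi fun w => ?_
    ext _
    exact h w
  ext u
  exact congrFun (congrFun h1 ()) u

theorem smul_chi_congr {w w' : Fin 4 → ℤ} (h : ∀ μ, (size L τ σ i μ : ℤ) ∣ w' μ - w μ) :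
    (chi w' : Site L τ σ j i → ℂ) = chi w := funext fun u => chi_congr h u

end

/-- `momZ` on a translated momentum is a point of a fibre. -/
theorem momZ_add_mul {N N' s : Fin 4 → ℕ} (hN : ∀ μ, N μ = s μ * N' μ) (hN0 : ∀ μ, N' μ ≠ 0)
    (k : Fin 4 → ℤ) (l : ∀ μ, ZMod (s μ)) (hs : ∀ μ, s μ ≠ 0) :
    toC (momZ N (k + fun μ => (N' μ : ℤ) * ((l μ).val : ℤ))) = fib s (toC (momZ N' k)) l := by
  ext μ
  have h1 : (N' μ : ℂ) ≠ 0 := Nat.cast_ne_zero.2 (hN0 μ)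
  have h2 : (s μ : ℂ) ≠ 0 := Nat.cast_ne_zero.2 (hs μ)
  simp only [toC, momZ, fib, hN μ, Pi.add_apply]
  push_cast
  field_simp

theorem IsPeriodic.momZ_congr {β : Type*} {f : (Fin 4 → ℂ) → β} (hf : IsPeriodic f) {N : Fin 4 → ℕ}
    (hN : ∀ μ, N μ ≠ 0) {w w' : Fin 4 → ℤ} (h : ∀ μ, (N μ : ℤ) ∣ w' μ - w μ) :
    f (toC (momZ N w')) = f (toC (momZ N w)) := by
  choose z hz using h
  refine hf.congr_int z fun μ => ?_
  have h1 : (N μ : ℂ) ≠ 0 := Nat.cast_ne_zero.2 (hN μ)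
  have h2 : (w' μ : ℂ) = w μ + N μ * z μ := by
    have : w' μ = w μ + N μ * z μ := by rw [← hz μ]; ring
    exact_mod_cast this
  simp only [toC, momZ]
  push_cast
  rw [h2]
  field_simp

section

variable {L τ σ : ℕ} [NeZero L] {j j' : ℤ} {i i' : ℕ} {s : Fin 4 → ℕ} [∀ μ, NeZero (s μ)]

/-- The transpose of an operator that maps characters to multiples of characters. -/
theorem transpose_mulVec_chi {B : Matrix (Site L τ σ j' i') (Site L τ σ j i) ℂ}
    {U : (Fin 4 → ℂ) → ℂ} (hU : IsPeriodic U) (hU' : ∀ θ, U (-θ) = U θ)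
    (hs : ∀ μ, size L τ σ i μ = s μ * size L τ σ i' μ)
    (hB : ∀ w, B.mulVec (chi w) = U (toC (momZ (size L τ σ i) w)) • chi w) (k : Fin 4 → ℤ) :
    (∏ μ, (s μ : ℂ)) • B.transpose.mulVec (chi k) =
      ∑ l : (∀ μ, ZMod (s μ)), U (fib s (toC (momZ (size L τ σ i') k)) l) •
        chi (k + fun μ => (size L τ σ i' μ : ℤ) * ((l μ).val : ℤ)) := by
  have hN' : ∀ μ, size L τ σ i' μ ≠ 0 := fun μ => NeZero.ne _
  have hs0 : ∀ μ, s μ ≠ 0 := fun μ => NeZero.ne _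
  -- Both sides are paired with χ_w. On the left B moves onto χ_w and orthogonality on the coarse
  -- torus requires k + w ≡ 0; on the right exactly one point of the fibre then contributes. The
  -- product of the s_μ is the ratio of the numbers of sites.
  refine funext_chi fun w => ?_
  have hleft : ∑ u, ((∏ μ, (s μ : ℂ)) • B.transpose.mulVec (chi k)) u * chi w u =
      (∏ μ, (s μ : ℂ)) * (U (toC (momZ (size L τ σ i) w)) *
        if ∀ μ, (size L τ σ i' μ : ℤ) ∣ (k + w) μ then ∏ μ, (size L τ σ i' μ : ℂ) else 0) := by
    have h1 : ∑ u, B.transpose.mulVec (chi k) u * chi w u =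
        ∑ y, chi k y * B.mulVec (chi w) y := by
      simp only [Matrix.mulVec, dotProduct, Finset.sum_mul, Finset.mul_sum]
      rw [Finset.sum_comm]
      refine Finset.sum_congr rfl fun y _ => Finset.sum_congr rfl fun u _ => ?_
      rw [Matrix.transpose_apply]; ring
    simp only [Pi.smul_apply, smul_eq_mul, mul_assoc]
    rw [← Finset.mul_sum, h1, hB, ← sum_chi (j := j')]
    congr 1
    rw [Finset.mul_sum]
    refine Finset.sum_congr rfl fun y _ => ?_
    rw [Pi.smul_apply, smul_eq_mul, chi_add_left]; ring
  have hright : ∑ u : Site L τ σ j i, (∑ l : (∀ μ, ZMod (s μ)),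
      U (fib s (toC (momZ (size L τ σ i') k)) l) •
        (chi (k + fun μ => (size L τ σ i' μ : ℤ) * ((l μ).val : ℤ)) : Site L τ σ j i → ℂ)) u *
          chi w u =
      ∑ l : (∀ μ, ZMod (s μ)), U (fib s (toC (momZ (size L τ σ i') k)) l) *
        if ∀ μ, (size L τ σ i μ : ℤ) ∣
          (k + (fun μ => (size L τ σ i' μ : ℤ) * ((l μ).val : ℤ)) + w) μ then
          ∏ μ, (size L τ σ i μ : ℂ) else 0 := by
    simp only [← sum_chi (j := j), Finset.mul_sum]
    rw [Finset.sum_comm]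
    refine Finset.sum_congr rfl fun u _ => ?_
    rw [Finset.sum_apply, Finset.sum_mul]
    refine Finset.sum_congr rfl fun l _ => ?_
    rw [Pi.smul_apply, smul_eq_mul, chi_add_left _ w, mul_assoc]
  rw [hleft, hright]
  by_cases hd : ∀ μ, (size L τ σ i' μ : ℤ) ∣ (k + w) μ
  · rw [if_pos hd]
    choose z hz using hd
    set l₀ : ∀ μ, ZMod (s μ) := fun μ => ((-z μ : ℤ) : ZMod (s μ)) with hl₀
    have hiff : ∀ l : (∀ μ, ZMod (s μ)), (∀ μ, (size L τ σ i μ : ℤ) ∣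
        (k + (fun μ => (size L τ σ i' μ : ℤ) * ((l μ).val : ℤ)) + w) μ) ↔ l = l₀ := by
      intro l
      have h2 : ∀ μ, (size L τ σ i μ : ℤ) ∣
          (k + (fun μ => (size L τ σ i' μ : ℤ) * ((l μ).val : ℤ)) + w) μ ↔ l μ = l₀ μ := by
        intro μ
        have h3 : (k + (fun μ => (size L τ σ i' μ : ℤ) * ((l μ).val : ℤ)) + w) μ =
            (size L τ σ i' μ : ℤ) * ((l μ).val - -z μ) := by
          have := hz μ
          simp only [Pi.add_apply] at this ⊢
          linear_combination this
        have h4 : (size L τ σ i' μ : ℤ) ≠ 0 := by exact_mod_cast hN' μ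
        rw [h3, hs μ, Nat.cast_mul, mul_comm (s μ : ℤ), mul_dvd_mul_iff_left h4,
          ← ZMod.intCast_eq_intCast_iff_dvd_sub, eq_comm, hl₀]
        simp
      simp only [h2, funext_iff]
    simp only [hiff]
    rw [Finset.sum_eq_single l₀ (fun l _ h => by rw [if_neg h, mul_zero]) (by simp), if_pos rfl]
    -- The surviving momentum is the negative of that of χ_w, hence the need for an even symbol.
    have h5 : U (fib s (toC (momZ (size L τ σ i') k)) l₀) = U (toC (momZ (size L τ σ i) w)) := by
      rw [← momZ_add_mul hs hN' k l₀ hs0, ← hU']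
      have h6 : -toC (momZ (size L τ σ i) (k + fun μ => (size L τ σ i' μ : ℤ) * ((l₀ μ).val : ℤ))) =
          toC (momZ (size L τ σ i) (-(k + fun μ => (size L τ σ i' μ : ℤ) * ((l₀ μ).val : ℤ)))) := by
        ext μ
        simp only [toC, momZ, Pi.neg_apply]
        push_cast; ring
      rw [h6]
      refine (hU.momZ_congr (fun μ => NeZero.ne _) fun μ => ?_).symm
      have := ((hiff l₀).2 rfl) μ
      simp only [Pi.add_apply, Pi.neg_apply] at this ⊢
      convert this using 1
      ring
    rw [h5]
    have h7 : ∏ μ, (size L τ σ i μ : ℂ) = (∏ μ, (s μ : ℂ)) * ∏ μ, (size L τ σ i' μ : ℂ) := by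
      rw [← Finset.prod_mul_distrib]
      exact Finset.prod_congr rfl fun μ _ => by rw [hs μ]; push_cast; rfl
    rw [h7]
    ring
  · rw [if_neg hd, mul_zero, mul_zero]
    symm
    refine Finset.sum_eq_zero fun l _ => ?_
    rw [if_neg, mul_zero]
    intro h
    refine hd fun μ => ?_
    have h1 := (Dvd.intro_left (s μ : ℤ) (by rw [hs μ]; push_cast; rfl) :
      (size L τ σ i' μ : ℤ) ∣ (size L τ σ i μ : ℤ)).trans (h μ)
    simp only [Pi.add_apply] at h1 ⊢
    have h2 : (size L τ σ i' μ : ℤ) ∣ (size L τ σ i' μ : ℤ) * ((l μ).val : ℤ) := dvd_mul_right _ _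
    have e : k μ + w μ = (k μ + (size L τ σ i' μ : ℤ) * ((l μ).val : ℤ) + w μ) -
        (size L τ σ i' μ : ℤ) * ((l μ).val : ℤ) := by ring
    rw [e]
    exact dvd_sub h1 h2

end

/-! ### The symbol of the averaging operator -/

theorem sum_Icc_exp {R : ℕ} (hR : Odd R) (θ : ℂ) :
    ∑ x ∈ Finset.Icc (-(((R : ℤ) - 1) / 2)) (((R : ℤ) - 1) / 2),
      Complex.exp (Complex.I * (θ * (x : ℂ))) = R * avg R θ := by
  obtain ⟨h, rfl⟩ := hR
  have h0 : (((2 * h + 1 : ℕ) : ℤ) - 1) / 2 = h := by push_cast; omega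
  have hne : ((2 * h + 1 : ℕ) : ℂ) ≠ 0 := Nat.cast_ne_zero.2 (by omega)
  rw [h0]
  unfold avg
  rw [mul_inv_cancel_left₀ hne]
  symm
  refine Finset.sum_bij (fun x _ => (x : ℤ) - h) ?_ ?_ ?_ ?_
  · intro x hx
    rw [Finset.mem_range] at hx
    rw [Finset.mem_Icc]
    omega
  · intro x _ y _ hxy
    omega
  · intro y hy
    rw [Finset.mem_Icc] at hy
    refine ⟨(y + h).toNat, ?_, ?_⟩
    · rw [Finset.mem_range]; omega
    · omega
  · intro x _
    congr 1
    push_cast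
    ring

theorem sum_box_phase {L : ℕ} (hL : Odd L) (θ : Fin 4 → ℝ) :
    ∑ b ∈ box L, phase θ b = (L : ℂ) ^ 5 * ∏ μ, avg (pscale L μ) (θ μ) := by
  have h1 : ∀ b : ℤ × (Fin 3 → ℤ), phase θ b = Complex.exp (Complex.I * ((θ 0 : ℂ) * b.1)) *
      ∏ ν : Fin 3, Complex.exp (Complex.I * ((θ ν.succ : ℂ) * b.2 ν)) := fun b => by
    rw [← Complex.exp_sum, ← Complex.exp_add, ← Finset.mul_sum, ← mul_add]
    rfl
  have h2 := sum_Icc_exp (hL.pow (n := 2)) (θ 0)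
  push_cast at h2
  unfold box
  simp only [h1]
  rw [Finset.sum_product]
  simp only [← Finset.mul_sum]
  rw [← Finset.sum_mul, h2, Fin.prod_univ_succ, pscale_zero]
  have h3 : ∑ y ∈ Fintype.piFinset fun _ : Fin 3 => Finset.Icc (-(((L : ℤ) - 1) / 2)) (((L : ℤ) - 1) / 2),
      ∏ ν : Fin 3, Complex.exp (Complex.I * ((θ ν.succ : ℂ) * y ν)) =
      ∏ ν : Fin 3, (L * avg L (θ ν.succ)) := by
    rw [← Finset.prod_univ_sum (fun _ : Fin 3 => Finset.Icc (-(((L : ℤ) - 1) / 2)) (((L : ℤ) - 1) / 2))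
      (fun ν x => Complex.exp (Complex.I * ((θ ν.succ : ℂ) * (x : ℂ))))]
    exact Finset.prod_congr rfl fun ν _ => sum_Icc_exp hL (θ ν.succ)
  rw [h3, Finset.prod_mul_distrib]
  simp only [pscale_succ, Finset.prod_const, Finset.card_univ, Fintype.card_fin]
  ring

/-- Convolution with the box multiplies the Fourier series by the sum of the plane wave over the
box. -/
theorem hasSum_boxConv_phase (L : ℕ) (θ : Fin 4 → ℝ) (r : ℕ) :
    HasSum (fun x => (boxConv L r x : ℂ) * phase θ x) ((∑ b ∈ box L, phase θ b) ^ r) := by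
  induction r with
  | zero =>
    have := hasSum_single (f := fun x => (boxConv L 0 x : ℂ) * phase θ x) 0 (fun x hx => by
      simp only [boxConv, Pi.single_eq_of_ne hx]; simp)
    simpa [boxConv, phase_zero_right] using this
  | succ r ih =>
    have h1 : ∀ b ∈ box L, HasSum (fun x => (boxConv L r (x - b) : ℂ) * phase θ x)
        ((∑ b ∈ box L, phase θ b) ^ r * phase θ b) := by
      intro b _
      have h2 := (Equiv.subRight b).hasSum_iff.2 (ih.mul_right (phase θ b))
      refine HasSum.congr_fun h2 fun x => ?_
      simp only [Function.comp, Equiv.subRight_apply]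
      rw [mul_assoc, ← phase_add, sub_add_cancel]
    have h3 := hasSum_sum h1
    rw [← Finset.mul_sum, ← pow_succ] at h3
    refine HasSum.congr_fun h3 fun x => ?_
    simp only [boxConv]
    push_cast
    rw [Finset.sum_mul]

theorem hasSum_profile_phase {L : ℕ} (hL : Odd L) (𝔮 : ℕ) (θ : Fin 4 → ℝ) :
    HasSum (fun x => (profile L 𝔮 x : ℂ) * phase θ x) (blockSym 𝔮 (pscale L) (toC θ)) := by
  have h1 := (hasSum_boxConv_phase L θ 𝔮).mul_left (((L : ℂ) ^ (5 * 𝔮))⁻¹)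
  have hne : (L : ℂ) ≠ 0 := Nat.cast_ne_zero.2 hL.pos.ne'
  have h2 : ((L : ℂ) ^ (5 * 𝔮))⁻¹ * (∑ b ∈ box L, phase θ b) ^ 𝔮 =
      blockSym 𝔮 (pscale L) (toC θ) := by
    rw [sum_box_phase hL, mul_pow, ← pow_mul, inv_mul_cancel_left₀ (pow_ne_zero _ hne), blockSym,
      Finset.prod_pow]
    rfl
  rw [h2] at h1
  refine HasSum.congr_fun h1 fun x => ?_
  simp only [profile]
  push_cast
  ring

theorem blockSym_neg (𝔮 : ℕ) (s : Fin 4 → ℕ) (θ : Fin 4 → ℂ) :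
    blockSym 𝔮 s (-θ) = blockSym 𝔮 s θ := by
  unfold blockSym
  simp only [Pi.neg_apply, avg_neg]

/-- Convolution type operators act on characters by multiplication. -/
theorem hasSum_ite_mulVec {X : Type*} {L τ σ : ℕ} [NeZero L] {j : ℤ} {i : ℕ} {q : X → ℂ}
    (hq : Summable q) (p : X → Site L τ σ j i) (g : Site L τ σ j i → ℂ) :
    HasSum (fun x => q x * g (p x)) (∑ u, (∑' x, if p x = u then q x else 0) * g u) := by
  have h1 : ∀ u ∈ (Finset.univ : Finset (Site L τ σ j i)),
      HasSum (fun x => (if p x = u then q x else 0) * g u)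
        ((∑' x, if p x = u then q x else 0) * g u) := by
    intro u _
    refine HasSum.mul_right _ (Summable.hasSum ?_)
    refine Summable.of_norm_bounded hq.norm fun x => ?_
    split_ifs
    · exact le_rfl
    · simp
  refine HasSum.congr_fun (hasSum_sum h1) fun x => ?_
  simp

theorem phase_zero_left (x : ℤ × (Fin 3 → ℤ)) : phase 0 x = 1 := by simp [phase]

section

variable {L τ σ : ℕ} [NeZero L] {i : ℕ}

theorem chi_incl (w : Fin 4 → ℤ) (y : Site L τ σ (-1) i) : chi w (incl y) = chi w y := by
  unfold incl
  rw [chi_ofInt]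
  have hL : (L : ℂ) ≠ 0 := Nat.cast_ne_zero.2 (NeZero.ne L)
  unfold chi phase
  congr 2
  simp only [momZ, size_zero, size_succ, Site.rep]
  congr 1
  · push_cast
    field_simp
    ring
  · refine Finset.sum_congr rfl fun ν _ => ?_
    push_cast
    field_simp
    ring

/-- χ_w restricts to the character with the same integer label on the coarse torus (`chi_incl`), and
the average over x is the Fourier series of the profile. -/
theorem Q_mulVec_chi (hL : Odd L) (𝔮 : ℕ) (w : Fin 4 → ℤ) :
    (Q L τ σ 𝔮 i).mulVec (chi w) =
      blockSym 𝔮 (pscale L) (toC (momZ (size L τ σ (i + 1)) w)) • chi w := by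
  ext y
  have hq : Summable fun x => (profile L 𝔮 x : ℂ) := by
    have := (hasSum_profile_phase hL 𝔮 0).summable
    simpa [phase_zero_left] using this
  have h1 := hasSum_ite_mulVec hq (fun x => incl y + (Site.ofInt x : Site L τ σ 0 (i + 1))) (chi w)
  have h2 := (hasSum_profile_phase hL 𝔮 (momZ (size L τ σ (i + 1)) w)).mul_right (chi w y)
  refine HasSum.unique (HasSum.congr_fun h1 fun x => ?_) h2
  rw [chi_add, chi_incl, chi_ofInt]
  ring

end

/-! ### The symbol of `D_0` -/

open scoped Matrix.Norms.Operator in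
theorem exp_mulVec {ι : Type*} [Fintype ι] [DecidableEq ι] {A : Matrix ι ι ℂ} {v : ι → ℂ} {c : ℂ}
    (h : A.mulVec v = c • v) : (NormedSpace.exp A).mulVec v = Complex.exp c • v := by
  have hpow : ∀ n : ℕ, (A ^ n).mulVec v = c ^ n • v := by
    intro n
    induction n with
    | zero => simp
    | succ n ih => rw [pow_succ, ← Matrix.mulVec_mulVec, h, Matrix.mulVec_smul, ih, smul_smul,
        pow_succ, mul_comm]
  have h1 := NormedSpace.exp_series_hasSum_exp' (𝕂 := ℂ) A
  have h2 := NormedSpace.exp_series_hasSum_exp' (𝕂 := ℂ) c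
  rw [← Complex.exp_eq_exp_ℂ] at h2
  ext i
  have h3 : HasSum (fun n : ℕ => ((n.factorial : ℂ)⁻¹ • A ^ n).mulVec v i)
      ((NormedSpace.exp A).mulVec v i) := by
    simp only [Matrix.mulVec, dotProduct]
    refine hasSum_sum fun k _ => HasSum.mul_right _ ?_
    exact (Pi.hasSum.1 (Pi.hasSum.1 h1 i) k)
  refine HasSum.unique h3 ?_
  refine HasSum.congr_fun (h2.mul_right (v i)) fun n => ?_
  rw [Matrix.smul_mulVec, hpow]
  simp [mul_assoc]

section

variable {L τ σ : ℕ} [NeZero L] {i : ℕ} {h : (Fin 3 → ℤ) → ℂ} {hhat : (Fin 3 → ℂ) → ℂ}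

theorem ham_mulVec_chi (H : IsHamiltonian h hhat) (w : Fin 4 → ℤ) :
    (ham L τ σ h i).mulVec (chi w) =
      (hhat fun ν => (momZ (size L τ σ i) w ν.succ : ℂ)) • chi w := by
  ext u
  have hq : Summable h := by
    have := (H.hasSum 0).summable
    simpa using this
  have h1 := hasSum_ite_mulVec hq
    (fun z => u - (Site.ofInt (0, z) : Site L τ σ 0 i)) (chi w)
  have h2 := (H.hasSum fun ν => momZ (size L τ σ i) w ν.succ).mul_right (chi w u)
  have h3 : ∀ u', ham L τ σ h i u u' =
      ∑' z, if u - (Site.ofInt (0, z) : Site L τ σ 0 i) = u' then h z else 0 := by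
    intro u'
    have h4 : ∀ z : Fin 3 → ℤ, u - (Site.ofInt (0, z) : Site L τ σ 0 i) = u' ↔
        u.1 = u'.1 ∧ (fun ν => ((z ν : ℤ) : ZMod (L ^ (i + σ)))) = u.2 - u'.2 := by
      intro z
      have e0 : u - (Site.ofInt (0, z) : Site L τ σ 0 i) = u' ↔
          (Site.ofInt (0, z) : Site L τ σ 0 i) = u - u' :=
        ⟨fun e => by rw [← e]; abel, fun e => by rw [e]; abel⟩
      rw [e0]
      constructor
      · intro e
        have e1 : ((0 : ℤ) : ZMod (L ^ (2 * i + τ))) = u.1 - u'.1 := congrArg Prod.fst e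
        rw [Int.cast_zero] at e1
        exact ⟨sub_eq_zero.1 e1.symm, congrArg Prod.snd e⟩
      · rintro ⟨e1, e2⟩
        refine Prod.ext ?_ e2
        have e3 : ((0 : ℤ) : ZMod (L ^ (2 * i + τ))) = u.1 - u'.1 := by rw [e1]; simp
        exact e3
    unfold ham
    simp only [h4]
    by_cases h5 : u.1 = u'.1
    · rw [if_pos h5]
      simp only [h5, true_and]
    · rw [if_neg h5]
      simp [h5]
  have h6 : (ham L τ σ h i).mulVec (chi w) u =
      ∑ u', (∑' z, if u - (Site.ofInt (0, z) : Site L τ σ 0 i) = u' then h z else 0) * chi w u' := by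
    simp only [Matrix.mulVec, dotProduct, h3]
  rw [h6]
  refine HasSum.unique h1 (HasSum.congr_fun h2 fun z => ?_)
  rw [sub_eq_add_neg, chi_add, chi_neg, chi_neg_left, chi_ofInt, mul_assoc, mul_comm (chi w u)]
  congr 2
  unfold phase
  rw [← Complex.exp_neg]
  congr 1
  simp

theorem D0_mulVec_chi (H : IsHamiltonian h hhat) (w : Fin 4 → ℤ) :
    (D0 L τ σ h i).mulVec (chi w) = heatSym hhat (toC (momZ (size L τ σ i) w)) • chi w := by
  have h1 : (-ham L τ σ h i).mulVec (chi w) =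
      (-hhat fun ν => (momZ (size L τ σ i) w ν.succ : ℂ)) • chi w := by
    rw [Matrix.neg_mulVec, ham_mulVec_chi H, neg_smul]
  have h2 := exp_mulVec h1
  have h3 : (timeDeriv L τ σ i).mulVec (chi w) =
      (Complex.exp (Complex.I * (momZ (size L τ σ i) w 0 : ℂ)) - 1) • chi w := by
    ext u
    have h4 : (timeDeriv L τ σ i).mulVec (chi w) u =
        chi w (u + (Site.ofInt (1, 0) : Site L τ σ 0 i)) - chi w u := by
      simp only [Matrix.mulVec, dotProduct, timeDeriv, sub_mul, ite_mul, one_mul, zero_mul,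
        Finset.sum_sub_distrib, Finset.sum_ite_eq', Finset.mem_univ, if_true]
    rw [h4, chi_add, chi_ofInt]
    have h5 : phase (momZ (size L τ σ i) w) (1, 0) =
        Complex.exp (Complex.I * (momZ (size L τ σ i) w 0 : ℂ)) := by
      unfold phase; simp
    rw [h5, Pi.smul_apply, smul_eq_mul]
    ring
  unfold D0
  rw [Matrix.sub_mulVec, Matrix.sub_mulVec, Matrix.one_mulVec, ← Matrix.mulVec_mulVec, h3,
    Matrix.mulVec_smul, h2]
  ext u
  simp only [Pi.sub_apply, Pi.smul_apply, smul_eq_mul, heatSym, toC]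
  ring

end

/-! ### The symbols of the composed operators -/

theorem prod_pscale (S : ℕ) : ∏ μ, (pscale S μ : ℂ) = (S : ℂ) ^ 5 := by
  rw [Fin.prod_univ_succ]
  simp only [pscale_zero, pscale_succ, Finset.prod_const, Finset.card_univ, Fintype.card_fin]
  push_cast
  ring

theorem ParabolicSymbol.re_nonneg_real {c C m₀ κ : ℝ} {f : (Fin 4 → ℂ) → ℂ}
    (hf : ParabolicSymbol c C m₀ κ f) (θ : Fin 4 → ℝ) : 0 ≤ (f (toC θ)).re := by
  obtain ⟨θ', z, hθ', hz⟩ := exists_cell θ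
  have h : f (toC θ) = f (toC θ') := IsPeriodic.congr_int hf.per z fun μ => by
    simp only [toC, hz μ]; push_cast; rfl
  rw [h]
  exact hf.re_nonneg θ' hθ'

theorem fib_toC_eq (s : Fin 4 → ℕ) (K : Fin 4 → ℝ) (l : ∀ μ, ZMod (s μ)) :
    fib s (toC K) l = toC fun μ => (K μ + 2 * Real.pi * (l μ).val) / s μ := by
  ext μ
  simp only [fib, toC]
  push_cast
  rfl

theorem blockSym_mul (𝔮 L S : ℕ) (θ : Fin 4 → ℂ) :
    blockSym 𝔮 (pscale (L * S)) θ =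
      blockSym 𝔮 (pscale L) θ * blockSym 𝔮 (pscale S) fun μ => pscale L μ * θ μ := by
  unfold blockSym
  rw [← Finset.prod_mul_distrib]
  refine Finset.prod_congr rfl fun μ _ => ?_
  rw [pscale_mul, avg_mul, mul_pow]

section

variable {L τ σ : ℕ} [NeZero L]

/-- Characters depend on integer coordinates only, so conjugation by scalings leaves the identity
unchanged by definition. -/
theorem rescale_mulVec_chi {k k' : ℤ} {i i' : ℕ} (j j' : ℤ)
    {A : Matrix (Site L τ σ k' i') (Site L τ σ k i) ℂ} {w w' : Fin 4 → ℤ} {c : ℂ}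
    (h : A.mulVec (chi w) = c • chi w') : (rescale j j' A).mulVec (chi w) = c • chi w' := h

/-- By `blockSym_mul` the symbols of the successive averages, each at its own scale, telescope into
the symbol of a single average over blocks of side L^j (L^{2j} in time). -/
theorem Qit_mulVec_chi (hL : Odd L) (𝔮 j : ℕ) (w : Fin 4 → ℤ) :
    (Qit L τ σ 𝔮 j).mulVec (chi w) =
      blockSym 𝔮 (pscale (L ^ j)) (toC (momZ (size L τ σ (j + 1)) w)) • chi w := by
  induction j with
  | zero =>
    have h1 : blockSym 𝔮 (pscale (L ^ 0)) (toC (momZ (size L τ σ (0 + 1)) w)) = 1 := by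
      unfold blockSym pscale
      refine Finset.prod_eq_one fun μ _ => ?_
      have : (if μ = 0 then (L ^ 0) ^ 2 else L ^ 0) = 1 := by split_ifs <;> simp
      rw [this, avg_one, one_pow]
    rw [h1, one_smul]
    exact Matrix.one_mulVec _
  | succ j ih =>
    have h1 := rescale_mulVec_chi ((j + 1 : ℕ) : ℤ) (j : ℤ)
      (Q_mulVec_chi (τ := τ) (σ := σ) (i := j + 1) hL 𝔮 w)
    change (Qit L τ σ 𝔮 j * rescale ((j + 1 : ℕ) : ℤ) (j : ℤ) (Q L τ σ 𝔮 (j + 1))).mulVec _ = _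
    rw [← Matrix.mulVec_mulVec, h1, Matrix.mulVec_smul, ih, smul_smul, pow_succ', blockSym_mul]
    congr 3
    ext μ
    have h2 : size L τ σ (j + 1 + 1) μ = pscale L μ * size L τ σ (j + 1) μ := by
      have := size_add L τ σ (j + 1) 1 μ
      rwa [pow_one, add_comm] at this
    have h3 : (pscale L μ : ℂ) ≠ 0 := Nat.cast_ne_zero.2 (NeZero.ne _)
    simp only [toC, momZ, h2]
    push_cast
    field_simp

/-- The ratio ε_0⁵/ε_j⁵ = L^{5j} in the adjoint is the number of points in a block, which is the
prefactor in `transpose_mulVec_chi`. -/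
theorem adj_Qit_mulVec_chi (hL : Odd L) (𝔮 j : ℕ) (k : Fin 4 → ℤ) :
    (adj (Qit L τ σ 𝔮 j)).mulVec (chi k) =
      ∑ l, blockSym 𝔮 (pscale (L ^ j)) (fib (pscale (L ^ j)) (toC (momZ (size L τ σ 1) k)) l) •
        chi (k + fun μ => (size L τ σ 1 μ : ℤ) * ((l μ).val : ℤ)) := by
  have h1 := transpose_mulVec_chi (B := Qit L τ σ 𝔮 j) (s := pscale (L ^ j))
    (isPeriodic_blockSym 𝔮 (odd_pscale (hL.pow (n := j)))) (blockSym_neg 𝔮 _)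
    (size_add L τ σ 1 j) (Qit_mulVec_chi hL 𝔮 j) k
  rw [← h1, prod_pscale, adj, Matrix.smul_mulVec]
  congr 1
  have hL0 : (L : ℝ) ≠ 0 := Nat.cast_ne_zero.2 (NeZero.ne L)
  unfold eps
  push_cast
  rw [zpow_neg (L : ℂ) (j : ℤ), zpow_natCast]
  simp

theorem adj_Q_mulVec_chi (hL : Odd L) (𝔮 : ℕ) (k : Fin 4 → ℤ) :
    (adj (Q L τ σ 𝔮 0)).mulVec (chi k) =
      ∑ l, blockSym 𝔮 (pscale L) (fib (pscale L) (toC (momZ (size L τ σ 0) k)) l) •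
        chi (k + fun μ => (size L τ σ 0 μ : ℤ) * ((l μ).val : ℤ)) := by
  have h0 : ∀ μ, size L τ σ (0 + 1) μ = pscale L μ * size L τ σ 0 μ := fun μ => by
    have := size_add L τ σ 0 1 μ
    rwa [pow_one] at this
  have h1 := transpose_mulVec_chi (B := Q L τ σ 𝔮 0) (s := pscale L)
    (isPeriodic_blockSym 𝔮 (odd_pscale hL)) (blockSym_neg 𝔮 _) h0 (Q_mulVec_chi hL 𝔮) k
  rw [← h1, prod_pscale, adj, Matrix.smul_mulVec]
  congr 1
  unfold eps
  push_cast
  simp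

theorem chi_add_size_mul {j : ℤ} {i : ℕ} (k z : Fin 4 → ℤ) :
    (chi (k + fun μ => (size L τ σ i μ : ℤ) * z μ) : Site L τ σ j i → ℂ) = chi k :=
  smul_chi_congr fun μ => by simp

theorem Qit_mul_adj_mulVec_chi (hL : Odd L) (𝔮 j : ℕ) (k : Fin 4 → ℤ) :
    (Qit L τ σ 𝔮 j * adj (Qit L τ σ 𝔮 j)).mulVec (chi k) =
      (∑ l, blockSym 𝔮 (pscale (L ^ j))
        (fib (pscale (L ^ j)) (toC (momZ (size L τ σ 1) k)) l) ^ 2) • chi k := by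
  rw [← Matrix.mulVec_mulVec, adj_Qit_mulVec_chi hL, Matrix.mulVec_sum, Finset.sum_smul]
  refine Finset.sum_congr rfl fun l _ => ?_
  rw [Matrix.mulVec_smul, Qit_mulVec_chi hL, smul_smul, chi_add_size_mul,
    momZ_add_mul (size_add L τ σ 1 j) (fun μ => NeZero.ne _) k l (fun μ => NeZero.ne _), sq]

theorem frakQ_mulVec_chi (hL : Odd L) (hL2 : 2 ≤ L) {𝔮 : ℕ} (h𝔮 : 1 ≤ 𝔮) {a : ℝ} (ha : 0 < a)
    (n : ℕ) (k : Fin 4 → ℤ) : (frakQ L τ σ 𝔮 a n).mulVec (chi k) =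
      (rhoSym 𝔮 L a n (toC (momZ (size L τ σ 1) k)))⁻¹ • chi k := by
  have ha0 : (a : ℂ) ≠ 0 := by exact_mod_cast ha.ne'
  have hρ : ∀ k : Fin 4 → ℤ, rhoSym 𝔮 L a n (toC (momZ (size L τ σ 1) k)) ≠ 0 := fun k h0 => by
    have := (rhoSym_bounds (n := n) ha hL2 h𝔮 (momZ (size L τ σ 1) k)).1
    rw [h0, Complex.zero_re] at this
    have := inv_pos.2 ha
    linarith
  have h1 : ∀ k : Fin 4 → ℤ, (1 + ∑ j ∈ Finset.Icc 1 (n - 1),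
      ((L : ℂ) ^ (2 * j))⁻¹ • (Qit L τ σ 𝔮 j * adj (Qit L τ σ 𝔮 j))).mulVec (chi k) =
      ((a : ℂ) * rhoSym 𝔮 L a n (toC (momZ (size L τ σ 1) k))) • chi k := by
    intro k
    rw [Matrix.add_mulVec, Matrix.one_mulVec, Matrix.sum_mulVec]
    simp only [Matrix.smul_mulVec, Qit_mul_adj_mulVec_chi hL, smul_smul]
    unfold rhoSym
    rw [mul_inv_cancel_left₀ ha0, add_smul, one_smul, Finset.sum_smul]
  have h2 := (isUnit_of_mulVec_chi h1 fun k => mul_ne_zero ha0 (hρ k)).2 k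
  unfold frakQ
  rw [Matrix.smul_mulVec, h2, smul_smul]
  congr 1
  have := hρ k
  field_simp

variable {h : (Fin 3 → ℤ) → ℂ} {hhat : (Fin 3 → ℂ) → ℂ}

theorem D_mulVec_chi (H : IsHamiltonian h hhat) (n : ℕ) (w : Fin 4 → ℤ) :
    (D L τ σ h n).mulVec (chi w) = (((L ^ n : ℕ) : ℂ) ^ 2 *
      heatSym hhat (toC (momZ (size L τ σ (n + 1)) w))) • chi w := by
  have h1 := rescale_mulVec_chi (n : ℤ) (n : ℤ)
    (D0_mulVec_chi (L := L) (τ := τ) (σ := σ) (i := n + 1) H w)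
  unfold D
  rw [Matrix.smul_mulVec, h1, smul_smul]
  congr 2
  push_cast
  ring

theorem re_fibSym_heatSym (H : IsHamiltonian h hhat) (S : ℕ) (t : ℝ) (K : Fin 4 → ℝ)
    (l : ∀ μ, ZMod (pscale S μ)) :
    (S : ℝ) ^ 2 * t ≤ (fibSym S (heatSym hhat) t (toC K) l).re := by
  obtain ⟨c, C, -, -, hP⟩ := H.exists_parabolicSymbol
  have h1 := (hP 1 one_pos le_rfl).re_nonneg_real fun μ => (K μ + 2 * Real.pi * (l μ).val) / pscale S μ
  unfold fibSym
  rw [fib_toC_eq, ← Complex.ofReal_natCast, ← Complex.ofReal_pow, Complex.re_ofReal_mul,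
    Complex.add_re, Complex.ofReal_re]
  gcongr
  linarith

theorem isUnit_D_add (H : IsHamiltonian h hhat) (n : ℕ) {t : ℝ} (ht : 0 < t) :
    IsUnit (D L τ σ h n + (t : ℂ) • 1) ∧ ∀ w, (D L τ σ h n + (t : ℂ) • 1)⁻¹.mulVec (chi w) =
      (((L ^ n : ℕ) : ℂ) ^ 2 * heatSym hhat (toC (momZ (size L τ σ (n + 1)) w)) + t)⁻¹ • chi w := by
  obtain ⟨c, C, -, -, hP⟩ := H.exists_parabolicSymbol
  refine isUnit_of_mulVec_chi (fun w => ?_) fun w h0 => ?_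
  · rw [Matrix.add_mulVec, Matrix.smul_mulVec, Matrix.one_mulVec, D_mulVec_chi H, add_smul]
  · have h1 := (hP 1 one_pos le_rfl).re_nonneg_real (momZ (size L τ σ (n + 1)) w)
    have h2 := congrArg Complex.re h0
    rw [← Nat.cast_pow, ← Complex.ofReal_natCast, Complex.add_re, Complex.re_ofReal_mul,
      Complex.ofReal_re, Complex.zero_re] at h2
    have : 0 ≤ (((L ^ n) ^ 2 : ℕ) : ℝ) * (heatSym hhat (toC (momZ (size L τ σ (n + 1)) w))).re := by
      positivity
    linarith

/-- `ρ + ∑ U² / (D + t)` on the fibre over `k`. -/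
def resolventSym (𝔮 L : ℕ) [NeZero L] (a : ℝ) (f : (Fin 4 → ℂ) → ℂ) (n : ℕ) (t : ℝ)
    (k : Fin 4 → ℂ) : ℂ :=
  rhoSym 𝔮 L a n k + ∑ l, blockSym 𝔮 (pscale (L ^ n)) (fib (pscale (L ^ n)) k l) ^ 2 /
    fibSym (L ^ n) f (t / ((L ^ n : ℕ) : ℝ) ^ 2) k l

/-- The squares of the real block symbols are divided by numbers of nonnegative real part, and ρ
contributes at least 1/a. This makes the denominator of Δ^{(n)} invertible for every t > 0. -/
theorem re_resolventSym (H : IsHamiltonian h hhat) (hL2 : 2 ≤ L) {𝔮 : ℕ} (h𝔮 : 1 ≤ 𝔮)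
    {a : ℝ} (ha : 0 < a) (n : ℕ) {t : ℝ} (ht : 0 < t) (K : Fin 4 → ℝ) :
    0 < (resolventSym 𝔮 L a (heatSym hhat) n t (toC K)).re := by
  unfold resolventSym
  rw [Complex.add_re, Complex.re_sum]
  have h1 := (rhoSym_bounds (n := n) ha hL2 h𝔮 K).1
  have h2 := inv_pos.2 ha
  have h3 : 0 ≤ ∑ l, (blockSym 𝔮 (pscale (L ^ n)) (fib (pscale (L ^ n)) (toC K) l) ^ 2 /
      fibSym (L ^ n) (heatSym hhat) (t / ((L ^ n : ℕ) : ℝ) ^ 2) (toC K) l).re := by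
    refine Finset.sum_nonneg fun l _ => ?_
    refine FiberData.re_sq_div (v := fun l => blockSym 𝔮 (pscale (L ^ n))
      (fib (pscale (L ^ n)) (toC K) l)) (d := fibSym (L ^ n) (heatSym hhat)
        (t / ((L ^ n : ℕ) : ℝ) ^ 2) (toC K)) (fun i => blockSym_fib_im K i) (fun i => ?_) l
    exact le_trans (by positivity) (re_fibSym_heatSym H (L ^ n) _ K i)
  linarith

theorem deltaDen_mulVec_chi (H : IsHamiltonian h hhat) (hL : Odd L) (hL2 : 2 ≤ L) {𝔮 : ℕ}
    (h𝔮 : 1 ≤ 𝔮) {a : ℝ} (ha : 0 < a) (n : ℕ) {t : ℝ} (ht : 0 < t) (k : Fin 4 → ℤ) :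
    (deltaDen L τ σ 𝔮 a h n t).mulVec (chi k) =
      ((rhoSym 𝔮 L a n (toC (momZ (size L τ σ 1) k)))⁻¹ *
        resolventSym 𝔮 L a (heatSym hhat) n t (toC (momZ (size L τ σ 1) k))) • chi k := by
  have hρ : rhoSym 𝔮 L a n (toC (momZ (size L τ σ 1) k)) ≠ 0 := fun h0 => by
    have := (rhoSym_bounds (n := n) ha hL2 h𝔮 (momZ (size L τ σ 1) k)).1
    rw [h0, Complex.zero_re] at this
    have := inv_pos.2 ha
    linarith
  have hD := (isUnit_D_add (L := L) (τ := τ) (σ := σ) H n ht).2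
  have hS0 : ((L ^ n : ℕ) : ℂ) ≠ 0 := Nat.cast_ne_zero.2 (NeZero.ne _)
  unfold deltaDen
  rw [Matrix.add_mulVec, Matrix.one_mulVec, ← Matrix.mulVec_mulVec, adj_Qit_mulVec_chi hL,
    ← Matrix.mulVec_mulVec, Matrix.mulVec_sum, ← Matrix.mulVec_mulVec, Matrix.mulVec_sum]
  have h1 : ∀ l, (Qit L τ σ 𝔮 n).mulVec ((D L τ σ h n + (t : ℂ) • 1)⁻¹.mulVec
      (blockSym 𝔮 (pscale (L ^ n)) (fib (pscale (L ^ n)) (toC (momZ (size L τ σ 1) k)) l) •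
        chi (k + fun μ => (size L τ σ 1 μ : ℤ) * ((l μ).val : ℤ)))) =
      (blockSym 𝔮 (pscale (L ^ n)) (fib (pscale (L ^ n)) (toC (momZ (size L τ σ 1) k)) l) ^ 2 /
        fibSym (L ^ n) (heatSym hhat) (t / ((L ^ n : ℕ) : ℝ) ^ 2)
          (toC (momZ (size L τ σ 1) k)) l) • chi k := by
    intro l
    rw [Matrix.mulVec_smul, hD, smul_smul, Matrix.mulVec_smul, Qit_mulVec_chi hL, smul_smul,
      chi_add_size_mul,
      momZ_add_mul (size_add L τ σ 1 n) (fun μ => NeZero.ne _) k l (fun μ => NeZero.ne _)]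
    congr 1
    unfold fibSym
    have : ((L ^ n : ℕ) : ℂ) ^ 2 * (heatSym hhat (fib (pscale (L ^ n))
        (toC (momZ (size L τ σ 1) k)) l) + ((t / ((L ^ n : ℕ) : ℝ) ^ 2 : ℝ) : ℂ)) =
        ((L ^ n : ℕ) : ℂ) ^ 2 * heatSym hhat (fib (pscale (L ^ n))
        (toC (momZ (size L τ σ 1) k)) l) + t := by
      rw [mul_add]
      congr 1
      push_cast
      push_cast at hS0
      field_simp
    rw [this]
    ring
  simp only [h1]
  rw [← Finset.sum_smul, Matrix.mulVec_smul, frakQ_mulVec_chi hL hL2 h𝔮 ha, smul_smul]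
  nth_rewrite 1 [← one_smul ℂ (chi k)]
  rw [← add_smul]
  congr 1
  unfold resolventSym
  rw [mul_add, inv_mul_cancel₀ hρ]
  ring

end

/-! ### Translation invariant operators and the effective operator -/

section

variable {L τ σ : ℕ} [NeZero L] {j : ℤ} {i : ℕ} {ι : Type*}

theorem ofChar_mulVec (F : (∀ μ, ZMod (size L τ σ i μ)) → ι → ℂ) (w : ∀ μ, ZMod (size L τ σ i μ)) :
    (ofChar F : Matrix ι (Site L τ σ j i) ℂ).mulVec (chi (wrep w)) = F w := by
  have h1 : ∀ w' : (∀ μ, ZMod (size L τ σ i μ)),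
      ∑ v : Site L τ σ j i, chi (-wrep w') v * chi (wrep w) v =
        if w' = w then ∏ μ, (size L τ σ i μ : ℂ) else 0 := by
    intro w'
    simp only [← chi_add_left, sum_chi]
    congr 1
    rw [eq_iff_iff, funext_iff]
    refine forall_congr' fun μ => ?_
    have h2 : (-wrep w' + wrep w) μ = ((w μ).val : ℤ) - ((w' μ).val : ℤ) := by
      simp only [wrep, Pi.add_apply, Pi.neg_apply]; ring
    rw [h2, ← ZMod.intCast_eq_intCast_iff_dvd_sub]
    simp
  ext u
  simp only [Matrix.mulVec, dotProduct, ofChar]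
  have h3 : ∀ v : Site L τ σ j i, (∏ μ, (size L τ σ i μ : ℂ))⁻¹ * (∑ w', F w' u * chi (-wrep w') v) * chi (wrep w) v =
      ∑ w', (∏ μ, (size L τ σ i μ : ℂ))⁻¹ * F w' u * (chi (-wrep w') v * chi (wrep w) v) := by
    intro v
    rw [Finset.mul_sum, Finset.sum_mul]
    exact Finset.sum_congr rfl fun w' _ => by ring
  simp only [h3]
  rw [Finset.sum_comm]
  simp only [← Finset.mul_sum, h1, mul_ite, mul_zero, Finset.sum_ite_eq', Finset.mem_univ, if_true]
  rw [mul_right_comm, inv_mul_cancel₀ prod_size_ne_zero, one_mul]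

theorem exists_wrep (w : Fin 4 → ℤ) : ∃ w₀ : (∀ μ, ZMod (size L τ σ i μ)),
    ∀ μ, (size L τ σ i μ : ℤ) ∣ w μ - wrep w₀ μ := by
  refine ⟨fun μ => (w μ : ZMod (size L τ σ i μ)), fun μ => ?_⟩
  rw [← ZMod.intCast_eq_intCast_iff_dvd_sub]
  simp [wrep]

variable (L τ σ j i) in
/-- The translation invariant operator with symbol `f`. -/
def symOp (f : (Fin 4 → ℂ) → ℂ) : Matrix (Site L τ σ j i) (Site L τ σ j i) ℂ :=
  ofChar fun w => f (toC (mom (size L τ σ i) w)) • chi (wrep w)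

theorem symOp_mulVec_chi {f : (Fin 4 → ℂ) → ℂ} (hf : IsPeriodic f) (w : Fin 4 → ℤ) :
    (symOp L τ σ j i f).mulVec (chi w) = f (toC (momZ (size L τ σ i) w)) • chi w := by
  obtain ⟨w₀, hw⟩ := exists_wrep (L := L) (τ := τ) (σ := σ) (i := i) w
  rw [smul_chi_congr hw, hf.momZ_congr (fun μ => NeZero.ne _) hw, momZ_wrep]
  exact ofChar_mulVec _ _

/-- Parseval: the quadratic form is the average of f weighted by squared moduli of Fourier
coefficients. -/
theorem re_dotProduct_symOp_nonneg {f : (Fin 4 → ℂ) → ℂ} (hf : ∀ θ : Fin 4 → ℝ, 0 ≤ (f (toC θ)).re)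
    (v : Site L τ σ j i → ℂ) : 0 ≤ (star v ⬝ᵥ (symOp L τ σ j i f).mulVec v).re := by
  have h1 : star v ⬝ᵥ (symOp L τ σ j i f).mulVec v =
      (((∏ μ, (size L τ σ i μ : ℝ))⁻¹ : ℝ) : ℂ) * ∑ w, f (toC (mom (size L τ σ i) w)) *
        ((Complex.normSq (∑ u, chi (-wrep w) u * v u) : ℝ) : ℂ) := by
    have h2 : ∀ w : (∀ μ, ZMod (size L τ σ i μ)),
        ((Complex.normSq (∑ u, chi (-wrep w) u * v u) : ℝ) : ℂ) =
        (∑ u, star (v u) * chi (wrep w) u) * ∑ u, chi (-wrep w) u * v u := by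
      intro w
      rw [Complex.normSq_eq_conj_mul_self, map_sum]
      congr 1
      refine Finset.sum_congr rfl fun u _ => ?_
      rw [map_mul, conj_chi, neg_neg, mul_comm]
      rfl
    simp only [h2, dotProduct, Matrix.mulVec, symOp, ofChar, Pi.star_apply, Pi.smul_apply,
      smul_eq_mul]
    push_cast
    simp only [Finset.mul_sum, Finset.sum_mul]
    rw [Finset.sum_congr rfl fun u _ => Finset.sum_comm, Finset.sum_comm]
    refine Finset.sum_congr rfl fun w _ => ?_
    rw [Finset.sum_comm]
    refine Finset.sum_congr rfl fun u _ => Finset.sum_congr rfl fun y _ => ?_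
    ring
  rw [h1, Complex.re_ofReal_mul, Complex.re_sum]
  refine mul_nonneg (inv_nonneg.2 (Finset.prod_nonneg fun _ _ => Nat.cast_nonneg _))
    (Finset.sum_nonneg fun w _ => ?_)
  rw [mul_comm, Complex.re_ofReal_mul]
  exact mul_nonneg (Complex.normSq_nonneg _) (hf _)

end

section

variable {L τ σ : ℕ} [NeZero L] {h : (Fin 3 → ℤ) → ℂ} {hhat : (Fin 3 → ℂ) → ℂ}

theorem IsHamiltonian.isPeriodic_heatSym (H : IsHamiltonian h hhat) : IsPeriodic (heatSym hhat) := by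
  obtain ⟨c, C, -, -, hP⟩ := H.exists_parabolicSymbol
  exact (hP 1 one_pos le_rfl).per

/-- For t > 0 no fibre symbol vanishes, so both forms agree; the quotient of polynomials is the one
that remains meaningful at t = 0. As `fibSym` multiplies its shift by L^{2n}, t enters as t/L^{2n}.
-/
theorem inv_resolventSym (H : IsHamiltonian h hhat) (𝔮 : ℕ) (a : ℝ) (n : ℕ) {t : ℝ} (ht : 0 < t)
    (K : Fin 4 → ℝ) : (resolventSym 𝔮 L a (heatSym hhat) n t (toC K))⁻¹ =
      deltaNum L (heatSym hhat) n (t / ((L ^ n : ℕ) : ℝ) ^ 2) (toC K) /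
        deltaPoly 𝔮 L a (heatSym hhat) n (t / ((L ^ n : ℕ) : ℝ) ^ 2) (toC K) := by
  unfold deltaNum deltaPoly resolventSym
  rw [prod_div_polyDen_eq_inv]
  intro l h0
  have h1 := re_fibSym_heatSym H (L ^ n) (t / ((L ^ n : ℕ) : ℝ) ^ 2) K l
  have hS : (0 : ℝ) < ((L ^ n : ℕ) : ℝ) := by
    exact_mod_cast Nat.pos_of_ne_zero (NeZero.ne (L ^ n))
  rw [h0, Complex.zero_re] at h1
  have : 0 < ((L ^ n : ℕ) : ℝ) ^ 2 * (t / ((L ^ n : ℕ) : ℝ) ^ 2) := by positivity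
  linarith

theorem continuous_fibSym (S : ℕ) (f : (Fin 4 → ℂ) → ℂ) (k : Fin 4 → ℂ)
    (l : ∀ μ, ZMod (pscale S μ)) : Continuous fun t : ℝ => fibSym S f t k l := by
  unfold fibSym; fun_prop

theorem continuous_deltaNum (f : (Fin 4 → ℂ) → ℂ) (n : ℕ) (k : Fin 4 → ℂ) :
    Continuous fun t : ℝ => deltaNum L f n t k :=
  continuous_finsetProd _ fun l _ => continuous_fibSym _ f k l

theorem continuous_deltaPoly (𝔮 : ℕ) (a : ℝ) (f : (Fin 4 → ℂ) → ℂ) (n : ℕ) (k : Fin 4 → ℂ) :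
    Continuous fun t : ℝ => deltaPoly 𝔮 L a f n t k := by
  unfold deltaPoly polyDen
  exact (continuous_const.mul (continuous_finsetProd _ fun l _ => continuous_fibSym _ f k l)).add
    (continuous_finsetSum _ fun l _ => continuous_const.mul
      (continuous_finsetProd _ fun l _ => continuous_fibSym _ f k l))

theorem deltaDen_symbol_ne_zero (H : IsHamiltonian h hhat) (hL2 : 2 ≤ L) {𝔮 : ℕ} (h𝔮 : 1 ≤ 𝔮)
    {a : ℝ} (ha : 0 < a) (n : ℕ) {t : ℝ} (ht : 0 < t) (K : Fin 4 → ℝ) :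
    (rhoSym 𝔮 L a n (toC K))⁻¹ * resolventSym 𝔮 L a (heatSym hhat) n t (toC K) ≠ 0 := by
  refine mul_ne_zero (inv_ne_zero fun h0 => ?_) fun h0 => ?_
  · have := (rhoSym_bounds (n := n) ha hL2 h𝔮 K).1
    rw [h0, Complex.zero_re] at this
    have := inv_pos.2 ha
    linarith
  · have := re_resolventSym H hL2 h𝔮 ha n ht K
    rw [h0, Complex.zero_re] at this
    exact lt_irrefl _ this

/-- For t > 0 the operator multiplies each character by a quotient of polynomials in t whose
denominator does not vanish at t = 0, so the limit may be taken character by character. For n = 0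
the operators agree directly. -/
theorem isDelta_symOp (H : IsHamiltonian h hhat) (hL : Odd L) (hL2 : 2 ≤ L) {𝔮 : ℕ} (h𝔮 : 1 ≤ 𝔮)
    {a : ℝ} (ha : 0 < a) (n : ℕ)
    (hne : 1 ≤ n → ∀ K : Fin 4 → ℝ, deltaPoly 𝔮 L a (heatSym hhat) n 0 (toC K) ≠ 0) :
    IsDelta L τ σ 𝔮 a h n (symOp L τ σ 0 1 (deltaSym 𝔮 L a (heatSym hhat) n)) := by
  have hper := H.isPeriodic_heatSym
  refine ⟨?_, fun hn => ⟨fun t ht => ⟨(isUnit_D_add H n ht).1, ?_⟩, ?_⟩⟩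
  · rintro rfl
    refine ext_chi fun w => ?_
    have h1 : deltaSym 𝔮 L a (heatSym hhat) 0 = heatSym hhat := by ext k; simp [deltaSym]
    rw [h1, symOp_mulVec_chi hper, D0_mulVec_chi H]
  · exact (isUnit_of_mulVec_chi (deltaDen_mulVec_chi H hL hL2 h𝔮 ha n ht) fun k =>
      deltaDen_symbol_ne_zero H hL2 h𝔮 ha n ht _).1
  · have key : ∀ t : ℝ, 0 < t → (deltaDen L τ σ 𝔮 a h n t)⁻¹ * frakQ L τ σ 𝔮 a n =
        ofChar fun w => (deltaNum L (heatSym hhat) n (t / ((L ^ n : ℕ) : ℝ) ^ 2)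
            (toC (mom (size L τ σ 1) w)) /
          deltaPoly 𝔮 L a (heatSym hhat) n (t / ((L ^ n : ℕ) : ℝ) ^ 2)
            (toC (mom (size L τ σ 1) w))) • chi (wrep w) := by
      intro t ht
      rw [eq_ofChar ((deltaDen L τ σ 𝔮 a h n t)⁻¹ * frakQ L τ σ 𝔮 a n)]
      congr 1
      funext w
      have hρ : rhoSym 𝔮 L a n (toC (momZ (size L τ σ 1) (wrep w))) ≠ 0 := fun h0 => by
        have := (rhoSym_bounds (n := n) ha hL2 h𝔮 (momZ (size L τ σ 1) (wrep w))).1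
        rw [h0, Complex.zero_re] at this
        have := inv_pos.2 ha
        linarith
      have h1 := (isUnit_of_mulVec_chi (deltaDen_mulVec_chi (τ := τ) (σ := σ) H hL hL2 h𝔮 ha n ht) fun k =>
      deltaDen_symbol_ne_zero H hL2 h𝔮 ha n ht _).2 (wrep w)
      rw [← Matrix.mulVec_mulVec, frakQ_mulVec_chi hL hL2 h𝔮 ha, Matrix.mulVec_smul, h1, smul_smul,
        mul_inv, inv_inv, ← mul_assoc, inv_mul_cancel₀ hρ, one_mul, inv_resolventSym H 𝔮 a n ht,
        momZ_wrep]
    have hlim : Tendsto (fun t : ℝ => (ofChar fun w =>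
        (deltaNum L (heatSym hhat) n (t / ((L ^ n : ℕ) : ℝ) ^ 2) (toC (mom (size L τ σ 1) w)) /
          deltaPoly 𝔮 L a (heatSym hhat) n (t / ((L ^ n : ℕ) : ℝ) ^ 2)
            (toC (mom (size L τ σ 1) w))) • chi (wrep w) :
        Matrix (Site L τ σ 0 1) (Site L τ σ 0 1) ℂ)) (𝓝[>] 0)
        (𝓝 (symOp L τ σ 0 1 (deltaSym 𝔮 L a (heatSym hhat) n))) := by
      refine tendsto_pi_nhds.2 fun u => tendsto_pi_nhds.2 fun v => ?_
      simp only [symOp, ofChar, Pi.smul_apply, smul_eq_mul]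
      refine Tendsto.const_mul _ (tendsto_finsetSum _ fun w _ => Tendsto.mul_const _
        (Tendsto.mul_const _ ?_))
      have hs : Tendsto (fun t : ℝ => t / ((L ^ n : ℕ) : ℝ) ^ 2) (𝓝[>] 0) (𝓝 0) := by
        have : Tendsto (fun t : ℝ => t / ((L ^ n : ℕ) : ℝ) ^ 2) (𝓝 0)
            (𝓝 (0 / ((L ^ n : ℕ) : ℝ) ^ 2)) := tendsto_id.div_const _
        rw [zero_div] at this
        exact this.mono_left nhdsWithin_le_nhds
      have hd : deltaSym 𝔮 L a (heatSym hhat) n (toC (mom (size L τ σ 1) w)) =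
          deltaNum L (heatSym hhat) n 0 (toC (mom (size L τ σ 1) w)) /
            deltaPoly 𝔮 L a (heatSym hhat) n 0 (toC (mom (size L τ σ 1) w)) := by
        unfold deltaSym; rw [if_neg (by omega)]
      rw [hd]
      exact (((continuous_deltaNum (heatSym hhat) n _).tendsto 0).comp hs).div
        (((continuous_deltaPoly 𝔮 a (heatSym hhat) n _).tendsto 0).comp hs) (hne hn _)
    refine hlim.congr' ?_
    filter_upwards [self_mem_nhdsWithin] with t ht
    exact (key t ht).symm

end

/-! ### The covariance on the fibres of the coarse momenta -/

theorem fineMat_eq_add (𝔮 L : ℕ) [NeZero L] (a : ℝ) (f : (Fin 4 → ℂ) → ℂ) (lam : ℝ) (θ : Fin 4 → ℂ) :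
    fineMat 𝔮 L a f lam θ = fineMat 𝔮 L a f 0 θ + (lam : ℂ) • 1 := by
  unfold fineMat fibMat
  rw [add_right_comm]
  congr 1
  rw [Matrix.smul_one_eq_diagonal, Matrix.diagonal_add]
  simp

section

variable {L τ σ : ℕ} [NeZero L] {𝔮 : ℕ} {a : ℝ} {f : (Fin 4 → ℂ) → ℂ}

theorem size_one (μ : Fin 4) : size L τ σ 1 μ = pscale L μ * size L τ σ 0 μ := by
  have := size_add L τ σ 0 1 μ
  rwa [pow_one] at this

/-- The momentum that differs from `w` by a reciprocal vector of the coarse lattice. -/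
def lift (L τ σ : ℕ) (w : Fin 4 → ℤ) (l : ∀ μ, ZMod (pscale L μ)) : Fin 4 → ℤ :=
  w + fun μ => (size L τ σ 0 μ : ℤ) * ((l μ).val : ℤ)

theorem fineMat_momZ (lam : ℝ) (w : Fin 4 → ℤ) :
    fineMat 𝔮 L a f lam (toC (momZ (size L τ σ 1) w)) =
      fibMat 𝔮 L a f lam (toC (momZ (size L τ σ 0) w)) := by
  unfold fineMat
  congr 1
  ext μ
  have h1 : (pscale L μ : ℂ) ≠ 0 := Nat.cast_ne_zero.2 (NeZero.ne _)
  simp only [toC, momZ, size_one]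
  push_cast
  field_simp

/-- Q maps all characters of a fibre to the same coarse character and Q* spreads it over the fibre
again, a rank one action; Δ is diagonal. So the fibre spans an invariant subspace. -/
theorem covInv_mulVec_chi (hL : Odd L) (hf : IsPeriodic f) (w : Fin 4 → ℤ)
    (l : ∀ μ, ZMod (pscale L μ)) :
    (covInv L τ σ 𝔮 a (symOp L τ σ 0 1 f)).mulVec (chi (lift L τ σ w l)) =
      ∑ l', fineMat 𝔮 L a f 0 (toC (momZ (size L τ σ 1) w)) l' l • chi (lift L τ σ w l') := by
  have hm : toC (momZ (size L τ σ 1) (lift L τ σ w l)) =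
      fib (pscale L) (toC (momZ (size L τ σ 0) w)) l :=
    momZ_add_mul size_one (fun μ => NeZero.ne _) w l fun μ => NeZero.ne _
  have hc : (chi (lift L τ σ w l) : Site L τ σ (-1) 0 → ℂ) = chi w := chi_add_size_mul w _
  have hQ : (adj (Q L τ σ 𝔮 0) * Q L τ σ 𝔮 0).mulVec (chi (lift L τ σ w l)) =
      ∑ l', (blockSym 𝔮 (pscale L) (fib (pscale L) (toC (momZ (size L τ σ 0) w)) l') *
        blockSym 𝔮 (pscale L) (fib (pscale L) (toC (momZ (size L τ σ 0) w)) l)) •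
          chi (lift L τ σ w l') := by
    rw [← Matrix.mulVec_mulVec, Q_mulVec_chi hL, Matrix.mulVec_smul, hc, adj_Q_mulVec_chi hL,
      Finset.smul_sum]
    refine Finset.sum_congr rfl fun l' _ => ?_
    rw [smul_smul, zero_add, hm, mul_comm]
    rfl
  have hD : (symOp L τ σ 0 1 f).mulVec (chi (lift L τ σ w l)) =
      ∑ l', (if l' = l then f (fib (pscale L) (toC (momZ (size L τ σ 0) w)) l') else 0) •
        chi (lift L τ σ w l') := by
    rw [symOp_mulVec_chi hf, hm]
    simp [ite_smul]
  unfold covInv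
  rw [Matrix.add_mulVec, Matrix.smul_mulVec]
  erw [hQ, hD]
  rw [Finset.smul_sum, ← Finset.sum_add_distrib]
  refine Finset.sum_congr rfl fun l' _ => ?_
  rw [fineMat_momZ, smul_smul, ← add_smul]
  congr 1
  unfold fibMat
  rw [Matrix.add_apply, Matrix.smul_apply, Matrix.vecMulVec_apply, Matrix.diagonal_apply, smul_eq_mul,
    Complex.ofReal_zero, add_zero, add_comm]

/-- The operator that acts on the fibres over the coarse momenta by the matrices `M`. -/
def fibOp (L τ σ : ℕ) [NeZero L]
    (M : (Fin 4 → ℂ) → Matrix (∀ μ, ZMod (pscale L μ)) (∀ μ, ZMod (pscale L μ)) ℂ) :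
    Matrix (Site L τ σ 0 1) (Site L τ σ 0 1) ℂ :=
  ofChar fun w => ∑ l, M (toC (mom (size L τ σ 1) w)) l 0 • chi (lift L τ σ (wrep w) l)

variable {M M' : (Fin 4 → ℂ) → Matrix (∀ μ, ZMod (pscale L μ)) (∀ μ, ZMod (pscale L μ)) ℂ}

theorem fibOp_one : fibOp L τ σ (fun _ => 1) = 1 := by
  rw [← ofChar_chi]
  unfold fibOp
  congr 1
  funext w
  change ∑ l, (1 : Matrix (∀ μ, ZMod (pscale L μ)) (∀ μ, ZMod (pscale L μ)) ℂ) l 0 •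
    chi (lift L τ σ (wrep w) l) = _
  rw [Finset.sum_eq_single 0 (fun l _ h => by rw [Matrix.one_apply_ne h, zero_smul]) (by simp),
    Matrix.one_apply_eq, one_smul]
  congr 1
  ext μ
  simp [lift]

theorem fibOp_congr (h : ∀ θ : Fin 4 → ℝ, M (toC θ) = M' (toC θ)) :
    fibOp L τ σ M = fibOp L τ σ M' := by
  unfold fibOp
  simp only [h]

theorem fibOp_add : fibOp L τ σ (fun θ => M θ + M' θ) = fibOp L τ σ M + fibOp L τ σ M' := by
  ext u v
  simp only [fibOp, ofChar, Matrix.add_apply, add_smul, Finset.sum_add_distrib, Pi.add_apply,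
    add_mul, mul_add]

theorem fibOp_smul (c : ℂ) : fibOp L τ σ (fun θ => c • M θ) = c • fibOp L τ σ M := by
  ext u v
  simp only [fibOp, ofChar, Matrix.smul_apply, smul_assoc, ← Finset.smul_sum, Pi.smul_apply,
    smul_mul_assoc, mul_smul_comm]

/-- The fibre is based at w itself, so χ_w has index 0 and only the column 0 of M matters; applying
the inverse covariance to its image multiplies by the fibre matrix on the left. -/
theorem covInv_mul_fibOp (hL : Odd L) (hf : IsPeriodic f) :
    covInv L τ σ 𝔮 a (symOp L τ σ 0 1 f) * fibOp L τ σ M =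
      fibOp L τ σ fun θ => fineMat 𝔮 L a f 0 θ * M θ := by
  unfold fibOp
  rw [mul_ofChar]
  congr 1
  funext w
  rw [Matrix.mulVec_sum]
  simp only [Matrix.mulVec_smul, covInv_mulVec_chi hL hf, Finset.smul_sum, smul_smul,
    Matrix.mul_apply, Finset.sum_smul, momZ_wrep]
  rw [Finset.sum_comm]
  refine Finset.sum_congr rfl fun l _ => Finset.sum_congr rfl fun l' _ => ?_
  rw [mul_comm]

theorem covInv_add_mul_fibOp (hL : Odd L) (hf : IsPeriodic f) {lam : ℝ}
    (hu : ∀ θ : Fin 4 → ℝ, IsUnit (fineMat 𝔮 L a f lam (toC θ))) :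
    (covInv L τ σ 𝔮 a (symOp L τ σ 0 1 f) + (lam : ℂ) • 1) *
      fibOp L τ σ (fun θ => (fineMat 𝔮 L a f lam θ)⁻¹) = 1 := by
  rw [add_mul, covInv_mul_fibOp hL hf, smul_mul_assoc, one_mul, ← fibOp_smul, ← fibOp_add,
    ← fibOp_one]
  refine fibOp_congr fun θ => ?_
  have h1 : fineMat 𝔮 L a f 0 (toC θ) * (fineMat 𝔮 L a f lam (toC θ))⁻¹ +
      (lam : ℂ) • (fineMat 𝔮 L a f lam (toC θ))⁻¹ =
      (fineMat 𝔮 L a f 0 (toC θ) + (lam : ℂ) • 1) * (fineMat 𝔮 L a f lam (toC θ))⁻¹ := by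
    rw [add_mul, smul_mul_assoc, one_mul]
  rw [h1, ← fineMat_eq_add,
    Matrix.mul_nonsing_inv _ ((Matrix.isUnit_iff_isUnit_det _).1 (hu θ))]

/-- The shortest representative of a site. -/
def Site.centre {j : ℤ} {i : ℕ} (u : Site L τ σ j i) : Fin 4 → ℤ :=
  Fin.cons u.1.valMinAbs fun ν => (u.2 ν).valMinAbs

theorem two_mul_abs_valMinAbs_le {N : ℕ} [NeZero N] (x : ZMod N) : 2 * |x.valMinAbs| ≤ N := by
  have h := ZMod.natAbs_valMinAbs_le x
  rw [Int.abs_eq_natAbs]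
  omega

theorem Site.two_mul_abs_centre_le {j : ℤ} {i : ℕ} (u : Site L τ σ j i) (μ : Fin 4) :
    2 * |u.centre μ| ≤ size L τ σ i μ := by
  refine Fin.cases ?_ (fun ν => ?_) μ
  · rw [size_zero]; exact two_mul_abs_valMinAbs_le _
  · rw [size_succ]; exact two_mul_abs_valMinAbs_le _

theorem chi_wrep_eq {j : ℤ} {i : ℕ} (w : ∀ μ, ZMod (size L τ σ i μ)) (u : Site L τ σ j i) :
    chi (wrep w) u =
      Complex.exp (Complex.I * ∑ ν, (mom (size L τ σ i) w ν : ℂ) * u.centre ν) := by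
  have h1 : (Site.ofInt (u.1.valMinAbs, fun ν => (u.2 ν).valMinAbs) : Site L τ σ j i) = u := by
    refine Prod.ext ?_ (funext fun ν => ?_)
    · exact ZMod.coe_valMinAbs _
    · exact ZMod.coe_valMinAbs _
  conv_lhs => rw [← h1, chi_ofInt, momZ_wrep]
  rw [Fin.sum_univ_succ]
  rfl

/-- χ at a lifted momentum is χ_w times a unimodular factor depending only on l and u, so what
remains is a momentum average evaluated at u - v. The operator is not translation invariant on the
fine lattice, but its decay depends on u - v only. -/
theorem fibOp_apply (u v : Site L τ σ 0 1) : fibOp L τ σ M u v =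
    fibAvg L (size L τ σ 1) M (fun l => chi (lift L τ σ 0 l) u) (u - v).centre := by
  unfold fibOp ofChar fibAvg
  congr 1
  refine Finset.sum_congr rfl fun w _ => ?_
  beta_reduce
  rw [← chi_wrep_eq, sub_eq_add_neg, chi_add, chi_neg, Finset.sum_apply, Finset.sum_mul,
    Finset.sum_mul]
  refine Finset.sum_congr rfl fun l _ => ?_
  have h1 : lift L τ σ (wrep w) l = wrep w + lift L τ σ 0 l := by simp [lift]
  rw [Pi.smul_apply, smul_eq_mul, h1, chi_add_left]
  ring

/-! ### Positivity of the real part and the spectrum -/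

theorem Q_conjTranspose (L τ σ 𝔮 i : ℕ) : (Q L τ σ 𝔮 i).conjTranspose = (Q L τ σ 𝔮 i).transpose := by
  ext u y
  rw [Matrix.conjTranspose_apply, Matrix.transpose_apply]
  have h1 : Q L τ σ 𝔮 i y u = ((∑' x : ℤ × (Fin 3 → ℤ),
      if incl y + Site.ofInt x = u then profile L 𝔮 x else 0 : ℝ) : ℂ) := by
    rw [Complex.ofReal_tsum]
    unfold Q
    refine tsum_congr fun x => ?_
    split_ifs <;> simp
  rw [h1]
  exact Complex.conj_ofReal _

/-- For an eigenvector v the form equals z‖v‖², so z inherits its sign. -/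
theorem re_nonneg_of_mem_spectrum {ι : Type*} [Fintype ι] [DecidableEq ι] {A : Matrix ι ι ℂ}
    (hA : ∀ v : ι → ℂ, 0 ≤ (star v ⬝ᵥ A.mulVec v).re) {z : ℂ} (hz : z ∈ spectrum ℂ A) : 0 ≤ z.re := by
  rw [spectrum.mem_iff, Matrix.isUnit_iff_isUnit_det, isUnit_iff_ne_zero, not_not] at hz
  obtain ⟨v, hv, h0⟩ := Matrix.exists_mulVec_eq_zero_iff.2 hz
  rw [Matrix.sub_mulVec, Algebra.algebraMap_eq_smul_one, Matrix.smul_mulVec, Matrix.one_mulVec,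
    sub_eq_zero] at h0
  have h1 := hA v
  rw [← h0, dotProduct_smul, smul_eq_mul] at h1
  have h2 : star v ⬝ᵥ v = ((∑ i, Complex.normSq (v i) : ℝ) : ℂ) := by
    rw [dotProduct, Complex.ofReal_sum]
    exact Finset.sum_congr rfl fun i _ => by rw [Complex.normSq_eq_conj_mul_self]; rfl
  rw [h2, mul_comm, Complex.re_ofReal_mul] at h1
  obtain ⟨i, hi⟩ := Function.ne_iff.1 hv
  have h3 : 0 < ∑ i, Complex.normSq (v i) := Finset.sum_pos' (fun _ _ => Complex.normSq_nonneg _)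
    ⟨i, Finset.mem_univ _, Complex.normSq_pos.2 hi⟩
  exact nonneg_of_mul_nonneg_right h1 h3

open scoped ComplexOrder in
-- Q*Q is a nonnegative multiple of QᴴQ because the profile is real, and the symbol of Δ has
-- nonnegative real part.
theorem re_dotProduct_covInv_nonneg (ha : 0 ≤ a) (hf : ∀ θ : Fin 4 → ℝ, 0 ≤ (f (toC θ)).re)
    (v : Site L τ σ 0 1 → ℂ) :
    0 ≤ (star v ⬝ᵥ (covInv L τ σ 𝔮 a (symOp L τ σ 0 1 f)).mulVec v).re := by
  unfold covInv
  rw [Matrix.add_mulVec, dotProduct_add, Complex.add_re]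
  refine add_nonneg ?_ (re_dotProduct_symOp_nonneg hf v)
  have h1 : adj (Q L τ σ 𝔮 0) * Q L τ σ 𝔮 0 = (((eps L (-1) ^ 5 / eps L 0 ^ 5 : ℝ)) : ℂ) •
      ((Q L τ σ 𝔮 0).conjTranspose * Q L τ σ 𝔮 0) := by
    rw [Q_conjTranspose, adj, Matrix.smul_mul]
  have h2 : 0 ≤ (star v ⬝ᵥ ((Q L τ σ 𝔮 0).conjTranspose * Q L τ σ 𝔮 0).mulVec v).re :=
    (Matrix.posSemidef_conjTranspose_mul_self (Q L τ σ 𝔮 0)).re_dotProduct_nonneg v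
  rw [Matrix.smul_mulVec, dotProduct_smul, smul_eq_mul, Complex.re_ofReal_mul]
  refine mul_nonneg (by positivity) ?_
  have h3 : star v ⬝ᵥ (adj (Q L τ σ 𝔮 0) * Q L τ σ 𝔮 0).mulVec v =
      (((eps L (-1) ^ 5 / eps L 0 ^ 5 : ℝ)) : ℂ) *
        (star v ⬝ᵥ ((Q L τ σ 𝔮 0).conjTranspose * Q L τ σ 𝔮 0).mulVec v) := by
    rw [h1, Matrix.smul_mulVec, dotProduct_smul, smul_eq_mul]
  erw [h3]
  rw [Complex.re_ofReal_mul]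
  exact mul_nonneg (by unfold eps; positivity) h2

end

/-! ### Decay of kernels and the operator norm -/

theorem sum_range_pow_le {ρ : ℝ} (h0 : 0 ≤ ρ) (h1 : ρ < 1) (N : ℕ) :
    ∑ k ∈ Finset.range N, ρ ^ k ≤ (1 - ρ)⁻¹ := by
  have h2 : 0 < 1 - ρ := by linarith
  have h3 := geom_sum_mul_neg ρ N
  rw [← one_div, le_div_iff₀ h2, h3]
  have := pow_nonneg h0 N
  linarith

/-- The two halves of the cycle are dominated by geometric series in val and N - val, and 1/(1 -
e^{-b}) ≤ 1 + 1/b. -/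
theorem sum_exp_neg_valMinAbs_le {b : ℝ} (hb : 0 < b) (N : ℕ) [NeZero N] :
    ∑ x : ZMod N, Real.exp (-(b * |(x.valMinAbs : ℝ)|)) ≤ 2 * (1 + b⁻¹) := by
  set ρ := Real.exp (-b) with hρ
  have hρ0 : 0 < ρ := Real.exp_pos _
  have hρ1 : ρ < 1 := Real.exp_lt_one_iff.2 (by linarith)
  have hpow : ∀ k : ℕ, Real.exp (-(b * k)) = ρ ^ k := fun k => by
    rw [hρ, ← Real.exp_nat_mul]; congr 1; ring
  have h1 : ∀ x : ZMod N, Real.exp (-(b * |(x.valMinAbs : ℝ)|)) ≤ ρ ^ x.val + ρ ^ (N - x.val) := by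
    intro x
    have hx := (ZMod.val_lt x).le
    rw [ZMod.valMinAbs_def_pos]
    split_ifs with h
    · rw [Int.cast_natCast, Nat.abs_cast, hpow]
      exact le_add_of_nonneg_right (by positivity)
    · have h2 : |(((x.val : ℤ) - N : ℤ) : ℝ)| = ((N - x.val : ℕ) : ℝ) := by
        rw [Nat.cast_sub hx, abs_of_nonpos]
        · push_cast; ring
        · push_cast
          have : (x.val : ℝ) ≤ N := by exact_mod_cast hx
          linarith
      rw [h2, hpow]
      exact le_add_of_nonneg_left (by positivity)
  have h3 : ∑ k ∈ Finset.range N, ρ ^ (N - k) ≤ ∑ k ∈ Finset.range N, ρ ^ k := by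
    rw [← Finset.sum_range_reflect (fun k => ρ ^ k)]
    refine Finset.sum_le_sum fun k hk => pow_le_pow_of_le_one hρ0.le hρ1.le ?_
    omega
  have h4 := sum_range_pow_le hρ0.le hρ1 N
  have h5 : (1 - ρ)⁻¹ ≤ 1 + b⁻¹ := by
    have h6 : ρ ≤ (1 + b)⁻¹ := by
      rw [hρ, Real.exp_neg]
      refine inv_anti₀ (by linarith) ?_
      linarith [Real.add_one_le_exp b]
    have h7 : b / (1 + b) ≤ 1 - ρ := by
      have : b / (1 + b) = 1 - (1 + b)⁻¹ := by field_simp; ring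
      linarith
    refine (inv_anti₀ (by positivity) h7).trans_eq ?_
    field_simp
    ring
  calc ∑ x : ZMod N, Real.exp (-(b * |(x.valMinAbs : ℝ)|))
      ≤ ∑ x : ZMod N, (ρ ^ x.val + ρ ^ (N - x.val)) := Finset.sum_le_sum fun x _ => h1 x
    _ = ∑ k ∈ Finset.range N, (ρ ^ k + ρ ^ (N - k)) :=
        sum_zmod_val N (fun k => ρ ^ k + ρ ^ (N - k))
    _ ≤ 2 * (1 + b⁻¹) := by rw [Finset.sum_add_distrib]; linarith

section

variable {L τ σ : ℕ} [NeZero L] {j : ℤ} {i : ℕ}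

/-- The `ℓ¹` length of a site in units of the coarse lattice. -/
def Site.len (u : Site L τ σ j i) : ℝ := ∑ μ, |(u.centre μ : ℝ)| / pscale L μ

theorem one_le_pscale (μ : Fin 4) : (1 : ℝ) ≤ pscale L μ := by
  exact_mod_cast Nat.pos_of_ne_zero (NeZero.ne (pscale L μ))

/-- The sum factorises over the directions; each contributes a constant times s_μ, and the product
of the s_μ is L⁵. -/
theorem sum_exp_neg_len_le {c : ℝ} (hc : 0 < c) :
    ∑ u : Site L τ σ j i, Real.exp (-(c * u.len)) ≤ (2 * (1 + c⁻¹)) ^ 4 * (L : ℝ) ^ 5 := by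
  have h1 : ∀ u : Site L τ σ j i, Real.exp (-(c * u.len)) =
      Real.exp (-(c / pscale L 0 * |(u.1.valMinAbs : ℝ)|)) *
        ∏ ν : Fin 3, Real.exp (-(c / pscale L ν.succ * |((u.2 ν).valMinAbs : ℝ)|)) := by
    intro u
    rw [← Real.exp_sum, ← Real.exp_add]
    congr 1
    simp only [Site.len, Fin.sum_univ_succ (n := 3), Site.centre, Fin.cons_zero, Fin.cons_succ,
      Finset.sum_neg_distrib, mul_add, neg_add, Finset.mul_sum]
    congr 2
    · ring
    · exact Finset.sum_congr rfl fun ν _ => by ring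
  simp only [h1]
  rw [sum_site_prod (fun x => Real.exp (-(c / pscale L 0 * |(x.valMinAbs : ℝ)|)))
    fun ν x => Real.exp (-(c / pscale L ν.succ * |(x.valMinAbs : ℝ)|))]
  have h2 : ∀ μ : Fin 4, ∀ N : ℕ, ∀ [NeZero N],
      ∑ x : ZMod N, Real.exp (-(c / pscale L μ * |(x.valMinAbs : ℝ)|)) ≤
        2 * (1 + c⁻¹) * pscale L μ := by
    intro μ N _
    have hs := one_le_pscale (L := L) μ
    refine (sum_exp_neg_valMinAbs_le (by positivity) N).trans ?_
    rw [inv_div, mul_assoc]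
    gcongr
    rw [add_mul, one_mul, div_eq_inv_mul]
    linarith
  have h3 : (2 * (1 + c⁻¹)) ^ 4 * (L : ℝ) ^ 5 = (2 * (1 + c⁻¹) * pscale L 0) *
      ∏ ν : Fin 3, (2 * (1 + c⁻¹) * pscale L ν.succ) := by
    simp only [pscale_zero, pscale_succ, Finset.prod_const, Finset.card_univ, Fintype.card_fin]
    push_cast
    ring
  rw [h3]
  exact mul_le_mul (h2 0 _) (Finset.prod_le_prod (fun ν _ => by positivity) fun ν _ => h2 ν.succ _)
    (by positivity) (by positivity)

/-- On the lattice of index 1 the spacings are L⁻² and L⁻¹, that is 1/s_μ, so the Euclidean distance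
is the ℓ² version of the length and is dominated by the ℓ¹ one. This is why the decay rate is free
of `L` after rescaling. -/
theorem Site.abs_le_len (u : Site L τ σ 1 i) : u.abs ≤ u.len := by
  have h0 : (0 : ℝ) ≤ u.len := Finset.sum_nonneg fun μ _ => by positivity
  have h1 : (eps L 1 ^ 2 * (u.1.valMinAbs : ℝ)) ^ 2 + ∑ ν, (eps L 1 * ((u.2 ν).valMinAbs : ℝ)) ^ 2 =
      ∑ μ, (|(u.centre μ : ℝ)| / pscale L μ) ^ 2 := by
    rw [Fin.sum_univ_succ (n := 3) fun μ => (|(u.centre μ : ℝ)| / pscale L μ) ^ 2]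
    simp only [Site.centre, Fin.cons_zero, Fin.cons_succ, pscale_zero, pscale_succ, eps, zpow_neg,
      zpow_one, div_pow, sq_abs, mul_pow]
    congr 1
    · push_cast; ring
    · exact Finset.sum_congr rfl fun ν _ => by ring
  unfold Site.abs
  rw [h1]
  refine Real.sqrt_le_iff.2 ⟨h0, ?_⟩
  exact Finset.sum_sq_le_sq_sum_of_nonneg fun μ _ => by positivity

/-- Half of the decay absorbs the weight e^{c|u-u'|}, the other half is summed at the cost of L⁵.
The volume factor of the measure cancels the one in the kernel. -/
theorem opNorm_le {c B : ℝ} (hc : 0 < c) (hB : 0 ≤ B)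
    {A : Matrix (Site L τ σ 1 i) (Site L τ σ 1 i) ℂ}
    (hA : ∀ u u', ‖A u u'‖ ≤ B * Real.exp (-(2 * c * (u - u').len))) :
    opNorm c A ≤ B * (2 * (1 + c⁻¹)) ^ 4 * (L : ℝ) ^ 5 := by
  have hL : (0 : ℝ) < L := by exact_mod_cast Nat.pos_of_ne_zero (NeZero.ne L)
  have he : 0 < eps L 1 ^ 5 := by unfold eps; positivity
  have h1 : ∀ u u' : Site L τ σ 1 i, eps L 1 ^ 5 * (Real.exp (c * (u - u').abs) * ‖kernel A u u'‖) ≤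
      B * Real.exp (-(c * (u - u').len)) := by
    intro u u'
    unfold kernel
    rw [norm_div, Complex.norm_real, Real.norm_of_nonneg he.le]
    have h2 : eps L 1 ^ 5 * (Real.exp (c * (u - u').abs) * (‖A u u'‖ / eps L 1 ^ 5)) =
        Real.exp (c * (u - u').abs) * ‖A u u'‖ := by
      rw [mul_left_comm, mul_div_cancel₀ _ he.ne']
    rw [h2]
    have h3 : Real.exp (c * (u - u').abs) ≤ Real.exp (c * (u - u').len) := by
      gcongr
      exact Site.abs_le_len _
    calc _ ≤ Real.exp (c * (u - u').len) * (B * Real.exp (-(2 * c * (u - u').len))) := by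
          gcongr
          exact hA u u'
      _ = B * Real.exp (-(c * (u - u').len)) := by
          rw [mul_left_comm, ← Real.exp_add]
          congr 2
          ring
  have h4 := sum_exp_neg_len_le (L := L) (τ := τ) (σ := σ) (j := 1) (i := i) hc
  have h5 : B * ∑ u : Site L τ σ 1 i, Real.exp (-(c * u.len)) ≤
      B * (2 * (1 + c⁻¹)) ^ 4 * (L : ℝ) ^ 5 := by
    rw [mul_assoc]; gcongr
  have : Nonempty (Site L τ σ 1 i) := ⟨0⟩
  refine max_le (ciSup_le fun u => ?_) (ciSup_le fun u' => ?_)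
  · refine le_trans ?_ h5
    rw [Finset.mul_sum, Finset.mul_sum,
      ← Equiv.sum_comp (Equiv.subLeft u) fun v : Site L τ σ 1 i => B * Real.exp (-(c * v.len))]
    exact Finset.sum_le_sum fun u' _ => h1 u u'
  · refine le_trans ?_ h5
    rw [Finset.mul_sum, Finset.mul_sum,
      ← Equiv.sum_comp (Equiv.subRight u') fun v : Site L τ σ 1 i => B * Real.exp (-(c * v.len))]
    exact Finset.sum_le_sum fun u _ => h1 u u'

/-- Decay is known in each direction separately; the direction with the largest scaled coordinate
carries at least a quarter of the length. -/
theorem le_exp_neg_len {m E y : ℝ} (hm : 0 ≤ m) (hE : 0 ≤ E) (u : Site L τ σ j i)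
    (h : ∀ μ, y ≤ E * Real.exp (-(m / pscale L μ * |(u.centre μ : ℝ)|))) :
    y ≤ E * Real.exp (-(m / 4 * u.len)) := by
  obtain ⟨μ, -, hμ⟩ := Finset.exists_max_image Finset.univ
    (fun μ => |(u.centre μ : ℝ)| / pscale L μ) ⟨0, Finset.mem_univ _⟩
  refine (h μ).trans (mul_le_mul_of_nonneg_left (Real.exp_le_exp.2 (neg_le_neg ?_)) hE)
  have h1 : u.len ≤ ∑ _μ : Fin 4, |(u.centre μ : ℝ)| / pscale L μ :=
    Finset.sum_le_sum fun ν _ => hμ ν (Finset.mem_univ _)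
  rw [Finset.sum_const, Finset.card_univ, Fintype.card_fin, nsmul_eq_mul] at h1
  push_cast at h1
  calc m / 4 * u.len ≤ m / 4 * (4 * (|(u.centre μ : ℝ)| / pscale L μ)) := by gcongr
    _ = m / pscale L μ * |(u.centre μ : ℝ)| := by ring

end

/-- A fibre operator built from the inverse fibre matrices inverts the shifted covariance, and its
entries are the averages already estimated. The second bound is stated for A(A + λ)⁻¹ because √C⁻¹ =
A√C is the integral of these. -/
theorem exists_covInv_bounds {𝔮 : ℕ} {a c C m₀ : ℝ} (h𝔮 : 2 ≤ 𝔮) (ha : 0 < a) (hc : 0 < c)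
    (hC : 0 < C) (hm₀ : 0 < m₀) : ∃ m B : ℝ, 0 < m ∧ 0 < B ∧
      ∀ (L : ℕ) [NeZero L] (f : (Fin 4 → ℂ) → ℂ), Odd L →
      ParabolicSymbol c C m₀ ((L : ℝ) ^ 2)⁻¹ f → ∀ (τ σ : ℕ) (lam : ℝ), 0 ≤ lam →
      IsUnit (covInv L τ σ 𝔮 a (symOp L τ σ 0 1 f) + (lam : ℂ) • 1) ∧
      (∀ u u', ‖(covInv L τ σ 𝔮 a (symOp L τ σ 0 1 f) + (lam : ℂ) • 1)⁻¹ u u'‖ ≤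
        B * Real.exp (-(m * (u - u').len)) * (((L : ℝ)⁻¹) ^ 2 + lam)⁻¹) ∧
      ∀ u u', ‖(covInv L τ σ 𝔮 a (symOp L τ σ 0 1 f) *
          (covInv L τ σ 𝔮 a (symOp L τ σ 0 1 f) + (lam : ℂ) • 1)⁻¹) u u'‖ ≤
        B * Real.exp (-(m * (u - u').len)) * (((L : ℝ)⁻¹) ^ 2 + lam)⁻¹ := by
  obtain ⟨m, B, hm, hB, key⟩ := exists_fibAvg_bounds h𝔮 ha hc hC hm₀
  refine ⟨m / 4, B, by positivity, hB, fun L _ f hL hf τ σ lam hlam => ?_⟩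
  obtain ⟨hu, hbd⟩ := key L f hL hf lam hlam
  have h1 := covInv_add_mul_fibOp (τ := τ) (σ := σ) hL hf.per hu
  have h2 : (covInv L τ σ 𝔮 a (symOp L τ σ 0 1 f) + (lam : ℂ) • 1)⁻¹ =
      fibOp L τ σ (fun θ => (fineMat 𝔮 L a f lam θ)⁻¹) := Matrix.inv_eq_right_inv h1
  have hN : ∀ μ, pscale L μ ≤ size L τ σ 1 μ := fun μ => by
    rw [size_one]
    exact Nat.le_mul_of_pos_right _ (Nat.pos_of_ne_zero (NeZero.ne _))
  have hφ : ∀ u : Site L τ σ 0 1, ∀ l, ‖chi (lift L τ σ 0 l) u‖ ≤ 1 := fun u l => (norm_chi _ _).le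
  refine ⟨IsUnit.of_mul_eq_one _ h1, fun u u' => ?_, fun u u' => ?_⟩
  · rw [h2, fibOp_apply, mul_right_comm, inv_pow]
    exact le_exp_neg_len hm.le (by positivity) _ fun μ =>
      (hbd _ μ (hN μ) _ (hφ u) _ (Site.two_mul_abs_centre_le _ μ)).1
  · rw [h2, covInv_mul_fibOp hL hf.per, fibOp_apply, mul_right_comm, inv_pow]
    exact le_exp_neg_len hm.le (by positivity) _ fun μ =>
      (hbd _ μ (hN μ) _ (hφ u) _ (Site.two_mul_abs_centre_le _ μ)).2

end BlockSpin

end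

/-- `Γ₂` depends only on `𝔮`; `m₂` and `Γ₁₀` depend only on `𝔮`, `a` and the Hamiltonian. They are
independent of `L`, of the scale `n` and of the size of the torus, which has `L_tp = L^(2(n+1)+τ)`
and `L_sp = L^(n+1+σ)`. -/
theorem mainTheorem3 (𝔮 : ℕ) (h𝔮 : 4 ≤ 𝔮) (h𝔮_even : Even 𝔮) :
    ∃ Γ₂ : ℝ, ∀ (a : ℝ), 0 < a →
      ∀ (h : (Fin 3 → ℤ) → ℂ) (hhat : (Fin 3 → ℂ) → ℂ), BlockSpin.IsHamiltonian h hhat →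
        ∃ m₂ : ℝ, 0 < m₂ ∧ ∃ Γ₁₀ : ℝ,
          ∀ (L : ℕ) [NeZero L], Odd L → Γ₂ < (L : ℝ) → ∀ n τ σ : ℕ,
            ∃ Δ : Matrix (BlockSpin.Site L τ σ 0 1) (BlockSpin.Site L τ σ 0 1) ℂ,
              BlockSpin.IsDelta L τ σ 𝔮 a h n Δ ∧
              IsUnit (BlockSpin.covInv L τ σ 𝔮 a Δ) ∧
              ∃ C R : Matrix (BlockSpin.Site L τ σ 0 1) (BlockSpin.Site L τ σ 0 1) ℂ,
                C = (BlockSpin.covInv L τ σ 𝔮 a Δ)⁻¹ ∧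
                BlockSpin.IsPrincipalSqrt R C ∧
                IsUnit R ∧
                BlockSpin.opNorm m₂ (BlockSpin.rescale 1 1 C) ≤ Γ₁₀ * (L : ℝ) ^ 9 ∧
                ∃ S : Matrix (BlockSpin.Site L τ σ 1 1) (BlockSpin.Site L τ σ 1 1) ℂ,
                  BlockSpin.IsPrincipalSqrt S (BlockSpin.rescale 1 1 C) ∧
                  IsUnit S ∧
                  BlockSpin.opNorm m₂ S ≤ Γ₁₀ * (L : ℝ) ^ 9 ∧
                  BlockSpin.opNorm m₂ S⁻¹ ≤ Γ₁₀ * (L : ℝ) ^ 9 := by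
  -- L ≥ 2 is used for the geometric series in the symbol of 𝔔_n⁻¹.
  refine ⟨2, fun a ha h hhat H => ?_⟩
  obtain ⟨c, C, hc, hC, hsym⟩ := H.exists_parabolicSymbol
  obtain ⟨c', C', m', hc', hC', hm', hdelta⟩ :=
    BlockSpin.exists_parabolicSymbol_deltaSym (by omega : 1 ≤ 𝔮) ha hc hC
  obtain ⟨m, B, hm, hB, hcov⟩ :=
    BlockSpin.exists_covInv_bounds (by omega : 2 ≤ 𝔮) ha hc' hC' hm'
  -- Half of the decay rate of the entries is spent on the weight in the norm, the other half on the
  -- summation.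
  refine ⟨m / 2, by positivity, B * (2 * (1 + (m / 2)⁻¹)) ^ 4, fun L _ hLodd hL2 n τ σ => ?_⟩
  have hL : 2 ≤ L := by
    have : (2 : ℝ) ≤ L := hL2.le
    exact_mod_cast this
  obtain ⟨hpar, hne⟩ := hdelta _ H.differentiable_heatSym hsym L hLodd hL n
  set f := BlockSpin.deltaSym 𝔮 L a (BlockSpin.heatSym hhat) n with hf
  set A := BlockSpin.covInv L τ σ 𝔮 a (BlockSpin.symOp L τ σ 0 1 f) with hA
  have hres := hcov L f hLodd hpar τ σ
  have hLpos : (0 : ℝ) < (L : ℝ)⁻¹ := by positivity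
  have hL1 : (1 : ℝ) ≤ L := by exact_mod_cast (by omega : 1 ≤ L)
  -- The square root bound is applied with l = L⁻¹, matching (L⁻² + λ)⁻¹; both R and R⁻¹ then have
  -- entries of order `L`.
  obtain ⟨R, hR, hRu, hRb, hRb'⟩ := BlockSpin.exists_isPrincipalSqrt_inv (A := A) hLpos
    (fun t ht => (hres t ht).1) (fun t ht => (hres t ht).2.1) (fun t ht => (hres t ht).2.2)
    fun z hz => BlockSpin.re_nonneg_of_mem_spectrum
      (BlockSpin.re_dotProduct_covInv_nonneg ha.le hpar.re_nonneg_real) hz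
  have h0 := hres 0 le_rfl
  simp only [Complex.ofReal_zero, zero_smul, add_zero] at h0
  -- Entries of order L^p give norms of order L^{p+5}; p = 2 for C and p = 1 for the roots, so L⁹
  -- leaves room.
  have hnorm : ∀ (p : ℕ), p ≤ 4 → ∀ T : Matrix (BlockSpin.Site L τ σ 1 1) (BlockSpin.Site L τ σ 1 1) ℂ,
      (∀ u u', ‖T u u'‖ ≤ B * Real.exp (-(m * (u - u').len)) * (L : ℝ) ^ p) →
      BlockSpin.opNorm (m / 2) T ≤ B * (2 * (1 + (m / 2)⁻¹)) ^ 4 * (L : ℝ) ^ 9 := by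
    intro p hp T hT
    refine (BlockSpin.opNorm_le (B := B * (L : ℝ) ^ p) (by positivity) (by positivity)
      fun u u' => (hT u u').trans_eq ?_).trans ?_
    · rw [mul_div_cancel₀ m two_ne_zero]; ring
    · have : (L : ℝ) ^ p ≤ (L : ℝ) ^ 4 := pow_le_pow_right₀ hL1 hp
      calc _ = B * (2 * (1 + (m / 2)⁻¹)) ^ 4 * (L : ℝ) ^ 5 * (L : ℝ) ^ p := by ring
        _ ≤ B * (2 * (1 + (m / 2)⁻¹)) ^ 4 * (L : ℝ) ^ 5 * (L : ℝ) ^ 4 := by gcongr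
        _ = _ := by ring
  have hinv : (BlockSpin.rescale 1 1 R : Matrix (BlockSpin.Site L τ σ 1 1) _ ℂ)⁻¹ =
      BlockSpin.rescale 1 1 R⁻¹ := Matrix.inv_submatrix_equiv _ _ _
  -- Rescaling only relabels the sites, so the rescaled R is the principal root of the rescaled C by
  -- definition.
  refine ⟨BlockSpin.symOp L τ σ 0 1 f,
    BlockSpin.isDelta_symOp H hLodd hL (by omega) ha n hne, h0.1, A⁻¹, R, rfl, hR, hRu, ?_,
    BlockSpin.rescale 1 1 R, hR, hRu, ?_, ?_⟩
  · refine hnorm 2 (by norm_num) _ fun u u' => (h0.2.1 u u').trans_eq ?_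
    rw [inv_pow, inv_inv]
    rfl
  · refine hnorm 1 (by norm_num) _ fun u u' => (hRb u u').trans_eq ?_
    rw [inv_inv, pow_one]
    rfl
  · rw [hinv]
    refine hnorm 1 (by norm_num) _ fun u u' => (hRb' u u').trans_eq ?_
    rw [inv_inv, pow_one]
    rfl
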